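/- **Setting.** Let $(M,\omega)$ be a closed symplectic manifold and let $H_1,H_2,H_3:\mathbb R\times M\to\mathbb R$ be smooth Hamiltonians of period one in time. Write $\omega(X_{H},\cdot)=dH$ and $$\mathcal A_H([z,w])=-\int_{D^2} w^*\omega-\int_0^1H(t,z(t))\,dt,\qquad E^+(H)=\int_0^1\max_M H_t\,dt,\qquad E^-(H)=\int_0^1-\min_M H_t\,dt .$$ Let $\Sigma=\mathbb C\setminus\{0,1\}$ be the three-punctured sphere with its minimal area metric. It is the union $\Sigma=\Sigma_1\cup\Sigma_2\cup\Sigma_3$ of the closed regions around the punctures $0,1,\infty$ cut out by $\mathrm{Re}\,z=\frac12$, $|z|=1$ and $|z-1|=1$. Fix holomorphic identifications (with coordinates $\tau+it$, $S^1=\mathbb R/\mathbb Z$) of $\Sigma_1,\Sigma_2$ with $(-\infty,0]\times S^1$ and of $\Sigma_3$ with $[0,\infty)\times S^1$. For each $i$ let $0<R_{i,1}<R_{i,2}$ and let $\rho_i$ be a smooth cut-off function of $\tau$ with values in $[0,1]$ that is $0$ for $|\tau|\le R_{i,1}$, is $1$ for $|\tau|\ge R_{i,2}$, and is nondecreasing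 in $|\tau|$ (so $\rho_1',\rho_2'\le0\le\rho_3'$). On the trivial bundle $P=\Sigma\times M$ let $\omega_P$ be the closed 2-form equal to $\omega+d(\rho_iH_i\,dt)$ over $\Sigma_i$, with its induced connection: the horizontal lifts of $\partial_\tau,\partial_t$ over $\Sigma_i$ are $\partial_\tau$ and $\partial_t+\rho_iX_{H_i}$. Let $\{J_\zeta\}_{\zeta\in\Sigma}$ be a smooth family of $\omega$-compatible almost complex structures on $M$ that does not depend on $\tau$ on the parts $|\tau|\ge R_{i,2}$ of the ends. Let $\widetilde J$ be the almost complex structure on $P$ that equals $J_\zeta$ on vertical vectors and the lift of the complex structure $j$ of $\Sigma$ on horizontal ones. For a section $v=(\mathrm{id},u)$, let $(Dv)^v$ be the vertical part of $Dv$, measured by $|\xi|^2_{\widetilde J}=\omega(\xi,J_\zeta\xi)$ and $|(Dv)^v|^2=|(Dv)^v(\partial_\tau)|^2+|(Dv)^v(\partial_t)|^2$. **Proposition.** For $i=1,2,3$ let $\widehat z_i=[z_i,w_i]\in\mathrm{Crit}\,\mathcal A_{H_i}$, that is, $z_i$ is a one-periodic orbit of $X_{H_i}$ and $w_i$ is a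 smooth disc with boundary $z_i$. Let $v=(\mathrm{id},u)$, $u:\Sigma\to M$ smooth, be a $\widetilde J$-holomorphic section with asymptotic condition $(\widehat z_1,\widehat z_2,\widehat z_3)$: $u(\tau,\cdot)\to z_i$ uniformly along the $i$-th end, and the sphere obtained by capping off $u$ with the discs $w_1,w_2$ and with $w_3$ taken with the opposite orientation represents zero in $\mathrm{Im}(\pi_2(M)\to H_2(M;\mathbb Z))$ modulo torsion. Then all the integrals below converge absolutely and $$\begin{aligned}\frac12\int_\Sigma|(Dv)^v|^2_{\widetilde J}&=\int_\Sigma v^*\omega_P-\sum_{i=1}^3\int_{\Sigma_i}\rho_i'(\tau)H_i(t,u(\tau,t))\,d\tau\,dt\\&=\mathcal A_{H_1}(\widehat z_1)+\mathcal A_{H_2}(\widehat z_2)-\mathcal A_{H_3}(\widehat z_3)-\sum_{i=1}^3\int_{\Sigma_i}\rho_i'(\tau)H_i(t,u(\tau,t))\,d\tau\,dt\\&\le\mathcal A_{H_1}(\widehat z_1)+\mathcal A_{H_2}(\widehat z_2)-\mathcal A_{H_3}(\widehat z_3)+E^+(H_1)+E^+(H_2)+E^-(H_3).\end{aligned}$$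 In particular the vertical energy has an upper bound that does not depend on the cut-off functions $\rho_i$ or on the numbers $R_{i,1}<R_{i,2}$. -/

import Mathlib

open Set Filter Topology MeasureTheory
open scoped Manifold

noncomputable section

namespace Pants

universe u v

/-! ### Symplectic manifolds, Hamiltonians, the action functional -/

section Manifold

variable {E : Type v} [NormedAddCommGroup E] [NormedSpace ℝ E]
  {M : Type u} [TopologicalSpace M] [ChartedSpace E M]

/-- The expression of a 2-form on `M` in the chart around `x₀`: its pullback under the inverse
chart, a 2-form on the chart target in `E`. -/
def localForm (form : ∀ x : M, TangentSpace 𝓘(ℝ, E) x [⋀^Fin 2]→L[ℝ] ℝ) (x₀ : M) :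
    E → E [⋀^Fin 2]→L[ℝ] ℝ := fun y =>
  (form ((extChartAt 𝓘(ℝ, E) x₀).symm y)).compContinuousLinearMap
    (mfderiv 𝓘(ℝ, E) 𝓘(ℝ, E) (extChartAt 𝓘(ℝ, E) x₀).symm y)

/-- The expression of a field of endomorphisms of `TM` in the chart around `x₀`. -/
def localEnd (A : ∀ x : M, TangentSpace 𝓘(ℝ, E) x →L[ℝ] TangentSpace 𝓘(ℝ, E) x) (x₀ : M) :
    E → E →L[ℝ] E := fun y =>
  (mfderiv 𝓘(ℝ, E) 𝓘(ℝ, E) (extChartAt 𝓘(ℝ, E) x₀) ((extChartAt 𝓘(ℝ, E) x₀).symm y)).comp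
    ((A ((extChartAt 𝓘(ℝ, E) x₀).symm y)).comp
      (mfderiv 𝓘(ℝ, E) 𝓘(ℝ, E) (extChartAt 𝓘(ℝ, E) x₀).symm y))

variable (E M) in
/-- A symplectic form on `M`: a smooth closed nondegenerate 2-form. -/
structure SymplecticForm where
  /-- the alternating form on each tangent space -/
  form : ∀ x : M, TangentSpace 𝓘(ℝ, E) x [⋀^Fin 2]→L[ℝ] ℝ
  smooth : ∀ x₀ : M, ContDiffOn ℝ (⊤ : ℕ∞) (localForm form x₀) (extChartAt 𝓘(ℝ, E) x₀).target
  closed : ∀ x₀ : M, ∀ y ∈ (extChartAt 𝓘(ℝ, E) x₀).target, extDeriv (localForm form x₀) y = 0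
  nondegenerate : ∀ (x : M) (ξ : TangentSpace 𝓘(ℝ, E) x),
    (∀ η : TangentSpace 𝓘(ℝ, E) x, form x ![ξ, η] = 0) → ξ = 0

/-- A smooth time-dependent Hamiltonian on `M`, of period one in time. -/
structure IsPeriodicHamiltonian (H : ℝ → M → ℝ) : Prop where
  smooth : ContMDiff (𝓘(ℝ, ℝ).prod 𝓘(ℝ, E)) 𝓘(ℝ, ℝ) (⊤ : ℕ∞) (fun p : ℝ × M => H p.1 p.2)
  periodic : ∀ t x, H (t + 1) x = H t x

/-- `df(ξ)` for a function `f` on `M` and a tangent vector `ξ` at `x`, as a real number. -/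
def dApply (f : M → ℝ) (x : M) (ξ : TangentSpace 𝓘(ℝ, E) x) : ℝ :=
  mfderiv 𝓘(ℝ, E) 𝓘(ℝ, ℝ) f x ξ

/-- `E⁺(H) = ∫₀¹ max H_t dt` (used for compact `M`, where the supremum is a maximum). -/
def Eplus (H : ℝ → M → ℝ) : ℝ := ∫ t in (0 : ℝ)..1, ⨆ x, H t x

/-- `E⁻(H) = ∫₀¹ - min H_t dt` (used for compact `M`, where the infimum is a minimum). -/
def Eminus (H : ℝ → M → ℝ) : ℝ := ∫ t in (0 : ℝ)..1, -⨅ x, H t x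

variable [FiniteDimensional ℝ E]

/-- Existence of Hamiltonian vectors: by nondegeneracy `ω(X, ·) = df` is solvable for `X`. -/
theorem SymplecticForm.exists_hamVF (ω : SymplecticForm E M) (f : M → ℝ) (x : M) :
    ∃ X : TangentSpace 𝓘(ℝ, E) x, ∀ η : TangentSpace 𝓘(ℝ, E) x,
      ω.form x ![X, η] = dApply f x η := by
  have hadd : ∀ a b c : TangentSpace 𝓘(ℝ, E) x,
      ω.form x ![a + b, c] = ω.form x ![a, c] + ω.form x ![b, c] := fun a b c =>
    (ω.form x).toMultilinearMap.cons_add ![c] a b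
  have hsmul : ∀ (r : ℝ) (a c : TangentSpace 𝓘(ℝ, E) x),
      ω.form x ![r • a, c] = r * ω.form x ![a, c] := fun r a c =>
    (ω.form x).toMultilinearMap.cons_smul ![c] r a
  have hanti : ∀ a b : TangentSpace 𝓘(ℝ, E) x, ω.form x ![a, b] = -ω.form x ![b, a] := by
    intro a b
    have h := (ω.form x).toAlternatingMap.map_swap ![b, a] (i := 0) (j := 1) (by decide)
    have e : (![b, a] : Fin 2 → TangentSpace 𝓘(ℝ, E) x) ∘ (Equiv.swap (0 : Fin 2) 1) = ![a, b] := by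
      ext k
      fin_cases k <;> simp
    rw [e] at h
    exact h
  have hadd' : ∀ a b c : TangentSpace 𝓘(ℝ, E) x,
      ω.form x ![a, b + c] = ω.form x ![a, b] + ω.form x ![a, c] := fun a b c => by
    rw [hanti, hadd, hanti b, hanti c]; ring
  have hsmul' : ∀ (r : ℝ) (a c : TangentSpace 𝓘(ℝ, E) x),
      ω.form x ![a, r • c] = r * ω.form x ![a, c] := fun r a c => by
    rw [hanti, hsmul, hanti c]; ring
  let B : E →ₗ[ℝ] Module.Dual ℝ E :=
    LinearMap.mk₂ ℝ (fun a b : E => (ω.form x ![a, b] : ℝ)) hadd hsmul hadd' hsmul'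
  have hinj : Function.Injective B := by
    rw [injective_iff_map_eq_zero]
    intro a ha
    exact ω.nondegenerate x a fun η => by
      have := LinearMap.congr_fun ha η
      exact this
  have hsurj : Function.Surjective B :=
    (LinearMap.injective_iff_surjective_of_finrank_eq_finrank
      (Subspace.dual_finrank_eq (K := ℝ) (V := E)).symm).1 hinj
  obtain ⟨X, hX⟩ := hsurj
    (show E →L[ℝ] ℝ from mfderiv 𝓘(ℝ, E) 𝓘(ℝ, ℝ) f x).toLinearMap
  exact ⟨X, fun η => LinearMap.congr_fun hX η⟩

/-- The Hamiltonian vector field `X_f`, with the sign convention `ω(X_f, ·) = df`. -/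
def SymplecticForm.hamVF (ω : SymplecticForm E M) (f : M → ℝ) (x : M) : TangentSpace 𝓘(ℝ, E) x :=
  Classical.choose (ω.exists_hamVF f x)

theorem SymplecticForm.hamVF_spec (ω : SymplecticForm E M) (f : M → ℝ) (x : M)
    (η : TangentSpace 𝓘(ℝ, E) x) :
    ω.form x ![ω.hamVF f x, η] = dApply f x η :=
  Classical.choose_spec (ω.exists_hamVF f x) η

/-- `[z, w] ∈ Crit 𝒜_H`: a contractible orbit `z` of period one of the Hamiltonian vector field
of `H`, with a smooth disc `w` of boundary `z`. -/
structure IsCappedOrbit (ω : SymplecticForm E M) (H : ℝ → M → ℝ) (z : ℝ → M) (w : ℂ → M) :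
    Prop where
  smooth_orbit : ContMDiff 𝓘(ℝ, ℝ) 𝓘(ℝ, E) (⊤ : ℕ∞) z
  orbit : ∀ t : ℝ, mfderiv 𝓘(ℝ, ℝ) 𝓘(ℝ, E) z t (1 : ℝ) = ω.hamVF (H t) (z t)
  smooth_disc : ContMDiffOn 𝓘(ℝ, ℂ) 𝓘(ℝ, E) (⊤ : ℕ∞) w (Metric.closedBall 0 1)
  boundary : ∀ t : ℝ, w (Complex.exp (2 * Real.pi * t * Complex.I)) = z t

/-- The action functional `𝒜_H([z, w]) = - ∫ w^*ω - ∫₀¹ H(t, z(t)) dt`. -/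
def action (ω : SymplecticForm E M) (H : ℝ → M → ℝ) (z : ℝ → M) (w : ℂ → M) : ℝ :=
  -(∫ q in Metric.ball (0 : ℂ) 1, ω.form (w q)
      ![mfderiv 𝓘(ℝ, ℂ) 𝓘(ℝ, E) w q (1 : ℂ), mfderiv 𝓘(ℝ, ℂ) 𝓘(ℝ, E) w q Complex.I])
    - ∫ t in (0 : ℝ)..1, H t (z t)

end Manifold

/-! ### The pair of pants as a union of three half cylinders

The three-punctured sphere is `ℂ \ {0, 1}`, with punctures `0, 1, ∞`. Its minimal area metric is
the flat metric `|z² - z + 1|^(1/2) |dz| / (2π |z| |z - 1|)` (meridians of length one), whose two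
singular points are `exp (± π i / 3)`. The three half cylinders are the regions around the three
punctures cut out by the line `Re z = 1/2` and the circles `|z| = 1`, `|z - 1| = 1`. -/

/-- The three-punctured sphere. -/
def surface : Set ℂ := {z | z ≠ 0 ∧ z ≠ 1}

/-- The closed region of the surface that is identified with the `i`-th half cylinder. -/
def endRegion : Fin 3 → Set ℂ :=
  ![{z | z ≠ 0 ∧ ‖z‖ ≤ 1 ∧ z.re ≤ 1 / 2},
    {z | z ≠ 1 ∧ ‖z - 1‖ ≤ 1 ∧ 1 / 2 ≤ z.re},
    {z | 1 ≤ ‖z‖ ∧ 1 ≤ ‖z - 1‖}]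

/-- `-1` for the ends `0, 1`, modelled on `(-∞, 0] × S¹`, and `1` for the end `2`, modelled on
`[0, ∞) × S¹`. -/
def sgn : Fin 3 → ℝ := ![-1, -1, 1]

/-- `ψ` is (the inverse of) a holomorphic identification of the `i`-th region with its half
cylinder. The point `(τ, t)` of the cylinder is `τ + i t`, with `t` modulo one. -/
structure IsCylinderCoordinate (i : Fin 3) (ψ : ℂ → ℂ) : Prop where
  continuousOn : ContinuousOn ψ {ζ | 0 ≤ sgn i * ζ.re}
  holomorphic : DifferentiableOn ℂ ψ {ζ | 0 < sgn i * ζ.re}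
  periodic : ∀ ζ, ψ (ζ + Complex.I) = ψ ζ
  injective : ∀ ζ ζ' : ℂ, 0 ≤ sgn i * ζ.re → 0 ≤ sgn i * ζ'.re → ψ ζ = ψ ζ' →
    ∃ n : ℤ, ζ' = ζ + n * Complex.I
  image : ψ '' {ζ | 0 ≤ sgn i * ζ.re} = endRegion i

/-- A fundamental domain of (the interior of) the `i`-th half cylinder. -/
def cyl (i : Fin 3) : Set ℂ := {ζ | 0 < sgn i * ζ.re ∧ 0 < ζ.im ∧ ζ.im ≤ 1}

/-- A cut-off function on the `i`-th half cylinder: zero up to distance `R₁` from the boundary,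
one from distance `R₂` on, and monotone in between. -/
structure IsCutOff (i : Fin 3) (R₁ R₂ : ℝ) (ρ : ℝ → ℝ) : Prop where
  smooth : ContDiff ℝ (⊤ : ℕ∞) ρ
  mem_Icc : ∀ τ, ρ τ ∈ Icc (0 : ℝ) 1
  inner : ∀ τ, sgn i * τ ≤ R₁ → ρ τ = 0
  outer : ∀ τ, R₂ ≤ sgn i * τ → ρ τ = 1
  monotone : ∀ τ τ', sgn i * τ ≤ sgn i * τ' → ρ τ ≤ ρ τ'

section Fibration

variable {E : Type v} [NormedAddCommGroup E] [NormedSpace ℝ E]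
  {M : Type u} [TopologicalSpace M] [ChartedSpace E M]

/-- A smooth family, parametrized by the surface, of `ω`-compatible almost complex structures
on `M`: the restriction to the fibres of an almost complex structure on `surface × M`. -/
structure IsCompatibleFamily (ω : SymplecticForm E M)
    (J : ℂ → ∀ x : M, TangentSpace 𝓘(ℝ, E) x →L[ℝ] TangentSpace 𝓘(ℝ, E) x) : Prop where
  smooth : ∀ x₀ : M, ContDiffOn ℝ (⊤ : ℕ∞) (fun p : ℂ × E => localEnd (J p.1) x₀ p.2)
    (surface ×ˢ (extChartAt 𝓘(ℝ, E) x₀).target)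
  sq : ∀ z ∈ surface, ∀ (x : M) (ξ : TangentSpace 𝓘(ℝ, E) x), J z x (J z x ξ) = -ξ
  invariant : ∀ z ∈ surface, ∀ (x : M) (ξ η : TangentSpace 𝓘(ℝ, E) x),
    ω.form x ![J z x ξ, J z x η] = ω.form x ![ξ, η]
  positive : ∀ z ∈ surface, ∀ (x : M) (ξ : TangentSpace 𝓘(ℝ, E) x), ξ ≠ 0 →
    0 < ω.form x ![ξ, J z x ξ]

/-- The tangent space of `(half cylinder) × M`; the base component is `(α, β) = α + i β` in the
frame `∂/∂τ, ∂/∂t`. -/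
abbrev TP (E : Type v) [NormedAddCommGroup E] [NormedSpace ℝ E]
    {M : Type u} [TopologicalSpace M] [ChartedSpace E M] (x : M) : Type v :=
  ℂ × TangentSpace 𝓘(ℝ, E) x

/-- The differential of the function `(τ, t, x) ↦ ρ(τ) H(t, x)`. -/
def dRhoH (H : ℝ → M → ℝ) (ρ : ℝ → ℝ) (ζ : ℂ) (x : M) (V : TP E x) : ℝ :=
  V.1.re * (deriv ρ ζ.re * H ζ.im x) + V.1.im * (ρ ζ.re * deriv (fun s => H s x) ζ.im)
    + ρ ζ.re * dApply (H ζ.im) x V.2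

/-- The closed 2-form `ω_P = ω + d(ρ H_t dt) = ω + d(ρ H_t) ∧ dt` at `(ζ, x)`, `ζ = τ + i t`. -/
def omegaP (ω : SymplecticForm E M) (H : ℝ → M → ℝ) (ρ : ℝ → ℝ) (ζ : ℂ) (x : M)
    (V W : TP E x) : ℝ :=
  ω.form x ![V.2, W.2] + (dRhoH H ρ ζ x V * W.1.im - dRhoH H ρ ζ x W * V.1.im)

/-- The derivative of the section `ζ ↦ (ζ, u (ψ ζ))` of the trivial bundle over a half
cylinder. -/
def sectionDeriv (ψ : ℂ → ℂ) (u : ℂ → M) (ζ b : ℂ) : TP E (u (ψ ζ)) :=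
  (b, mfderiv 𝓘(ℝ, ℂ) 𝓘(ℝ, E) (fun ζ' => u (ψ ζ')) ζ b)

/-- The coefficient of `v^*ω_P` with respect to `dτ ∧ dt`. -/
def pullbackDensity (ω : SymplecticForm E M) (H : ℝ → M → ℝ) (ρ : ℝ → ℝ)
    (ψ : ℂ → ℂ) (u : ℂ → M) (ζ : ℂ) : ℝ :=
  omegaP ω H ρ ζ (u (ψ ζ)) (sectionDeriv ψ u ζ 1) (sectionDeriv ψ u ζ Complex.I)

/-- The curvature term `ρ'(τ) H(t, u(τ, t))`. -/
def curvatureDensity (H : ℝ → M → ℝ) (ρ : ℝ → ℝ) (ψ : ℂ → ℂ) (u : ℂ → M) (ζ : ℂ) : ℝ :=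
  deriv ρ ζ.re * H ζ.im (u (ψ ζ))

variable [FiniteDimensional ℝ E]

/-- Horizontal lift of a base vector for the connection induced by `ω_P`: the lift of `∂/∂τ` is
`∂/∂τ`, the lift of `∂/∂t` is `∂/∂t + ρ X_H`. -/
def horLift (ω : SymplecticForm E M) (H : ℝ → M → ℝ) (ρ : ℝ → ℝ) (ζ : ℂ) (x : M) (b : ℂ) :
    TP E x :=
  (b, (b.im * ρ ζ.re) • ω.hamVF (H ζ.im) x)

/-- The horizontal lifts are `ω_P`-orthogonal to the fibres, which characterizes the connection. -/
theorem omegaP_horLift (ω : SymplecticForm E M) (H : ℝ → M → ℝ) (ρ : ℝ → ℝ) (ζ : ℂ) (x : M)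
    (b : ℂ) (η : TangentSpace 𝓘(ℝ, E) x) :
    omegaP ω H ρ ζ x (horLift ω H ρ ζ x b) ((0, η) : TP E x) = 0 := by
  have h : ω.form x ![(b.im * ρ ζ.re) • ω.hamVF (H ζ.im) x, η]
      = (b.im * ρ ζ.re) * ω.form x ![ω.hamVF (H ζ.im) x, η] :=
    (ω.form x).toMultilinearMap.cons_smul ![η] _ _
  simp only [omegaP, horLift, dRhoH, h, ω.hamVF_spec, Complex.zero_im, Complex.zero_re]
  ring

/-- The vertical projection of the connection. -/
def vertProj (ω : SymplecticForm E M) (H : ℝ → M → ℝ) (ρ : ℝ → ℝ) (ζ : ℂ) (x : M)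
    (V : TP E x) : TP E x :=
  V - horLift ω H ρ ζ x V.1

/-- The almost complex structure `J̃` of the total space with fibre structure `A`: it maps
`(α, β, ξ)` to `(-β, α, A (ξ - β ρ X_H) + α ρ X_H)`, that is, it is `A` on vertical vectors and
the lift of the complex structure of the base on horizontal ones. -/
def Jtilde (ω : SymplecticForm E M) (H : ℝ → M → ℝ) (ρ : ℝ → ℝ) (ζ : ℂ) (x : M)
    (A : TangentSpace 𝓘(ℝ, E) x →L[ℝ] TangentSpace 𝓘(ℝ, E) x) (V : TP E x) : TP E x :=
  horLift ω H ρ ζ x (Complex.I * V.1) + (0, A (vertProj ω H ρ ζ x V).2)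

/-- The section `v` given by `u` is `J̃`-holomorphic, `Dv ∘ j = J̃ ∘ Dv`, over the interior of
the `i`-th half cylinder. (For `u` smooth on the surface, holomorphy over the three interiors
implies, by continuity, holomorphy along the curves where the half cylinders meet.) -/
def IsHolomorphicOnEnd (ω : SymplecticForm E M) (H : ℝ → M → ℝ) (ρ : ℝ → ℝ)
    (J : ℂ → ∀ x : M, TangentSpace 𝓘(ℝ, E) x →L[ℝ] TangentSpace 𝓘(ℝ, E) x)
    (i : Fin 3) (ψ : ℂ → ℂ) (u : ℂ → M) : Prop :=
  ∀ ζ : ℂ, 0 < sgn i * ζ.re → ∀ b : ℂ,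
    (sectionDeriv ψ u ζ (Complex.I * b) : TP E (u (ψ ζ)))
      = Jtilde ω H ρ ζ (u (ψ ζ)) (J (ψ ζ) (u (ψ ζ))) (sectionDeriv ψ u ζ b)

/-- `|V|²` for a vertical vector `V` in the metric associated to `J̃`, that is `ω_P(V, J̃ V)`. -/
def vertNormSq (ω : SymplecticForm E M) (H : ℝ → M → ℝ) (ρ : ℝ → ℝ) (ζ : ℂ) (x : M)
    (A : TangentSpace 𝓘(ℝ, E) x →L[ℝ] TangentSpace 𝓘(ℝ, E) x) (V : TP E x) : ℝ :=
  omegaP ω H ρ ζ x V (Jtilde ω H ρ ζ x A V)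

/-- The density `|(Dv)^v|²` in the flat coordinates of a half cylinder: the sum of the squared
norms of the vertical parts of `Dv(∂/∂τ)` and `Dv(∂/∂t)`. -/
def vertEnergyDensity (ω : SymplecticForm E M) (H : ℝ → M → ℝ) (ρ : ℝ → ℝ)
    (J : ℂ → ∀ x : M, TangentSpace 𝓘(ℝ, E) x →L[ℝ] TangentSpace 𝓘(ℝ, E) x)
    (ψ : ℂ → ℂ) (u : ℂ → M) (ζ : ℂ) : ℝ :=
  vertNormSq ω H ρ ζ (u (ψ ζ)) (J (ψ ζ) (u (ψ ζ)))
      (vertProj ω H ρ ζ (u (ψ ζ)) (sectionDeriv ψ u ζ 1))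
    + vertNormSq ω H ρ ζ (u (ψ ζ)) (J (ψ ζ) (u (ψ ζ)))
      (vertProj ω H ρ ζ (u (ψ ζ)) (sectionDeriv ψ u ζ Complex.I))

end Fibration

/-! ### Asymptotics and the homotopical condition -/

section Asymptotics

variable {M : Type u} [TopologicalSpace M]

/-- `u(τ, ·)` converges to the loop `z` along the `i`-th end, uniformly in `t` (stated as locally
uniform convergence, which is the same for periodic loops). -/
def ConvergesTo (i : Fin 3) (ψ : ℂ → ℂ) (u : ℂ → M) (z : ℝ → M) : Prop :=
  ∀ t₀ : ℝ, Tendsto (fun p : ℝ × ℝ => u (ψ ⟨sgn i * p.1, p.2⟩)) (atTop ×ˢ 𝓝 t₀) (𝓝 (z t₀))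

/-- `f` is the map on the sphere `ℂ ∪ {∞}` obtained by capping off `u` with the discs `w i`.
On the `i`-th half cylinder, the part at distance less than one from the boundary is stretched to
the whole half cylinder and carries `u`; the rest, which together with the puncture is a disc,
carries `w i`. In the orientation of the sphere, this disc is `w i` with its own orientation for
`i = 0, 1` and with the opposite one for `i = 2`. -/
def IsCappedSphere (ψ : Fin 3 → ℂ → ℂ) (u : ℂ → M) (w : Fin 3 → ℂ → M)
    (f : C(OnePoint ℂ, M)) : Prop :=
  ∀ (i : Fin 3) (ζ : ℂ),
    (0 ≤ sgn i * ζ.re → sgn i * ζ.re < 1 →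
      f (ψ i ζ : ℂ) = u (ψ i ⟨ζ.re / (1 - sgn i * ζ.re), ζ.im⟩)) ∧
    (1 ≤ sgn i * ζ.re →
      f (ψ i ζ : ℂ) = w i (Complex.exp (2 * Real.pi * ⟨1 - sgn i * ζ.re, ζ.im⟩)))

open CategoryTheory AlgebraicTopology in
/-- Second singular homology with integer coefficients. -/
abbrev H2 (X : Type u) [TopologicalSpace X] : ModuleCat.{u} ℤ :=
  ((singularHomologyFunctor (ModuleCat.{u} ℤ) 2).obj (ModuleCat.of ℤ (ULift.{u} ℤ))).obj
    (TopCat.of X)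

open CategoryTheory AlgebraicTopology in
/-- The map induced on second singular homology. -/
abbrev H2map {X Y : Type u} [TopologicalSpace X] [TopologicalSpace Y] (f : C(X, Y)) :
    H2 X ⟶ H2 Y :=
  ((singularHomologyFunctor (ModuleCat.{u} ℤ) 2).obj (ModuleCat.of ℤ (ULift.{u} ℤ))).map
    (TopCat.ofHom f)

/-- The sphere `f` represents zero in `Im(π₂(M) → H₂(M; ℤ)) / torsion`: the image of every class
of `H₂(S²; ℤ)`, so of the fundamental class, is a torsion class. -/
def RepresentsZero (f : C(OnePoint ℂ, M)) : Prop :=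
  ∀ a : H2 (ULift.{u} (OnePoint ℂ)), ∃ N : ℤ, N ≠ 0 ∧
    N • (H2map (f.comp ⟨ULift.down, continuous_uliftDown⟩)).hom a = 0

end Asymptotics

end Pants

end

open Pants

/-! Pointwise, the holomorphic equation on a cylinder is `∂_t u = ρ X_H + J ∂_τ u`. It makes half
the vertical energy density equal to the density of `u^*ω`, plus the `τ`-derivative of `ρ H(t, u)`,
minus the curvature term `ρ' H` (`energy_eq`). Integrated up to depth `T ≥ R₂` on all three ends,
the middle term gives signed circle integrals of `H`, and the curvature integral no longer depends
on `T`. What remains is to compare the area of the truncated surface with the areas of the discs,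
and to let `T` tend to infinity. There are three obstacles: the capped sphere `f` is only
continuous, its class is only known to be torsion, and `u` converges to the orbits only in `C⁰`.

Topology. Points `p` of `M` serve as labels of local primitives `θ p` of `ω`, and `φ p q` is a local
primitive of `θ p - θ q`. The defect `φ p q + φ q r - φ p r` is locally constant, so it is a
2-cocycle near the diagonal: the Alexander–Spanier form of the class of `ω`. On a singular simplex
such a cocycle has a primitive, and its polygonal sums along the boundary define a singular cocycle
with values in germs of real sequences. This coefficient group is torsion free, so the homological
hypothesis forces equal values on two discs that together form the sphere (`cocycle_eq_of_torsion`).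
Hence the primitives over the two discs can be glued to a primitive of the pulled-back cocycle on
the whole sphere (`exists_global_locCob`). Such a `Gauge` corrects the `φ p q` to an exact cocycle
of transition functions. A partition of unity then produces a primitive of `U^*ω` for every smooth
`U` that factors continuously through `f` (`Gauge.exists_primitive`). Its integral over a loop is
the number `Gauge.hol`, which depends only on the image loop in `M` and on a list of labels
(`IsGaugedPrimitive.integral_loop`).

Stokes' theorem now expresses the area of the truncated surface as the signed sum of the holonomies
of the three circles `u(T, ·)` (`sum_area_strip`), and the area of each disc as the holonomy of its
orbit (`Gauge.hol_cap`). The same labels serve for a circle and for its limit orbit.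

Analysis. Integration by parts bounds the difference of the holonomies of two `C⁰`-close loops by
`ε` times one plus the mean speed (`integral_form_sub_le`). Along the ends the speed is controlled
by the square root of the energy density (`exists_chartVel_le`). So, if `b(T)` is the energy up to
depth `T` and `L` the asserted value, then `|b - L| ≤ ε (1 + √b')` for large `T`. As `b` is
nondecreasing, this alone forces `b → L` (`tendsto_of_sub_le_sqrt_deriv`), which gives both
integrability and the identity; no decay estimate at the orbits is needed.

The inequality follows because `|ρ'|` has integral one over each end: `-ρ' H` is at most `|ρ'| max
H` on the two negative ends and `-|ρ'| min H` on the positive one (`neg_integral_curvature_le`). -/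

noncomputable section

namespace Pants

/-! ### Alexander–Spanier cochains near the diagonal -/

section Cochains

variable {X : Type*} [TopologicalSpace X]

/-- Near the diagonal, the coboundary of the 1-cochain `h` is the 2-cochain `G`. -/
def LocCob (G : X → X → X → ℝ) (h : X → X → ℝ) : Prop :=
  ∀ x, ∃ U ∈ 𝓝 x, ∀ a ∈ U, ∀ b ∈ U, ∀ c ∈ U, h a b + h b c - h a c = G a b c

/-- Near the diagonal, `G` is a 2-cocycle. -/
def LocCocycle (G : X → X → X → ℝ) : Prop :=
  ∀ x, ∃ U ∈ 𝓝 x, ∀ a ∈ U, ∀ b ∈ U, ∀ c ∈ U, ∀ d ∈ U,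
    G b c d - G a c d + G a b d - G a b c = 0

/-- Near the diagonal, the coboundary of the function `φ` is the 1-cochain `κ`. -/
def LocDiff (κ : X → X → ℝ) (φ : X → ℝ) : Prop :=
  ∀ x, ∃ U ∈ 𝓝 x, ∀ a ∈ U, ∀ b ∈ U, κ a b = φ b - φ a

variable {Y : Type*} [TopologicalSpace Y]

theorem LocCob.comp {G : X → X → X → ℝ} {h : X → X → ℝ} (H : LocCob G h) {f : Y → X}
    (hf : Continuous f) : LocCob (fun a b c => G (f a) (f b) (f c)) (fun a b => h (f a) (f b)) := by
  intro y
  obtain ⟨U, hU, H⟩ := H (f y)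
  exact ⟨f ⁻¹' U, hf.continuousAt hU, fun a ha b hb c hc => H _ ha _ hb _ hc⟩

theorem LocCocycle.comp {G : X → X → X → ℝ} (H : LocCocycle G) {f : Y → X}
    (hf : Continuous f) : LocCocycle (fun a b c => G (f a) (f b) (f c)) := by
  intro y
  obtain ⟨U, hU, H⟩ := H (f y)
  exact ⟨f ⁻¹' U, hf.continuousAt hU, fun a ha b hb c hc d hd => H _ ha _ hb _ hc _ hd⟩

theorem LocCob.sub {G G' : X → X → X → ℝ} {h h' : X → X → ℝ} (H : LocCob G h)
    (H' : LocCob G' h') :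
    LocCob (fun a b c => G a b c - G' a b c) (fun a b => h a b - h' a b) := by
  intro y
  obtain ⟨U, hU, H⟩ := H y
  obtain ⟨U', hU', H'⟩ := H' y
  refine ⟨U ∩ U', inter_mem hU hU', fun a ha b hb c hc => ?_⟩
  beta_reduce
  rw [← H _ ha.1 _ hb.1 _ hc.1, ← H' _ ha.2 _ hb.2 _ hc.2]
  ring

end Cochains

/-! ### Discrete contractions and the homotopy operators built from them -/

/-- A contractible compact metric space has arbitrarily fine discrete contractions. -/
theorem exists_discrete_contraction {X : Type*} [MetricSpace X] [CompactSpace X]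
    [ContractibleSpace X] (𝒰 : X → Set X) (h𝒰 : ∀ x, 𝒰 x ∈ 𝓝 x) :
    ∃ (n : ℕ) (c : ℕ → X → X) (x₀ : X), (∀ a, c 0 a = x₀) ∧ (∀ a, c n a = a) ∧
      ∀ x, ∃ W ∈ 𝓝 x, ∀ k < n, ∃ y, ∀ a ∈ W, c k a ∈ 𝒰 y ∧ c (k + 1) a ∈ 𝒰 y := by
  obtain ⟨x₀, ⟨H⟩⟩ := id_nullhomotopic X
  have hcov : (univ : Set (unitInterval × X)) ⊆ ⋃ y, H ⁻¹' (interior (𝒰 y)) := fun p _ =>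
    mem_iUnion.2 ⟨H p, mem_interior_iff_mem_nhds.2 (h𝒰 _)⟩
  obtain ⟨δ, hδ, hL⟩ := lebesgue_number_lemma_of_metric isCompact_univ
    (fun y => isOpen_interior.preimage H.continuous) hcov
  obtain ⟨n, hn⟩ := exists_nat_one_div_lt hδ
  -- The nullhomotopy starts at the identity, while the discrete contraction is to end there, so
  -- time is reversed. Steps of length `1 / (n + 1)` are shorter than the Lebesgue number.
  let τ : ℕ → unitInterval := fun k => unitInterval.symm (projIcc 0 1 zero_le_one (k / (n + 1) : ℝ))
  refine ⟨n + 1, fun k a => H (τ k, a), x₀, fun a => ?_, fun a => ?_, fun x => ?_⟩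
  · have : τ 0 = 1 := by simp [τ]
    simp [this]
  · have : τ (n + 1) = 0 := by
      have : ((n + 1 : ℕ) / (n + 1) : ℝ) = 1 := by push_cast; exact div_self (by positivity)
      simp only [τ, this, projIcc_right]
      exact unitInterval.symm_one
    simp only [this, H.apply_zero]
    rfl
  · refine ⟨Metric.ball x δ, Metric.ball_mem_nhds x hδ, fun k hk => ?_⟩
    obtain ⟨y, hy⟩ := hL (τ k, x) trivial
    refine ⟨y, fun a ha => ⟨interior_subset (hy ?_), interior_subset (hy ?_)⟩⟩
    · simpa [Prod.dist_eq, hδ] using ha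
    · rw [Metric.mem_ball, Prod.dist_eq]
      refine max_lt ?_ ha
      have h1 : ∀ j : ℕ, j ≤ n + 1 → (j / (n + 1) : ℝ) ∈ Icc (0 : ℝ) 1 := fun j hj =>
        ⟨by positivity, by rw [div_le_one (by positivity)]; exact_mod_cast hj⟩
      have h2 : ∀ j : ℕ, j ≤ n + 1 → ((τ j : unitInterval) : ℝ) = 1 - j / (n + 1) := fun j hj => by
        simp only [τ, projIcc_of_mem zero_le_one (h1 j hj), unitInterval.coe_symm_eq]
      rw [Subtype.dist_eq, Real.dist_eq, h2 _ (by omega), h2 _ (by omega)]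
      have : (1 - ((k + 1 : ℕ) : ℝ) / (n + 1)) - (1 - (k : ℝ) / (n + 1)) = -(1 / (n + 1)) := by
        push_cast; field_simp; ring
      rw [this, abs_neg, abs_of_pos (by positivity)]
      exact hn

/-- On a contractible compact metric space, 1-cocycles are coboundaries. -/
theorem exists_locDiff {X : Type*} [MetricSpace X] [CompactSpace X] [ContractibleSpace X]
    {κ : X → X → ℝ} (hκ : LocCob (fun _ _ _ => 0) κ) : ∃ φ, LocDiff κ φ := by
  choose 𝒰 h𝒰 H using hκ
  obtain ⟨n, c, x₀, h0, hn, hc⟩ := exists_discrete_contraction 𝒰 h𝒰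
  -- The primitive at `a` is the sum of `κ` along the discrete path from `x₀` to `a`.
  refine ⟨fun a => ∑ k ∈ Finset.range n, κ (c k a) (c (k + 1) a), fun x => ?_⟩
  obtain ⟨W, hW, hc⟩ := hc x
  refine ⟨W, hW, fun a ha b hb => ?_⟩
  -- The square with corners at times `k` and `k + 1` of the paths of `a` and `b` is cut into two
  -- triangles, on which `κ` is closed.
  have h1 : ∀ k ∈ Finset.range n, κ (c k b) (c (k + 1) b) - κ (c k a) (c (k + 1) a)
      = κ (c (k + 1) a) (c (k + 1) b) - κ (c k a) (c k b) := fun k hk => by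
    obtain ⟨y, hy⟩ := hc k (Finset.mem_range.1 hk)
    have e1 := H y _ (hy a ha).1 _ (hy a ha).2 _ (hy b hb).2
    have e2 := H y _ (hy a ha).1 _ (hy b hb).1 _ (hy b hb).2
    linarith
  have h2 : κ x₀ x₀ = 0 := by
    have := H x₀ x₀ (mem_of_mem_nhds (h𝒰 _)) x₀ (mem_of_mem_nhds (h𝒰 _)) x₀
      (mem_of_mem_nhds (h𝒰 _))
    linarith
  rw [← Finset.sum_sub_distrib, Finset.sum_congr rfl h1,
    Finset.sum_range_sub (fun k => κ (c k a) (c k b)), hn, hn, h0, h0, h2, sub_zero]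

/-- On a contractible compact metric space, 2-cocycles are coboundaries. -/
theorem LocCocycle.exists_locCob {X : Type*} [MetricSpace X] [CompactSpace X]
    [ContractibleSpace X] {G : X → X → X → ℝ} (hG : LocCocycle G) : ∃ h, LocCob G h := by
  choose 𝒰 h𝒰 H using hG
  obtain ⟨n, c, x₀, h0, hn, hc⟩ := exists_discrete_contraction 𝒰 h𝒰
  -- This is the prism operator: each square between consecutive times contributes its two triangles
  -- with opposite signs. The coboundary telescopes to `G a b d - G x₀ x₀ x₀`, which the added
  -- constant corrects, because a constant 1-cochain has that constant as its coboundary.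
  refine ⟨fun a b => (∑ k ∈ Finset.range n, (G (c k a) (c (k + 1) a) (c (k + 1) b)
    - G (c k a) (c k b) (c (k + 1) b))) + G x₀ x₀ x₀, fun x => ?_⟩
  obtain ⟨W, hW, hc⟩ := hc x
  refine ⟨W, hW, fun a ha b hb d hd => ?_⟩
  have h1 : ∀ k ∈ Finset.range n,
      (G (c k a) (c (k + 1) a) (c (k + 1) b) - G (c k a) (c k b) (c (k + 1) b))
      + (G (c k b) (c (k + 1) b) (c (k + 1) d) - G (c k b) (c k d) (c (k + 1) d))
      - (G (c k a) (c (k + 1) a) (c (k + 1) d) - G (c k a) (c k d) (c (k + 1) d))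
      = G (c (k + 1) a) (c (k + 1) b) (c (k + 1) d) - G (c k a) (c k b) (c k d) := fun k hk => by
    obtain ⟨y, hy⟩ := hc k (Finset.mem_range.1 hk)
    -- The three tetrahedra of the triangulated prism over the triangle `a b d`.
    have e1 := H y _ (hy a ha).1 _ (hy a ha).2 _ (hy b hb).2 _ (hy d hd).2
    have e2 := H y _ (hy a ha).1 _ (hy b hb).1 _ (hy b hb).2 _ (hy d hd).2
    have e3 := H y _ (hy a ha).1 _ (hy b hb).1 _ (hy d hd).1 _ (hy d hd).2
    linarith
  have h2 := Finset.sum_range_sub (fun k => G (c k a) (c k b) (c k d)) n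
  rw [← Finset.sum_congr rfl h1, Finset.sum_sub_distrib, Finset.sum_add_distrib, hn, hn, hn,
    h0, h0, h0] at h2
  linarith

/-! ### Polygonal sums -/

/-- The sum of the 1-cochain `h` over the path `γ`, subdivided into `n` pieces. -/
def polySum {X : Type*} (h : X → X → ℝ) (γ : ℝ → X) (n : ℕ) : ℝ :=
  ∑ j ∈ Finset.range n, h (γ (j / n)) (γ ((j + 1 : ℕ) / n))

/-- Along a fine subdivision of a path, consecutive points are near each other. -/
theorem eventually_subdivision {X : Type*} [TopologicalSpace X] {γ : ℝ → X}
    (hγ : ContinuousOn γ (Icc 0 1)) (𝒰 : X → Set X) (h𝒰 : ∀ x, 𝒰 x ∈ 𝓝 x) :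
    ∀ᶠ n : ℕ in atTop, ∀ j < n, ∃ y, ∀ t ∈ Icc ((j : ℝ) / n) ((j + 1 : ℕ) / n), γ t ∈ 𝒰 y := by
  have hc : Continuous (IccExtend zero_le_one ((Icc (0:ℝ) 1).domRestrict γ)) :=
    (continuousOn_iff_continuous_domRestrict.1 hγ).Icc_extend'
  set g := IccExtend zero_le_one ((Icc (0:ℝ) 1).domRestrict γ)
  have hcov : Icc (0 : ℝ) 1 ⊆ ⋃ y, g ⁻¹' (interior (𝒰 y)) := fun p _ =>
    mem_iUnion.2 ⟨g p, mem_interior_iff_mem_nhds.2 (h𝒰 _)⟩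
  obtain ⟨δ, hδ, hL⟩ := lebesgue_number_lemma_of_metric isCompact_Icc
    (fun y => isOpen_interior.preimage hc) hcov
  obtain ⟨N, hN⟩ := exists_nat_one_div_lt hδ
  filter_upwards [eventually_ge_atTop (N + 1)] with n hn j hj
  have hn0 : (0 : ℝ) < n := by exact_mod_cast (by omega : 0 < n)
  have hj1 : ((j + 1 : ℕ) : ℝ) ≤ n := by exact_mod_cast hj
  have hj1' : ((j + 1 : ℕ) : ℝ) / n ≤ 1 := (div_le_one hn0).2 hj1
  have hj0 : (0 : ℝ) ≤ j / n := by positivity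
  have hlt : ((j + 1 : ℕ) : ℝ) / n - j / n < δ := by
    have : ((j + 1 : ℕ) : ℝ) / n - j / n = 1 / n := by push_cast; field_simp; ring
    rw [this]
    refine lt_of_le_of_lt (one_div_le_one_div_of_le (by positivity) ?_) hN
    exact_mod_cast hn
  have hle : (j : ℝ) / n ≤ (j + 1 : ℕ) / n := by push_cast; gcongr; linarith
  obtain ⟨y, hy⟩ := hL (j / n) ⟨hj0, hle.trans hj1'⟩
  refine ⟨y, fun t ht => ?_⟩
  have htI : t ∈ Icc (0 : ℝ) 1 := ⟨hj0.trans ht.1, ht.2.trans hj1'⟩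
  have : t ∈ g ⁻¹' (interior (𝒰 y)) := hy (by
    rw [Metric.mem_ball, Real.dist_eq, abs_of_nonneg (by linarith [ht.1])]; linarith [ht.2])
  have e : g t = γ t := by simp only [g]; rw [IccExtend_of_mem _ _ htI]; rfl
  rw [← e]
  exact interior_subset this

/-- A polygonal sum of a coboundary is, eventually, the difference of the values at the ends. -/
theorem LocDiff.eventually_polySum {X : Type*} [TopologicalSpace X] {κ : X → X → ℝ} {φ : X → ℝ}
    (H : LocDiff κ φ) {γ : ℝ → X} (hγ : ContinuousOn γ (Icc 0 1)) :
    ∀ᶠ n in atTop, polySum κ γ n = φ (γ 1) - φ (γ 0) := by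
  choose 𝒰 h𝒰 H using H
  filter_upwards [eventually_subdivision hγ 𝒰 h𝒰, eventually_gt_atTop 0] with n hn hn0
  have h1 : ∀ j ∈ Finset.range n, κ (γ (j / n)) (γ ((j + 1 : ℕ) / n))
      = φ (γ ((j + 1 : ℕ) / n)) - φ (γ (j / n)) := fun j hj => by
    obtain ⟨y, hy⟩ := hn j (Finset.mem_range.1 hj)
    have hle : (j : ℝ) / n ≤ (j + 1 : ℕ) / n := by push_cast; gcongr; linarith
    exact H y _ (hy _ ⟨le_rfl, hle⟩) _ (hy _ ⟨hle, le_rfl⟩)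
  have hn1 : (n : ℝ) / n = 1 := div_self (by positivity)
  rw [polySum, Finset.sum_congr rfl h1, Finset.sum_range_sub (fun j => φ (γ ((j : ℕ) / n))), hn1]
  simp

end Pants

namespace Pants

universe u

/-! ### Pairing singular homology with cocycles -/

/-- The `i`-th face of a standard simplex. -/
def faceMap {n : ℕ} (i : Fin (n + 2)) :
    C(stdSimplex ℝ (Fin (n + 1)), stdSimplex ℝ (Fin (n + 2))) :=
  ⟨stdSimplex.map (Fin.succAbove i), stdSimplex.continuous_map _⟩

section Pairing

open CategoryTheory AlgebraicTopology Simplicial Opposite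

/-- If `f` maps all of `H₂(X; ℤ)` to torsion classes, then a singular 2-cocycle with values in a
torsion free group takes the same values on the images of two simplices whose difference is a
cycle. -/
theorem cocycle_eq_of_torsion {X M : Type u} [TopologicalSpace X] [TopologicalSpace M]
    (f : C(X, M)) (hf : ∀ a : H2 X, ∃ N : ℤ, N ≠ 0 ∧ N • (H2map f).hom a = 0)
    {G : Type u} [AddCommGroup G] (hG : ∀ N : ℤ, N ≠ 0 → ∀ g : G, N • g = 0 → g = 0)
    (c : C(stdSimplex ℝ (Fin 3), M) → G)
    (hc : ∀ τ : C(stdSimplex ℝ (Fin 4), M),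
      ∑ i : Fin 4, (-1 : ℤ) ^ i.val • c (τ.comp (faceMap i)) = 0)
    (σ₁ σ₂ : C(stdSimplex ℝ (Fin 3), X))
    (h₁ : σ₁.comp (faceMap 0) = σ₁.comp (faceMap 1))
    (h₂ : σ₂.comp (faceMap 0) = σ₂.comp (faceMap 1))
    (h₁₂ : σ₁.comp (faceMap 2) = σ₂.comp (faceMap 2)) :
    c (f.comp σ₁) = c (f.comp σ₂) := by
  let R : ModuleCat.{u} ℤ := ModuleCat.of ℤ (ULift.{u} ℤ)
  -- Elements of `G` are encoded as morphisms from the free module of rank one, so that cochains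
  -- become morphisms out of the chain complex.
  let el : G → (R ⟶ ModuleCat.of ℤ G) := fun g =>
    ModuleCat.ofHom ((LinearMap.toSpanSingleton ℤ G g).comp ULift.moduleEquiv.toLinearMap)
  have el_one : ∀ g, (el g).hom (ULift.up 1) = g := fun g => one_smul ℤ g
  have el_ext : ∀ φ φ' : R ⟶ ModuleCat.of ℤ G,
      φ.hom (ULift.up 1) = φ'.hom (ULift.up 1) → φ = φ' := fun φ φ' h => by
    ext r
    have hr : r = r.down • (ULift.up 1 : ULift.{u} ℤ) := by
      ext
      simp
    rw [hr, map_zsmul, map_zsmul, h]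
  have el_sum : ∀ (n : ℕ) (k : Fin n → ℤ) (g : Fin n → G),
      ∑ i, k i • el (g i) = el (∑ i, k i • g i) := fun n k g => by
    apply el_ext
    have := map_sum (AddMonoidHom.mk' (fun φ : R ⟶ ModuleCat.of ℤ G => φ.hom (ULift.up 1))
      (fun a b => rfl)) (fun i => k i • el (g i)) Finset.univ
    refine (this.trans ?_).trans (el_one _).symm
    refine Finset.sum_congr rfl fun i _ => ?_
    change k i • (el (g i)).hom (ULift.up 1) = _
    rw [el_one]
  have el_zero : el 0 = 0 := by
    exact el_ext _ _ (el_one 0)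
  let SX : SSet.{u} := TopCat.toSSet.obj (TopCat.of X)
  let SM : SSet.{u} := TopCat.toSSet.obj (TopCat.of M)
  let F : SX ⟶ SM := TopCat.toSSet.map (TopCat.ofHom f)
  let toM := fun n : ℕ => (TopCat.of M).toSSetObjEquiv (op ⦋n⦌)
  let toX := fun n : ℕ => (TopCat.of X).toSSetObjEquiv (op ⦋n⦌)
  let Ψ : (SM.chainComplex R).X 2 ⟶ ModuleCat.of ℤ G :=
    (SM.isColimitChainComplexXCofan R 2).desc
      (Limits.Cofan.mk _ fun x : SM _⦋2⦌ => el (c (toM 2 x)))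
  have hΨ : ∀ x : SM _⦋2⦌, SM.ιChainComplex x ≫ Ψ = el (c (toM 2 x)) := fun x =>
    (SM.isColimitChainComplexXCofan R 2).fac _ ⟨x⟩
  have hdΨ : (SM.chainComplex R).d 3 2 ≫ Ψ = 0 := by
    apply SSet.chainComplex_hom_ext
    intro x
    rw [SSet.ιChainComplex_d_assoc, Preadditive.sum_comp, Limits.comp_zero]
    have : ∀ i : Fin 4, ((-1 : ℤ) ^ i.val • SM.ιChainComplex (R := R) (SM.δ i x)) ≫ Ψ
        = (-1 : ℤ) ^ i.val • el (c ((toM 3 x).comp (faceMap i))) := fun i => by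
      rw [Preadditive.zsmul_comp, hΨ]
      rfl
    rw [Finset.sum_congr rfl fun i _ => this i, el_sum, hc, el_zero]
  let s₁ : SX _⦋2⦌ := (toX 2).symm σ₁
  let s₂ : SX _⦋2⦌ := (toX 2).symm σ₂
  have hs₁ : toX 2 s₁ = σ₁ := (toX 2).apply_symm_apply σ₁
  have hs₂ : toX 2 s₂ = σ₂ := (toX 2).apply_symm_apply σ₂
  have hδ : ∀ (s : SX _⦋2⦌) (i : Fin 3), toX 1 (SX.δ i s) = (toX 2 s).comp (faceMap i) :=
    fun s i => rfl
  have e₁ : SX.δ 0 s₁ = SX.δ 1 s₁ := (toX 1).injective (by rw [hδ, hδ, hs₁, h₁])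
  have e₂ : SX.δ 0 s₂ = SX.δ 1 s₂ := (toX 1).injective (by rw [hδ, hδ, hs₂, h₂])
  have e₁₂ : SX.δ 2 s₁ = SX.δ 2 s₂ := (toX 1).injective (by rw [hδ, hδ, hs₁, hs₂, h₁₂])
  -- The chain `σ₁ - σ₂`. In the boundary of each simplex the faces `0` and `1` cancel, and the
  -- faces `2` cancel between the two simplices.
  let k : R ⟶ (SX.chainComplex R).X 2 := SX.ιChainComplex s₁ - SX.ιChainComplex s₂
  have hk : k ≫ (SX.chainComplex R).d 2 1 = 0 := by
    have t : ∀ s : SX _⦋2⦌, SX.ιChainComplex (R := R) s ≫ (SX.chainComplex R).d 2 1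
        = SX.ιChainComplex (SX.δ 0 s) - SX.ιChainComplex (SX.δ 1 s)
          + SX.ιChainComplex (SX.δ 2 s) := fun s => by
      rw [SSet.ιChainComplex_d]
      refine (Fin.sum_univ_three _).trans ?_
      simp [sub_eq_add_neg]
    rw [Preadditive.sub_comp, t, t, e₁, e₂, e₁₂]
    simp
  let z := (SX.chainComplex R).liftCycles k 1 (by simp) hk ≫ (SX.chainComplex R).homologyπ 2
  let a : H2 X := z.hom (ULift.up 1)
  obtain ⟨N, hN, ha⟩ := hf a
  let Φ := SSet.chainComplexMap F R
  -- Evaluation of the cocycle on homology: `Ψ` kills boundaries, so it factors through the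
  -- opcycles.
  let D := (SM.chainComplex R).homologyι 2 ≫ (SM.chainComplex R).descOpcycles Ψ 3 (by simp) hdΨ
  have hz : z ≫ HomologicalComplex.homologyMap Φ 2 ≫ D
      = el (c (f.comp σ₁)) - el (c (f.comp σ₂)) := by
    have hs : k ≫ Φ.f 2 ≫ Ψ = el (c (f.comp σ₁)) - el (c (f.comp σ₂)) := by
      simp only [k, Preadditive.sub_comp, Φ, SSet.ι_chainComplexMap_f_assoc, hΨ]
      have : ∀ s : SX _⦋2⦌, toM 2 (F.app _ s) = f.comp (toX 2 s) := fun s => rfl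
      rw [this, this, hs₁, hs₂]
    rw [← hs]
    simp only [z, D, Category.assoc, HomologicalComplex.homologyι_naturality_assoc,
      HomologicalComplex.homology_π_ι_assoc, HomologicalComplex.liftCycles_i_assoc,
      HomologicalComplex.p_opcyclesMap_assoc, HomologicalComplex.p_descOpcycles]
  have h0 : N • (c (f.comp σ₁) - c (f.comp σ₂)) = 0 := by
    have e := congrArg (fun φ : R ⟶ ModuleCat.of ℤ G => φ.hom (ULift.up 1)) hz
    have e' : (el (c (f.comp σ₁)) - el (c (f.comp σ₂))).hom (ULift.up 1)
      = c (f.comp σ₁) - c (f.comp σ₂) := by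
      change (el _).hom (ULift.up 1) - (el _).hom (ULift.up 1) = _
      rw [el_one, el_one]
    rw [← e', ← e]
    change N • D.hom ((H2map f).hom a) = 0
    exact (map_zsmul D.hom N _).symm.trans ((congrArg D.hom ha).trans (map_zero _))
  exact sub_eq_zero.1 (hG N hN _ h0)

end Pairing

/-- A nonzero integer can be cancelled in each entry. Germs at infinity serve as coefficients
because a polygonal sum is meaningful only for fine subdivisions, and how fine depends on the
simplex. -/
theorem germ_torsionFree (N : ℤ) (hN : N ≠ 0)
    (g : ULift.{u} (Germ (atTop : Filter ℕ) ℝ)) (hg : N • g = 0) : g = 0 := by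
  obtain ⟨g⟩ := g
  have h : N • g = 0 := congrArg ULift.down hg
  induction g using Filter.Germ.inductionOn with
  | _ s =>
    congr 1
    have h' : ((N • s : ℕ → ℝ) : Germ (atTop : Filter ℕ) ℝ) = ((0 : ℕ → ℝ) : Germ atTop ℝ) := h
    refine Germ.coe_eq.2 ?_
    filter_upwards [Germ.coe_eq.1 h'] with n hn
    have : (N : ℝ) * s n = 0 := by simpa using hn
    exact (mul_eq_zero.1 this).resolve_left (by exact_mod_cast hN)

end Pants

namespace Pants

universe u

/-! ### The singular 2-cocycle of an Alexander–Spanier 2-cocycle -/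

instance contractibleSpace_stdSimplex (n : ℕ) : ContractibleSpace (stdSimplex ℝ (Fin (n + 1))) :=
  (convex_stdSimplex ℝ (Fin (n + 1))).contractibleSpace ⟨_, single_mem_stdSimplex ℝ 0⟩

/-- The unit interval as the standard 1-simplex. -/
def edgePath (t : ℝ) : stdSimplex ℝ (Fin 2) :=
  ⟨![1 - (projIcc (0 : ℝ) 1 zero_le_one t : ℝ), projIcc (0 : ℝ) 1 zero_le_one t], by
    refine ⟨fun i => ?_, by simp⟩
    fin_cases i
    · exact sub_nonneg.2 (projIcc (0 : ℝ) 1 zero_le_one t).2.2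
    · exact (projIcc (0 : ℝ) 1 zero_le_one t).2.1⟩

theorem edgePath_apply_zero (t : ℝ) :
    (edgePath t : Fin 2 → ℝ) 0 = 1 - (projIcc (0 : ℝ) 1 zero_le_one t : ℝ) := rfl

theorem edgePath_apply_one (t : ℝ) :
    (edgePath t : Fin 2 → ℝ) 1 = (projIcc (0 : ℝ) 1 zero_le_one t : ℝ) := rfl

theorem continuous_edgePath : Continuous edgePath := by
  refine Continuous.subtype_mk (continuous_pi fun i => ?_) _
  fin_cases i
  · exact continuous_const.sub (continuous_subtype_val.comp continuous_projIcc)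
  · exact continuous_subtype_val.comp continuous_projIcc

theorem faceMap_apply {n : ℕ} (i : Fin (n + 2)) (x : stdSimplex ℝ (Fin (n + 1)))
    (k : Fin (n + 2)) : (faceMap i x : Fin (n + 2) → ℝ) k
      = ∑ j, if i.succAbove j = k then (x : Fin (n + 1) → ℝ) j else 0 := by
  have h : (faceMap i x : Fin (n + 2) → ℝ) = _ := stdSimplex.map_coe (Fin.succAbove i) x
  rw [h, FunOnFinite.linearMap_apply_apply, Finset.sum_filter]

theorem faceMap_zero_edgePath (t : ℝ) : (faceMap 0 (edgePath t) : Fin 3 → ℝ)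
    = ![0, 1 - (projIcc (0 : ℝ) 1 zero_le_one t : ℝ), (projIcc (0 : ℝ) 1 zero_le_one t : ℝ)] := by
  ext k
  rw [faceMap_apply, Fin.sum_univ_two, edgePath_apply_zero, edgePath_apply_one]
  have h0 : Fin.succAbove (0 : Fin 3) (0 : Fin 2) = 1 := by decide
  have h1 : Fin.succAbove (0 : Fin 3) (1 : Fin 2) = 2 := by decide
  rw [h0, h1]
  fin_cases k <;> simp

theorem faceMap_one_edgePath (t : ℝ) : (faceMap 1 (edgePath t) : Fin 3 → ℝ)
    = ![1 - (projIcc (0 : ℝ) 1 zero_le_one t : ℝ), 0, (projIcc (0 : ℝ) 1 zero_le_one t : ℝ)] := by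
  ext k
  rw [faceMap_apply, Fin.sum_univ_two, edgePath_apply_zero, edgePath_apply_one]
  have h0 : Fin.succAbove (1 : Fin 3) (0 : Fin 2) = 0 := by decide
  have h1 : Fin.succAbove (1 : Fin 3) (1 : Fin 2) = 2 := by decide
  rw [h0, h1]
  fin_cases k <;> simp

theorem faceMap_two_edgePath (t : ℝ) : (faceMap 2 (edgePath t) : Fin 3 → ℝ)
    = ![1 - (projIcc (0 : ℝ) 1 zero_le_one t : ℝ), (projIcc (0 : ℝ) 1 zero_le_one t : ℝ), 0] := by
  ext k
  rw [faceMap_apply, Fin.sum_univ_two, edgePath_apply_zero, edgePath_apply_one]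
  have h0 : Fin.succAbove (2 : Fin 3) (0 : Fin 2) = 0 := by decide
  have h1 : Fin.succAbove (2 : Fin 3) (1 : Fin 2) = 1 := by decide
  rw [h0, h1]
  fin_cases k <;> simp

/-- The alternating sum of the polygonal sums of `h` over the sides of a triangle. -/
def bdrySum {X : Type*} (h : X → X → ℝ) (σ : stdSimplex ℝ (Fin 3) → X) (n : ℕ) : ℝ :=
  polySum h (fun t => σ (faceMap 0 (edgePath t))) n
    - polySum h (fun t => σ (faceMap 1 (edgePath t))) n
    + polySum h (fun t => σ (faceMap 2 (edgePath t))) n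

theorem bdrySum_comp {X Y : Type*} (h : X → X → ℝ) (f : Y → X) (σ : stdSimplex ℝ (Fin 3) → Y)
    (n : ℕ) : bdrySum (fun a b => h (f a) (f b)) σ n = bdrySum h (fun x => f (σ x)) n := rfl

theorem bdrySum_sub {X : Type*} (h h' : X → X → ℝ) (σ : stdSimplex ℝ (Fin 3) → X) (n : ℕ) :
    bdrySum (fun a b => h a b - h' a b) σ n = bdrySum h σ n - bdrySum h' σ n := by
  simp only [bdrySum, polySum, Finset.sum_sub_distrib]
  ring

/-- Along each side a fine polygonal sum is the difference of the values of `φ` at the end points,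
and around the triangle these differences cancel. -/
theorem LocDiff.eventually_bdrySum {κ : stdSimplex ℝ (Fin 3) → stdSimplex ℝ (Fin 3) → ℝ}
    {φ : stdSimplex ℝ (Fin 3) → ℝ} (H : LocDiff κ φ) : ∀ᶠ n in atTop, bdrySum κ id n = 0 := by
  have hc : ∀ i : Fin 3, ContinuousOn (fun t => faceMap i (edgePath t)) (Icc 0 1) := fun i =>
    ((faceMap i).continuous.comp continuous_edgePath).continuousOn
  have e1 : faceMap (n := 1) 0 (edgePath 0) = faceMap 2 (edgePath 1) := by
    ext k
    rw [faceMap_zero_edgePath, faceMap_two_edgePath]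
    simp
  have e2 : faceMap (n := 1) 0 (edgePath 1) = faceMap 1 (edgePath 1) := by
    ext k
    rw [faceMap_zero_edgePath, faceMap_one_edgePath]
    simp
  have e3 : faceMap (n := 1) 1 (edgePath 0) = faceMap 2 (edgePath 0) := by
    ext k
    rw [faceMap_one_edgePath, faceMap_two_edgePath]
    simp
  filter_upwards [H.eventually_polySum (hc 0), H.eventually_polySum (hc 1),
    H.eventually_polySum (hc 2)] with n h0 h1 h2
  simp only [bdrySum, id]
  rw [h0, h1, h2, e1, e2, e3]
  ring

variable {M : Type u} [TopologicalSpace M] {F : M → M → M → ℝ}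

/-- A primitive of the pullback of `F` to a singular simplex. -/
def simplexGauge (hF : LocCocycle F) (σ : C(stdSimplex ℝ (Fin 3), M)) :
    stdSimplex ℝ (Fin 3) → stdSimplex ℝ (Fin 3) → ℝ :=
  Classical.choose (hF.comp σ.continuous).exists_locCob

theorem simplexGauge_spec (hF : LocCocycle F) (σ : C(stdSimplex ℝ (Fin 3), M)) :
    LocCob (fun a b c => F (σ a) (σ b) (σ c)) (simplexGauge hF σ) :=
  Classical.choose_spec (hF.comp σ.continuous).exists_locCob

/-- Two primitives differ by a 1-cocycle on a contractible simplex, hence by a coboundary, whose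
boundary sums vanish eventually. So the germ of boundary sums does not depend on the primitive
chosen. -/
theorem eventually_bdrySum_eq (hF : LocCocycle F) (σ : C(stdSimplex ℝ (Fin 3), M))
    {h : stdSimplex ℝ (Fin 3) → stdSimplex ℝ (Fin 3) → ℝ}
    (hh : LocCob (fun a b c => F (σ a) (σ b) (σ c)) h) :
    ∀ᶠ n in atTop, bdrySum (simplexGauge hF σ) id n = bdrySum h id n := by
  have := (simplexGauge_spec hF σ).sub hh
  simp only [sub_self] at this
  obtain ⟨φ, hφ⟩ := exists_locDiff this
  filter_upwards [hφ.eventually_bdrySum] with n hn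
  rw [bdrySum_sub] at hn
  linarith

/-- The singular 2-cochain of an Alexander–Spanier 2-cocycle, with values in germs at infinity of
sequences (the sequence is that of the polygonal sums along the boundary). -/
def singularCochain (hF : LocCocycle F) (σ : C(stdSimplex ℝ (Fin 3), M)) :
    ULift.{u} (Germ (atTop : Filter ℕ) ℝ) :=
  ULift.up ((fun n => bdrySum (simplexGauge hF σ) id n : ℕ → ℝ) : Germ atTop ℝ)

theorem ulift_germ_alt_eq_zero (s₀ s₁ s₂ s₃ : ℕ → ℝ)
    (h : ∀ᶠ n in atTop, s₀ n - s₁ n + s₂ n - s₃ n = 0) :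
    (ULift.up (s₀ : Germ atTop ℝ) - ULift.up (s₁ : Germ atTop ℝ) + ULift.up (s₂ : Germ atTop ℝ)
      - ULift.up (s₃ : Germ atTop ℝ) : ULift.{u} (Germ (atTop : Filter ℕ) ℝ)) = 0 :=
  ULift.down_injective (Germ.coe_eq.2 h)

/-- All four faces may use restrictions of a single primitive on the tetrahedron, since the choice
of primitive is irrelevant by `eventually_bdrySum_eq`. Every edge of the tetrahedron then occurs
twice, with opposite signs. -/
theorem singularCochain_cocycle (hF : LocCocycle F) (τ : C(stdSimplex ℝ (Fin 4), M)) :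
    ∑ i : Fin 4, (-1 : ℤ) ^ i.val • singularCochain hF (τ.comp (faceMap i)) = 0 := by
  obtain ⟨h, hh⟩ := (hF.comp τ.continuous).exists_locCob
  have key : ∀ i : Fin 4, ∀ᶠ n in atTop, bdrySum (simplexGauge hF (τ.comp (faceMap i))) id n
      = bdrySum h (faceMap i) n := fun i => by
    have h' : LocCob (fun a b c => F (τ.comp (faceMap i) a) (τ.comp (faceMap i) b)
        (τ.comp (faceMap i) c)) (fun a b => h (faceMap i a) (faceMap i b)) :=
      hh.comp (faceMap (n := 2) i).continuous
    filter_upwards [eventually_bdrySum_eq hF (τ.comp (faceMap i)) h'] with n hn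
    rw [hn, bdrySum_comp]
    rfl
  -- The simplicial identities, which match the twelve edges of the four faces in pairs.
  have comm : ∀ (i k : Fin 4) (j l : Fin 3), (∀ m : Fin 2, i.succAbove (j.succAbove m)
      = k.succAbove (l.succAbove m)) → ∀ x, faceMap i (faceMap j x) = faceMap k (faceMap l x) := by
    intro i k j l hm x
    change stdSimplex.map _ (stdSimplex.map _ _) = stdSimplex.map _ (stdSimplex.map _ _)
    rw [stdSimplex.map_comp_apply, stdSimplex.map_comp_apply]
    congr 1
    exact funext hm
  have c1 := comm 0 1 0 0 (by decide)
  have c2 := comm 0 2 1 0 (by decide)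
  have c3 := comm 0 3 2 0 (by decide)
  have c4 := comm 1 2 1 1 (by decide)
  have c5 := comm 1 3 2 1 (by decide)
  have c6 := comm 2 3 2 2 (by decide)
  have alt : ∀ g : Fin 4 → ULift.{u} (Germ (atTop : Filter ℕ) ℝ),
      ∑ i : Fin 4, (-1 : ℤ) ^ i.val • g i = g 0 - g 1 + g 2 - g 3 := fun g => by
    rw [Fin.sum_univ_four]
    have e3 : (-1 : ℤ) ^ ((3 : Fin 4) : ℕ) = -1 := by decide
    have e2 : (-1 : ℤ) ^ ((2 : Fin 4) : ℕ) = 1 := by decide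
    have e1 : (-1 : ℤ) ^ ((1 : Fin 4) : ℕ) = -1 := by decide
    have e0 : (-1 : ℤ) ^ ((0 : Fin 4) : ℕ) = 1 := by decide
    rw [e3, e2, e1, e0, one_smul, neg_smul, one_smul, one_smul, neg_smul, one_smul]
    abel
  rw [alt]
  refine ulift_germ_alt_eq_zero _ _ _ _ ?_
  filter_upwards [key 0, key 1, key 2, key 3] with n h0 h1 h2 h3
  rw [h0, h1, h2, h3]
  simp only [bdrySum, c1, c2, c3, c4, c5, c6]
  ring

end Pants

namespace Pants

universe u

/-! ### Primitives on convex compact sets -/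

section Convex

variable {V : Type*} [NormedAddCommGroup V] [NormedSpace ℝ V] {S : Set V}

/-- This is `exists_locDiff` on the subspace `S`, with the primitive extended by zero to `V`, so
that later gluing needs no subtypes. -/
theorem exists_locDiff_on (hS : Convex ℝ S) (hc : IsCompact S) (hne : S.Nonempty)
    {κ : V → V → ℝ} (H : ∀ x ∈ S, ∃ U ∈ 𝓝[S] x, ∀ a ∈ U, ∀ b ∈ U, ∀ c ∈ U,
      κ a b + κ b c - κ a c = 0) :
    ∃ φ : V → ℝ, ∀ x ∈ S, ∃ U ∈ 𝓝[S] x, ∀ a ∈ U, ∀ b ∈ U, κ a b = φ b - φ a := by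
  classical
  have : CompactSpace S := isCompact_iff_compactSpace.1 hc
  have : ContractibleSpace S := hS.contractibleSpace hne
  obtain ⟨φ, hφ⟩ := exists_locDiff (X := S) (κ := fun a b => κ a b) (fun x => by
    obtain ⟨U, hU, H⟩ := H x x.2
    exact ⟨_, preimage_coe_mem_nhds_subtype.2 hU, fun a ha b hb c hc => H a ha b hb c hc⟩)
  refine ⟨fun x => if h : x ∈ S then φ ⟨x, h⟩ else 0, fun x hx => ?_⟩
  obtain ⟨U, hU, H⟩ := hφ ⟨x, hx⟩
  refine ⟨_, mem_nhds_subtype_iff_nhdsWithin.1 hU, ?_⟩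
  rintro _ ⟨a, ha, rfl⟩ _ ⟨b, hb, rfl⟩
  simp only [a.2, b.2, dif_pos]
  exact H a ha b hb

end Convex

/-! ### A two-simplex cycle on the sphere -/

theorem projIcc_coe_eq {t : ℝ} (ht : t ∈ Icc (0 : ℝ) 1) :
    (projIcc (0 : ℝ) 1 zero_le_one t : ℝ) = t := by
  rw [projIcc_of_mem _ ht]

/-- The standard triangle as a disc, one side wrapping around the boundary. -/
def triDisc (x : stdSimplex ℝ (Fin 3)) : ℂ :=
  ((1 - x 2 : ℝ) : ℂ) * Complex.exp ((2 * Real.pi * (x 1 / (1 - x 2)) : ℝ) * Complex.I)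

theorem norm_triDisc (x : stdSimplex ℝ (Fin 3)) : ‖triDisc x‖ = 1 - x 2 := by
  rw [triDisc, norm_mul, Complex.norm_exp_ofReal_mul_I, mul_one, Complex.norm_real,
    Real.norm_of_nonneg]
  have := x.2.2
  rw [Fin.sum_univ_three] at this
  have h0 := x.2.1 0
  have h1 := x.2.1 1
  change 0 ≤ 1 - x.1 2
  linarith

theorem continuous_triDisc : Continuous triDisc := by
  have hc : ∀ i : Fin 3, Continuous fun x : stdSimplex ℝ (Fin 3) => x i := fun i =>
    (continuous_apply i).comp continuous_subtype_val
  refine continuous_iff_continuousAt.2 fun x => ?_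
  -- At the vertex `x 2 = 1` the angle has no limit, but the radius `1 - x 2` tends to zero.
  by_cases hx : 1 - x 2 = 0
  · have h0 : triDisc x = 0 := by rw [← norm_eq_zero, norm_triDisc, hx]
    rw [ContinuousAt, h0, tendsto_zero_iff_norm_tendsto_zero]
    have : Tendsto (fun x : stdSimplex ℝ (Fin 3) => 1 - x 2) (𝓝 x) (𝓝 (1 - x 2)) :=
      (continuous_const.sub (hc 2)).continuousAt
    rw [hx] at this
    exact this.congr fun y => (norm_triDisc y).symm
  · unfold triDisc
    have h1 : ContinuousAt (fun x : stdSimplex ℝ (Fin 3) => x 1 / (1 - x 2)) x :=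
      (hc 1).continuousAt.div (continuous_const.sub (hc 2)).continuousAt hx
    have h2 : ContinuousAt (fun x : stdSimplex ℝ (Fin 3) => 1 - x 2) x :=
      (continuous_const.sub (hc 2)).continuousAt
    have h3 : ContinuousAt (fun x : stdSimplex ℝ (Fin 3) => 2 * Real.pi * (x 1 / (1 - x 2))) x :=
      continuousAt_const.mul h1
    exact (Complex.continuous_ofReal.continuousAt.comp h2).mul
      (Complex.continuous_exp.continuousAt.comp
        ((Complex.continuous_ofReal.continuousAt.comp h3).mul continuousAt_const))

/-- The two sides through the centre have the constant angles `2π` and `0`. So as a singular chain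
the disc has only the circle as its boundary. -/
theorem triDisc_face_zero_eq_face_one (t : ℝ) :
    triDisc (faceMap 0 (edgePath t)) = triDisc (faceMap 1 (edgePath t)) := by
  simp only [triDisc, faceMap_zero_edgePath, faceMap_one_edgePath]
  simp only [Matrix.cons_val]
  by_cases h : 1 - (projIcc (0 : ℝ) 1 zero_le_one t : ℝ) = 0
  · simp [h]
  · rw [div_self h]
    have : (((2 * Real.pi * 1 : ℝ) : ℂ) * Complex.I) = 2 * Real.pi * Complex.I := by push_cast; ring
    rw [this, Complex.exp_two_pi_mul_I]
    simp

theorem triDisc_face_two (t : ℝ) (ht : t ∈ Icc (0 : ℝ) 1) :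
    triDisc (faceMap 2 (edgePath t)) = Complex.exp ((2 * Real.pi * t : ℝ) * Complex.I) := by
  simp only [triDisc, faceMap_two_edgePath]
  simp only [Matrix.cons_val, projIcc_coe_eq ht]
  simp

theorem edgePath_surjective (x : stdSimplex ℝ (Fin 2)) : ∃ t ∈ Icc (0 : ℝ) 1, edgePath t = x := by
  have h := x.2.2
  rw [Fin.sum_univ_two] at h
  have h0 := x.2.1 0
  have h1 := x.2.1 1
  have ht : x.1 1 ∈ Icc (0 : ℝ) 1 := ⟨h1, by linarith⟩
  refine ⟨x.1 1, ht, ?_⟩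
  ext k
  fin_cases k
  · change (edgePath _ : Fin 2 → ℝ) 0 = x.1 0
    rw [edgePath_apply_zero, projIcc_coe_eq ht]
    linarith
  · change (edgePath _ : Fin 2 → ℝ) 1 = x.1 1
    rw [edgePath_apply_one, projIcc_coe_eq ht]

/-- Inversion in the circle of radius `√r` as a map to the sphere. -/
def invSphere (r : ℝ) (w : ℂ) : OnePoint ℂ :=
  open Classical in if w = 0 then OnePoint.infty else ((r / (starRingEnd ℂ) w : ℂ) : OnePoint ℂ)

/-- The norm `r / ‖w‖` tends to infinity at the origin. Since `r / conj w = r w / ‖w‖²`, the map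
equals `w ↦ r w` on the unit circle; with `triDisc` it therefore parametrizes the outer disc of the
sphere with the same boundary as the inner disc. -/
theorem continuous_invSphere {r : ℝ} (hr : 0 < r) : Continuous (invSphere r) := by
  refine continuous_iff_continuousAt.2 fun w => ?_
  have hr' : (r : ℂ) ≠ 0 := by exact_mod_cast hr.ne'
  by_cases hw : w = 0
  · subst hw
    rw [ContinuousAt, ← nhdsNE_sup_pure, tendsto_sup]
    have e0 : invSphere r 0 = OnePoint.infty := by simp [invSphere]
    refine ⟨?_, by rw [tendsto_pure_left]; exact fun s hs => mem_of_mem_nhds hs⟩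
    rw [e0]
    have h1 : Tendsto (fun w : ℂ => (r : ℂ) / (starRingEnd ℂ) w) (𝓝[≠] 0)
        (Filter.coclosedCompact ℂ) := by
      rw [Filter.coclosedCompact_eq_cocompact, ← Metric.cobounded_eq_cocompact,
        ← tendsto_norm_atTop_iff_cobounded]
      have h2 : Tendsto (fun w : ℂ => r * ‖w⁻¹‖) (𝓝[≠] 0) atTop :=
        (tendsto_norm_atTop_iff_cobounded.2 Filter.tendsto_inv₀_nhdsNE_zero).const_mul_atTop hr
      refine h2.congr fun w => ?_
      rw [norm_div, RCLike.norm_conj, norm_inv, Complex.norm_real, Real.norm_of_nonneg hr.le,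
        div_eq_mul_inv]
    refine (OnePoint.tendsto_coe_infty.comp h1).congr' ?_
    filter_upwards [self_mem_nhdsWithin] with w hw
    simp only [invSphere, if_neg (show w ≠ 0 from hw), Function.comp]
  · have hc : (starRingEnd ℂ) w ≠ 0 := by simpa using hw
    have h1 : ContinuousAt (fun w : ℂ => (((r : ℂ) / (starRingEnd ℂ) w : ℂ) : OnePoint ℂ)) w :=
      OnePoint.continuous_coe.continuousAt.comp
        (continuousAt_const.div Complex.continuous_conj.continuousAt hc)
    refine h1.congr ?_
    filter_upwards [isOpen_ne.mem_nhds hw] with w hw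
    simp only [invSphere, if_neg (show w ≠ 0 from hw)]

variable {M : Type u} [TopologicalSpace M] {F : M → M → M → ℝ}

/-- The difference `σ₁ - σ₂` is a cycle on the sphere, its image is torsion, and the cocycle
`singularCochain` has torsion free values, so it cannot distinguish the two simplices. By
`eventually_bdrySum_eq` any primitives may be used to compute those values. -/
theorem eventually_bdrySum_eq_of_representsZero (hF : LocCocycle F) (f : C(OnePoint ℂ, M))
    (hf : RepresentsZero f) (σ₁ σ₂ : C(stdSimplex ℝ (Fin 3), OnePoint ℂ))
    (h₁ : ∀ t, σ₁ (faceMap 0 (edgePath t)) = σ₁ (faceMap 1 (edgePath t)))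
    (h₂ : ∀ t, σ₂ (faceMap 0 (edgePath t)) = σ₂ (faceMap 1 (edgePath t)))
    (h₁₂ : ∀ t ∈ Icc (0 : ℝ) 1, σ₁ (faceMap 2 (edgePath t)) = σ₂ (faceMap 2 (edgePath t)))
    {k₁ k₂ : stdSimplex ℝ (Fin 3) → stdSimplex ℝ (Fin 3) → ℝ}
    (hk₁ : LocCob (fun a b c => F (f (σ₁ a)) (f (σ₁ b)) (f (σ₁ c))) k₁)
    (hk₂ : LocCob (fun a b c => F (f (σ₂ a)) (f (σ₂ b)) (f (σ₂ c))) k₂) :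
    ∀ᶠ n in atTop, bdrySum k₁ id n = bdrySum k₂ id n := by
  let up : C(OnePoint ℂ, ULift.{u} (OnePoint ℂ)) := ⟨ULift.up, continuous_uliftUp⟩
  have key := cocycle_eq_of_torsion _ hf germ_torsionFree (singularCochain hF)
    (singularCochain_cocycle hF) (up.comp σ₁) (up.comp σ₂)
    (by
      ext1 x
      obtain ⟨t, -, rfl⟩ := edgePath_surjective x
      exact congrArg ULift.up (h₁ t))
    (by
      ext1 x
      obtain ⟨t, -, rfl⟩ := edgePath_surjective x
      exact congrArg ULift.up (h₂ t))
    (by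
      ext1 x
      obtain ⟨t, ht, rfl⟩ := edgePath_surjective x
      exact congrArg ULift.up (h₁₂ t ht))
  have key' := Germ.coe_eq.1 (congrArg ULift.down key)
  filter_upwards [key', eventually_bdrySum_eq hF (f.comp σ₁) hk₁,
    eventually_bdrySum_eq hF (f.comp σ₂) hk₂] with n hn h1 h2
  rw [← h1, ← h2]
  exact hn

end Pants

/-! ### Periods on an annulus and a global primitive of the cocycle on the sphere -/

namespace Pants

universe u

/-- Polar coordinates. -/
def polarMap (p : ℝ × ℝ) : ℂ := (p.1 : ℂ) * Complex.exp (p.2 * Complex.I)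

theorem continuous_polarMap : Continuous polarMap := by
  unfold polarMap
  fun_prop

theorem norm_polarMap {p : ℝ × ℝ} (hp : 0 ≤ p.1) : ‖polarMap p‖ = p.1 := by
  rw [polarMap, norm_mul, Complex.norm_exp_ofReal_mul_I, mul_one, Complex.norm_real,
    Real.norm_of_nonneg hp]

theorem polarMap_add_two_pi (r θ : ℝ) : polarMap (r, θ + 2 * Real.pi) = polarMap (r, θ) := by
  simp only [polarMap]
  congr 1
  push_cast
  rw [add_mul, Complex.exp_add, Complex.exp_two_pi_mul_I, mul_one]

/-- A 1-cocycle on an annulus with vanishing periods is a coboundary near a middle circle. -/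
theorem exists_locDiff_annulus {R : ℝ} (hR : 0 < R) {κ : ℂ → ℂ → ℝ}
    (hκ : ∀ z : ℂ, R ≤ ‖z‖ → ‖z‖ ≤ R + 2 → ∃ U ∈ 𝓝 z, ∀ a ∈ U, ∀ b ∈ U, ∀ c ∈ U,
      κ a b + κ b c - κ a c = 0)
    (hper : ∃ᶠ n in atTop, polySum κ (fun t => polarMap (R + 1, 2 * Real.pi * t)) n = 0) :
    ∃ φ : ℂ → ℝ, ∀ z : ℂ, ‖z‖ = R + 1 → ∃ U ∈ 𝓝 z, ∀ a ∈ U, ∀ b ∈ U, κ a b = φ b - φ a := by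
  have hpi := Real.pi_gt_three
  have hpi4 := Real.pi_lt_d2
  -- The angles `[-4, 8]` contain `(-π, π]` and `(0, 2π]`, the ranges of the two branches of the
  -- argument used below, and also the shift by `2π` of the smaller range `[-4, 1]`.
  let Q : Set (ℝ × ℝ) := Icc R (R + 2) ×ˢ Icc (-4) 8
  obtain ⟨ψ, hψ⟩ := exists_locDiff_on (S := Q) ((convex_Icc _ _).prod (convex_Icc _ _))
    (isCompact_Icc.prod isCompact_Icc) ⟨(R, 0), by constructor <;> constructor <;> norm_num⟩
    (κ := fun p q => κ (polarMap p) (polarMap q)) (fun p hp => by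
      have hn := norm_polarMap (p := p) (hR.le.trans hp.1.1)
      obtain ⟨U, hU, H⟩ := hκ (polarMap p) (by rw [hn]; exact hp.1.1) (by rw [hn]; exact hp.1.2)
      exact ⟨_, mem_nhdsWithin_of_mem_nhds (continuous_polarMap.continuousAt hU),
        fun a ha b hb c hc => H _ ha _ hb _ hc⟩)
  -- the monodromy is locally constant
  let Q' : Set (ℝ × ℝ) := Icc R (R + 2) ×ˢ Icc (-4) 1
  let D : ℝ × ℝ → ℝ := fun p => ψ (p.1, p.2 + 2 * Real.pi) - ψ p
  have hQ' : ∀ p ∈ Q', p ∈ Q ∧ (p.1, p.2 + 2 * Real.pi) ∈ Q := fun p hp =>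
    ⟨⟨hp.1, hp.2.1, by linarith [hp.2.2]⟩, hp.1, by linarith [hp.2.1], by linarith [hp.2.2]⟩
  have hDconst : ∀ p ∈ Q', ∀ q ∈ Q', D p = D q := by
    have hpre : IsPreconnected Q' := isPreconnected_Icc.prod isPreconnected_Icc
    intro p hp q hq
    refine hpre.induction₂ (fun p q => D p = D q) (fun x hx => ?_)
      (fun _ _ _ _ _ _ h h' => h.trans h') (fun _ _ _ _ h => h.symm) hp hq
    obtain ⟨U, hU, H⟩ := hψ x (hQ' x hx).1
    obtain ⟨U', hU', H'⟩ := hψ _ (hQ' x hx).2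
    have hc : Continuous fun p : ℝ × ℝ => (p.1, p.2 + 2 * Real.pi) := by fun_prop
    have t : Tendsto (fun p : ℝ × ℝ => (p.1, p.2 + 2 * Real.pi)) (𝓝[Q'] x)
        (𝓝[Q] (x.1, x.2 + 2 * Real.pi)) :=
      tendsto_nhdsWithin_of_tendsto_nhds_of_eventually_within _
        (hc.continuousAt.mono_left nhdsWithin_le_nhds)
        (eventually_of_mem self_mem_nhdsWithin fun y hy => (hQ' y hy).2)
    have hxU : x ∈ U := mem_of_mem_nhdsWithin (hQ' x hx).1 hU
    have hxU' := mem_of_mem_nhdsWithin (hQ' x hx).2 hU'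
    filter_upwards [nhdsWithin_mono x (fun y hy => (hQ' y hy).1) hU, t hU'] with y hy hy'
    have e1 := H x hxU y hy
    have e2 := H' _ hxU' _ hy'
    rw [polarMap_add_two_pi, polarMap_add_two_pi] at e2
    simp only [D]
    simp only [Prod.mk.eta] at e2
    linarith
  -- The constant monodromy is a polygonal sum of `κ` around the middle circle for every fine
  -- subdivision, and some fine subdivision has sum zero.
  have hD0 : ∀ p ∈ Q', D p = 0 := by
    have h0 : (R + 1, (0 : ℝ)) ∈ Q' := by constructor <;> constructor <;> norm_num
    suffices D (R + 1, 0) = 0 from fun p hp => (hDconst p hp _ h0).trans this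
    have hseg : ContinuousOn (fun t : ℝ => (R + 1, 2 * Real.pi * t)) (Icc 0 1) := by fun_prop
    have hsegQ : ∀ t ∈ Icc (0 : ℝ) 1, (R + 1, 2 * Real.pi * t) ∈ Q := fun t ht =>
      ⟨⟨by norm_num, by norm_num⟩, by nlinarith [ht.1], by nlinarith [ht.2, ht.1]⟩
    choose! U hU H using hψ
    classical
    have hev := eventually_subdivision (X := Q)
      (γ := fun t => ⟨(R + 1, 2 * Real.pi * (projIcc (0 : ℝ) 1 zero_le_one t : ℝ)),
        hsegQ _ (projIcc (0 : ℝ) 1 zero_le_one t).2⟩)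
      (Continuous.continuousOn (Continuous.subtype_mk (by fun_prop) _))
      (fun x => Subtype.val ⁻¹' U x) (fun x => preimage_coe_mem_nhds_subtype.2 (hU x x.2))
    obtain ⟨n, hn0, hn, hpos⟩ := (hper.and_eventually (hev.and (eventually_gt_atTop 0))).exists
    have hpos' : (0 : ℝ) < n := by exact_mod_cast hpos
    have h1 : ∀ j ∈ Finset.range n, κ (polarMap (R + 1, 2 * Real.pi * (j / n)))
        (polarMap (R + 1, 2 * Real.pi * ((j + 1 : ℕ) / n)))
        = ψ (R + 1, 2 * Real.pi * ((j + 1 : ℕ) / n)) - ψ (R + 1, 2 * Real.pi * (j / n)) := by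
      intro j hj
      have hj := Finset.mem_range.1 hj
      obtain ⟨y, hy⟩ := hn j hj
      have hle : (j : ℝ) / n ≤ (j + 1 : ℕ) / n := by push_cast; gcongr; linarith
      have hj1 : ((j + 1 : ℕ) : ℝ) / n ≤ 1 := (div_le_one hpos').2 (by exact_mod_cast hj)
      have hj0 : (0 : ℝ) ≤ j / n := by positivity
      have a1 := hy _ ⟨le_rfl, hle⟩
      have a2 := hy _ ⟨hle, le_rfl⟩
      simp only [mem_preimage, projIcc_coe_eq (⟨hj0, hle.trans hj1⟩ : (j : ℝ) / n ∈ Icc (0 : ℝ) 1),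
        projIcc_coe_eq (⟨hj0.trans hle, hj1⟩ : ((j + 1 : ℕ) : ℝ) / n ∈ Icc (0 : ℝ) 1)] at a1 a2
      exact H y y.2 _ a1 _ a2
    rw [polySum, Finset.sum_congr rfl h1,
      Finset.sum_range_sub (fun j => ψ (R + 1, 2 * Real.pi * ((j : ℕ) / n))), div_self hpos'.ne']
      at hn0
    simp only [D]
    simpa using hn0
  -- The principal argument jumps at the negative axis. As the monodromy vanishes, `ψ` does not
  -- notice the jump, and near each point a continuous branch can replace it.
  refine ⟨fun z => ψ (‖z‖, z.arg), fun z hz => ?_⟩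
  have hz0 : z ≠ 0 := by rw [← norm_pos_iff, hz]; linarith
  have hrad : ∀ᶠ a in 𝓝 z, ‖a‖ ∈ Icc R (R + 2) := by
    refine continuous_norm.continuousAt (Icc_mem_nhds ?_ ?_) <;> rw [hz] <;> linarith
  have lift : ∀ ℓ : ℂ → ℝ, ContinuousAt ℓ z → (∀ᶠ a in 𝓝 z, ℓ a ∈ Icc (-4 : ℝ) 8) →
      (∀ᶠ a in 𝓝 z, polarMap (‖a‖, ℓ a) = a ∧ ψ (‖a‖, ℓ a) = ψ (‖a‖, a.arg)) →
      ∃ U ∈ 𝓝 z, ∀ a ∈ U, ∀ b ∈ U, κ a b = ψ (‖b‖, b.arg) - ψ (‖a‖, a.arg) := by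
    intro ℓ hc hI he
    have hmem : ∀ᶠ a in 𝓝 z, (‖a‖, ℓ a) ∈ Q := by
      filter_upwards [hrad, hI] with a h1 h2 using ⟨h1, h2⟩
    obtain ⟨U, hU, H⟩ := hψ _ hmem.self_of_nhds
    have t : Tendsto (fun a => (‖a‖, ℓ a)) (𝓝 z) (𝓝[Q] (‖z‖, ℓ z)) :=
      tendsto_nhdsWithin_of_tendsto_nhds_of_eventually_within _
        (continuous_norm.continuousAt.prodMk hc) hmem
    refine ⟨_, inter_mem (t hU) he, fun a ha b hb => ?_⟩
    have := H _ ha.1 _ hb.1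
    rw [ha.2.1, ha.2.2, hb.2.1, hb.2.2] at this
    exact this
  have hbound : ∀ a : ℂ, a.arg ∈ Icc (-4 : ℝ) 8 := fun a =>
    ⟨by linarith [Complex.neg_pi_lt_arg a], by linarith [Complex.arg_le_pi a]⟩
  by_cases hs : z ∈ Complex.slitPlane
  · exact lift Complex.arg (Complex.continuousAt_arg hs) (Eventually.of_forall hbound)
      (Eventually.of_forall fun a => ⟨Complex.norm_mul_exp_arg_mul_I a, rfl⟩)
  · have hs' : -z ∈ Complex.slitPlane := by
      rw [Complex.mem_slitPlane_iff] at hs ⊢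
      push Not at hs
      left
      rw [Complex.neg_re, neg_pos]
      rcases lt_or_eq_of_le hs.1 with h | h
      · exact h
      · exact absurd (Complex.ext h hs.2) hz0
    have hre : z.re < 0 := by
      rw [Complex.mem_slitPlane_iff] at hs
      push Not at hs
      rcases lt_or_eq_of_le hs.1 with h | h
      · exact h
      · exact absurd (Complex.ext h hs.2) hz0
    -- The branch of the argument with values in `(0, 2π]`, continuous across the negative axis.
    have hc : ContinuousAt (fun a : ℂ => (-a).arg + Real.pi) z :=
      ((Complex.continuousAt_arg hs').comp (f := fun a : ℂ => -a) continuousAt_neg).add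
        continuousAt_const
    refine lift (fun a => (-a).arg + Real.pi) hc (Eventually.of_forall fun a => ?_) ?_
    · exact ⟨by linarith [Complex.neg_pi_lt_arg (-a)], by linarith [Complex.arg_le_pi (-a)]⟩
    have hre' : ∀ᶠ a in 𝓝 z, a.re < 0 := Complex.continuous_re.continuousAt (Iio_mem_nhds hre)
    filter_upwards [hre', hrad] with a ha har
    rcases lt_or_ge a.im 0 with h | h
    · have e : (-a).arg = a.arg + Real.pi := Complex.arg_neg_eq_arg_add_pi_iff.2 (Or.inl h)
      have e' : (-a).arg + Real.pi = a.arg + 2 * Real.pi := by rw [e]; ring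
      rw [e', polarMap_add_two_pi]
      refine ⟨Complex.norm_mul_exp_arg_mul_I a, ?_⟩
      have := hD0 (‖a‖, a.arg) ⟨har, (hbound a).1, by
        have := Complex.arg_le_pi (-a); linarith⟩
      simp only [D] at this
      linarith
    · have e : (-a).arg = a.arg - Real.pi := Complex.arg_neg_eq_arg_sub_pi_iff.2 (by
        rcases lt_or_eq_of_le h with h | h
        · exact Or.inl h
        · exact Or.inr ⟨h.symm, ha⟩)
      rw [e, sub_add_cancel]
      exact ⟨Complex.norm_mul_exp_arg_mul_I a, rfl⟩

variable {M : Type u} [TopologicalSpace M] {F : M → M → M → ℝ}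

/-- If the sphere `f` is torsion in homology, then every 2-cocycle becomes a coboundary when pulled
back by `f`. -/
theorem exists_global_locCob (hF : LocCocycle F) (f : C(OnePoint ℂ, M)) (hf : RepresentsZero f) :
    ∃ h : OnePoint ℂ → OnePoint ℂ → ℝ, LocCob (fun a b c => F (f a) (f b) (f c)) h := by
  classical
  set G : OnePoint ℂ → OnePoint ℂ → OnePoint ℂ → ℝ := fun a b c => F (f a) (f b) (f c) with hGdef
  have hG : LocCocycle G := hF.comp f.continuous
  obtain ⟨U, hU, HU⟩ := hG OnePoint.infty
  have hUinf : OnePoint.infty ∈ U := mem_of_mem_nhds hU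
  obtain ⟨R, hR, hRU⟩ : ∃ R : ℝ, 0 < R ∧ ∀ z : ℂ, R - 1 < ‖z‖ → (z : OnePoint ℂ) ∈ U := by
    have h1 : (OnePoint.some ⁻¹' U : Set ℂ) ∈ Bornology.cobounded ℂ := by
      rw [Metric.cobounded_eq_cocompact, ← Filter.coclosedCompact_eq_cocompact]
      exact OnePoint.tendsto_coe_infty hU
    obtain ⟨r, -, hr⟩ := (Metric.hasBasis_cobounded_compl_closedBall (0 : ℂ)).mem_iff.1 h1
    refine ⟨max r 0 + 1, by positivity, fun z hz => hr ?_⟩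
    simp only [mem_compl_iff, Metric.mem_closedBall, dist_zero_right, not_le]
    linarith [le_max_left r 0]
  -- Near infinity the cone with apex `∞` is an explicit primitive, `(a, b) ↦ G ∞ a b`.
  have HU' : ∀ a ∈ U, ∀ b ∈ U, ∀ c ∈ U, G OnePoint.infty a b + G OnePoint.infty b c
      - G OnePoint.infty a c = G a b c := fun a ha b hb c hc => by
    have := HU _ hUinf a ha b hb c hc
    linarith
  -- the primitive on a large disc
  let B : Set ℂ := Metric.closedBall 0 (R + 3)
  have : CompactSpace B := isCompact_iff_compactSpace.1 (isCompact_closedBall _ _)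
  have : ContractibleSpace B := (convex_closedBall (0 : ℂ) (R + 3)).contractibleSpace
    ⟨0, by simp; linarith⟩
  have hcB : Continuous fun b : B => ((b : ℂ) : OnePoint ℂ) :=
    OnePoint.continuous_coe.comp continuous_subtype_val
  obtain ⟨h₁, hh₁⟩ := (hG.comp hcB).exists_locCob
  let hB : ℂ → ℂ → ℝ := fun a b => if h : a ∈ B ∧ b ∈ B then h₁ ⟨a, h.1⟩ ⟨b, h.2⟩ else 0
  have hB_eq : ∀ a b (ha : a ∈ B) (hb : b ∈ B), hB a b = h₁ ⟨a, ha⟩ ⟨b, hb⟩ := fun a b ha hb =>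
    dif_pos ⟨ha, hb⟩
  have hhB : ∀ z : ℂ, ‖z‖ < R + 3 → ∃ W ∈ 𝓝 z, ∀ a ∈ W, ∀ b ∈ W, ∀ c ∈ W,
      hB a b + hB b c - hB a c = G a b c := fun z hz => by
    have hzB : z ∈ B := by simp only [B, Metric.mem_closedBall, dist_zero_right]; exact hz.le
    obtain ⟨W, hW, H⟩ := hh₁ ⟨z, hzB⟩
    have hW' := mem_nhds_subtype_iff_nhdsWithin.1 hW
    have hBn : B ∈ 𝓝 z := Metric.isOpen_ball.mem_nhds (show z ∈ Metric.ball (0 : ℂ) (R + 3) by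
      simpa using hz) |> mem_of_superset <| Metric.ball_subset_closedBall
    rw [nhdsWithin_eq_nhds.2 hBn] at hW'
    refine ⟨_, hW', ?_⟩
    rintro _ ⟨a, ha, rfl⟩ _ ⟨b, hb, rfl⟩ _ ⟨c, hc, rfl⟩
    rw [hB_eq _ _ a.2 b.2, hB_eq _ _ b.2 c.2, hB_eq _ _ a.2 c.2]
    exact H a ha b hb c hc
  -- The difference of the inner and outer primitives. It is closed where both are defined, and they
  -- can be glued once its period around the circle of radius `R + 1` vanishes.
  let κ : ℂ → ℂ → ℝ := fun a b => hB a b - G OnePoint.infty a b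
  -- the two simplices
  have hR1 : 0 < R + 1 := by linarith
  have hσB : ∀ x, ((R + 1 : ℝ) : ℂ) * triDisc x ∈ B := fun x => by
    simp only [B, Metric.mem_closedBall, dist_zero_right, norm_mul, norm_triDisc, Complex.norm_real,
      Real.norm_of_nonneg hR1.le]
    have : (0 : ℝ) ≤ x 2 := x.2.1 2
    nlinarith
  have hcσ : Continuous fun x => ((R + 1 : ℝ) : ℂ) * triDisc x :=
    continuous_const.mul continuous_triDisc
  let σ₁ : C(stdSimplex ℝ (Fin 3), OnePoint ℂ) :=
    ⟨fun x => (((R + 1 : ℝ) : ℂ) * triDisc x : ℂ), OnePoint.continuous_coe.comp hcσ⟩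
  let σ₂ : C(stdSimplex ℝ (Fin 3), OnePoint ℂ) :=
    ⟨fun x => invSphere (R + 1) (triDisc x), (continuous_invSphere hR1).comp continuous_triDisc⟩
  have hσ₂U : ∀ x, σ₂ x ∈ U := fun x => by
    change invSphere (R + 1) (triDisc x) ∈ U
    unfold invSphere
    split_ifs with h0
    · exact hUinf
    · refine hRU _ (lt_of_lt_of_le (by linarith : R - 1 < R) ?_)
      have hpos : 0 < ‖triDisc x‖ := norm_pos_iff.2 h0
      have hle : ‖triDisc x‖ ≤ 1 := by
        rw [norm_triDisc]
        have : (0 : ℝ) ≤ x 2 := x.2.1 2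
        linarith
      rw [norm_div, RCLike.norm_conj, Complex.norm_real, Real.norm_of_nonneg hR1.le,
        le_div_iff₀ hpos]
      nlinarith
  have hedge : ∀ t ∈ Icc (0 : ℝ) 1, σ₁ (faceMap 2 (edgePath t))
      = (polarMap (R + 1, 2 * Real.pi * t) : ℂ) ∧ σ₂ (faceMap 2 (edgePath t))
      = (polarMap (R + 1, 2 * Real.pi * t) : ℂ) := fun t ht => by
    constructor
    · change ((((R + 1 : ℝ) : ℂ) * triDisc _ : ℂ) : OnePoint ℂ) = _
      rw [triDisc_face_two t ht]
      rfl
    · change invSphere (R + 1) (triDisc _) = _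
      rw [triDisc_face_two t ht, invSphere, if_neg (Complex.exp_ne_zero _)]
      congr 1
      rw [polarMap, ← Complex.exp_conj, map_mul, Complex.conj_I, Complex.conj_ofReal, mul_neg,
        Complex.exp_neg, div_inv_eq_mul]
  -- This is the only place where the torsion hypothesis enters: the inner and outer discs have
  -- equal boundary sums, which is the vanishing of the period of `κ`.
  have hbd : ∀ᶠ n in atTop, bdrySum (fun a b => hB (((R + 1 : ℝ) : ℂ) * triDisc a)
        (((R + 1 : ℝ) : ℂ) * triDisc b)) id n
      = bdrySum (fun a b => G OnePoint.infty (σ₂ a) (σ₂ b)) id n := by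
    refine eventually_bdrySum_eq_of_representsZero hF f hf σ₁ σ₂ (fun t => ?_) (fun t => ?_)
      (fun t ht => (hedge t ht).1.trans (hedge t ht).2.symm) ?_ ?_
    · change ((_ * triDisc _ : ℂ) : OnePoint ℂ) = ((_ * triDisc _ : ℂ) : OnePoint ℂ)
      rw [triDisc_face_zero_eq_face_one]
    · change invSphere (R + 1) (triDisc _) = invSphere (R + 1) (triDisc _)
      rw [triDisc_face_zero_eq_face_one]
    · have := hh₁.comp (f := fun x => (⟨_, hσB x⟩ : B)) (hcσ.subtype_mk hσB)
      have e : (fun a b => hB (((R + 1 : ℝ) : ℂ) * triDisc a) (((R + 1 : ℝ) : ℂ) * triDisc b))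
          = fun a b => h₁ ⟨_, hσB a⟩ ⟨_, hσB b⟩ := by
        ext a b
        exact hB_eq _ _ (hσB a) (hσB b)
      rw [e]
      exact this
    · exact fun x => ⟨univ, univ_mem, fun a _ b _ c _ =>
        HU' _ (hσ₂U a) _ (hσ₂U b) _ (hσ₂U c)⟩
  have hper : ∀ᶠ n in atTop, polySum κ (fun t => polarMap (R + 1, 2 * Real.pi * t)) n = 0 := by
    filter_upwards [hbd, eventually_gt_atTop 0] with n hn hn0
    have hn0' : (0 : ℝ) < n := by exact_mod_cast hn0
    have hmem : ∀ j ∈ Finset.range n, (j : ℝ) / n ∈ Icc (0 : ℝ) 1 ∧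
        ((j + 1 : ℕ) : ℝ) / n ∈ Icc (0 : ℝ) 1 := fun j hj => by
      have hj := Finset.mem_range.1 hj
      have h1 : (j : ℝ) ≤ n := by exact_mod_cast hj.le
      have h2 : ((j + 1 : ℕ) : ℝ) ≤ n := by exact_mod_cast hj
      exact ⟨⟨by positivity, (div_le_one hn0').2 h1⟩, ⟨by positivity, (div_le_one hn0').2 h2⟩⟩
    have e1 : bdrySum (fun a b => hB (((R + 1 : ℝ) : ℂ) * triDisc a)
        (((R + 1 : ℝ) : ℂ) * triDisc b)) id n
        = polySum hB (fun t => polarMap (R + 1, 2 * Real.pi * t)) n := by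
      simp only [bdrySum, polySum, id, triDisc_face_zero_eq_face_one, sub_self, zero_add]
      refine Finset.sum_congr rfl fun j hj => ?_
      rw [triDisc_face_two _ (hmem j hj).1, triDisc_face_two _ (hmem j hj).2]
      rfl
    have e2 : bdrySum (fun a b => G OnePoint.infty (σ₂ a) (σ₂ b)) id n
        = polySum (fun a b => G OnePoint.infty (a : ℂ) (b : ℂ))
          (fun t => polarMap (R + 1, 2 * Real.pi * t)) n := by
      have e3 : ∀ t, σ₂ (faceMap 0 (edgePath t)) = σ₂ (faceMap 1 (edgePath t)) := fun t => by
        change invSphere (R + 1) (triDisc _) = invSphere (R + 1) (triDisc _)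
        rw [triDisc_face_zero_eq_face_one]
      simp only [bdrySum, polySum, id, e3, sub_self, zero_add]
      refine Finset.sum_congr rfl fun j hj => ?_
      rw [(hedge _ (hmem j hj).1).2, (hedge _ (hmem j hj).2).2]
    rw [e1, e2] at hn
    simp only [κ, polySum, Finset.sum_sub_distrib]
    simp only [polySum] at hn
    rw [hn, sub_self]
  obtain ⟨φ, hφ⟩ := exists_locDiff_annulus hR (κ := κ) (fun z hz hz' => by
    obtain ⟨W, hW, H⟩ := hhB z (by linarith)
    obtain ⟨W', hW', H'⟩ := hG (z : OnePoint ℂ)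
    refine ⟨W ∩ {a | R - 1 < ‖a‖}, inter_mem hW ((isOpen_lt continuous_const
      continuous_norm).mem_nhds (show R - 1 < ‖z‖ by linarith)), fun a ha b hb c hc => ?_⟩
    have e1 := H a ha.1 b hb.1 c hc.1
    have e2 := HU' _ (hRU a ha.2) _ (hRU b hb.2) _ (hRU c hc.2)
    simp only [κ]
    linarith) hper.frequently
  -- gluing
  let toC : OnePoint ℂ → ℂ := fun x => x.elim 0 id
  let inS : OnePoint ℂ → Prop := fun x => ∃ z : ℂ, x = z ∧ ‖z‖ < R + 1
  -- The coboundary of `φ` is added to the outer primitive, so near the circle both formulas agree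
  -- and the case distinction is harmless. Away from the circle `φ` may be arbitrary, since adding
  -- its coboundary does not affect the coboundary of `h`.
  let h : OnePoint ℂ → OnePoint ℂ → ℝ := fun x y => if inS x ∧ inS y then hB (toC x) (toC y)
    else G OnePoint.infty x y + φ (toC y) - φ (toC x)
  have outer : ∀ x, (∃ N ∈ 𝓝 x, ∀ a ∈ N, a ∈ U ∧ ∀ b ∈ N,
      h a b = G OnePoint.infty a b + φ (toC b) - φ (toC a)) →
      ∃ N ∈ 𝓝 x, ∀ a ∈ N, ∀ b ∈ N, ∀ c ∈ N, h a b + h b c - h a c = G a b c := by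
    rintro x ⟨N, hN, H⟩
    refine ⟨N, hN, fun a ha b hb c hc => ?_⟩
    rw [(H a ha).2 b hb, (H b hb).2 c hc, (H a ha).2 c hc,
      ← HU' a (H a ha).1 b (H b hb).1 c (H c hc).1]
    ring
  have coe_nhds : ∀ (z : ℂ) (N : Set ℂ), N ∈ 𝓝 z → OnePoint.some '' N ∈ 𝓝 (z : OnePoint ℂ) :=
    fun z N hN => OnePoint.isOpenEmbedding_coe.isOpenMap.image_mem_nhds hN
  have inS_coe : ∀ z : ℂ, inS z ↔ ‖z‖ < R + 1 := fun z =>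
    ⟨fun ⟨w, hw, hw'⟩ => by rwa [OnePoint.coe_eq_coe.1 hw], fun hz => ⟨z, rfl, hz⟩⟩
  refine ⟨h, fun x => ?_⟩
  induction x using OnePoint.rec with
  | infty =>
    refine outer _ ⟨U ∩ (OnePoint.some '' Metric.closedBall (0 : ℂ) (R + 1))ᶜ, inter_mem hU
      ((OnePoint.isOpen_compl_image_coe.2 ⟨Metric.isClosed_closedBall,
        isCompact_closedBall _ _⟩).mem_nhds (by simp)), fun a ha => ⟨ha.1, fun b _ => if_neg ?_⟩⟩
    rintro ⟨⟨w, rfl, hw⟩, -⟩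
    exact ha.2 ⟨w, by simpa using hw.le, rfl⟩
  | coe z =>
    rcases lt_trichotomy ‖z‖ (R + 1) with hz | hz | hz
    · obtain ⟨W, hW, H⟩ := hhB z (by linarith)
      refine ⟨_, coe_nhds z _ (inter_mem hW ((isOpen_lt continuous_norm continuous_const).mem_nhds
        hz)), ?_⟩
      rintro _ ⟨a, ha, rfl⟩ _ ⟨b, hb, rfl⟩ _ ⟨c, hc, rfl⟩
      have e : ∀ a b : ℂ, ‖a‖ < R + 1 → ‖b‖ < R + 1 → h a b = hB a b := fun a b ha hb =>
        if_pos ⟨(inS_coe a).2 ha, (inS_coe b).2 hb⟩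
      rw [e a b ha.2 hb.2, e b c hb.2 hc.2, e a c ha.2 hc.2]
      exact H a ha.1 b hb.1 c hc.1
    · obtain ⟨W, hW, H⟩ := hφ z hz
      refine outer _ ⟨_, coe_nhds z _ (inter_mem hW ((isOpen_lt continuous_const
        continuous_norm).mem_nhds (show R - 1 < ‖z‖ by linarith))), ?_⟩
      rintro _ ⟨a, ha, rfl⟩
      refine ⟨hRU a ha.2, ?_⟩
      rintro _ ⟨b, hb, rfl⟩
      simp only [h]
      split_ifs with hS
      · have := H a ha.1 b hb.1
        simp only [κ] at this
        simp only [toC, OnePoint.elim_some, id]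
        linarith
      · rfl
    · refine outer _ ⟨_, coe_nhds z _ ((isOpen_lt continuous_const continuous_norm).mem_nhds hz), ?_⟩
      rintro _ ⟨a, ha, rfl⟩
      have ha' : R + 1 < ‖a‖ := ha
      refine ⟨hRU a (by linarith), fun b _ => if_neg fun hS => ?_⟩
      have := (inS_coe a).1 hS.1
      linarith

end Pants

namespace Pants

set_option maxSynthPendingDepth 3
set_option linter.unusedSectionVars false

/-! ### Poincaré lemma for 2-forms -/

section Poincare

variable {E : Type*} [NormedAddCommGroup E] [NormedSpace ℝ E]

/-- A 2-form as a bilinear form. -/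
def alt2 (E : Type*) [NormedAddCommGroup E] [NormedSpace ℝ E] :
    (E [⋀^Fin 2]→L[ℝ] ℝ) →L[ℝ] E →L[ℝ] E →L[ℝ] ℝ :=
  (ContinuousLinearMap.compL ℝ E (E [⋀^Fin 1]→L[ℝ] ℝ) (E →L[ℝ] ℝ)
    (ContinuousAlternatingMap.ofSubsingletonLIE (𝕜 := ℝ) (E := E) (F := ℝ)
      (0 : Fin 1)).symm.toContinuousLinearEquiv.toContinuousLinearMap).comp
    (ContinuousAlternatingMap.curryLeftLI (𝕜 := ℝ) (E := E) (F := ℝ)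
      (n := 1)).toContinuousLinearMap

theorem alt2_apply (Ω : E [⋀^Fin 2]→L[ℝ] ℝ) (v w : E) : alt2 E Ω v w = Ω ![v, w] := by
  change (Ω.curryLeft v) (fun _ => w) = _
  rw [ContinuousAlternatingMap.curryLeft_apply_apply]
  congr 1
  ext k
  fin_cases k <;> rfl

theorem alternating_swap (Ω : E [⋀^Fin 2]→L[ℝ] ℝ) (v w : E) : Ω ![v, w] = - Ω ![w, v] := by
  have h := Ω.toAlternatingMap.map_swap ![w, v] (i := 0) (j := 1) (by decide)
  have e : (![w, v] : Fin 2 → E) ∘ (Equiv.swap (0 : Fin 2) 1) = ![v, w] := by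
    ext k
    fin_cases k <;> simp
  rw [e] at h
  exact h

theorem contDiff_one_intervalIntegral [FiniteDimensional ℝ E] {F : Type*} [NormedAddCommGroup F]
    [NormedSpace ℝ F] [CompleteSpace F] {G : E → ℝ → F}
    (hG : ContDiff ℝ 1 (fun p : E × ℝ => G p.1 p.2)) :
    ContDiff ℝ 1 (fun y => ∫ s in (0 : ℝ)..1, G y s) ∧
      ∀ y, HasFDerivAt (fun y => ∫ s in (0 : ℝ)..1, G y s)
        (∫ s in (0 : ℝ)..1, fderiv ℝ (fun y => G y s) y) y := by
  have hcont : Continuous (fun p : E × ℝ => fderiv ℝ (fun y => G y p.2) p.1) := by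
    have h1 : ∀ p : E × ℝ, fderiv ℝ (fun y => G y p.2) p.1
        = (fderiv ℝ (fun p : E × ℝ => G p.1 p.2) p).comp (ContinuousLinearMap.inl ℝ E ℝ) := by
      intro p
      have h2 : HasFDerivAt (fun p : E × ℝ => G p.1 p.2) _ p :=
        ((hG.differentiable one_ne_zero) p).hasFDerivAt
      have h3 : HasFDerivAt (fun y : E => (y, p.2)) (ContinuousLinearMap.inl ℝ E ℝ) p.1 :=
        hasFDerivAt_prodMk_left _ _
      exact (h2.comp p.1 h3).fderiv
    simp_rw [h1]
    exact (hG.continuous_fderiv one_ne_zero).clm_comp continuous_const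
  have hdiff : ∀ s y, HasFDerivAt (fun y => G y s) (fderiv ℝ (fun y => G y s) y) y := fun s y =>
    (((hG.comp (contDiff_id.prodMk contDiff_const)).differentiable one_ne_zero) y).hasFDerivAt
  have hder : ∀ y, HasFDerivAt (fun y => ∫ s in (0 : ℝ)..1, G y s)
        (∫ s in (0 : ℝ)..1, fderiv ℝ (fun y => G y s) y) y := by
    intro y₀
    obtain ⟨C, hC⟩ := ((isCompact_closedBall y₀ 1).prod
      (isCompact_Icc (a := (0 : ℝ)) (b := 1))).exists_bound_of_continuousOn hcont.continuousOn
    refine (intervalIntegral.hasFDerivAt_integral_of_dominated_of_fderiv_le (𝕜 := ℝ)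
      (F := G) (F' := fun y s => fderiv ℝ (fun y => G y s) y) (bound := fun _ => C)
      (Metric.ball_mem_nhds y₀ one_pos) ?_ ?_ ?_ ?_ ?_ ?_)
    · exact Eventually.of_forall fun y =>
        (hG.continuous.comp (by fun_prop : Continuous fun s : ℝ => (y, s))).aestronglyMeasurable
    · exact (hG.continuous.comp
        (by fun_prop : Continuous fun s : ℝ => (y₀, s))).intervalIntegrable _ _
    · exact (hcont.comp (by fun_prop : Continuous fun s : ℝ => (y₀, s))).aestronglyMeasurable
    · refine Eventually.of_forall fun s hs y hy => hC (y, s) ⟨Metric.ball_subset_closedBall hy, ?_⟩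
      rw [uIoc_of_le zero_le_one] at hs
      exact Ioc_subset_Icc_self hs
    · exact intervalIntegrable_const
    · exact Eventually.of_forall fun s _ y _ => hdiff s y
  refine ⟨contDiff_one_iff_fderiv.2 ⟨fun y => (hder y).differentiableAt, ?_⟩, hder⟩
  rw [funext fun y => (hder y).fderiv]
  exact intervalIntegral.continuous_parametric_intervalIntegral_of_continuous'
    (f := fun y s => fderiv ℝ (fun y => G y s) y) hcont 0 1

/-- The radial homotopy operator gives the primitive `l(y) = ∫₀¹ s Ω_{c + s(y - c)}(y - c, ·) ds`.
-/
theorem exists_primitive_of_closed [FiniteDimensional ℝ E] {Ω : E → E [⋀^Fin 2]→L[ℝ] ℝ}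
    {T : Set E} (hT : IsOpen T) (hΩ : ContDiffOn ℝ (⊤ : ℕ∞) Ω T)
    (hcl : ∀ y ∈ T, extDeriv Ω y = 0) {c : E} (hc : c ∈ T) :
    ∃ r > 0, Metric.ball c r ⊆ T ∧ ∃ l : E → E →L[ℝ] ℝ, ContDiff ℝ 1 l ∧
      ∀ y ∈ Metric.ball c r, ∀ v w, fderiv ℝ l y v w - fderiv ℝ l y w v = Ω y ![v, w] := by
  -- The cut-off makes the form smooth on all of `E`, so `l` is globally `C¹`; it is one near `c`,
  -- where the primitive is needed.
  obtain ⟨χ, hχT, -, hχ, -, hχ1⟩ : ∃ f : E → ℝ, tsupport f ⊆ T ∧ HasCompactSupport f ∧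
      ContDiff ℝ (⊤ : ℕ∞) f ∧ range f ⊆ Icc 0 1 ∧ f =ᶠ[𝓝 c] 1 := by
    obtain ⟨r, hr, hrT⟩ := Metric.isOpen_iff.1 hT c hc
    let b : ContDiffBump c := ⟨r / 4, r / 2, by positivity, by linarith⟩
    refine ⟨b, ?_, b.hasCompactSupport, b.contDiff, ?_, b.eventuallyEq_one⟩
    · rw [b.tsupport_eq]
      exact (Metric.closedBall_subset_ball (by simp [b, hr])).trans hrT
    · rintro _ ⟨x, rfl⟩
      exact ⟨b.nonneg, b.le_one⟩
  obtain ⟨r, hr, hrχ⟩ := Metric.eventually_nhds_iff_ball.1 (hχ1.and (hT.mem_nhds hc))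
  let B : E → E →L[ℝ] E →L[ℝ] ℝ := fun y => χ y • alt2 E (Ω y)
  have hB : ContDiff ℝ 2 B := by
    have : ContDiff ℝ (⊤ : ℕ∞) B := by
      rw [contDiff_iff_contDiffAt]
      intro y
      by_cases hy : y ∈ tsupport χ
      · have h1 : ContDiffAt ℝ (⊤ : ℕ∞) (fun y => alt2 E (Ω y)) y :=
          (alt2 E).contDiff.contDiffAt.comp y (hΩ.contDiffAt (hT.mem_nhds (hχT hy)))
        exact ContDiffAt.smul (F := E →L[ℝ] E →L[ℝ] ℝ) hχ.contDiffAt h1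
      · refine contDiffAt_const (c := 0) |>.congr_of_eventuallyEq ?_
        filter_upwards [(isClosed_tsupport χ).isOpen_compl.mem_nhds hy] with x hx
        simp only [B, image_eq_zero_of_notMem_tsupport hx]
        exact zero_smul ℝ (alt2 E (Ω x))
    exact this.of_le (WithTop.coe_le_coe.2 (le_top : (2 : ℕ∞) ≤ ⊤))
  have hBd : Differentiable ℝ B := hB.differentiable two_ne_zero
  let G : E → ℝ → E →L[ℝ] ℝ := fun y s => s • B (c + s • (y - c)) (y - c)
  have hG : ContDiff ℝ 1 (fun p : E × ℝ => G p.1 p.2) := by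
    have h2 : ContDiff ℝ 2 (fun p : E × ℝ => c + p.2 • (p.1 - c)) :=
      contDiff_const.add (contDiff_snd.smul (contDiff_fst.sub contDiff_const))
    have : ContDiff ℝ 2 (fun p : E × ℝ => G p.1 p.2) :=
      contDiff_snd.smul ((hB.comp h2).clm_apply (contDiff_fst.sub contDiff_const))
    exact this.of_le one_le_two
  obtain ⟨h1, h2⟩ := contDiff_one_intervalIntegral hG
  refine ⟨r, hr, fun y hy => (hrχ y hy).2, _, h1, fun y hy v w => ?_⟩
  have hp : ∀ s ∈ Icc (0 : ℝ) 1, c + s • (y - c) ∈ Metric.ball c r := by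
    intro s hs
    have := (convex_ball c r).add_smul_sub_mem (Metric.mem_ball_self hr) hy hs
    exact this
  have hBev : ∀ p ∈ Metric.ball c r, B =ᶠ[𝓝 p] fun y => alt2 E (Ω y) := fun p hp => by
    filter_upwards [Metric.isOpen_ball.mem_nhds hp] with q hq
    simp [B, (hrχ q hq).1]
  have hfd : ∀ p ∈ Metric.ball c r, ∀ x v w, fderiv ℝ B p x v w = fderiv ℝ Ω p x ![v, w] := by
    intro p hp x v w
    have hd : DifferentiableAt ℝ Ω p :=
      (hΩ.contDiffAt (hT.mem_nhds (hrχ p hp).2)).differentiableAt (by simp)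
    have e1 : HasFDerivAt (fun y => alt2 E (Ω y)) _ p :=
      (alt2 E).hasFDerivAt.comp p hd.hasFDerivAt
    rw [(hBev p hp).fderiv_eq, e1.fderiv]
    exact alt2_apply _ _ _
  have hclosed : ∀ p ∈ Metric.ball c r, ∀ x v w, fderiv ℝ B p v x w - fderiv ℝ B p w x v
      = fderiv ℝ B p x v w := by
    intro p hp x v w
    have hd : DifferentiableAt ℝ Ω p :=
      (hΩ.contDiffAt (hT.mem_nhds (hrχ p hp).2)).differentiableAt (by simp)
    have h := extDeriv_apply hd ![x, v, w]
    rw [hcl p (hrχ p hp).2] at h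
    have e0 : Fin.removeNth (0 : Fin 3) ![x, v, w] = ![v, w] := by ext k; fin_cases k <;> rfl
    have e1 : Fin.removeNth (1 : Fin 3) ![x, v, w] = ![x, w] := by ext k; fin_cases k <;> rfl
    have e2 : Fin.removeNth (2 : Fin 3) ![x, v, w] = ![x, v] := by ext k; fin_cases k <;> rfl
    rw [Fin.sum_univ_three, e0, e1, e2] at h
    have e3 : ∀ a b x, fderiv ℝ (fun q => Ω q ![a, b]) p x = fderiv ℝ B p x a b := by
      intro a b x
      have e4 : HasFDerivAt B (fderiv ℝ B p) p := (hBd p).hasFDerivAt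
      have e5 : (fun q => Ω q ![a, b]) =ᶠ[𝓝 p] fun q => B q a b := by
        filter_upwards [hBev p hp] with q hq
        rw [hq, alt2_apply]
      have e6 := (e4.clm_apply (hasFDerivAt_const a p)).clm_apply (hasFDerivAt_const b p)
      rw [e5.fderiv_eq, e6.fderiv]
      simp
    simp [e3] at h
    linarith
  have hGf : ∀ s v w, fderiv ℝ (fun y => G y s) y v w
      = s * (s * fderiv ℝ B (c + s • (y - c)) v (y - c) w + B (c + s • (y - c)) v w) := by
    intro s v w
    have e1 : HasFDerivAt (fun y : E => c + s • (y - c)) (s • ContinuousLinearMap.id ℝ E) y :=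
      (((hasFDerivAt_id y).sub_const c).const_smul s).const_add c
    have e2 := ((hBd _).hasFDerivAt.comp y e1).clm_apply ((hasFDerivAt_id y).sub_const c)
    have e3 := e2.const_smul s
    have e4 : HasFDerivAt (fun y => G y s) _ y := e3
    rw [e4.fderiv]
    simp
    ring
  have hcont : ∀ v w, Continuous fun s : ℝ =>
      s * (s * fderiv ℝ B (c + s • (y - c)) v (y - c) w + B (c + s • (y - c)) v w) := by
    intro v w
    have e1 : Continuous fun s : ℝ => c + s • (y - c) := by fun_prop
    have e2 : Continuous fun s : ℝ => fderiv ℝ B (c + s • (y - c)) v (y - c) w :=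
      ((((hB.continuous_fderiv two_ne_zero).comp e1).clm_apply continuous_const).clm_apply
        continuous_const).clm_apply continuous_const
    have e3 : Continuous fun s : ℝ => B (c + s • (y - c)) v w :=
      ((hB.continuous.comp e1).clm_apply continuous_const).clm_apply continuous_const
    exact continuous_id.mul ((continuous_id.mul e2).add e3)
  have hval : ∀ v w, (∫ s in (0 : ℝ)..1, fderiv ℝ (fun y => G y s) y) v w
      = ∫ s in (0 : ℝ)..1,
        s * (s * fderiv ℝ B (c + s • (y - c)) v (y - c) w + B (c + s • (y - c)) v w) := by
    intro v w
    have e1 : ∀ s, fderiv ℝ (fun y => G y s) y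
        = (fderiv ℝ (fun p : E × ℝ => G p.1 p.2) (y, s)).comp (ContinuousLinearMap.inl ℝ E ℝ) :=
      fun s => (HasFDerivAt.comp (f := fun y => (y, s)) (g := fun p : E × ℝ => G p.1 p.2) y
        (hG.differentiable one_ne_zero (y, s)).hasFDerivAt (hasFDerivAt_prodMk_left y s)).fderiv
    have e2 : Continuous fun s => fderiv ℝ (fun y => G y s) y := by
      simp_rw [e1]
      exact ((hG.continuous_fderiv one_ne_zero).comp (by fun_prop)).clm_comp continuous_const
    rw [ContinuousLinearMap.intervalIntegral_apply (e2.intervalIntegrable _ _),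
      ContinuousLinearMap.intervalIntegral_apply
        ((e2.clm_apply continuous_const).intervalIntegrable _ _)]
    simp_rw [hGf]
  rw [(h2 y).fderiv, hval, hval, ← intervalIntegral.integral_sub]
  -- By closedness the integrand of `dl(v, w)` is the `s`-derivative of `s² Ω_{c + s(y - c)}(v, w)`.
  · have hFTC : ∀ s ∈ uIcc (0 : ℝ) 1, HasDerivAt (fun s => s ^ 2 * B (c + s • (y - c)) v w)
        (s * (s * fderiv ℝ B (c + s • (y - c)) v (y - c) w + B (c + s • (y - c)) v w)
        - s * (s * fderiv ℝ B (c + s • (y - c)) w (y - c) v + B (c + s • (y - c)) w v)) s := by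
      intro s hs
      rw [uIcc_of_le zero_le_one] at hs
      have e1 : HasDerivAt (fun s : ℝ => c + s • (y - c)) ((1 : ℝ) • (y - c)) s :=
        ((hasDerivAt_id s).smul_const _).const_add c
      have e2 := (((hBd _).hasFDerivAt.comp_hasDerivAt s e1).clm_apply
        (hasDerivAt_const s v)).clm_apply (hasDerivAt_const s w)
      have e3 := (hasDerivAt_pow 2 s).mul e2
      refine e3.congr_deriv ?_
      have e4 := hclosed _ (hp s hs) (y - c) v w
      have e5 : B (c + s • (y - c)) w v = - B (c + s • (y - c)) v w := by
        rw [(hBev _ (hp s hs)).eq_of_nhds, alt2_apply, alt2_apply, alternating_swap]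
      simp only [one_smul, Function.comp_apply, map_zero, add_zero, e5]
      simp only [← e4]
      push_cast
      ring
    rw [intervalIntegral.integral_eq_sub_of_hasDerivAt hFTC]
    · simp [(hBev y hy).eq_of_nhds, alt2_apply]
    · exact ((hcont v w).sub (hcont w v)).intervalIntegrable _ _
  · exact (hcont v w).intervalIntegrable _ _
  · exact (hcont w v).intervalIntegrable _ _

end Poincare

end Pants

namespace Pants

set_option maxSynthPendingDepth 3
set_option linter.unusedSectionVars false

universe u v

/-! ### Local primitives of the symplectic form -/

section Primitives

variable {E : Type v} [NormedAddCommGroup E] [NormedSpace ℝ E]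
  {M : Type u} [TopologicalSpace M] [ChartedSpace E M]

variable (E) in
/-- Pullback of a 1-form on `M` to a normed space. -/
def pull {A : Type*} [NormedAddCommGroup A] [NormedSpace ℝ A]
    (θ : ∀ y : M, TangentSpace 𝓘(ℝ, E) y →L[ℝ] ℝ) (U : A → M) (y : A) : A →L[ℝ] ℝ :=
  (θ (U y)).comp (show A →L[ℝ] TangentSpace 𝓘(ℝ, E) (U y) from mfderiv 𝓘(ℝ, A) 𝓘(ℝ, E) U y)

/-- The 1-form on `M` with expression `l` in the chart at `x₀`. -/
def formAt (l : E → E →L[ℝ] ℝ) (x₀ : M) (y : M) : TangentSpace 𝓘(ℝ, E) y →L[ℝ] ℝ :=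
  (l (extChartAt 𝓘(ℝ, E) x₀ y)).comp
    (show TangentSpace 𝓘(ℝ, E) y →L[ℝ] E from
      mfderiv 𝓘(ℝ, E) 𝓘(ℝ, E) (extChartAt 𝓘(ℝ, E) x₀) y)

/-- On the open set `G`, which lies in a chart domain, `θ` is a primitive of `ω` of class `C¹`. -/
def IsPrimOn (ω : SymplecticForm E M) (θ : ∀ y : M, TangentSpace 𝓘(ℝ, E) y →L[ℝ] ℝ)
    (G : Set M) : Prop :=
  IsOpen G ∧ ∃ (x₀ : M) (l : E → E →L[ℝ] ℝ), ContDiff ℝ 1 l ∧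
    G ⊆ (extChartAt 𝓘(ℝ, E) x₀).source ∧ θ = formAt l x₀ ∧
    ∀ y ∈ G, ∀ v w, fderiv ℝ l (extChartAt 𝓘(ℝ, E) x₀ y) v w
      - fderiv ℝ l (extChartAt 𝓘(ℝ, E) x₀ y) w v
      = localForm ω.form x₀ (extChartAt 𝓘(ℝ, E) x₀ y) ![v, w]

theorem exists_isPrimOn [FiniteDimensional ℝ E] (ω : SymplecticForm E M) (x : M) :
    ∃ θ G, x ∈ G ∧ IsPrimOn ω θ G := by
  obtain ⟨r, hr, hrT, l, hl, hl'⟩ := exists_primitive_of_closed (isOpen_extChartAt_target x)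
    (ω.smooth x) (ω.closed x) (mem_extChartAt_target (I := 𝓘(ℝ, E)) x)
  refine ⟨formAt l x, (extChartAt 𝓘(ℝ, E) x).source ∩ extChartAt 𝓘(ℝ, E) x ⁻¹'
    (Metric.ball (extChartAt 𝓘(ℝ, E) x x) r), ⟨mem_extChartAt_source x, Metric.mem_ball_self hr⟩,
    ?_, x, l, hl, inter_subset_left, rfl, fun y hy => hl' _ hy.2⟩
  rw [extChartAt_source]
  exact isOpen_extChartAt_preimage x Metric.isOpen_ball

variable {A : Type*} [NormedAddCommGroup A] [NormedSpace ℝ A]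

theorem pull_formAt {l : E → E →L[ℝ] ℝ} {x₀ : M} [IsManifold 𝓘(ℝ, E) (⊤ : ℕ∞) M] {U : A → M}
    {y : A} (hU : MDifferentiableAt 𝓘(ℝ, A) 𝓘(ℝ, E) U y)
    (hy : U y ∈ (extChartAt 𝓘(ℝ, E) x₀).source) :
    pull E (formAt l x₀) U y = (l (extChartAt 𝓘(ℝ, E) x₀ (U y))).comp
      (fderiv ℝ (fun y => extChartAt 𝓘(ℝ, E) x₀ (U y)) y) := by
  rw [extChartAt_source] at hy
  have h1 : MDifferentiableAt 𝓘(ℝ, E) 𝓘(ℝ, E) (extChartAt 𝓘(ℝ, E) x₀) (U y) :=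
    (contMDiffAt_extChartAt' (n := (⊤ : ℕ∞)) hy).mdifferentiableAt (by simp)
  rw [← mfderiv_eq_fderiv]
  have := mfderiv_comp y h1 hU
  simp only [Function.comp_def] at this
  rw [this]
  rfl

/-- Exterior differentiation commutes with pullback. In the chart the pullback is `l(V) ∘ DV` with
`V = e ∘ U`; the terms containing `D²V` cancel by symmetry, and what is left is `dl(DV v, DV w)`. -/
theorem IsPrimOn.contDiffAt_pull [IsManifold 𝓘(ℝ, E) (⊤ : ℕ∞) M]
    {ω : SymplecticForm E M} {θ : ∀ y : M, TangentSpace 𝓘(ℝ, E) y →L[ℝ] ℝ}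
    {G : Set M} (hθ : IsPrimOn ω θ G) {U : A → M} {y : A}
    (hU : ContMDiffAt 𝓘(ℝ, A) 𝓘(ℝ, E) (⊤ : ℕ∞) U y) (hy : U y ∈ G) :
    ContDiffAt ℝ 1 (pull E θ U) y ∧ ∀ v w,
      fderiv ℝ (pull E θ U) y v w - fderiv ℝ (pull E θ U) y w v
        = ω.form (U y) ![mfderiv 𝓘(ℝ, A) 𝓘(ℝ, E) U y v, mfderiv 𝓘(ℝ, A) 𝓘(ℝ, E) U y w] := by
  obtain ⟨hG, x₀, l, hl, hGs, rfl, hd⟩ := hθ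
  have hys := hGs hy
  rw [extChartAt_source] at hys
  set e := extChartAt 𝓘(ℝ, E) x₀ with he
  have hV : ContDiffAt ℝ 2 (fun y => e (U y)) y := by
    have h1 : ContMDiffAt 𝓘(ℝ, A) 𝓘(ℝ, E) (⊤ : ℕ∞) (fun y => e (U y)) y :=
      (contMDiffAt_extChartAt' (I := 𝓘(ℝ, E)) (n := (⊤ : ℕ∞)) hys).comp y hU
    exact h1.contDiffAt.of_le (WithTop.coe_le_coe.2 (le_top : (2 : ℕ∞) ≤ ⊤))
  have hU2 : ContMDiffAt 𝓘(ℝ, A) 𝓘(ℝ, E) 2 U y :=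
    hU.of_le (WithTop.coe_le_coe.2 (le_top : (2 : ℕ∞) ≤ ⊤))
  have : IsManifold 𝓘(ℝ, E) 2 M :=
    IsManifold.of_le (n := (⊤ : ℕ∞)) (WithTop.coe_le_coe.2 (le_top : (2 : ℕ∞) ≤ ⊤))
  have hev : pull E (formAt l x₀) U =ᶠ[𝓝 y]
      fun y => (l (e (U y))).comp (fderiv ℝ (fun y => e (U y)) y) := by
    filter_upwards [(contMDiffAt_iff_contMDiffAt_nhds (by simp)).1 hU2,
      hU.continuousAt.preimage_mem_nhds (hG.mem_nhds hy)] with q hq hq'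
    exact pull_formAt (hq.mdifferentiableAt (by simp)) (hGs hq')
  have hD : ContDiffAt ℝ 1 (fderiv ℝ (fun y => e (U y))) y := hV.fderiv_right (by norm_num)
  refine ⟨ContDiffAt.congr_of_eventuallyEq ?_ hev, fun v w => ?_⟩
  · exact (hl.contDiffAt.comp y (hV.of_le one_le_two)).clm_comp hD
  have hV1 : HasFDerivAt (fun y => e (U y)) _ y := (hV.differentiableAt two_ne_zero).hasFDerivAt
  have h1 : HasFDerivAt (fun y => l (e (U y))) _ y :=
    HasFDerivAt.comp y ((hl.differentiable one_ne_zero) (e (U y))).hasFDerivAt hV1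
  have h2 := h1.clm_comp (hD.differentiableAt one_ne_zero).hasFDerivAt
  have hsym := hV.isSymmSndFDerivAt (by simp)
  have hmf : ∀ v, mfderiv 𝓘(ℝ, E) 𝓘(ℝ, E) e.symm (e (U y)) (fderiv ℝ (fun y => e (U y)) y v)
      = mfderiv 𝓘(ℝ, A) 𝓘(ℝ, E) U y v := by
    intro v
    have h3 : U =ᶠ[𝓝 y] fun q => e.symm (e (U q)) := by
      filter_upwards [hU.continuousAt.preimage_mem_nhds (hG.mem_nhds hy)] with q hq
      exact (e.left_inv (hGs hq)).symm
    have h4 : MDifferentiableAt 𝓘(ℝ, E) 𝓘(ℝ, E) e.symm (e (U y)) :=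
      ((contMDiffOn_extChartAt_symm (n := (⊤ : ℕ∞)) x₀).contMDiffAt
        ((isOpen_extChartAt_target x₀).mem_nhds (e.map_source (hGs hy)))).mdifferentiableAt (by simp)
    have h5 := mfderiv_comp (I' := 𝓘(ℝ, E)) (f := fun y => e (U y)) y h4
      (hV.differentiableAt two_ne_zero).mdifferentiableAt
    have h6 : mfderiv 𝓘(ℝ, A) 𝓘(ℝ, E) U y
        = mfderiv 𝓘(ℝ, A) 𝓘(ℝ, E) (e.symm ∘ fun y => e (U y)) y := h3.mfderiv_eq
    rw [h6, h5, mfderiv_eq_fderiv]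
    rfl
  have hbase : ω.form (U y) = ω.form (e.symm (e (U y))) := by rw [e.left_inv (hGs hy)]
  rw [hev.fderiv_eq, h2.fderiv]
  have h3 := hd (U y) hy (fderiv ℝ (fun y => e (U y)) y v) (fderiv ℝ (fun y => e (U y)) y w)
  have h4 : ∀ a b : E, localForm ω.form x₀ (e (U y)) ![a, b]
      = ω.form (e.symm (e (U y))) ![mfderiv 𝓘(ℝ, E) 𝓘(ℝ, E) e.symm (e (U y)) a,
        mfderiv 𝓘(ℝ, E) 𝓘(ℝ, E) e.symm (e (U y)) b] := by
    intro a b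
    change ω.form (e.symm (e (U y)))
      (fun k => mfderiv 𝓘(ℝ, E) 𝓘(ℝ, E) e.symm (e (U y)) ((![a, b] : Fin 2 → E) k)) = _
    congr 1
    ext k
    fin_cases k <;> rfl
  rw [h4, hmf, hmf] at h3
  rw [← hbase] at h3
  refine Eq.trans ?_ h3
  have h5 := congrArg (l (e (U y))) (hsym.eq v w)
  simp only [add_apply, ContinuousLinearMap.comp_apply, ContinuousLinearMap.compL_apply,
    ContinuousLinearMap.flip_apply]
  linarith


theorem IsPrimOn.mono {ω : SymplecticForm E M} {θ : ∀ y : M, TangentSpace 𝓘(ℝ, E) y →L[ℝ] ℝ}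
    {G G' : Set M} (hθ : IsPrimOn ω θ G) (hG : IsOpen G') (h : G' ⊆ G) : IsPrimOn ω θ G' := by
  obtain ⟨-, x₀, l, h1, h2, h3, h4⟩ := hθ
  exact ⟨hG, x₀, l, h1, h.trans h2, h3, fun y hy => h4 y (h hy)⟩

variable (E) in
/-- The preimage under the chart at `x` of a ball around the image of `x`. -/
def chartBall (x : M) (r : ℝ) : Set M :=
  (extChartAt 𝓘(ℝ, E) x).source ∩
    extChartAt 𝓘(ℝ, E) x ⁻¹' (Metric.ball (extChartAt 𝓘(ℝ, E) x x) r)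

theorem isOpen_chartBall (x : M) (r : ℝ) : IsOpen (chartBall E x r) := by
  rw [chartBall, extChartAt_source]
  exact isOpen_extChartAt_preimage x Metric.isOpen_ball

theorem mem_chartBall (x : M) {r : ℝ} (hr : 0 < r) : x ∈ chartBall E x r :=
  ⟨mem_extChartAt_source x, Metric.mem_ball_self hr⟩

variable (E) in
theorem exists_chartBall_subset {x : M} {O : Set M} (hO : O ∈ 𝓝 x) :
    ∃ r > 0, Metric.ball (extChartAt 𝓘(ℝ, E) x x) r ⊆ (extChartAt 𝓘(ℝ, E) x).target ∧
      chartBall E x r ⊆ O := by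
  have h1 : (extChartAt 𝓘(ℝ, E) x).target ∩ (extChartAt 𝓘(ℝ, E) x).symm ⁻¹' O
      ∈ 𝓝 (extChartAt 𝓘(ℝ, E) x x) := by
    refine inter_mem ((isOpen_extChartAt_target x).mem_nhds (mem_extChartAt_target x)) ?_
    refine (continuousAt_extChartAt_symm (I := 𝓘(ℝ, E)) x).preimage_mem_nhds ?_
    rwa [extChartAt_to_inv]
  obtain ⟨r, hr, h⟩ := Metric.mem_nhds_iff.1 h1
  refine ⟨r, hr, fun y hy => (h hy).1, fun y hy => ?_⟩
  have := (h hy.2).2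
  rwa [mem_preimage, (extChartAt 𝓘(ℝ, E) x).left_inv hy.1] at this

theorem extChartAt_symm_mem_chartBall {x : M} {r : ℝ}
    (hr : Metric.ball (extChartAt 𝓘(ℝ, E) x x) r ⊆ (extChartAt 𝓘(ℝ, E) x).target) {y : E}
    (hy : y ∈ Metric.ball (extChartAt 𝓘(ℝ, E) x x) r) :
    (extChartAt 𝓘(ℝ, E) x).symm y ∈ chartBall E x r :=
  ⟨(extChartAt 𝓘(ℝ, E) x).map_target (hr hy), by
    rw [mem_preimage, (extChartAt 𝓘(ℝ, E) x).right_inv (hr hy)]; exact hy⟩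

variable [IsManifold 𝓘(ℝ, E) (⊤ : ℕ∞) M]

theorem contMDiffAt_extChartAt_symm {x : M} {y : E} (hy : y ∈ (extChartAt 𝓘(ℝ, E) x).target) :
    ContMDiffAt 𝓘(ℝ, E) 𝓘(ℝ, E) (⊤ : ℕ∞) (extChartAt 𝓘(ℝ, E) x).symm y :=
  (contMDiffOn_extChartAt_symm (n := (⊤ : ℕ∞)) x).contMDiffAt
    ((isOpen_extChartAt_target x).mem_nhds hy)

theorem contMDiffAt_extChartAt_of_mem {x y : M} (hy : y ∈ (extChartAt 𝓘(ℝ, E) x).source) :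
    ContMDiffAt 𝓘(ℝ, E) 𝓘(ℝ, E) (⊤ : ℕ∞) (extChartAt 𝓘(ℝ, E) x) y := by
  rw [extChartAt_source] at hy
  exact contMDiffAt_extChartAt' hy

theorem pull_extChartAt_symm_mfderiv (θ : ∀ y : M, TangentSpace 𝓘(ℝ, E) y →L[ℝ] ℝ) {x y : M}
    (hy : y ∈ (extChartAt 𝓘(ℝ, E) x).source) (v : TangentSpace 𝓘(ℝ, E) y) :
    pull E θ (extChartAt 𝓘(ℝ, E) x).symm (extChartAt 𝓘(ℝ, E) x y)
      (mfderiv 𝓘(ℝ, E) 𝓘(ℝ, E) (extChartAt 𝓘(ℝ, E) x) y v) = θ y v := by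
  set e := extChartAt 𝓘(ℝ, E) x with he
  have h1 := mfderiv_comp y ((contMDiffAt_extChartAt_symm
    (e.map_source hy)).mdifferentiableAt (by simp))
    ((contMDiffAt_extChartAt_of_mem hy).mdifferentiableAt (by simp))
  have h2 : e.symm ∘ e =ᶠ[𝓝 y] id := by
    filter_upwards [(isOpen_extChartAt_source (I := 𝓘(ℝ, E)) x).mem_nhds hy] with q hq
    exact e.left_inv hq
  have h3 := h2.mfderiv_eq (I := 𝓘(ℝ, E)) (I' := 𝓘(ℝ, E))
  rw [mfderiv_id] at h3
  have h4 : ∀ a b : M, a = b → ∀ v : E, (θ a : E →L[ℝ] ℝ) v = (θ b : E →L[ℝ] ℝ) v := by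
    rintro a b rfl v; rfl
  have h5 : mfderiv 𝓘(ℝ, E) 𝓘(ℝ, E) e.symm (e y) (mfderiv 𝓘(ℝ, E) 𝓘(ℝ, E) e y v) = v := by
    have h6 : (mfderiv 𝓘(ℝ, E) 𝓘(ℝ, E) (e.symm ∘ e) y : E →L[ℝ] E) v = v := by rw [h3]; rfl
    rw [h1] at h6
    exact h6
  have h7 := h4 _ _ (e.left_inv hy) v
  refine Eq.trans ?_ h7
  change (θ (e.symm (e y))) (mfderiv 𝓘(ℝ, E) 𝓘(ℝ, E) e.symm (e y) _) = _
  rw [h5]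

/-- Two primitives of the same form differ by a closed 1-form, which is exact on a ball in the
chart. -/
theorem IsPrimOn.exists_difference {ω : SymplecticForm E M}
    {θ θ' : ∀ y : M, TangentSpace 𝓘(ℝ, E) y →L[ℝ] ℝ} {x : M} {r : ℝ}
    (hr : Metric.ball (extChartAt 𝓘(ℝ, E) x x) r ⊆ (extChartAt 𝓘(ℝ, E) x).target)
    (hθ : IsPrimOn ω θ (chartBall E x r)) (hθ' : IsPrimOn ω θ' (chartBall E x r)) :
    ∃ φ : M → ℝ, ∀ y ∈ chartBall E x r,
      HasMFDerivAt 𝓘(ℝ, E) 𝓘(ℝ, ℝ) φ y (θ y - θ' y) := by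
  set e := extChartAt 𝓘(ℝ, E) x with he
  have hc : ∀ y ∈ Metric.ball (e x) r, ContDiffAt ℝ 1 (pull E θ e.symm) y ∧
      ContDiffAt ℝ 1 (pull E θ' e.symm) y ∧ ∀ v w,
        fderiv ℝ (pull E θ e.symm) y v w - fderiv ℝ (pull E θ e.symm) y w v
        = fderiv ℝ (pull E θ' e.symm) y v w - fderiv ℝ (pull E θ' e.symm) y w v := by
    intro y hy
    have h1 := hθ.contDiffAt_pull (contMDiffAt_extChartAt_symm (hr hy))
      (extChartAt_symm_mem_chartBall hr hy)
    have h2 := hθ'.contDiffAt_pull (contMDiffAt_extChartAt_symm (hr hy))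
      (extChartAt_symm_mem_chartBall hr hy)
    exact ⟨h1.1, h2.1, fun v w => (h1.2 v w).trans (h2.2 v w).symm⟩
  obtain ⟨φ, hφ⟩ := (convex_ball (e x) r).exists_forall_hasFDerivAt_of_fderiv_symmetric
    Metric.isOpen_ball (ω := fun y => pull E θ e.symm y - pull E θ' e.symm y)
    (fun y hy => (((hc y hy).1.differentiableAt one_ne_zero).sub
      ((hc y hy).2.1.differentiableAt one_ne_zero)).differentiableWithinAt) (fun y hy v w => by
      have h := (hc y hy).2.2 v w
      rw [fderiv_fun_sub ((hc y hy).1.differentiableAt one_ne_zero)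
        ((hc y hy).2.1.differentiableAt one_ne_zero)]
      simp only [sub_apply]
      linarith)
  refine ⟨fun y => φ (e y), fun y hy => ?_⟩
  have h1 := HasMFDerivAt.comp y (hφ (e y) hy.2).hasMFDerivAt
    ((contMDiffAt_extChartAt_of_mem hy.1).mdifferentiableAt (by simp)).hasMFDerivAt
  refine h1.congr_mfderiv ?_
  ext v
  have h2 := pull_extChartAt_symm_mfderiv θ hy.1 v
  have h3 := pull_extChartAt_symm_mfderiv θ' hy.1 v
  exact congrArg₂ (· - ·) h2 h3

/-! ### Systems of local primitives labelled by the points of `M` -/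

/-- Compatible local primitives `θ p` of `ω`, with primitives `φ p q` of their differences. -/
structure PotentialSystem (ω : SymplecticForm E M) where
  θ : M → ∀ y : M, TangentSpace 𝓘(ℝ, E) y →L[ℝ] ℝ
  φ : M → M → M → ℝ
  V : M → Set M
  ctr : M → M
  l : M → E → E →L[ℝ] ℝ
  contDiff_l : ∀ p, ContDiff ℝ 1 (l p)
  θ_eq : ∀ p, θ p = formAt (l p) (ctr p)
  V_subset : ∀ x, ∀ p ∈ V x, V x ⊆ (extChartAt 𝓘(ℝ, E) (ctr p)).source
  mem_V : ∀ x, x ∈ V x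
  isPrimOn : ∀ x, ∀ p ∈ V x, IsPrimOn ω (θ p) (V x)
  hasMFDerivAt : ∀ x, ∀ p ∈ V x, ∀ q ∈ V x, ∀ y ∈ V x,
    HasMFDerivAt 𝓘(ℝ, E) 𝓘(ℝ, ℝ) (φ p q) y (θ p y - θ q y)
  cocycle : ∀ x, ∀ p ∈ V x, ∀ q ∈ V x, ∀ r ∈ V x, ∀ y ∈ V x, ∀ y' ∈ V x,
    φ p q y + φ q r y - φ p r y = φ p q y' + φ q r y' - φ p r y'

theorem PotentialSystem.isOpen_V {ω : SymplecticForm E M} (S : PotentialSystem ω) (x : M) :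
    IsOpen (S.V x) := (S.isPrimOn x x (S.mem_V x)).1

/-- An open cover of a compact space is uniformly fine near the diagonal. -/
theorem exists_rel_of_cover {X : Type*} [TopologicalSpace X] [CompactSpace X] [T2Space X]
    (c : X → Set X) (hc : ∀ x, c x ∈ 𝓝 x) :
    ∃ (R : X → X → Prop) (k : X → X), IsOpen {p : X × X | R p.1 p.2} ∧ (∀ x, R x x) ∧
      (∀ x y, R x y → R y x) ∧ ∀ x y, R x y → y ∈ c (k x) := by
  let := uniformSpaceOfCompactR1 (γ := X)
  obtain ⟨V, hV, h⟩ := lebesgue_number_lemma (K := (univ : Set X)) isCompact_univ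
    (fun x => isOpen_interior (s := c x))
    (fun x _ => mem_iUnion.2 ⟨x, mem_interior_iff_mem_nhds.2 (hc x)⟩)
  obtain ⟨V', hV', ho, hs, hVV⟩ := comp_open_symm_mem_uniformity_sets hV
  choose k hk using fun x => h x trivial
  have hsub : ∀ x y, (x, y) ∈ V' → (x, y) ∈ V := fun x y hxy =>
    hVV ⟨x, refl_mem_uniformity hV', hxy⟩
  exact ⟨fun x y => (x, y) ∈ V', k, ho, fun x => refl_mem_uniformity hV',
    fun x y hxy => hs.symm _ _ hxy, fun x y hxy => interior_subset (hk x (hsub x y hxy))⟩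

theorem exists_prod_subset {X : Type*} [TopologicalSpace X] {R : X → X → Prop}
    (hR : IsOpen {p : X × X | R p.1 p.2}) {x : X} (hx : R x x) :
    ∃ W ∈ 𝓝 x, ∀ p ∈ W, ∀ q ∈ W, R p q := by
  have h : {p : X × X | R p.1 p.2} ∈ 𝓝 (x, x) := hR.mem_nhds hx
  rw [nhds_prod_eq, mem_prod_same_iff] at h
  obtain ⟨W, hW, h⟩ := h
  exact ⟨W, hW, fun p hp q hq => h (mk_mem_prod hp hq)⟩

/-- The cover is refined twice. After the first refinement, labels in a chart ball of radius `r₁`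
all have primitives on that whole ball, so their differences are exact there. After the second, `V
x` lies in the ball that was used to choose `φ p q`, for every `p` in `V x`. -/
theorem nonempty_potentialSystem [FiniteDimensional ℝ E] [CompactSpace M] [T2Space M]
    (ω : SymplecticForm E M) : Nonempty (PotentialSystem ω) := by
  choose θ G hG hθ using exists_isPrimOn (M := M) ω
  obtain ⟨R₁, k₁, hR₁, hr₁, -, hk₁⟩ := exists_rel_of_cover G fun x => (hθ x).1.mem_nhds (hG x)
  choose W₁ hW₁ hWR₁ using fun x => exists_prod_subset hR₁ (hr₁ x)
  choose r₁ hr₁0 hr₁T hr₁W using fun x => exists_chartBall_subset E (hW₁ x)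
  obtain ⟨R₂, k₂, hR₂, hr₂, -, hk₂⟩ := exists_rel_of_cover (fun x => chartBall E x (r₁ x))
    fun x => (isOpen_chartBall x _).mem_nhds (mem_chartBall x (hr₁0 x))
  choose W₂ hW₂ hWR₂ using fun x => exists_prod_subset hR₂ (hr₂ x)
  choose r₂ hr₂0 hr₂T hr₂W using fun x => exists_chartBall_subset E (hW₂ x)
  have hprim : ∀ l, ∀ p ∈ chartBall E l (r₁ l), IsPrimOn ω (θ (k₁ p)) (chartBall E l (r₁ l)) :=
    fun l p hp => (hθ (k₁ p)).mono (isOpen_chartBall _ _) fun y hy =>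
      hk₁ p y (hWR₁ l p (hr₁W l hp) y (hr₁W l hy))
  have hφ : ∀ p q, ∃ φ : M → ℝ, p ∈ chartBall E (k₂ p) (r₁ (k₂ p)) →
      q ∈ chartBall E (k₂ p) (r₁ (k₂ p)) → ∀ y ∈ chartBall E (k₂ p) (r₁ (k₂ p)),
        HasMFDerivAt 𝓘(ℝ, E) 𝓘(ℝ, ℝ) φ y (θ (k₁ p) y - θ (k₁ q) y) := by
    intro p q
    by_cases h : p ∈ chartBall E (k₂ p) (r₁ (k₂ p)) ∧ q ∈ chartBall E (k₂ p) (r₁ (k₂ p))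
    · obtain ⟨φ, hφ⟩ := (hprim _ p h.1).exists_difference (hr₁T _) (hprim _ q h.2)
      exact ⟨φ, fun _ _ => hφ⟩
    · exact ⟨0, fun h1 h2 => (h ⟨h1, h2⟩).elim⟩
  choose φ hφ using hφ
  have hin : ∀ x, ∀ p ∈ chartBall E x (r₂ x), ∀ y ∈ chartBall E x (r₂ x),
      y ∈ chartBall E (k₂ p) (r₁ (k₂ p)) := fun x p hp y hy =>
    hk₂ p y (hWR₂ x p (hr₂W x hp) y (hr₂W x hy))
  have hder : ∀ x, ∀ p ∈ chartBall E x (r₂ x), ∀ q ∈ chartBall E x (r₂ x),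
      ∀ y ∈ chartBall E x (r₂ x),
      HasMFDerivAt 𝓘(ℝ, E) 𝓘(ℝ, ℝ) (φ p q) y (θ (k₁ p) y - θ (k₁ q) y) := fun x p hp q hq y hy =>
    hφ p q (hin x p hp p hp) (hin x p hp q hq) y (hin x p hp y hy)
  choose hGo ctr l hl hGs hθl hdl using hθ
  refine ⟨⟨fun p => θ (k₁ p), φ, fun x => chartBall E x (r₂ x), fun p => ctr (k₁ p),
    fun p => l (k₁ p), fun p => hl _, fun p => hθl _, fun x p hp y hy => hGs _ (hk₁ p y
      (hWR₁ (k₂ p) p (hr₁W _ (hin x p hp p hp)) y (hr₁W _ (hin x p hp y hy)))), fun x => mem_chartBall x (hr₂0 x),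
    fun x p hp => (hprim (k₂ p) p (hin x p hp p hp)).mono (isOpen_chartBall _ _) (hin x p hp), hder,
    fun x p hp q hq r hr y hy y' hy' => ?_⟩⟩
  set e := extChartAt 𝓘(ℝ, E) x with he
  -- The defect of the `φ`'s has derivative `(θ p - θ q) + (θ q - θ r) - (θ p - θ r) = 0`, so it is
  -- constant on the chart ball.
  let g : M → ℝ := fun y => φ p q y + φ q r y - φ p r y
  have hg : ∀ z ∈ Metric.ball (e x) (r₂ x), HasFDerivAt (fun z => g (e.symm z)) (0 : E →L[ℝ] ℝ) z := by
    intro z hz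
    have hz' := extChartAt_symm_mem_chartBall (hr₂T x) hz
    have h1 : HasMFDerivAt 𝓘(ℝ, E) 𝓘(ℝ, ℝ) g (e.symm z) (0 : TangentSpace 𝓘(ℝ, E) (e.symm z) →L[ℝ] ℝ) := by
      have := ((hder x p hp q hq _ hz').add (hder x q hq r hr _ hz')).sub (hder x p hp r hr _ hz')
      refine this.congr_mfderiv ?_
      have h0 : ∀ a b c : E →L[ℝ] ℝ, a - b + (b - c) - (a - c) = 0 := fun a b c => by abel
      exact h0 (θ (k₁ p) (e.symm z)) (θ (k₁ q) (e.symm z)) (θ (k₁ r) (e.symm z))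
    have h2 := h1.comp z ((contMDiffAt_extChartAt_symm (hr₂T x hz)).mdifferentiableAt (by simp)).hasMFDerivAt
    have h3 := hasMFDerivAt_iff_hasFDerivAt.1 h2
    refine h3.congr_fderiv ?_
    ext v
    rfl
  have h5 := Metric.isOpen_ball.is_const_of_fderiv_eq_zero (𝕜 := ℝ) (convex_ball (e x) (r₂ x)).isPreconnected
    (fun z hz => (hg z hz).differentiableAt.differentiableWithinAt) (fun z hz => (hg z hz).fderiv)
    hy.2 hy'.2
  simp only [he] at h5
  rw [(extChartAt 𝓘(ℝ, E) x).left_inv hy.1, (extChartAt 𝓘(ℝ, E) x).left_inv hy'.1] at h5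
  exact h5

/-- Because the defect is constant, the term for `b, c, d` may be evaluated at `a` as well; with all
four terms at one point, the alternating sum cancels identically. -/
theorem PotentialSystem.locCocycle {ω : SymplecticForm E M} (S : PotentialSystem ω) :
    LocCocycle (fun p q r => S.φ p q p + S.φ q r p - S.φ p r p) := by
  intro x
  refine ⟨S.V x, (S.isOpen_V x).mem_nhds (S.mem_V x), fun a ha b hb c hc d hd => ?_⟩
  have := S.cocycle x b hb c hc d hd b hb a ha
  linarith

end Primitives

end Pants

namespace Pants

set_option maxSynthPendingDepth 3
set_option linter.unusedSectionVars false

universe u v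

/-! ### Global primitives of pullbacks along maps with a gauge -/

section Gauge

variable {E : Type v} [NormedAddCommGroup E] [NormedSpace ℝ E]
  {M : Type u} [TopologicalSpace M] [ChartedSpace E M] [IsManifold 𝓘(ℝ, E) (⊤ : ℕ∞) M]
  {X : Type*} [TopologicalSpace X]

/-- A gauge `h` of the cocycle of `S` along `f`, with a relation `R` of nearness on which it
is effective. -/
structure Gauge {ω : SymplecticForm E M} (S : PotentialSystem ω) (f : X → M) where
  h : X → X → ℝ
  R : X → X → Prop
  isOpen_R : IsOpen {p : X × X | R p.1 p.2}
  refl : ∀ x, R x x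
  v : X → M
  mem_V : ∀ y a, R y a → f a ∈ S.V (v y)
  cob : ∀ y a b c, R y a → R y b → R y c → h a b + h b c - h a c
    = S.φ (f a) (f b) (f a) + S.φ (f b) (f c) (f a) - S.φ (f a) (f c) (f a)

theorem nonempty_gauge [CompactSpace X] [T2Space X] {ω : SymplecticForm E M}
    (S : PotentialSystem ω) (f : C(X, M)) {h : X → X → ℝ}
    (hh : LocCob (fun a b c => S.φ (f a) (f b) (f a) + S.φ (f b) (f c) (f a)
      - S.φ (f a) (f c) (f a)) h) : Nonempty (Gauge S f) := by
  choose U hU hc using hh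
  obtain ⟨R, k, h1, h2, -, h4⟩ := exists_rel_of_cover (fun x => U x ∩ f ⁻¹' (S.V (f x)))
    fun x => inter_mem (hU x)
      (f.continuous.continuousAt.preimage_mem_nhds ((S.isOpen_V _).mem_nhds (S.mem_V _)))
  exact ⟨⟨h, R, h1, h2, fun y => f (k y), fun y a ha => (h4 y a ha).2,
    fun y a b c ha hb hc' => hc (k y) a (h4 y a ha).1 b (h4 y b hb).1 c (h4 y c hc').1⟩⟩

variable {ω : SymplecticForm E M} {S : PotentialSystem ω} {f : X → M} (Γ : Gauge S f)

/-- Transition functions of the gauge. -/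
def Gauge.Φ (a b : X) (x : M) : ℝ := S.φ (f a) (f b) x - Γ.h a b

/-- The constant by which the `φ`'s fail to be additive is the coboundary of `h`, so subtracting `h`
makes them additive. -/
theorem Gauge.Φ_add {y a b c : X} (ha : Γ.R y a) (hb : Γ.R y b) (hc : Γ.R y c) {x : M}
    (hx : x ∈ S.V (Γ.v y)) : Γ.Φ a b x + Γ.Φ b c x = Γ.Φ a c x := by
  have h1 := Γ.cob y a b c ha hb hc
  have h2 := S.cocycle _ _ (Γ.mem_V y a ha) _ (Γ.mem_V y b hb) _ (Γ.mem_V y c hc) x hx _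
    (Γ.mem_V y a ha)
  simp only [Gauge.Φ]
  linarith

theorem Gauge.hasFDerivAt_Φ {A : Type*} [NormedAddCommGroup A] [NormedSpace ℝ A] {y a b : X}
    (ha : Γ.R y a) (hb : Γ.R y b) {U : A → M} {q : A}
    (hU : MDifferentiableAt 𝓘(ℝ, A) 𝓘(ℝ, E) U q) (hq : U q ∈ S.V (Γ.v y)) :
    HasFDerivAt (fun q => Γ.Φ a b (U q)) (pull E (S.θ (f a)) U q - pull E (S.θ (f b)) U q) q := by
  have h1 := S.hasMFDerivAt _ _ (Γ.mem_V y a ha) _ (Γ.mem_V y b hb) _ hq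
  have h2 := hasMFDerivAt_iff_hasFDerivAt.1 (h1.comp q hU.hasMFDerivAt)
  exact (h2.sub_const (Γ.h a b)).congr_fderiv rfl

/-- Discrete holonomy of the curve `μ` with respect to the labels `a`. -/
def Gauge.hol (a : ℕ → X) (N : ℕ) (μ : ℝ → M) : ℝ :=
  ∑ j ∈ Finset.range N, ((∫ t in (j / N : ℝ)..((j + 1 : ℕ) / N : ℝ),
    pull E (S.θ (f (a j))) μ t 1) - Γ.Φ (a j) (a (j + 1)) (μ ((j + 1 : ℕ) / N)))

theorem Gauge.contDiffAt_pull {y a : X} (ha : Γ.R y a) {A : Type*} [NormedAddCommGroup A]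
    [NormedSpace ℝ A] {U : A → M} {q : A} (hU : ContMDiffAt 𝓘(ℝ, A) 𝓘(ℝ, E) (⊤ : ℕ∞) U q)
    (hq : U q ∈ S.V (Γ.v y)) :
    ContDiffAt ℝ 1 (pull E (S.θ (f a)) U) q ∧ ∀ v w,
      fderiv ℝ (pull E (S.θ (f a)) U) q v w - fderiv ℝ (pull E (S.θ (f a)) U) q w v
        = ω.form (U q) ![mfderiv 𝓘(ℝ, A) 𝓘(ℝ, E) U q v, mfderiv 𝓘(ℝ, A) 𝓘(ℝ, E) U q w] :=
  (S.isPrimOn _ _ (Γ.mem_V y a ha)).contDiffAt_pull hU hq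

/-- `Λ` is a primitive of `U^*ω` along `K`, locally gauge equivalent to the primitives of `S`. -/
structure IsGaugedPrimitive (U : ℂ → M) (c : ℂ → X) (K : Set ℂ) (Λ : ℂ → ℂ →L[ℝ] ℝ)
    (ν : X → ℂ → ℝ) : Prop where
  contDiffAt : ∀ y ∈ K, ContDiffAt ℝ 1 Λ y
  curl : ∀ y ∈ K, ∀ v w, fderiv ℝ Λ y v w - fderiv ℝ Λ y w v
    = ω.form (U y) ![mfderiv 𝓘(ℝ, ℂ) 𝓘(ℝ, E) U y v, mfderiv 𝓘(ℝ, ℂ) 𝓘(ℝ, E) U y w]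
  hasFDerivAt : ∀ y ∈ K, ∀ a, Γ.R (c y) a →
    HasFDerivAt (ν a) (Λ y - pull E (S.θ (f a)) U y) y
  sub_eq : ∀ y ∈ K, ∀ a b, Γ.R (c y) a → Γ.R (c y) b → ν a y - ν b y = - Γ.Φ a b (U y)

/-- The functions `Φ` form a Čech 1-cocycle of functions, which a partition of unity writes as a
difference: `ν_a - ν_b = -Φ_{ab}`. Hence `θ_a + dν_a` does not depend on the label `a` and is a
global primitive. -/
theorem Gauge.exists_primitive {U : ℂ → M} {c : ℂ → X} {O K : Set ℂ} (hO : IsOpen O)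
    (hK : IsCompact K) (hKO : K ⊆ O) (hU : ∀ y ∈ O, ContMDiffAt 𝓘(ℝ, ℂ) 𝓘(ℝ, E) (⊤ : ℕ∞) U y)
    (hc : ContinuousOn c O) (hfc : ∀ y ∈ O, f (c y) = U y) :
    ∃ Λ ν, IsGaugedPrimitive Γ U c K Λ ν := by
  -- The partition of unity sums to one on `K'`, so the identities hold in a neighbourhood of each
  -- point of `K` and can be differentiated there.
  obtain ⟨K', hK', hKK', hK'O⟩ := exists_compact_between hK hO hKO
  have hRo : ∀ b, IsOpen {q | q ∈ O ∧ Γ.R (c q) b} := by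
    intro b
    have h1 : IsOpen {x | Γ.R x b} :=
      Γ.isOpen_R.preimage (by fun_prop : Continuous fun x : X => (x, b))
    exact hc.isOpen_inter_preimage hO h1
  obtain ⟨t, htK, ht⟩ := hK'.elim_nhds_subcover (fun y => {q | q ∈ O ∧ Γ.R (c q) (c y)})
    fun y hy => (hRo _).mem_nhds ⟨hK'O hy, Γ.refl _⟩
  obtain ⟨χ, hχ⟩ := SmoothPartitionOfUnity.exists_isSubordinate 𝓘(ℝ, ℂ) hK'.isClosed
    (fun k : t => {q | q ∈ O ∧ Γ.R (c q) (c k)}) (fun k => hRo _) (by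
      intro q hq
      obtain ⟨y, hy, h⟩ := mem_iUnion₂.1 (ht hq)
      exact mem_iUnion.2 ⟨⟨y, hy⟩, h⟩)
  have hχs : ∀ k, ContDiff ℝ (⊤ : ℕ∞) (χ k) := fun k => (χ k).contMDiff.contDiff
  have hχ1 : ∀ q ∈ K', ∑ k, χ k q = 1 := fun q hq => by
    rw [← finsum_eq_sum_of_fintype]; exact χ.sum_eq_one hq
  let ν : X → ℂ → ℝ := fun a q => -∑ k : t, χ k q * Γ.Φ a (c k) (U q)
  let Λ : ℂ → ℂ →L[ℝ] ℝ := fun q => pull E (S.θ (f (c q))) U q + fderiv ℝ (ν (c q)) q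
  have hV : ∀ q ∈ O, U q ∈ S.V (Γ.v (c q)) := fun q hq => by
    rw [← hfc q hq]; exact Γ.mem_V _ _ (Γ.refl _)
  have hΦ2 : ∀ q ∈ O, ∀ a b, Γ.R (c q) a → Γ.R (c q) b →
      ContDiffAt ℝ 2 (fun q => Γ.Φ a b (U q)) q := by
    intro q hq a b ha hb
    -- `Φ` is `C²` because its derivative is a difference of pullbacks of class `C¹`.
    rw [show (2 : WithTop ℕ∞) = ((1 : ℕ) : WithTop ℕ∞) + 1 by norm_num,
      contDiffAt_succ_iff_hasFDerivAt]
    refine ⟨fun q => pull E (S.θ (f a)) U q - pull E (S.θ (f b)) U q,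
      ⟨O ∩ U ⁻¹' S.V (Γ.v (c q)), ?_, fun x hx => ?_⟩, ?_⟩
    · exact inter_mem (hO.mem_nhds hq)
        ((hU q hq).continuousAt.preimage_mem_nhds ((S.isOpen_V _).mem_nhds (hV q hq)))
    · exact Γ.hasFDerivAt_Φ ha hb ((hU x hx.1).mdifferentiableAt (by simp)) hx.2
    · exact (Γ.contDiffAt_pull ha (hU q hq) (hV q hq)).1.sub
        (Γ.contDiffAt_pull hb (hU q hq) (hV q hq)).1
  have hν2 : ∀ q ∈ O, ∀ a, Γ.R (c q) a → ContDiffAt ℝ 2 (ν a) q := by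
    intro q hq a ha
    refine ContDiffAt.neg (ContDiffAt.sum fun k _ => ?_)
    by_cases hk : q ∈ tsupport (χ k)
    · exact ((hχs k).contDiffAt.of_le (WithTop.coe_le_coe.2 (le_top : (2 : ℕ∞) ≤ ⊤))).mul
        (hΦ2 q hq a _ ha (hχ k hk).2)
    · refine contDiffAt_const (c := 0) |>.congr_of_eventuallyEq ?_
      filter_upwards [(isClosed_tsupport (χ k)).isOpen_compl.mem_nhds hk] with x hx
      rw [image_eq_zero_of_notMem_tsupport hx, zero_mul]
  have hsub : ∀ q ∈ K', ∀ a b, Γ.R (c q) a → Γ.R (c q) b → ν a q - ν b q = - Γ.Φ a b (U q) := by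
    intro q hq a b ha hb
    have h1 : ∀ k : t, χ k q * Γ.Φ a (c k) (U q) - χ k q * Γ.Φ b (c k) (U q)
        = χ k q * Γ.Φ a b (U q) := by
      intro k
      by_cases hk : q ∈ tsupport (χ k)
      · rw [← Γ.Φ_add ha hb (hχ k hk).2 (hV q (hK'O hq))]; ring
      · rw [image_eq_zero_of_notMem_tsupport hk]; ring
    have h2 : ∑ k : t, (χ k q * Γ.Φ a (c k) (U q) - χ k q * Γ.Φ b (c k) (U q))
        = Γ.Φ a b (U q) := by
      rw [Finset.sum_congr rfl fun k _ => h1 k, ← Finset.sum_mul, hχ1 q hq, one_mul]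
    rw [Finset.sum_sub_distrib] at h2
    simp only [ν]
    linarith
  have hev : ∀ q ∈ interior K', ∀ a, Γ.R (c q) a → ∀ᶠ x in 𝓝 q, x ∈ interior K' ∧ Γ.R (c x) a :=
    fun q hq a ha => (isOpen_interior.eventually_mem hq).and
      (((hRo a).eventually_mem ⟨hK'O (interior_subset hq), ha⟩).mono fun x hx => hx.2)
  have hΛ : ∀ q ∈ interior K', ∀ a, Γ.R (c q) a →
      Λ q = pull E (S.θ (f a)) U q + fderiv ℝ (ν a) q := by
    intro q hq a ha
    have hqO := hK'O (interior_subset hq)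
    have h1 : ν a =ᶠ[𝓝 q] fun x => ν (c q) x - Γ.Φ a (c q) (U x) := by
      filter_upwards [hev q hq a ha, hev q hq _ (Γ.refl _)] with x hx hx'
      have := hsub x (interior_subset hx.1) a (c q) hx.2 hx'.2
      linarith
    have h2 := ((hν2 q hqO _ (Γ.refl _)).differentiableAt two_ne_zero).hasFDerivAt.sub
      (Γ.hasFDerivAt_Φ ha (Γ.refl _) ((hU q hqO).mdifferentiableAt (by simp)) (hV q hqO))
    have h3 : HasFDerivAt (fun x => ν (c q) x - Γ.Φ a (c q) (U x)) _ q := h2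
    rw [h1.fderiv_eq, h3.fderiv]
    simp only [Λ]
    abel
  refine ⟨Λ, ν, ?_, ?_, ?_, fun y hy => hsub y (interior_subset (hKK' hy))⟩
  · intro y hy
    have hyO := hKO hy
    have h1 : Λ =ᶠ[𝓝 y] fun q => pull E (S.θ (f (c y))) U q + fderiv ℝ (ν (c y)) q := by
      filter_upwards [hev y (hKK' hy) _ (Γ.refl _)] with q hq
      exact hΛ q hq.1 _ hq.2
    exact ((Γ.contDiffAt_pull (Γ.refl _) (hU y hyO) (hV y hyO)).1.add
      ((hν2 y hyO _ (Γ.refl _)).fderiv_right (by norm_num))).congr_of_eventuallyEq h1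
  · intro y hy v w
    have hyO := hKO hy
    have h1 : Λ =ᶠ[𝓝 y] fun q => pull E (S.θ (f (c y))) U q + fderiv ℝ (ν (c y)) q := by
      filter_upwards [hev y (hKK' hy) _ (Γ.refl _)] with q hq
      exact hΛ q hq.1 _ hq.2
    obtain ⟨h2, h3⟩ := Γ.contDiffAt_pull (Γ.refl (c y)) (hU y hyO) (hV y hyO)
    have h4 : ContDiffAt ℝ 1 (fderiv ℝ (ν (c y))) y :=
      (hν2 y hyO _ (Γ.refl _)).fderiv_right (by norm_num)
    have h5 := ((hν2 y hyO _ (Γ.refl _)).isSymmSndFDerivAt (by simp)).eq v w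
    rw [h1.fderiv_eq, fderiv_fun_add (h2.differentiableAt one_ne_zero)
      (h4.differentiableAt one_ne_zero), ← h3 v w]
    simp only [add_apply]
    linarith
  · intro y hy a ha
    rw [hΛ y (hKK' hy) a ha, add_sub_cancel_left]
    exact ((hν2 y (hKO hy) a ha).differentiableAt two_ne_zero).hasFDerivAt

theorem pull_comp_curve {θ : ∀ y : M, TangentSpace 𝓘(ℝ, E) y →L[ℝ] ℝ} {U : ℂ → M} {γ : ℝ → ℂ}
    {γ' : ℂ} {t : ℝ} (hU : MDifferentiableAt 𝓘(ℝ, ℂ) 𝓘(ℝ, E) U (γ t)) (hγ : HasDerivAt γ γ' t) :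
    pull E θ (fun t => U (γ t)) t 1 = pull E θ U (γ t) γ' := by
  have h1 := (hU.hasMFDerivAt.comp t hγ.hasFDerivAt.hasMFDerivAt).mfderiv
  have h2 : mfderiv 𝓘(ℝ, ℝ) 𝓘(ℝ, E) (fun t => U (γ t)) t (1 : ℝ)
      = mfderiv 𝓘(ℝ, ℂ) 𝓘(ℝ, E) U (γ t) γ' := by
    rw [show (fun t => U (γ t)) = U ∘ γ from rfl, h1]
    change mfderiv 𝓘(ℝ, ℂ) 𝓘(ℝ, E) U (γ t) ((ContinuousLinearMap.toSpanSingleton ℝ γ') (1 : ℝ)) = _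
    rw [ContinuousLinearMap.toSpanSingleton_apply, one_smul]
  exact congrArg (θ (U (γ t))) h2

/-- On the `j`-th segment `Λ` is the pullback of `θ` for the label `a j` plus the differential of `ν
(a j)`. A change of label at a vertex costs a value of `Φ`; the remaining values of `ν` telescope to
zero, because both the loop and the list of labels close up. The auxiliary `Λ` and `ν` thus
disappear from the result. -/
theorem IsGaugedPrimitive.integral_loop {U : ℂ → M} {c : ℂ → X} {O K : Set ℂ}
    {Λ : ℂ → ℂ →L[ℝ] ℝ} {ν : X → ℂ → ℝ} (hΛ : IsGaugedPrimitive Γ U c K Λ ν) (hKO : K ⊆ O)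
    (hU : ∀ y ∈ O, ContMDiffAt 𝓘(ℝ, ℂ) 𝓘(ℝ, E) (⊤ : ℕ∞) U y) (hfc : ∀ y ∈ O, f (c y) = U y)
    {γ γ' : ℝ → ℂ} (hγ : ∀ t, HasDerivAt γ (γ' t) t) (hγ' : Continuous γ')
    (hγK : ∀ t ∈ Icc (0 : ℝ) 1, γ t ∈ K) (hγ01 : γ 1 = γ 0) {a : ℕ → X} {N : ℕ} (hN : 0 < N)
    (haN : a N = a 0)
    (ha : ∀ j < N, ∀ t ∈ Icc (j / N : ℝ) ((j + 1 : ℕ) / N), Γ.R (c (γ t)) (a j)) :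
    ∫ t in (0 : ℝ)..1, Λ (γ t) (γ' t) = Γ.hol a N (fun t => U (γ t)) := by
  have hN' : (0 : ℝ) < N := Nat.cast_pos.2 hN
  have hle : ∀ j : ℕ, (j / N : ℝ) ≤ ((j + 1 : ℕ) / N : ℝ) := fun j => by
    gcongr; exact_mod_cast Nat.le_succ j
  have hsub : ∀ j < N, Icc (j / N : ℝ) ((j + 1 : ℕ) / N) ⊆ Icc 0 1 := by
    intro j hj
    refine Icc_subset_Icc (by positivity) ?_
    rw [div_le_one hN']
    exact_mod_cast hj
  have hγc : Continuous γ := continuous_iff_continuousAt.2 fun t => (hγ t).continuousAt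
  have hcont : ContinuousOn (fun t => Λ (γ t) (γ' t)) (Icc 0 1) := by
    refine ContinuousOn.clm_apply (fun t ht => ?_) hγ'.continuousOn
    exact ((hΛ.contDiffAt _ (hγK t ht)).continuousAt.comp hγc.continuousAt).continuousWithinAt
  have hseg : ∀ j < N, (∫ t in (j / N : ℝ)..((j + 1 : ℕ) / N : ℝ), Λ (γ t) (γ' t))
      = (∫ t in (j / N : ℝ)..((j + 1 : ℕ) / N : ℝ), pull E (S.θ (f (a j))) (fun t => U (γ t)) t 1)
        + (ν (a j) (γ ((j + 1 : ℕ) / N)) - ν (a j) (γ (j / N))) := by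
    intro j hj
    have hpc : ContinuousOn (fun t => pull E (S.θ (f (a j))) U (γ t) (γ' t))
        (Icc (j / N : ℝ) ((j + 1 : ℕ) / N)) := by
      refine ContinuousOn.clm_apply (fun t ht => ?_) hγ'.continuousOn
      have hO := hKO (hγK t (hsub j hj ht))
      have h1 := (Γ.contDiffAt_pull (ha j hj t ht) (hU _ hO)
        (by rw [← hfc _ hO]; exact Γ.mem_V _ _ (Γ.refl _))).1.continuousAt
      exact (ContinuousAt.comp (f := γ) h1 hγc.continuousAt).continuousWithinAt
    have h1 : (∫ t in (j / N : ℝ)..((j + 1 : ℕ) / N : ℝ),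
        pull E (S.θ (f (a j))) (fun t => U (γ t)) t 1)
        = ∫ t in (j / N : ℝ)..((j + 1 : ℕ) / N : ℝ), pull E (S.θ (f (a j))) U (γ t) (γ' t) := by
      refine intervalIntegral.integral_congr fun t ht => ?_
      rw [uIcc_of_le (hle j)] at ht
      exact pull_comp_curve ((hU _ (hKO (hγK t (hsub j hj ht)))).mdifferentiableAt (by simp)) (hγ t)
    have i1 := (hcont.mono (hsub j hj)).intervalIntegrable_of_Icc (μ := volume) (hle j)
    have i2 := hpc.intervalIntegrable_of_Icc (μ := volume) (hle j)
    rw [h1, ← sub_eq_iff_eq_add', ← intervalIntegral.integral_sub i1 i2]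
    refine intervalIntegral.integral_eq_sub_of_hasDerivAt (f := fun t => ν (a j) (γ t))
      (fun t ht => ?_) (i1.sub i2)
    rw [uIcc_of_le (hle j)] at ht
    exact (hΛ.hasFDerivAt _ (hγK t (hsub j hj ht)) _ (ha j hj t ht)).comp_hasDerivAt t (hγ t)
  have hvert : ∀ j < N, ν (a j) (γ ((j + 1 : ℕ) / N)) = ν (a (j + 1)) (γ ((j + 1 : ℕ) / N))
      - Γ.Φ (a j) (a (j + 1)) (U (γ ((j + 1 : ℕ) / N))) := by
    intro j hj
    -- At the last vertex there is no following segment; there `a N = a 0`, and nearness is taken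
    -- from the start of the loop.
    have hr : Γ.R (c (γ ((j + 1 : ℕ) / N))) (a (j + 1)) := by
      rcases (Nat.succ_le_of_lt hj).lt_or_eq with h | h
      · exact ha (j + 1) h _ (left_mem_Icc.2 (hle _))
      · have h2 := ha 0 hN 0 (by simp)
        have h3 : ((j + 1 : ℕ) / N : ℝ) = 1 := by
          rw [← h]; exact div_self (by positivity)
        rw [h3, hγ01, show j + 1 = N from h, haN]
        exact h2
    have := hΛ.sub_eq _ (hγK _ (hsub j hj (right_mem_Icc.2 (hle j)))) (a j) (a (j + 1))
      (ha j hj _ (right_mem_Icc.2 (hle j))) hr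
    linarith
  have hadj := intervalIntegral.sum_integral_adjacent_intervals (f := fun t => Λ (γ t) (γ' t))
    (μ := volume) (a := fun j : ℕ => (j / N : ℝ)) (n := N) fun j hj =>
      (hcont.mono (hsub j hj)).intervalIntegrable_of_Icc (hle j)
  have e0 : ((0 : ℕ) / N : ℝ) = 0 := by simp
  have e1 : (N / N : ℝ) = 1 := div_self hN'.ne'
  rw [e0, e1] at hadj
  have htel := Finset.sum_range_sub (fun j : ℕ => ν (a j) (γ (j / N))) N
  rw [e0, e1, haN, hγ01, sub_self] at htel
  rw [← hadj, Gauge.hol, ← sub_eq_zero, ← Finset.sum_sub_distrib, ← htel]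
  refine Finset.sum_congr rfl fun j hj => ?_
  have hj := Finset.mem_range.1 hj
  rw [hseg j hj, hvert j hj]
  ring

end Gauge

end Pants

namespace Pants

set_option maxSynthPendingDepth 3
set_option linter.unusedSectionVars false

universe u v

/-! ### Convergence of the discrete holonomy -/

/-- Only `w`, not `w'`, is close to its limit. The part `l(z)(w' - z')` is integrated by parts,
which moves the derivative onto `l(z)`; the rest, `(l(w) - l(z)) w'`, is small times the speed. So a
bound on the speed, with `σ` entering only through its integral, suffices. -/
theorem integral_form_sub_le {E : Type*} [NormedAddCommGroup E] [NormedSpace ℝ E]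
    {l : E → E →L[ℝ] ℝ} (hl : ContDiff ℝ 1 l) {a b : ℝ} (hab : a ≤ b) {z z' : ℝ → E}
    (hz : ∀ t ∈ Icc a b, HasDerivAt z (z' t) t) (hz' : ContinuousOn z' (Icc a b)) (C : ℝ) {ε : ℝ}
    (hε : 0 < ε) :
    ∃ δ > 0, ∀ (w w' : ℝ → E) (σ : ℝ → ℝ), (∀ t ∈ Icc a b, HasDerivAt w (w' t) t) →
      ContinuousOn w' (Icc a b) → (∀ t ∈ Icc a b, dist (w t) (z t) < δ) →
      (∀ t ∈ Icc a b, ‖w' t‖ ≤ C * (1 + σ t)) → ContinuousOn σ (Icc a b) →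
      (∀ t ∈ Icc a b, 0 ≤ σ t) →
      |(∫ t in a..b, l (w t) (w' t)) - ∫ t in a..b, l (z t) (z' t)|
        ≤ ε * (1 + ∫ t in a..b, σ t) := by
  have hzc : ContinuousOn z (Icc a b) := fun t ht => (hz t ht).continuousAt.continuousWithinAt
  let L' : ℝ → E →L[ℝ] ℝ := fun t => fderiv ℝ l (z t) (z' t)
  have hL : ∀ t ∈ Icc a b, HasDerivAt (fun t => l (z t)) (L' t) t := fun t ht =>
    ((hl.differentiable one_ne_zero) (z t)).hasFDerivAt.comp_hasDerivAt t (hz t ht)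
  have hLc : ContinuousOn (fun t => l (z t)) (Icc a b) := hl.continuous.comp_continuousOn hzc
  have hL'c : ContinuousOn L' (Icc a b) :=
    ((hl.continuous_fderiv one_ne_zero).comp_continuousOn hzc).clm_apply hz'
  obtain ⟨K₁, hK₁⟩ := isCompact_Icc.exists_bound_of_continuousOn hLc
  obtain ⟨K₂, hK₂⟩ := isCompact_Icc.exists_bound_of_continuousOn hL'c
  have hK₁0 : 0 ≤ K₁ := (norm_nonneg _).trans (hK₁ a (left_mem_Icc.2 hab))
  have hK₂0 : 0 ≤ K₂ := (norm_nonneg _).trans (hK₂ a (left_mem_Icc.2 hab))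
  -- With this bound on `l(w) - l(z)`, the speed term is at most `ε / 4 * (1 + ∫ σ)`. Similarly `δ₂`
  -- below makes the two boundary terms and the term with `L'` together at most `ε / 2`.
  set η : ℝ := ε / (4 * (|C| + 1) * (1 + (b - a))) with hη
  have hba : 0 ≤ b - a := sub_nonneg.2 hab
  have hη0 : 0 < η := by positivity
  have huc := (isCompact_Icc.image_of_continuousOn hzc).uniformContinuousAt_of_continuousAt l
    (fun x _ => hl.continuous.continuousAt) (Metric.dist_mem_uniformity hη0)
  obtain ⟨δ₁, hδ₁, huc⟩ := Metric.mem_uniformity_dist.1 huc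
  set δ₂ : ℝ := ε / (4 * (K₁ + 1 + K₂ * (b - a))) with hδ₂
  have hδ₂0 : 0 < δ₂ := by positivity
  refine ⟨min δ₁ δ₂, lt_min hδ₁ hδ₂0, fun w w' σ hw hw' hd hC hσ hσ0 => ?_⟩
  have hwc : ContinuousOn w (Icc a b) := fun t ht => (hw t ht).continuousAt.continuousWithinAt
  have hlw : ContinuousOn (fun t => l (w t)) (Icc a b) := hl.continuous.comp_continuousOn hwc
  have hclose : ∀ t ∈ Icc a b, ‖l (w t) - l (z t)‖ ≤ η := fun t ht => by
    have := huc (a := z t) (b := w t) (by rw [dist_comm]; exact (hd t ht).trans_le (min_le_left _ _))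
      (mem_image_of_mem _ ht)
    rw [← dist_eq_norm, dist_comm]
    exact le_of_lt this
  have hwz : ∀ t ∈ Icc a b, ‖w t - z t‖ ≤ δ₂ := fun t ht => by
    rw [← dist_eq_norm]
    exact (hd t ht).le.trans (min_le_right _ _)
  have hparts : ∫ t in a..b, (L' t (w t - z t) + l (z t) (w' t - z' t))
      = l (z b) (w b - z b) - l (z a) (w a - z a) := by
    refine intervalIntegral.integral_eq_sub_of_hasDerivAt (f := fun t => l (z t) (w t - z t))
      (fun t ht => ?_) (ContinuousOn.intervalIntegrable_of_Icc hab ?_)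
    · rw [uIcc_of_le hab] at ht
      exact (hL t ht).clm_apply ((hw t ht).sub (hz t ht))
    · exact (hL'c.clm_apply (hwc.sub hzc)).add (hLc.clm_apply (hw'.sub hz'))
  have i1 : IntervalIntegrable (fun t => l (w t) (w' t)) volume a b :=
    (hlw.clm_apply hw').intervalIntegrable_of_Icc hab
  have i2 : IntervalIntegrable (fun t => l (z t) (z' t)) volume a b :=
    (hLc.clm_apply hz').intervalIntegrable_of_Icc hab
  have i3 : IntervalIntegrable (fun t => L' t (w t - z t) + l (z t) (w' t - z' t)) volume a b :=
    ((hL'c.clm_apply (hwc.sub hzc)).add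
      (hLc.clm_apply (hw'.sub hz'))).intervalIntegrable_of_Icc hab
  have hσi : IntervalIntegrable σ volume a b := hσ.intervalIntegrable_of_Icc hab
  have hrest : |∫ t in a..b, ((l (w t) (w' t) - l (z t) (z' t))
      - (L' t (w t - z t) + l (z t) (w' t - z' t)))|
      ≤ ∫ t in a..b, (η * (|C| * (1 + σ t)) + K₂ * δ₂) := by
    rw [← Real.norm_eq_abs]
    refine intervalIntegral.norm_integral_le_of_norm_le hab ?_ ?_
    · refine Eventually.of_forall fun t ht => ?_
      have ht := Ioc_subset_Icc_self ht
      have e1 : (l (w t) (w' t) - l (z t) (z' t)) - (L' t (w t - z t) + l (z t) (w' t - z' t))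
          = (l (w t) - l (z t)) (w' t) - L' t (w t - z t) := by
        simp only [sub_apply, map_sub]; ring
      rw [e1]
      refine (norm_sub_le _ _).trans (add_le_add ?_ ?_)
      · refine ((l (w t) - l (z t)).le_opNorm _).trans (mul_le_mul (hclose t ht) ?_
          (norm_nonneg _) hη0.le)
        refine (hC t ht).trans (mul_le_mul_of_nonneg_right (le_abs_self C) ?_)
        have := hσ0 t ht
        linarith
      · exact ((L' t).le_opNorm _).trans (mul_le_mul (hK₂ t ht) (hwz t ht) (norm_nonneg _) hK₂0)
    · exact (((intervalIntegrable_const.add hσi).const_mul _).const_mul _).add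
        intervalIntegrable_const
  rw [intervalIntegral.integral_sub (i1.sub i2) i3, hparts,
    intervalIntegral.integral_sub i1 i2,
    intervalIntegral.integral_add (((intervalIntegrable_const.add hσi).const_mul _).const_mul _)
      intervalIntegrable_const, intervalIntegral.integral_const_mul,
    intervalIntegral.integral_const_mul, intervalIntegral.integral_add intervalIntegrable_const hσi,
    intervalIntegral.integral_const, intervalIntegral.integral_const] at hrest
  have hend : ∀ t ∈ Icc a b, |l (z t) (w t - z t)| ≤ K₁ * δ₂ := fun t ht =>
    ((l (z t)).le_opNorm _).trans (mul_le_mul (hK₁ t ht) (hwz t ht) (norm_nonneg _) hK₁0)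
  have hb := hend b (right_mem_Icc.2 hab)
  have ha := hend a (left_mem_Icc.2 hab)
  have hσI : 0 ≤ ∫ t in a..b, σ t := intervalIntegral.integral_nonneg hab hσ0
  set I := ∫ t in a..b, σ t
  have k1 : η * (|C| * ((b - a) • (1 : ℝ) + I)) ≤ ε / 4 * (1 + I) := by
    have k2 : η * (|C| * ((b - a) • (1 : ℝ) + I)) ≤ η * ((|C| + 1) * ((1 + (b - a)) * (1 + I))) := by
      have hC0 := abs_nonneg C
      rw [smul_eq_mul]
      gcongr
      · linarith
      · nlinarith
    refine k2.trans (le_of_eq ?_)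
    rw [hη]; field_simp
  have k3 : 2 * (K₁ * δ₂) + (b - a) • (K₂ * δ₂) ≤ ε / 2 := by
    have k4 : δ₂ * (K₁ + 1 + K₂ * (b - a)) = ε / 4 := by rw [hδ₂]; field_simp
    rw [smul_eq_mul]
    nlinarith [mul_nonneg (mul_nonneg hK₂0 hba) hδ₂0.le]
  rw [abs_le] at *
  constructor <;> nlinarith [mul_nonneg hε.le hσI]

section Thin

variable {E : Type v} [NormedAddCommGroup E] [NormedSpace ℝ E]
  {M : Type u} [TopologicalSpace M] [ChartedSpace E M] [IsManifold 𝓘(ℝ, E) (⊤ : ℕ∞) M]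
  {X : Type*} [TopologicalSpace X]
  {ω : SymplecticForm E M} {S : PotentialSystem ω} {f : X → M} (Γ : Gauge S f)

/-- Compactness of the interval turns local uniformity in `t` into uniformity. -/
theorem eventually_forall_Icc {ι : Type*} {ℓ : Filter ι} {a b : ℝ} {P : ι → ℝ → Prop}
    (h : ∀ t ∈ Icc a b, ∀ᶠ p in ℓ ×ˢ 𝓝 t, P p.1 p.2) : ∀ᶠ i in ℓ, ∀ t ∈ Icc a b, P i t := by
  refine isCompact_Icc.induction_on (p := fun s => ∀ᶠ i in ℓ, ∀ t ∈ s, P i t) ?_ ?_ ?_ ?_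
  · simp
  · exact fun s t hst ht => ht.mono fun i hi x hx => hi x (hst hx)
  · exact fun s t hs ht => (hs.and ht).mono fun i hi x hx => hx.elim (hi.1 x) (hi.2 x)
  · intro t ht
    obtain ⟨pa, h1, pb, h2, h3⟩ := eventually_prod_iff.1 (h t ht)
    exact ⟨{t | pb t}, mem_nhdsWithin_of_mem_nhds h2, h1.mono fun i hi x hx => h3 hi hx⟩

theorem exists_bound_forall_Icc {ι : Type*} {ℓ : Filter ι} {a b : ℝ} {g σ : ι → ℝ → ℝ}
    (hσ : ∀ i t, 0 ≤ σ i t)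
    (h : ∀ t ∈ Icc a b, ∃ C, ∀ᶠ p in ℓ ×ˢ 𝓝 t, g p.1 p.2 ≤ C * (1 + σ p.1 p.2)) :
    ∃ C, ∀ᶠ i in ℓ, ∀ t ∈ Icc a b, g i t ≤ C * (1 + σ i t) := by
  refine isCompact_Icc.induction_on
    (p := fun s => ∃ C, ∀ᶠ i in ℓ, ∀ t ∈ s, g i t ≤ C * (1 + σ i t)) ?_ ?_ ?_ ?_
  · exact ⟨0, by simp⟩
  · rintro s t hst ⟨C, ht⟩
    exact ⟨C, ht.mono fun i hi x hx => hi x (hst hx)⟩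
  · rintro s t ⟨C, hs⟩ ⟨C', ht⟩
    refine ⟨max C C', (hs.and ht).mono fun i hi x hx => ?_⟩
    have h0 : 0 ≤ 1 + σ i x := by have := hσ i x; linarith
    rcases hx with hx | hx
    · exact (hi.1 x hx).trans (mul_le_mul_of_nonneg_right (le_max_left _ _) h0)
    · exact (hi.2 x hx).trans (mul_le_mul_of_nonneg_right (le_max_right _ _) h0)
  · intro t ht
    obtain ⟨C, hC⟩ := h t ht
    obtain ⟨pa, h1, pb, h2, h3⟩ := eventually_prod_iff.1 hC
    exact ⟨{t | pb t}, mem_nhdsWithin_of_mem_nhds h2, C, h1.mono fun i hi x hx => h3 hi hx⟩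

/-- The derivative of the expression of the curve `μ` in the chart at `x₀`. -/
def chartVel (x₀ : M) (μ : ℝ → M) (t : ℝ) : E :=
  deriv (fun t => extChartAt 𝓘(ℝ, E) x₀ (μ t)) t

theorem contDiffAt_chart_curve {x₀ : M} {μ : ℝ → M} {t : ℝ}
    (hμ : ContMDiffAt 𝓘(ℝ, ℝ) 𝓘(ℝ, E) (⊤ : ℕ∞) μ t)
    (h : μ t ∈ (extChartAt 𝓘(ℝ, E) x₀).source) :
    ContDiffAt ℝ (⊤ : ℕ∞) (fun t => extChartAt 𝓘(ℝ, E) x₀ (μ t)) t :=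
  ((contMDiffAt_extChartAt_of_mem h).comp t hμ).contDiffAt

theorem hasDerivAt_chart_curve {x₀ : M} {μ : ℝ → M} {t : ℝ}
    (hμ : ContMDiffAt 𝓘(ℝ, ℝ) 𝓘(ℝ, E) (⊤ : ℕ∞) μ t)
    (h : μ t ∈ (extChartAt 𝓘(ℝ, E) x₀).source) :
    HasDerivAt (fun t => extChartAt 𝓘(ℝ, E) x₀ (μ t)) (chartVel x₀ μ t) t :=
  ((contDiffAt_chart_curve hμ h).differentiableAt (by simp)).hasDerivAt

theorem continuousOn_chartVel {x₀ : M} {μ : ℝ → M} {s : Set ℝ}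
    (hμ : ∀ t ∈ s, ContMDiffAt 𝓘(ℝ, ℝ) 𝓘(ℝ, E) (⊤ : ℕ∞) μ t)
    (h : ∀ t ∈ s, μ t ∈ (extChartAt 𝓘(ℝ, E) x₀).source) :
    ContinuousOn (chartVel (E := E) x₀ μ) s := by
  intro t ht
  have h1 := (contDiffAt_chart_curve (hμ t ht) (h t ht)).fderiv_right (m := 1) (by norm_cast)
  have h2 := h1.continuousAt.clm_apply (continuousAt_const (y := (1 : ℝ)))
  exact h2.continuousWithinAt

/-- On each segment the integrals are compared by `integral_form_sub_le` in the chart of the label,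
and the vertex terms converge because `Φ` is continuous. The error is shared equally among the `N`
segments and the `N` vertices. -/
theorem Gauge.eventually_hol_sub_le {ι : Type*} {ℓ : Filter ι} {μ : ι → ℝ → M} {σ : ι → ℝ → ℝ}
    {z : ℝ → M} {c : ℝ → X} {a : ℕ → X} {N : ℕ} (hN : 0 < N) (haN : a N = a 0) (hc1 : c 1 = c 0)
    (hz : ContMDiff 𝓘(ℝ, ℝ) 𝓘(ℝ, E) (⊤ : ℕ∞) z) (hfc : ∀ t, f (c t) = z t)
    (ha : ∀ j < N, ∀ t ∈ Icc (j / N : ℝ) ((j + 1 : ℕ) / N), Γ.R (c t) (a j))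
    (hμ : ∀ᶠ i in ℓ, ∀ t ∈ Icc (0 : ℝ) 1, ContMDiffAt 𝓘(ℝ, ℝ) 𝓘(ℝ, E) (⊤ : ℕ∞) (μ i) t)
    (hlim : ∀ t ∈ Icc (0 : ℝ) 1, Tendsto (fun p : ι × ℝ => μ p.1 p.2) (ℓ ×ˢ 𝓝 t) (𝓝 (z t)))
    (hσ0 : ∀ i t, 0 ≤ σ i t) (hσ : ∀ᶠ i in ℓ, ContinuousOn (σ i) (Icc 0 1))
    (hspeed : ∀ t ∈ Icc (0 : ℝ) 1, ∀ x₀ : M, z t ∈ (extChartAt 𝓘(ℝ, E) x₀).source →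
      ∃ C, ∀ᶠ p in ℓ ×ˢ 𝓝 t, ‖chartVel (E := E) x₀ (μ p.1) p.2‖ ≤ C * (1 + σ p.1 p.2))
    {ε : ℝ} (hε : 0 < ε) :
    ∀ᶠ i in ℓ, |Γ.hol a N (μ i) - Γ.hol a N z| ≤ ε * (1 + ∫ t in (0 : ℝ)..1, σ i t) := by
  have hN' : (0 : ℝ) < N := Nat.cast_pos.2 hN
  have hle : ∀ j : ℕ, (j / N : ℝ) ≤ ((j + 1 : ℕ) / N : ℝ) := fun j => by
    gcongr; exact_mod_cast Nat.le_succ j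
  have hsub : ∀ j < N, Icc (j / N : ℝ) ((j + 1 : ℕ) / N) ⊆ Icc 0 1 := by
    intro j hj
    refine Icc_subset_Icc (by positivity) ?_
    rw [div_le_one hN']
    exact_mod_cast hj
  have hzV : ∀ t, z t ∈ S.V (Γ.v (c t)) := fun t => by
    rw [← hfc]; exact Γ.mem_V _ _ (Γ.refl _)
  have hseg : ∀ j < N, ∀ᶠ i in ℓ, |(∫ t in (j / N : ℝ)..((j + 1 : ℕ) / N : ℝ),
      pull E (S.θ (f (a j))) (μ i) t 1) - ∫ t in (j / N : ℝ)..((j + 1 : ℕ) / N : ℝ),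
      pull E (S.θ (f (a j))) z t 1| ≤ ε / (2 * N) * (1 + ∫ t in (0 : ℝ)..1, σ i t) := by
    intro j hj
    set e := extChartAt 𝓘(ℝ, E) (S.ctr (f (a j))) with he
    have hsrc : ∀ t ∈ Icc (j / N : ℝ) ((j + 1 : ℕ) / N), z t ∈ e.source := fun t ht =>
      S.V_subset _ _ (Γ.mem_V _ _ (ha j hj t ht)) (hzV t)
    have hpull : ∀ ν : ℝ → M, (∀ t ∈ Icc (0 : ℝ) 1, ContMDiffAt 𝓘(ℝ, ℝ) 𝓘(ℝ, E) (⊤ : ℕ∞) ν t) →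
        (∀ t ∈ Icc (j / N : ℝ) ((j + 1 : ℕ) / N), ν t ∈ e.source) →
        (∫ t in (j / N : ℝ)..((j + 1 : ℕ) / N : ℝ), pull E (S.θ (f (a j))) ν t 1)
        = ∫ t in (j / N : ℝ)..((j + 1 : ℕ) / N : ℝ),
          S.l (f (a j)) (e (ν t)) (chartVel (S.ctr (f (a j))) ν t) := by
      intro ν hν hνe
      refine intervalIntegral.integral_congr fun t ht => ?_
      rw [uIcc_of_le (hle j)] at ht
      rw [S.θ_eq, pull_formAt ((hν t (hsub j hj ht)).mdifferentiableAt (by simp)) (hνe t ht)]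
      rfl
    obtain ⟨C, hC⟩ := exists_bound_forall_Icc
      (g := fun i t => ‖chartVel (E := E) (S.ctr (f (a j))) (μ i) t‖) hσ0 fun t ht =>
      hspeed t (hsub j hj ht) (S.ctr (f (a j))) (hsrc t ht)
    obtain ⟨δ, hδ, hmain⟩ := integral_form_sub_le (S.contDiff_l (f (a j))) (hle j)
      (z := fun t => e (z t)) (fun t ht => hasDerivAt_chart_curve hz.contMDiffAt (hsrc t ht))
      (continuousOn_chartVel (fun t _ => hz.contMDiffAt) hsrc) C
      (ε := ε / (2 * N)) (by positivity)
    have hclose : ∀ᶠ i in ℓ, ∀ t ∈ Icc (j / N : ℝ) ((j + 1 : ℕ) / N),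
        μ i t ∈ e.source ∧ dist (e (μ i t)) (e (z t)) < δ := by
      refine eventually_forall_Icc fun t ht => ?_
      have hl := hlim t (hsub j hj ht)
      have h1 : ContinuousAt e (z t) := (contMDiffAt_extChartAt_of_mem (hsrc t ht)).continuousAt
      refine Eventually.and (hl.eventually_mem ((isOpen_extChartAt_source (I := 𝓘(ℝ, E))
        (S.ctr (f (a j)))).mem_nhds (hsrc t ht))) ?_
      have h2 : Tendsto (fun p : ι × ℝ => e (z p.2)) (ℓ ×ˢ 𝓝 t) (𝓝 (e (z t))) :=
        (ContinuousAt.comp (f := z) h1 hz.continuous.continuousAt).tendsto.comp tendsto_snd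
      have h3 := (h1.tendsto.comp hl).dist h2
      rw [dist_self] at h3
      exact h3 (Iio_mem_nhds hδ)
    filter_upwards [hclose, hC, hμ, hσ] with i h1 h2 h3 h4
    rw [hpull _ h3 fun t ht => (h1 t ht).1, hpull _ (fun t _ => hz.contMDiffAt) hsrc]
    refine (hmain _ _ (σ i) (fun t ht => hasDerivAt_chart_curve (h3 t (hsub j hj ht)) (h1 t ht).1)
      (continuousOn_chartVel (fun t ht => h3 t (hsub j hj ht)) fun t ht => (h1 t ht).1)
      (fun t ht => (h1 t ht).2) h2 (h4.mono (hsub j hj)) fun t _ => hσ0 i t).trans ?_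
    refine mul_le_mul_of_nonneg_left (add_le_add le_rfl ?_) (by positivity)
    have h01 := hsub j hj
    have h5 := h01 (left_mem_Icc.2 (hle j))
    have h6 := h01 (right_mem_Icc.2 (hle j))
    refine intervalIntegral.integral_mono_interval h5.1 (hle j) h6.2
      (Eventually.of_forall fun t => hσ0 i t) (h4.intervalIntegrable_of_Icc zero_le_one)
  have hvert : ∀ j < N, ∀ᶠ i in ℓ, |Γ.Φ (a j) (a (j + 1)) (μ i ((j + 1 : ℕ) / N))
      - Γ.Φ (a j) (a (j + 1)) (z ((j + 1 : ℕ) / N))| ≤ ε / (2 * N) := by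
    intro j hj
    set t : ℝ := (j + 1 : ℕ) / N with ht
    have htI : t ∈ Icc (0 : ℝ) 1 := hsub j hj (right_mem_Icc.2 (hle j))
    have hr : Γ.R (c t) (a (j + 1)) := by
      rcases (Nat.succ_le_of_lt hj).lt_or_eq with h | h
      · exact ha (j + 1) h _ (left_mem_Icc.2 (hle _))
      · have h2 := ha 0 hN 0 (by simp)
        have h3 : t = 1 := by
          rw [ht, ← h]; exact div_self (by positivity)
        rw [h3, hc1, show j + 1 = N from h, haN]
        exact h2
    have h1 : ContinuousAt (Γ.Φ (a j) (a (j + 1))) (z t) :=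
      ((S.hasMFDerivAt _ _ (Γ.mem_V _ _ (ha j hj t (right_mem_Icc.2 (hle j)))) _
        (Γ.mem_V _ _ hr) _ (hzV t)).continuousAt.sub continuousAt_const)
    have h2 : Tendsto (fun i => μ i t) ℓ (𝓝 (z t)) :=
      (hlim t htI).comp (tendsto_id.prodMk (tendsto_const_pure.mono_right (pure_le_nhds t)))
    have h3 := (h1.tendsto.comp h2) (Metric.closedBall_mem_nhds _ (show 0 < ε / (2 * N) by positivity))
    exact h3
  have hall : ∀ᶠ i in ℓ, ∀ j ∈ Finset.range N, _ := (Finset.range N).eventually_all.2 fun j hj =>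
    (hseg j (Finset.mem_range.1 hj)).and (hvert j (Finset.mem_range.1 hj))
  filter_upwards [hall, hσ] with i hi hσi
  have hI : 0 ≤ ∫ t in (0 : ℝ)..1, σ i t :=
    intervalIntegral.integral_nonneg zero_le_one fun t _ => hσ0 i t
  rw [Gauge.hol, Gauge.hol, ← Finset.sum_sub_distrib]
  refine (Finset.abs_sum_le_sum_abs _ _).trans ?_
  refine (Finset.sum_le_sum (g := fun _ => ε / N * (1 + ∫ t in (0 : ℝ)..1, σ i t))
    fun j hj => ?_).trans (le_of_eq ?_)
  · obtain ⟨h1, h2⟩ := hi j hj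
    rw [sub_sub_sub_comm]
    refine ((abs_sub _ _).trans (add_le_add h1 h2)).trans ?_
    have h4 : ε / N = ε / (2 * N) + ε / (2 * N) := by field_simp; norm_num
    rw [h4]
    have h5 : 0 < ε / (2 * N) := by positivity
    nlinarith
  rw [Finset.sum_const, Finset.card_range, nsmul_eq_mul]
  field_simp

end Thin

end Pants

namespace Pants

set_option maxSynthPendingDepth 3
set_option linter.unusedSectionVars false

/-! ### Cylinder coordinates on the normalized region -/

/-- A cylinder coordinate on the region around `0`, with sign `s`. -/
structure NormCyl (s : ℝ) (χ : ℂ → ℂ) : Prop where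
  sign : s = 1 ∨ s = -1
  continuousOn : ContinuousOn χ {ζ | 0 ≤ s * ζ.re}
  holomorphic : DifferentiableOn ℂ χ {ζ | 0 < s * ζ.re}
  periodic : ∀ ζ, χ (ζ + Complex.I) = χ ζ
  injective : ∀ ζ ζ' : ℂ, 0 ≤ s * ζ.re → 0 ≤ s * ζ'.re → χ ζ = χ ζ' →
    ∃ n : ℤ, ζ' = ζ + n * Complex.I
  image : χ '' {ζ | 0 ≤ s * ζ.re} = endRegion 0

/-- One function, `max ‖z‖ (2 Re z)`, describes the lens-shaped region: below one it is the
interior, equal to one the boundary curve. -/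
theorem mem_endRegion_zero {z : ℂ} : z ∈ endRegion 0 ↔ z ≠ 0 ∧ max ‖z‖ (2 * z.re) ≤ 1 := by
  change z ≠ 0 ∧ ‖z‖ ≤ 1 ∧ z.re ≤ 1 / 2 ↔ _
  rw [max_le_iff]
  constructor
  · rintro ⟨h1, h2, h3⟩; exact ⟨h1, h2, by linarith⟩
  · rintro ⟨h1, h2, h3⟩; exact ⟨h1, h2, by linarith⟩

theorem isOpen_end (s T : ℝ) : IsOpen {ζ : ℂ | T < s * ζ.re} :=
  isOpen_lt continuous_const (continuous_const.mul Complex.continuous_re)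

theorem convex_end (s T : ℝ) : Convex ℝ {ζ : ℂ | T < s * ζ.re} := by
  have : {ζ : ℂ | T < s * ζ.re} = (fun ζ : ℂ => s * ζ.re) ⁻¹' Ioi T := rfl
  rw [this]
  exact (convex_Ioi T).is_linear_preimage
    ⟨fun x y => by simp [mul_add], fun c x => by simp; ring⟩

theorem periodic_int {χ : ℂ → ℂ} (h : ∀ ζ, χ (ζ + Complex.I) = χ ζ) (ζ : ℂ) (n : ℤ) :
    χ (ζ + n * Complex.I) = χ ζ :=
  (show Function.Periodic χ Complex.I from h).int_mul n ζ

namespace NormCyl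

variable {s : ℝ} {χ : ℂ → ℂ} (h : NormCyl s χ)
include h

theorem sq : s * s = 1 := by rcases h.sign with h | h <;> rw [h] <;> norm_num

theorem mem_region {ζ : ℂ} (hζ : 0 ≤ s * ζ.re) : χ ζ ∈ endRegion 0 :=
  h.image ▸ mem_image_of_mem _ hζ

theorem isOpen_image {V : Set ℂ} (hV : IsOpen V) (hVs : V ⊆ {ζ | 0 < s * ζ.re}) :
    IsOpen (χ '' V) := by
  have han : AnalyticOnNhd ℂ χ {ζ | 0 < s * ζ.re} := h.holomorphic.analyticOnNhd (isOpen_end s 0)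
  refine (han.is_constant_or_isOpen (convex_end s 0).isPreconnected).resolve_left ?_ V hVs hV
  rintro ⟨w, hw⟩
  have h1 : (0 : ℝ) < s * ((s : ℂ)).re := by rw [Complex.ofReal_re, h.sq]; norm_num
  have h2 : (0 : ℝ) < s * ((2 * s : ℝ) : ℂ).re := by
    rw [Complex.ofReal_re]; linarith [h.sq]
  obtain ⟨n, hn⟩ := h.injective s ((2 * s : ℝ) : ℂ) h1.le h2.le
    ((hw _ h1).trans (hw _ h2).symm)
  have h3 := congrArg Complex.re hn
  simp at h3
  have h4 := h.sq
  have h5 : s = 0 := by linarith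
  rw [h5] at h4
  norm_num at h4

theorem gauge_lt {ζ : ℂ} (hζ : 0 < s * ζ.re) : max ‖χ ζ‖ (2 * (χ ζ).re) < 1 := by
  have ho := h.isOpen_image (isOpen_end s 0) subset_rfl
  have hsub : χ '' {ζ | 0 < s * ζ.re} ⊆ Metric.closedBall 0 1 ∩ {z | z.re ≤ 1 / 2} := by
    rintro _ ⟨ζ, hζ, rfl⟩
    obtain ⟨-, h2, h3⟩ := h.mem_region (le_of_lt hζ)
    exact ⟨by simpa using h2, h3⟩
  have h1 := interior_maximal hsub ho (mem_image_of_mem χ hζ)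
  rw [interior_inter, interior_closedBall _ one_ne_zero, Complex.interior_setOfPred_re_le] at h1
  obtain ⟨h2, h3⟩ := h1
  have h3 : (χ ζ).re < 1 / 2 := h3
  exact max_lt (by simpa using h2) (by linarith)

theorem exists_of_gauge_eq_one {z : ℂ} (hz : max ‖z‖ (2 * z.re) = 1) (t₀ : ℝ) :
    ∃ t ∈ Ico t₀ (t₀ + 1), χ (t * Complex.I) = z := by
  have hz0 : z ≠ 0 := by rintro rfl; simp at hz
  have h1 : z ∈ endRegion 0 := mem_endRegion_zero.2 ⟨hz0, hz.le⟩
  rw [← h.image] at h1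
  obtain ⟨ζ, hζ, rfl⟩ := h1
  have hre : ζ.re = 0 := by
    by_contra hne
    have : 0 < s * ζ.re := lt_of_le_of_ne hζ (by
      rcases h.sign with h | h <;> rw [h] <;> simpa [eq_comm] using hne)
    exact (h.gauge_lt this).ne hz
  obtain ⟨n, hn, -⟩ := existsUnique_add_zsmul_mem_Ico one_pos ζ.im t₀
  refine ⟨_, hn, ?_⟩
  rw [← periodic_int h.periodic ζ n]
  congr 1
  apply Complex.ext <;> simp [hre]

theorem injOn_boundary {t t' t₀ : ℝ} (ht : t ∈ Ico t₀ (t₀ + 1)) (ht' : t' ∈ Ico t₀ (t₀ + 1))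
    (heq : χ (t * Complex.I) = χ (t' * Complex.I)) : t = t' := by
  obtain ⟨n, hn⟩ := h.injective _ _ (by simp) (by simp) heq
  have h1 := congrArg Complex.im hn
  simp at h1
  have h2 : (n : ℝ) < 1 := by linarith [ht.1, ht'.2]
  have h3 : (-1 : ℝ) < n := by linarith [ht.2, ht'.1]
  have h4 : n = 0 := by
    have : n < 1 := by exact_mod_cast h2
    have : -1 < n := by exact_mod_cast h3
    omega
  rw [h1, h4]; simp

/-- The boundary circle of the cylinder is mapped to the boundary of the region: otherwise the
boundary of the region would embed in an interval. -/
theorem gauge_eq_one {ζ : ℂ} (hζ : ζ.re = 0) : max ‖χ ζ‖ (2 * (χ ζ).re) = 1 := by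
  have hζ' : ζ = ζ.im * Complex.I := by apply Complex.ext <;> simp [hζ]
  set t₀ := ζ.im with ht₀
  have hle := (mem_endRegion_zero.1 (h.mem_region (ζ := ζ) (by simp [hζ]))).2
  by_contra hne
  let g : ℂ → ℝ := fun z => max ‖z‖ (2 * z.re)
  have hg : Continuous g := continuous_norm.max (continuous_const.mul Complex.continuous_re)
  have hχc : Continuous fun t : ℝ => χ (t * Complex.I) := by
    refine continuous_iff_continuousAt.2 fun t => ?_
    have h1 : ContinuousOn (fun t : ℝ => χ (t * Complex.I)) univ :=
      h.continuousOn.comp (by fun_prop) (fun t _ => by simp)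
    exact h1.continuousAt univ_mem
  -- The times at which the boundary circle hits the boundary curve. If `ζ` misses the curve, the
  -- circle may be cut at `ζ`, so `χ` is injective on the compact set `A` in a line, which
  -- nevertheless covers the whole curve.
  let A : Set ℝ := Icc t₀ (t₀ + 1) ∩ {t | g (χ (t * Complex.I)) = 1}
  have hA : IsCompact A := isCompact_Icc.inter_right (isClosed_eq (hg.comp hχc) continuous_const)
  have hA' : ∀ t ∈ A, t ∈ Ico t₀ (t₀ + 1) := by
    rintro t ⟨ht, ht1⟩
    refine ⟨ht.1, lt_of_le_of_ne ht.2 fun he => hne ?_⟩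
    have h2 : χ (t * Complex.I) = χ ζ := by
      rw [he, hζ', ← h.periodic (t₀ * Complex.I)]
      congr 1
      push_cast
      ring
    rw [← h2]
    exact ht1
  have : CompactSpace A := isCompact_iff_compactSpace.1 hA
  let F : A → ℂ := fun t => χ ((t : ℝ) * Complex.I)
  have hF : Topology.IsClosedEmbedding F :=
    (hχc.comp continuous_subtype_val).isClosedEmbedding fun t t' heq =>
      Subtype.ext (h.injOn_boundary (hA' _ t.2) (hA' _ t'.2) heq)
  -- The boundary curve is star-shaped about the origin; `σ` is its parametrization by angle.
  let r : ℝ → ℝ := fun θ => max 1 (2 * Real.cos θ)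
  have hr : ∀ θ, 0 < r θ := fun θ => lt_max_of_lt_left one_pos
  let σ : ℝ → ℂ := fun θ => ((r θ)⁻¹ : ℝ) * Complex.exp (θ * Complex.I)
  have hσc : Continuous σ := by
    refine (Complex.continuous_ofReal.comp (Continuous.inv₀ ?_ fun θ => (hr θ).ne')).mul
      (by fun_prop)
    exact continuous_const.max (by fun_prop)
  have hσ1 : ∀ θ, g (σ θ) = 1 := by
    intro θ
    have e1 : ‖σ θ‖ = (r θ)⁻¹ := by
      rw [norm_mul, Complex.norm_exp_ofReal_mul_I, mul_one, Complex.norm_real, Real.norm_eq_abs,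
        abs_of_pos (inv_pos.2 (hr θ))]
    have e2 : (σ θ).re = (r θ)⁻¹ * Real.cos θ := by
      rw [Complex.re_ofReal_mul, Complex.exp_ofReal_mul_I_re]
    simp only [g, e1, e2]
    rw [show 2 * ((r θ)⁻¹ * Real.cos θ) = (r θ)⁻¹ * (2 * Real.cos θ) by ring]
    nth_rewrite 1 [← mul_one (r θ)⁻¹]
    rw [← mul_max_of_nonneg _ _ (inv_pos.2 (hr θ)).le]
    exact inv_mul_cancel₀ (hr θ).ne'
  have hex : ∀ θ, ∃ t : A, F t = σ θ := fun θ => by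
    obtain ⟨t, ht, he⟩ := h.exists_of_gauge_eq_one (hσ1 θ) t₀
    exact ⟨⟨t, Ico_subset_Icc_self ht, by change g _ = 1; rw [he]; exact hσ1 θ⟩, he⟩
  choose T hT using hex
  have hTc : Continuous T := hF.isEmbedding.continuous_iff.2 (by
    rw [show F ∘ T = σ from funext hT]; exact hσc)
  have hT2 : ∀ θ, T (θ + 2 * Real.pi) = T θ := fun θ => by
    apply hF.injective
    rw [hT, hT]
    simp only [σ, r, Real.cos_add_two_pi]
    congr 1
    push_cast
    rw [add_mul, Complex.exp_periodic]
  -- The Borsuk–Ulam argument in dimension one: a continuous `2π`-periodic real function takes equal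
  -- values at two opposite angles, whereas `σ` separates opposite angles.
  let φ : ℝ → ℝ := fun θ => T (θ + Real.pi) - T θ
  have hφc : Continuous φ := by
    have := continuous_subtype_val.comp hTc
    exact (this.comp (continuous_id.add continuous_const)).sub this
  have hφ : φ Real.pi = - φ 0 := by
    simp only [φ, zero_add]
    rw [← two_mul, ← zero_add (2 * Real.pi), hT2]
    ring
  obtain ⟨θ, hθ⟩ : ∃ θ, φ θ = 0 := by
    rcases le_total (φ 0) 0 with h0 | h0
    · exact mem_range_of_exists_le_of_exists_ge hφc ⟨0, h0⟩ ⟨Real.pi, by rw [hφ]; linarith⟩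
    · exact mem_range_of_exists_le_of_exists_ge hφc ⟨Real.pi, by rw [hφ]; linarith⟩ ⟨0, h0⟩
  have hTT : T (θ + Real.pi) = T θ := Subtype.ext (sub_eq_zero.1 hθ)
  have hσσ : σ (θ + Real.pi) = σ θ := by rw [← hT, hTT, hT]
  have e3 : σ (θ + Real.pi) = -(((r (θ + Real.pi))⁻¹ : ℝ) * Complex.exp (θ * Complex.I)) := by
    simp only [σ]
    push_cast
    rw [add_mul, Complex.exp_add, Complex.exp_pi_mul_I]
    ring
  rw [e3] at hσσ
  have e4 : ((((r (θ + Real.pi))⁻¹ + (r θ)⁻¹ : ℝ)) : ℂ) * Complex.exp (θ * Complex.I) = 0 := by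
    have : σ θ = (((r θ)⁻¹ : ℝ) : ℂ) * Complex.exp (θ * Complex.I) := rfl
    rw [this] at hσσ
    push_cast at hσσ ⊢
    linear_combination -hσσ
  have e5 := (mul_eq_zero.1 e4).resolve_right (Complex.exp_ne_zero _)
  have e6 : 0 < (r (θ + Real.pi))⁻¹ + (r θ)⁻¹ := add_pos (inv_pos.2 (hr _)) (inv_pos.2 (hr _))
  exact e6.ne' (Complex.ofReal_eq_zero.1 e5)

/-- The end of the cylinder converges to the puncture. -/
theorem tendsto_zero : Tendsto χ (comap (fun ζ : ℂ => s * ζ.re) atTop) (𝓝 0) := by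
  -- A rotation turns the half cylinder into the upper half plane with period one, where boundedness
  -- makes the function extend holomorphically over the cusp.
  let f : ℂ → ℂ := fun z => χ (-(s * Complex.I) * z)
  have hfre : ∀ z : ℂ, s * (-(s * Complex.I) * z).re = z.im := fun z => by
    simp
    rw [← mul_assoc, h.sq, one_mul]
  have hper : Function.Periodic f (1 : ℝ) := by
    intro z
    simp only [f]
    rcases h.sign with hs | hs
    · rw [← h.periodic, hs]; congr 1; push_cast; ring
    · rw [← h.periodic (-(s * Complex.I) * z), hs]; congr 1; push_cast; ring
  have hpos : ∀ A : ℝ, ∀ᶠ z in comap Complex.im atTop, A < z.im := fun A =>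
    tendsto_comap.eventually (eventually_gt_atTop A)
  have hfreg : ∀ z : ℂ, 0 < z.im → f z ∈ endRegion 0 := fun z hz =>
    h.mem_region (by rw [hfre]; exact hz.le)
  have hhol : ∀ᶠ z in comap Complex.im atTop, DifferentiableAt ℂ f z := by
    filter_upwards [hpos 0] with z hz
    have h1 : DifferentiableAt ℂ χ (-(s * Complex.I) * z) :=
      h.holomorphic.differentiableAt ((isOpen_end s 0).mem_nhds (by
        change 0 < s * _; rw [hfre]; exact hz))
    exact h1.comp z (by fun_prop)
  have hbd : BoundedAtFilter (comap Complex.im atTop) f := by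
    refine Asymptotics.IsBigO.of_bound 1 ?_
    filter_upwards [hpos 0] with z hz
    simpa using (hfreg z hz).2.1
  set F := Function.Periodic.cuspFunction 1 f with hF
  have hlim : Tendsto f (comap Complex.im atTop) (𝓝 (F 0)) :=
    Function.Periodic.tendsto_at_I_inf one_pos hper hhol hbd
  have hne : (comap Complex.im atTop).NeBot := by
    refine comap_neBot fun t ht => ?_
    obtain ⟨x, hx⟩ := Filter.nonempty_of_mem ht
    exact ⟨⟨0, x⟩, hx⟩
  have hinj : ∀ z z' : ℂ, 0 < z.im → 0 < z'.im → f z = f z' → z.im = z'.im := by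
    intro z z' hz hz' he
    obtain ⟨n, hn⟩ := h.injective _ _ (by rw [hfre]; exact hz.le) (by rw [hfre]; exact hz'.le) he
    have := congrArg (fun ζ : ℂ => s * ζ.re) hn
    simp only [Complex.add_re] at this
    rw [hfre, mul_add, hfre] at this
    simpa using this.symm
  -- A nonzero limit would lie in the region and be a value `χ ζ₀` at finite depth. Either the cusp
  -- function is constant near the cusp, against injectivity, or it is open there, so that points
  -- near `χ ζ₀` are also attained at arbitrarily large depth, again against injectivity.
  have hF0 : F 0 = 0 := by
    by_contra hL
    have hmem : F 0 ∈ endRegion 0 := by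
      have hcl : IsClosed {z : ℂ | max ‖z‖ (2 * z.re) ≤ 1} := isClosed_le
        (continuous_norm.max (continuous_const.mul Complex.continuous_re)) continuous_const
      exact mem_endRegion_zero.2 ⟨hL, hcl.mem_of_tendsto hlim ((hpos 0).mono fun z hz =>
        (mem_endRegion_zero.1 (hfreg z hz)).2)⟩
    rw [← h.image] at hmem
    obtain ⟨ζ₀, hζ₀, hχ⟩ := hmem
    have han : AnalyticAt ℂ F 0 := by
      rw [Complex.analyticAt_iff_eventually_differentiableAt]
      have h1 := Function.Periodic.eventually_differentiableAt_cuspFunction_nhds_ne_zero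
        one_pos hper hhol
      rw [eventually_nhdsWithin_iff] at h1
      filter_upwards [h1] with q hq
      by_cases hq0 : q = 0
      · rw [hq0]
        exact Function.Periodic.differentiableAt_cuspFunction_zero one_pos hper hhol hbd
      · exact hq hq0
    rcases han.eventually_constant_or_nhds_le_map_nhds with hc | ho
    · have h1 := ((Function.Periodic.qParam_tendsto one_pos).mono_right
        nhdsWithin_le_nhds).eventually hc
      obtain ⟨b, hb⟩ := (eventually_atTop.1 (eventually_comap.1 h1))
      have h2 : ∀ z : ℂ, b ≤ z.im → f z = F 0 := fun z hz => by
        rw [← Function.Periodic.eq_cuspFunction one_ne_zero hper]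
        exact hb _ hz z rfl
      have h3 := hinj ⟨0, max b 1⟩ ⟨0, max b 1 + 1⟩ (lt_max_of_lt_right one_pos)
        (add_pos (lt_max_of_lt_right one_pos) one_pos) ((h2 _ (le_max_left _ _)).trans
          (h2 _ (show b ≤ max b 1 + 1 by linarith [le_max_left b 1])).symm)
      simp at h3
    · set A := s * ζ₀.re + 1 with hA
      have h1 : {w | w = F 0 ∨ ∃ z : ℂ, A < z.im ∧ f z = w} ∈ 𝓝 (F 0) := by
        refine ho ?_
        have h2 := (Function.Periodic.invQParam_tendsto (h := 1) one_pos).eventually (hpos A)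
        rw [eventually_nhdsWithin_iff] at h2
        rw [mem_map]
        filter_upwards [h2] with q hq
        by_cases hq0 : q = 0
        · exact Or.inl (by rw [hq0])
        · exact Or.inr ⟨_, hq hq0, (Function.Periodic.cuspFunction_eq_of_nonzero 1 f hq0).symm⟩
      -- The point `ζ₀` is moved slightly deeper into the cylinder, where the value of `χ` cannot be
      -- `F 0` itself.
      have h3 : Tendsto (fun δ : ℝ => ζ₀ + ((s * δ : ℝ) : ℂ)) (𝓝[>] 0)
          (𝓝[{ζ | 0 ≤ s * ζ.re}] ζ₀) := by
        refine tendsto_nhdsWithin_iff.2 ⟨?_, ?_⟩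
        · have : Continuous fun δ : ℝ => ζ₀ + ((s * δ : ℝ) : ℂ) := by fun_prop
          have h4 := this.tendsto 0
          simp only [mul_zero, Complex.ofReal_zero, add_zero] at h4
          exact h4.mono_left nhdsWithin_le_nhds
        · filter_upwards [self_mem_nhdsWithin] with δ hδ
          have hδ : 0 < δ := hδ
          have hζ₀ : 0 ≤ s * ζ₀.re := hζ₀
          change 0 ≤ s * (ζ₀ + ((s * δ : ℝ) : ℂ)).re
          rw [Complex.add_re, Complex.ofReal_re, mul_add]
          rw [← mul_assoc, h.sq]
          linarith
      have h4 := (h.continuousOn ζ₀ hζ₀).tendsto.comp h3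
      rw [hχ] at h4
      obtain ⟨δ, hδ, hδ0, hδ1⟩ := ((h4.eventually h1).and (Ioo_mem_nhdsGT one_pos)).exists
      have h5 : s * (ζ₀ + ((s * δ : ℝ) : ℂ)).re = s * ζ₀.re + δ := by
        simp only [Complex.add_re, Complex.ofReal_re, mul_add]
        rw [← mul_assoc, h.sq, one_mul]
      have hζ₀ : 0 ≤ s * ζ₀.re := hζ₀
      have hre : ∀ ζ ζ' : ℂ, 0 ≤ s * ζ.re → 0 ≤ s * ζ'.re → χ ζ = χ ζ' →
          s * ζ.re = s * ζ'.re := by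
        intro ζ ζ' h6 h7 h8
        obtain ⟨n, hn⟩ := h.injective _ _ h6 h7 h8
        rw [hn]; simp
      rcases hδ with hδ | ⟨z, hz, hδ⟩
      · have := hre _ _ (by rw [h5]; linarith) hζ₀ (hδ.trans hχ.symm)
        linarith
      · have := hre _ _ (by rw [hfre]; linarith) (by rw [h5]; linarith) hδ
        rw [hfre, h5] at this
        linarith
  rw [hF0] at hlim
  have hχf : χ = fun ζ => f (s * Complex.I * ζ) := by
    ext ζ
    simp only [f]
    congr 1
    have : (s : ℂ) * s = 1 := by exact_mod_cast h.sq
    linear_combination (-ζ) * this + (s * s * ζ) * Complex.I_mul_I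
  rw [hχf]
  refine hlim.comp (tendsto_comap_iff.2 ?_)
  have : Complex.im ∘ (fun ζ : ℂ => s * Complex.I * ζ) = fun ζ : ℂ => s * ζ.re := by
    ext ζ; simp
  rw [this]
  exact tendsto_comap

end NormCyl

end Pants

namespace Pants

set_option maxSynthPendingDepth 3
set_option linter.unusedSectionVars false

/-! ### The three cylinder coordinates of the pair of pants -/

/-- Möbius transformations mapping the three regions to the one around `0`. -/
def mob : Fin 3 → ℂ → ℂ := ![fun z => z, fun z => 1 - z, fun z => z⁻¹]

/-- A function that is less than one in the interior of the `i`-th region and one on its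
boundary. -/
def regionGauge (i : Fin 3) (z : ℂ) : ℝ := max ‖mob i z‖ (2 * (mob i z).re)

theorem regionGauge_zero_lt {z : ℂ} : regionGauge 0 z < 1 ↔ ‖z‖ < 1 ∧ z.re < 1 / 2 := by
  change max ‖z‖ (2 * z.re) < 1 ↔ _
  rw [max_lt_iff]
  exact and_congr_right fun _ => ⟨fun h => by linarith, fun h => by linarith⟩

theorem regionGauge_one_lt {z : ℂ} : regionGauge 1 z < 1 ↔ ‖z - 1‖ < 1 ∧ 1 / 2 < z.re := by
  change max ‖1 - z‖ (2 * (1 - z).re) < 1 ↔ _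
  rw [max_lt_iff, norm_sub_rev]
  simp only [Complex.sub_re, Complex.one_re]
  exact and_congr_right fun _ => ⟨fun h => by linarith, fun h => by linarith⟩

/-- Inversion carries the half plane `Re ≤ 1/2`, apart from the origin, to the outside of the circle
`‖z - 1‖ = 1`; this identifies the region around infinity with the one around zero. -/
theorem two_mul_inv_re_le {z : ℂ} (hz : z ≠ 0) : 2 * (z⁻¹).re ≤ 1 ↔ 1 ≤ ‖z - 1‖ := by
  have h1 : 0 < Complex.normSq z := Complex.normSq_pos.2 hz
  rw [Complex.inv_re, ← mul_div_assoc, div_le_one h1, ← one_le_sq_iff₀ (norm_nonneg _),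
    ← Complex.normSq_eq_norm_sq, Complex.normSq_apply, Complex.normSq_apply]
  simp only [Complex.sub_re, Complex.one_re, Complex.sub_im, Complex.one_im]
  constructor <;> intro h <;> nlinarith

theorem two_mul_inv_re_lt {z : ℂ} (hz : z ≠ 0) : 2 * (z⁻¹).re < 1 ↔ 1 < ‖z - 1‖ := by
  have h1 : 0 < Complex.normSq z := Complex.normSq_pos.2 hz
  rw [Complex.inv_re, ← mul_div_assoc, div_lt_one h1, ← one_lt_sq_iff₀ (norm_nonneg _),
    ← Complex.normSq_eq_norm_sq, Complex.normSq_apply, Complex.normSq_apply]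
  simp only [Complex.sub_re, Complex.one_re, Complex.sub_im, Complex.one_im]
  constructor <;> intro h <;> nlinarith

theorem regionGauge_two_lt {z : ℂ} (hz : z ≠ 0) :
    regionGauge 2 z < 1 ↔ 1 < ‖z‖ ∧ 1 < ‖z - 1‖ := by
  change max ‖z⁻¹‖ (2 * (z⁻¹).re) < 1 ↔ _
  rw [max_lt_iff, two_mul_inv_re_lt hz, norm_inv, inv_lt_one₀ (norm_pos_iff.2 hz)]

theorem endRegion_subset_surface (i : Fin 3) : endRegion i ⊆ surface := by
  fin_cases i
  · rintro z ⟨h1, h2, h3⟩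
    exact ⟨h1, by rintro rfl; norm_num at h3⟩
  · rintro z ⟨h1, h2, h3⟩
    exact ⟨by rintro rfl; norm_num at h3, h1⟩
  · rintro z ⟨h1, h2⟩
    exact ⟨by rintro rfl; norm_num at h1, by rintro rfl; norm_num at h2⟩

theorem surface_subset : surface ⊆ ⋃ i, endRegion i := by
  rintro z ⟨h0, h1⟩
  rw [mem_iUnion]
  rcases le_total z.re (1 / 2) with h | h
  · rcases le_total ‖z‖ 1 with h2 | h2
    · exact ⟨0, h0, h2, h⟩
    · refine ⟨2, h2, h2.trans ?_⟩
      rw [← sq_le_sq₀ (norm_nonneg _) (norm_nonneg _), ← Complex.normSq_eq_norm_sq,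
        ← Complex.normSq_eq_norm_sq, Complex.normSq_apply, Complex.normSq_apply]
      simp only [Complex.sub_re, Complex.one_re, Complex.sub_im, Complex.one_im]
      nlinarith
  · rcases le_total ‖z - 1‖ 1 with h2 | h2
    · exact ⟨1, h1, h2, h⟩
    · refine ⟨2, h2.trans ?_, h2⟩
      rw [← sq_le_sq₀ (norm_nonneg _) (norm_nonneg _), ← Complex.normSq_eq_norm_sq,
        ← Complex.normSq_eq_norm_sq, Complex.normSq_apply, Complex.normSq_apply]
      simp only [Complex.sub_re, Complex.one_re, Complex.sub_im, Complex.one_im]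
      nlinarith

/-- The puncture at the `i`-th end. -/
def puncture : Fin 3 → OnePoint ℂ := ![((0 : ℂ) : OnePoint ℂ), ((1 : ℂ) : OnePoint ℂ), OnePoint.infty]

theorem puncture_notMem (i : Fin 3) {z : ℂ} (hz : z ∈ surface) : (z : OnePoint ℂ) ≠ puncture i := by
  fin_cases i
  · exact fun h => hz.1 (OnePoint.coe_injective h)
  · exact fun h => hz.2 (OnePoint.coe_injective h)
  · exact OnePoint.coe_ne_infty z

theorem endRegion_closed (i : Fin 3) : ∃ F, IsClosed F ∧ endRegion i = surface ∩ F := by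
  have hn : Continuous fun z : ℂ => ‖z - 1‖ := by fun_prop
  fin_cases i
  · refine ⟨{z | ‖z‖ ≤ 1 ∧ z.re ≤ 1 / 2}, (isClosed_le continuous_norm continuous_const).inter
      (isClosed_le Complex.continuous_re continuous_const), ?_⟩
    ext z
    exact ⟨fun h => ⟨endRegion_subset_surface 0 h, h.2⟩, fun h => ⟨h.1.1, h.2⟩⟩
  · refine ⟨{z | ‖z - 1‖ ≤ 1 ∧ 1 / 2 ≤ z.re}, (isClosed_le hn continuous_const).inter
      (isClosed_le continuous_const Complex.continuous_re), ?_⟩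
    ext z
    exact ⟨fun h => ⟨endRegion_subset_surface 1 h, h.2⟩, fun h => ⟨h.1.2, h.2⟩⟩
  · refine ⟨{z | 1 ≤ ‖z‖ ∧ 1 ≤ ‖z - 1‖}, (isClosed_le continuous_const continuous_norm).inter
      (isClosed_le continuous_const hn), ?_⟩
    ext z
    exact ⟨fun h => ⟨endRegion_subset_surface 2 h, h⟩, fun h => h.2⟩

theorem isOpen_surface : IsOpen surface :=
  (isOpen_ne (x := (0 : ℂ))).inter (isOpen_ne (x := (1 : ℂ)))

theorem sgn_eq (i : Fin 3) : sgn i = 1 ∨ sgn i = -1 := by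
  fin_cases i <;> simp [sgn]

/-- The filter of neighbourhoods of the `i`-th end of a half cylinder. -/
def endFilter (i : Fin 3) : Filter ℂ := comap (fun ζ : ℂ => sgn i * ζ.re) atTop

namespace IsCylinderCoordinate

variable {i : Fin 3} {ψ : ℂ → ℂ} (hψ : IsCylinderCoordinate i ψ)
include hψ

theorem mem_endRegion {ζ : ℂ} (hζ : 0 ≤ sgn i * ζ.re) : ψ ζ ∈ endRegion i :=
  hψ.image ▸ mem_image_of_mem _ hζ

theorem mem_surface {ζ : ℂ} (hζ : 0 ≤ sgn i * ζ.re) : ψ ζ ∈ surface :=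
  endRegion_subset_surface i (hψ.mem_endRegion hζ)

theorem periodic_int (ζ : ℂ) (n : ℤ) : ψ (ζ + n * Complex.I) = ψ ζ :=
  Pants.periodic_int hψ.periodic ζ n

/-- The maps `mob i` are involutions that exchange the `i`-th region with the one around zero, so
boundary behaviour and limits at the punctures have to be studied only once. -/
theorem normCyl : NormCyl (sgn i) (fun ζ => mob i (ψ ζ)) := by
  have hper : ∀ ζ, mob i (ψ (ζ + Complex.I)) = mob i (ψ ζ) := fun ζ => by rw [hψ.periodic]
  have hminj : Function.Injective (mob i) := by
    fin_cases i
    · exact fun a b h => h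
    · exact fun a b h => sub_right_injective h
    · exact inv_injective
  have hinj : ∀ ζ ζ' : ℂ, 0 ≤ sgn i * ζ.re → 0 ≤ sgn i * ζ'.re → mob i (ψ ζ) = mob i (ψ ζ') →
      ∃ n : ℤ, ζ' = ζ + n * Complex.I := fun ζ ζ' h h' he => hψ.injective ζ ζ' h h' (hminj he)
  have himg : mob i '' endRegion i = endRegion 0 := by
    have hinv : ∀ z, mob i (mob i z) = z := by
      intro z
      fin_cases i
      · rfl
      · exact sub_sub_cancel 1 z
      · exact inv_inv z
    have h1 : ∀ z, mob i z ∈ endRegion 0 ↔ z ∈ endRegion i := by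
      intro z
      fin_cases i
      · rfl
      · change (1 - z ≠ 0 ∧ ‖1 - z‖ ≤ 1 ∧ (1 - z).re ≤ 1 / 2) ↔
          (z ≠ 1 ∧ ‖z - 1‖ ≤ 1 ∧ 1 / 2 ≤ z.re)
        rw [sub_ne_zero, norm_sub_rev, ne_comm]
        simp only [Complex.sub_re, Complex.one_re]
        exact and_congr_right fun _ => and_congr_right fun _ =>
          ⟨fun h => by linarith, fun h => by linarith⟩
      · change (z⁻¹ ≠ 0 ∧ ‖z⁻¹‖ ≤ 1 ∧ (z⁻¹).re ≤ 1 / 2) ↔ (1 ≤ ‖z‖ ∧ 1 ≤ ‖z - 1‖)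
        by_cases hz : z = 0
        · simp [hz]
        · rw [← two_mul_inv_re_le hz, norm_inv, inv_le_one₀ (norm_pos_iff.2 hz)]
          exact ⟨fun h => ⟨h.2.1, by linarith [h.2.2]⟩,
            fun h => ⟨inv_ne_zero hz, h.1, by linarith [h.2]⟩⟩
    ext w
    constructor
    · rintro ⟨z, hz, rfl⟩
      exact (h1 z).2 hz
    · intro hw
      refine ⟨mob i w, (h1 _).1 ?_, hinv w⟩
      rwa [hinv]
  have hne : ∀ ζ, 0 ≤ sgn i * ζ.re → ψ ζ ≠ 0 := fun ζ hζ => (hψ.mem_surface hζ).1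
  refine ⟨sgn_eq i, ?_, ?_, hper, hinj, ?_⟩
  · have := hψ.continuousOn
    fin_cases i
    · exact this
    · exact continuousOn_const.sub this
    · exact this.inv₀ fun ζ hζ => hne ζ hζ
  · have := hψ.holomorphic
    fin_cases i
    · exact this
    · exact (differentiableOn_const _).sub this
    · exact this.inv fun ζ hζ => hne ζ (le_of_lt hζ)
  · rw [← himg, ← hψ.image, image_image]

theorem regionGauge_lt {ζ : ℂ} (hζ : 0 < sgn i * ζ.re) : regionGauge i (ψ ζ) < 1 :=
  hψ.normCyl.gauge_lt hζ

theorem regionGauge_eq {ζ : ℂ} (hζ : ζ.re = 0) : regionGauge i (ψ ζ) = 1 :=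
  hψ.normCyl.gauge_eq_one hζ

theorem tendsto_puncture : Tendsto (fun ζ => (ψ ζ : OnePoint ℂ)) (endFilter i) (𝓝 (puncture i)) := by
  have h1 := hψ.normCyl.tendsto_zero
  have h2 : ∀ᶠ ζ in endFilter i, ψ ζ ≠ 0 := by
    filter_upwards [tendsto_comap.eventually (eventually_ge_atTop (0 : ℝ))] with ζ hζ
    exact (hψ.mem_surface hζ).1
  unfold endFilter at *
  fin_cases i
  · exact (OnePoint.continuous_coe.tendsto 0).comp h1
  · have h3 : Tendsto ψ (comap (fun ζ : ℂ => sgn 1 * ζ.re) atTop) (𝓝 1) := by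
      have h4 := h1.const_sub (1 : ℂ)
      rw [sub_zero] at h4
      exact h4.congr fun ζ => sub_sub_cancel 1 (ψ ζ)
    exact (OnePoint.continuous_coe.tendsto (1 : ℂ)).comp h3
  · have h3 : Tendsto ψ (comap (fun ζ : ℂ => sgn 2 * ζ.re) atTop) (coclosedCompact ℂ) := by
      rw [coclosedCompact_eq_cocompact, ← Metric.cobounded_eq_cocompact]
      have h4 : Tendsto (fun ζ => (ψ ζ)⁻¹) (comap (fun ζ : ℂ => sgn 2 * ζ.re) atTop) (𝓝[≠] 0) :=
        tendsto_nhdsWithin_iff.2 ⟨h1, h2.mono fun ζ hζ => inv_ne_zero hζ⟩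
      exact (tendsto_inv₀_nhdsNE_zero.comp h4).congr fun ζ => inv_inv (ψ ζ)
    exact OnePoint.tendsto_coe_infty.comp h3

theorem exists_notMem_of_isCompact {K : Set ℂ} (hK : IsCompact K) (hKs : K ⊆ surface) :
    ∃ T : ℝ, 0 ≤ T ∧ ∀ ζ : ℂ, T ≤ sgn i * ζ.re → ψ ζ ∉ K := by
  have h1 : ((↑) '' K : Set (OnePoint ℂ))ᶜ ∈ 𝓝 (puncture i) := by
    refine (hK.image OnePoint.continuous_coe).isClosed.isOpen_compl.mem_nhds ?_
    rintro ⟨z, hz, he⟩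
    exact puncture_notMem i (hKs hz) he
  have h2 := hψ.tendsto_puncture.eventually h1
  obtain ⟨b, hb⟩ := eventually_atTop.1 (eventually_comap.1 h2)
  refine ⟨max b 0, le_max_right _ _, fun ζ hζ hm => ?_⟩
  exact hb _ ((le_max_left _ _).trans hζ) ζ rfl (mem_image_of_mem _ hm)

theorem image_pos : ψ '' {ζ | 0 < sgn i * ζ.re} = {z ∈ endRegion i | regionGauge i z < 1} := by
  ext z
  constructor
  · rintro ⟨ζ, hζ, rfl⟩
    exact ⟨hψ.mem_endRegion (le_of_lt hζ), hψ.regionGauge_lt hζ⟩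
  · rintro ⟨hz, hz1⟩
    rw [← hψ.image] at hz
    obtain ⟨ζ, hζ, rfl⟩ := hz
    refine ⟨ζ, show 0 < sgn i * ζ.re from lt_of_le_of_ne hζ fun he => ?_, rfl⟩
    have : ζ.re = 0 := by
      rcases sgn_eq i with h | h <;> rw [h] at he <;> linarith
    exact hz1.ne (hψ.regionGauge_eq this)

end IsCylinderCoordinate

/-- Different regions meet only along their boundary curves. -/
theorem one_le_regionGauge {i j : Fin 3} (hij : i ≠ j) {z : ℂ} (hz : z ∈ endRegion j) :
    1 ≤ regionGauge i z := by
  by_contra! h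
  have hs := endRegion_subset_surface j hz
  fin_cases i
  · have h := regionGauge_zero_lt.1 h
    fin_cases j
    · exact hij rfl
    · have := hz.2.2; linarith [h.2]
    · have := hz.1; linarith [h.1]
  · have h := regionGauge_one_lt.1 h
    fin_cases j
    · have := hz.2.2; linarith [h.2]
    · exact hij rfl
    · have := hz.2; linarith [h.1]
  · have h := (regionGauge_two_lt hs.1).1 h
    fin_cases j
    · have := hz.2.1; linarith [h.1]
    · have := hz.2.1; linarith [h.2]
    · exact hij rfl

section Triple

variable {ψ : Fin 3 → ℂ → ℂ} (hψ : ∀ i, IsCylinderCoordinate i (ψ i))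
include hψ

theorem re_eq_zero_of_eq {i j : Fin 3} (hij : i ≠ j) {ζ ζ' : ℂ} (hζ : 0 ≤ sgn i * ζ.re)
    (hζ' : 0 ≤ sgn j * ζ'.re) (h : ψ i ζ = ψ j ζ') : ζ.re = 0 := by
  by_contra hne
  have h1 : 0 < sgn i * ζ.re := lt_of_le_of_ne hζ (by
    rcases sgn_eq i with h | h <;> rw [h] <;> simpa [eq_comm] using hne)
  have h2 := one_le_regionGauge hij ((hψ j).mem_endRegion hζ')
  rw [← h] at h2
  exact absurd ((hψ i).regionGauge_lt h1) (not_lt.2 h2)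

theorem image_cyl (i : Fin 3) : ψ i '' cyl i = {z ∈ endRegion i | regionGauge i z < 1} := by
  rw [← (hψ i).image_pos]
  refine Subset.antisymm (image_mono fun ζ hζ => hζ.1) ?_
  rintro _ ⟨ζ, hζ, rfl⟩
  obtain ⟨n, hn, -⟩ := existsUnique_add_zsmul_mem_Ioc one_pos ζ.im 0
  refine ⟨ζ + n * Complex.I, ⟨by simpa using hζ, ?_, ?_⟩, (hψ i).periodic_int ζ n⟩
  · simpa using hn.1
  · simpa using hn.2

theorem injOn_cyl (i : Fin 3) : InjOn (ψ i) (cyl i) := by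
  intro ζ hζ ζ' hζ' h
  obtain ⟨n, hn⟩ := (hψ i).injective _ _ hζ.1.le hζ'.1.le h
  have h1 := congrArg Complex.im hn
  simp at h1
  have h2 : (n : ℝ) < 1 := by linarith [hζ.2.1, hζ'.2.2]
  have h3 : (-1 : ℝ) < n := by linarith [hζ.2.2, hζ'.2.1]
  have h4 : n = 0 := by
    have : n < 1 := by exact_mod_cast h2
    have : -1 < n := by exact_mod_cast h3
    omega
  rw [hn, h4]; simp

/-- Only the punctures and points on one line and two circles are missed, a null set. -/
theorem ae_mem_image_cyl : ∀ᵐ z : ℂ, z ∈ ⋃ i, ψ i '' cyl i := by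
  have hline : volume {z : ℂ | z.re = 1 / 2} = 0 := by
    have h1 : {z : ℂ | z.re = 1 / 2} = Complex.measurableEquivRealProd ⁻¹' ({1 / 2} ×ˢ univ) := by
      ext z; simp
    rw [h1, Complex.volume_preserving_equiv_real_prod.measure_preimage
      ((measurableSet_singleton _).prod MeasurableSet.univ).nullMeasurableSet,
      Measure.volume_eq_prod, Measure.prod_prod]
    simp
  have hne : ∀ w : ℂ, ∀ᵐ z : ℂ, z ≠ w := fun w => by simp [ae_iff]
  have hs : ∀ w : ℂ, ∀ᵐ z : ℂ, ‖z - w‖ ≠ 1 := fun w => by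
    rw [ae_iff]
    have : {a : ℂ | ¬‖a - w‖ ≠ 1} = Metric.sphere w 1 := by ext z; simp
    rw [this]
    exact Measure.addHaar_sphere _ _ _
  have hl : ∀ᵐ z : ℂ, z.re ≠ 1 / 2 := by
    rw [ae_iff]
    simpa using hline
  filter_upwards [hne 0, hne 1, hs 0, hs 1, hl] with z h0 h1 h2 h3 h4
  rw [sub_zero] at h2
  obtain ⟨i, hi⟩ := mem_iUnion.1 (surface_subset ⟨h0, h1⟩)
  refine mem_iUnion.2 ⟨i, ?_⟩
  rw [image_cyl hψ]
  refine ⟨hi, ?_⟩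
  fin_cases i
  · exact regionGauge_zero_lt.2 ⟨lt_of_le_of_ne hi.2.1 h2, lt_of_le_of_ne hi.2.2 h4⟩
  · exact regionGauge_one_lt.2 ⟨lt_of_le_of_ne hi.2.1 h3, lt_of_le_of_ne hi.2.2 (Ne.symm h4)⟩
  · exact (regionGauge_two_lt h0).2 ⟨lt_of_le_of_ne hi.1 (Ne.symm h2),
      lt_of_le_of_ne hi.2 (Ne.symm h3)⟩

theorem pairwise_disjoint_image_cyl : Pairwise (Function.onFun Disjoint fun i => ψ i '' cyl i) := by
  intro i j hij
  rw [Function.onFun, Set.disjoint_left]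
  intro z hz hz'
  rw [image_cyl hψ] at hz hz'
  exact absurd hz.2 (not_lt.2 (one_le_regionGauge hij hz'.1))

end Triple

theorem measurableSet_cyl (i : Fin 3) : MeasurableSet (cyl i) :=
  (isOpen_end (sgn i) 0).measurableSet.inter
    ((isOpen_lt continuous_const Complex.continuous_im).measurableSet.inter
      (isClosed_le Complex.continuous_im continuous_const).measurableSet)

/-! ### Holomorphic changes of variables and the decomposition of plane integrals -/

/-- The real derivative of a holomorphic function. -/
def cderiv (ψ : ℂ → ℂ) (ζ : ℂ) : ℂ →L[ℝ] ℂ :=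
  (ContinuousLinearMap.toSpanSingleton ℂ (deriv ψ ζ)).restrictScalars ℝ

theorem cderiv_apply (ψ : ℂ → ℂ) (ζ v : ℂ) : cderiv ψ ζ v = v * deriv ψ ζ := rfl

theorem hasFDerivAt_cderiv {ψ : ℂ → ℂ} {ζ : ℂ} (h : DifferentiableAt ℂ ψ ζ) :
    HasFDerivAt ψ (cderiv ψ ζ) ζ := h.hasDerivAt.hasFDerivAt.restrictScalars ℝ

theorem det_cderiv (ψ : ℂ → ℂ) (ζ : ℂ) : (cderiv ψ ζ).det = ‖deriv ψ ζ‖ ^ 2 := by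
  rw [← Complex.normSq_eq_norm_sq, ← Algebra.norm_complex_apply, Algebra.norm_apply]
  change LinearMap.det _ = _
  congr 1
  ext v
  simp [cderiv, mul_comm]

theorem integral_image_holomorphic {ψ : ℂ → ℂ} {V : Set ℂ} (hV : MeasurableSet V)
    (hd : ∀ ζ ∈ V, DifferentiableAt ℂ ψ ζ) (hi : InjOn ψ V) (g : ℂ → ℝ) :
    ∫ z in ψ '' V, g z = ∫ ζ in V, ‖deriv ψ ζ‖ ^ 2 * g (ψ ζ) := by
  rw [integral_image_eq_integral_abs_det_fderiv_smul volume hV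
    (fun ζ hζ => (hasFDerivAt_cderiv (hd ζ hζ)).hasFDerivWithinAt) hi]
  simp_rw [det_cderiv, abs_pow, abs_norm, smul_eq_mul]

theorem integrableOn_image_holomorphic {ψ : ℂ → ℂ} {V : Set ℂ} (hV : MeasurableSet V)
    (hd : ∀ ζ ∈ V, DifferentiableAt ℂ ψ ζ) (hi : InjOn ψ V) (g : ℂ → ℝ) :
    IntegrableOn g (ψ '' V) ↔ IntegrableOn (fun ζ => ‖deriv ψ ζ‖ ^ 2 * g (ψ ζ)) V := by
  rw [integrableOn_image_iff_integrableOn_abs_det_fderiv_smul volume hV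
    (fun ζ hζ => (hasFDerivAt_cderiv (hd ζ hζ)).hasFDerivWithinAt) hi]
  simp_rw [det_cderiv, abs_pow, abs_norm, smul_eq_mul]

theorem IsCylinderCoordinate.differentiableAt {i : Fin 3} {ψ : ℂ → ℂ}
    (hψ : IsCylinderCoordinate i ψ) {ζ : ℂ} (hζ : 0 < sgn i * ζ.re) : DifferentiableAt ℂ ψ ζ :=
  hψ.holomorphic.differentiableAt ((isOpen_end _ 0).mem_nhds hζ)

theorem integral_eq_sum_cyl {ψ : Fin 3 → ℂ → ℂ} (hψ : ∀ i, IsCylinderCoordinate i (ψ i))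
    {g : ℂ → ℝ} (hg : Integrable g) :
    ∫ z, g z = ∑ i, ∫ ζ in cyl i, ‖deriv (ψ i) ζ‖ ^ 2 * g (ψ i ζ) := by
  have hm : ∀ i, MeasurableSet (ψ i '' cyl i) := fun i => by
    rw [image_cyl hψ, ← (hψ i).image_pos]
    have h1 := hψ i
    have h2 := h1.normCyl.isOpen_image (isOpen_end (sgn i) 0) subset_rfl
    have hminj : Function.Injective (mob i) ∧ ContinuousOn (mob i) surface := by
      fin_cases i
      · exact ⟨fun a b h => h, continuousOn_id⟩
      · exact ⟨fun a b h => sub_right_injective h, continuousOn_const.sub continuousOn_id⟩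
      · exact ⟨inv_injective, continuousOn_id.inv₀ fun z hz => hz.1⟩
    have h3 : ψ i '' {ζ | 0 < sgn i * ζ.re}
        = surface ∩ mob i ⁻¹' ((fun ζ => mob i (ψ i ζ)) '' {ζ | 0 < sgn i * ζ.re}) := by
      ext z
      constructor
      · rintro ⟨ζ, hζ, rfl⟩
        exact ⟨h1.mem_surface (le_of_lt hζ), ζ, hζ, rfl⟩
      · rintro ⟨-, ζ, hζ, he⟩
        exact ⟨ζ, hζ, hminj.1 he⟩
    rw [h3]
    exact (hminj.2.isOpen_inter_preimage isOpen_surface h2).measurableSet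
  have h1 : ∫ z, g z = ∫ z in ⋃ i, ψ i '' cyl i, g z := by
    rw [Measure.restrict_eq_self_of_ae_mem (ae_mem_image_cyl hψ)]
  rw [h1, integral_iUnion hm (pairwise_disjoint_image_cyl hψ) hg.integrableOn, tsum_fintype]
  refine Finset.sum_congr rfl fun i _ => ?_
  exact integral_image_holomorphic (measurableSet_cyl i)
    (fun ζ hζ => (hψ i).differentiableAt hζ.1) (injOn_cyl hψ i) g

end Pants

namespace Pants

set_option maxSynthPendingDepth 3
set_option linter.unusedSectionVars false

/-! ### Stokes' theorem on the pair of pants -/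

/-- The exterior derivative of a 1-form on `ℂ`, as a function. -/
def curl (Ξ : ℂ → ℂ →L[ℝ] ℝ) (z : ℂ) : ℝ :=
  fderiv ℝ Ξ z 1 Complex.I - fderiv ℝ Ξ z Complex.I 1

/-- Each partial derivative of a compactly supported coefficient integrates to zero, by parts
against the constant function one. -/
theorem integrable_curl_and_integral {Ξ : ℂ → ℂ →L[ℝ] ℝ} (h : ContDiff ℝ 1 Ξ)
    (hc : HasCompactSupport Ξ) : Integrable (curl Ξ) ∧ ∫ z, curl Ξ z = 0 := by
  have key : ∀ v w : ℂ, Integrable (fun z => fderiv ℝ Ξ z v w) ∧ ∫ z, fderiv ℝ Ξ z v w = 0 := by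
    intro v w
    have hd : ∀ z, fderiv ℝ (fun z => Ξ z w) z v = fderiv ℝ Ξ z v w := fun z => by
      have h1 := ((h.differentiable one_ne_zero).differentiableAt (x := z)).hasFDerivAt
      have h2 := (ContinuousLinearMap.apply ℝ ℝ w).hasFDerivAt.comp z h1
      have h3 : HasFDerivAt (fun z => Ξ z w) _ z := h2
      rw [h3.fderiv]
      rfl
    have i1 : Integrable (fun z => fderiv ℝ Ξ z v w) := by
      refine Continuous.integrable_of_hasCompactSupport ?_ ?_
      · have := h.continuous_fderiv one_ne_zero
        fun_prop
      · refine (hc.fderiv ℝ).mono fun z hz => ?_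
        rw [Function.mem_support] at hz ⊢
        intro h0
        exact hz (by rw [h0]; rfl)
    have i2 : Integrable (fun z => Ξ z w) := by
      refine Continuous.integrable_of_hasCompactSupport ?_ ?_
      · have := h.continuous
        fun_prop
      · refine hc.mono fun z hz => ?_
        rw [Function.mem_support] at hz ⊢
        intro h0
        exact hz (by rw [h0]; rfl)
    have h4 := integral_mul_fderiv_eq_neg_fderiv_mul_of_integrable (μ := (volume : Measure ℂ))
      (f := fun _ : ℂ => (1 : ℝ)) (g := fun z => Ξ z w) (v := v) (by simp)
      (by simpa [hd] using i1) (by simpa using i2) (fun x _ => differentiableAt_const _)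
      (fun x _ => ((h.differentiable one_ne_zero).differentiableAt).clm_apply
        (differentiableAt_const _))
    refine ⟨i1, ?_⟩
    simpa [hd] using h4
  refine ⟨(key 1 Complex.I).1.sub (key Complex.I 1).1, ?_⟩
  unfold curl
  rw [integral_sub (key 1 Complex.I).1 (key Complex.I 1).1, (key 1 Complex.I).2,
    (key Complex.I 1).2, sub_zero]

/-- Part of the half cylinder of sign `s`, with the circle coordinate in a fundamental domain. -/
def strip (s T T' : ℝ) : Set ℂ := {ζ | T < s * ζ.re ∧ s * ζ.re ≤ T' ∧ 0 < ζ.im ∧ ζ.im ≤ 1}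

/-- The coordinates `(s τ, t)`. -/
def cylMap (s : ℝ) (p : ℝ × ℝ) : ℂ := ⟨s * p.1, p.2⟩

theorem cylMap_eq (s x t : ℝ) : cylMap s (x, t) = ((s * x : ℝ) : ℂ) + t * Complex.I := by
  apply Complex.ext <;> simp [cylMap]

theorem continuous_cylMap (s : ℝ) : Continuous (cylMap s) := by
  have : cylMap s = fun p => ((s * p.1 : ℝ) : ℂ) + p.2 * Complex.I := by
    ext p; exact cylMap_eq s p.1 p.2
  rw [this]
  fun_prop

theorem measurableSet_strip (s T T' : ℝ) : MeasurableSet (strip s T T') := by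
  have h : Continuous fun ζ : ℂ => s * ζ.re := continuous_const.mul Complex.continuous_re
  exact (isOpen_lt continuous_const h).measurableSet.inter
    ((isClosed_le h continuous_const).measurableSet.inter
    ((isOpen_lt continuous_const Complex.continuous_im).measurableSet.inter
      (isClosed_le Complex.continuous_im continuous_const).measurableSet))

section Sign

variable {s : ℝ} (hs : s = 1 ∨ s = -1)
include hs

theorem sign_mul_sign_mul (x : ℝ) : s * (s * x) = x := by
  rcases hs with h | h <;> rw [h] <;> ring

theorem measurePreserving_cylMap : MeasurePreserving (cylMap s) := by
  have h1 : MeasurePreserving (fun p : ℝ × ℝ => (s * p.1, p.2)) := by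
    refine MeasurePreserving.prod ?_ (MeasurePreserving.id volume)
    rcases hs with h | h
    · rw [h]
      convert MeasurePreserving.id (volume : Measure ℝ) using 1
      ext x
      simp
    · have := Measure.measurePreserving_neg (volume : Measure ℝ)
      rw [h]
      convert this using 1
      ext x
      simp
  exact (Complex.volume_preserving_equiv_real_prod.symm).comp h1

theorem measurableEmbedding_cylMap : MeasurableEmbedding (cylMap s) := by
  refine (continuous_cylMap s).measurableEmbedding fun p q h => ?_
  have h1 := congrArg Complex.re h
  have h2 := congrArg Complex.im h
  change s * p.1 = s * q.1 at h1
  refine Prod.ext ?_ h2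
  rw [← sign_mul_sign_mul hs p.1, h1, sign_mul_sign_mul hs]

theorem preimage_strip (T T' : ℝ) : cylMap s ⁻¹' strip s T T' = Ioc T T' ×ˢ Ioc 0 1 := by
  ext p
  change (T < s * (s * p.1) ∧ s * (s * p.1) ≤ T' ∧ 0 < p.2 ∧ p.2 ≤ 1) ↔ _
  rw [sign_mul_sign_mul hs]
  exact ⟨fun h => ⟨⟨h.1, h.2.1⟩, h.2.2⟩, fun h => ⟨h.1.1, h.1.2, h.2⟩⟩

theorem integrableOn_strip {T T' : ℝ} {g : ℂ → ℝ}
    (hg : ContinuousOn (fun p => g (cylMap s p)) (Icc T T' ×ˢ Icc 0 1)) :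
    IntegrableOn g (strip s T T') := by
  rw [← (measurePreserving_cylMap hs).integrableOn_comp_preimage (measurableEmbedding_cylMap hs),
    preimage_strip hs]
  exact (hg.integrableOn_compact (isCompact_Icc.prod isCompact_Icc)).mono_set
    (prod_mono Ioc_subset_Icc_self Ioc_subset_Icc_self)

theorem integral_strip {T T' : ℝ} (hT : T ≤ T') {g : ℂ → ℝ}
    (hg : ContinuousOn (fun p => g (cylMap s p)) (Icc T T' ×ˢ Icc 0 1)) :
    ∫ ζ in strip s T T', g ζ = ∫ x in T..T', ∫ t in (0 : ℝ)..1, g (cylMap s (x, t)) := by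
  rw [← (measurePreserving_cylMap hs).setIntegral_preimage_emb (measurableEmbedding_cylMap hs),
    preimage_strip hs, Measure.volume_eq_prod, setIntegral_prod]
  · rw [intervalIntegral.integral_of_le hT]
    refine setIntegral_congr_fun measurableSet_Ioc fun x _ => ?_
    exact (intervalIntegral.integral_of_le zero_le_one).symm
  · exact (hg.integrableOn_compact (isCompact_Icc.prod isCompact_Icc)).mono_set
      (prod_mono Ioc_subset_Icc_self Ioc_subset_Icc_self)

end Sign

/-- The antisymmetric part of `B` is a multiple of the area form, and multiplication by `p` scales
area by `‖p‖²`. -/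
theorem curl_conformal (B : ℂ →L[ℝ] ℂ →L[ℝ] ℝ) (p : ℂ) :
    B p (Complex.I * p) - B (Complex.I * p) p = ‖p‖ ^ 2 * (B 1 Complex.I - B Complex.I 1) := by
  have h1 : p = p.re • (1 : ℂ) + p.im • Complex.I := by
    apply Complex.ext <;> simp
  have h2 : Complex.I * p = p.re • Complex.I - p.im • (1 : ℂ) := by
    apply Complex.ext <;> simp
  rw [h2]
  conv_lhs => rw [h1]
  rw [← Complex.normSq_eq_norm_sq, Complex.normSq_apply]
  simp only [map_add, map_sub, map_smul, add_apply, sub_apply, smul_apply, smul_eq_mul]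
  simp
  ring

/-- The integral of a 1-form along the circle at distance `T` of the cylinder. -/
def circ (s : ℝ) (ψ : ℂ → ℂ) (Ξ : ℂ → ℂ →L[ℝ] ℝ) (T : ℝ) : ℝ :=
  ∫ t in (0 : ℝ)..1, Ξ (ψ (cylMap s (T, t))) (Complex.I * deriv ψ (cylMap s (T, t)))

section Strip

variable {s : ℝ} (hs : s = 1 ∨ s = -1) {ψ : ℂ → ℂ} {T₀ : ℝ}
  (hd : DifferentiableOn ℂ ψ {ζ | T₀ < s * ζ.re}) {Ξ : ℂ → ℂ →L[ℝ] ℝ} {T T' : ℝ} (hT : T₀ < T)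
  (hΞ : ∀ ζ : ℂ, T ≤ s * ζ.re → s * ζ.re ≤ T' → ContDiffAt ℝ 1 Ξ (ψ ζ))
include hs hd hT hΞ

theorem hasFDerivAt_form_comp (w ζ : ℂ) (h1 : T ≤ s * ζ.re) (h2 : s * ζ.re ≤ T') :
    ∃ L : ℂ →L[ℝ] ℝ, HasFDerivAt (fun ζ => Ξ (ψ ζ) (w * deriv ψ ζ)) L ζ ∧
      ∀ v, L v = fderiv ℝ Ξ (ψ ζ) (v * deriv ψ ζ) (w * deriv ψ ζ)
        + Ξ (ψ ζ) (w * (v * deriv (deriv ψ) ζ)) := by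
  have hO := isOpen_end s T₀
  have hζ : ζ ∈ {ζ : ℂ | T₀ < s * ζ.re} := hT.trans_le h1
  have d1 := hasFDerivAt_cderiv (hd.differentiableAt (hO.mem_nhds hζ))
  have d2 := hasFDerivAt_cderiv ((hd.deriv hO).differentiableAt (hO.mem_nhds hζ))
  have d3 := ((hΞ ζ h1 h2).differentiableAt one_ne_zero).hasFDerivAt.comp ζ d1
  have d4 : HasFDerivAt (fun ζ => w * deriv ψ ζ) (w • cderiv (deriv ψ) ζ) ζ := d2.const_mul w
  have d5 := d3.clm_apply d4
  refine ⟨_, d5, fun v => ?_⟩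
  simp [cderiv_apply]
  ring_nf

theorem continuousOn_circ_integrand (w : ℂ) :
    ContinuousOn (fun p => Ξ (ψ (cylMap s p)) (w * deriv ψ (cylMap s p)))
      (Icc T T' ×ˢ Icc 0 1) := by
  intro p hp
  have e : s * (cylMap s p).re = p.1 := sign_mul_sign_mul hs p.1
  obtain ⟨L, hL, -⟩ := hasFDerivAt_form_comp hs hd hT hΞ w (cylMap s p) (by rw [e]; exact hp.1.1)
    (by rw [e]; exact hp.1.2)
  have h1 := hL.continuousAt
  exact (h1.comp (f := cylMap s) (continuous_cylMap s).continuousAt).continuousWithinAt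

theorem continuousOn_curl_comp :
    ContinuousOn (fun p => ‖deriv ψ (cylMap s p)‖ ^ 2 * curl Ξ (ψ (cylMap s p)))
      (Icc T T' ×ˢ Icc 0 1) := by
  intro p hp
  have e : s * (cylMap s p).re = p.1 := sign_mul_sign_mul hs p.1
  have hO := isOpen_end s T₀
  have h1 : T ≤ s * (cylMap s p).re := by rw [e]; exact hp.1.1
  have h2 : s * (cylMap s p).re ≤ T' := by rw [e]; exact hp.1.2
  have hζ : cylMap s p ∈ {ζ : ℂ | T₀ < s * ζ.re} := hT.trans_le h1
  have d1 := (hd.differentiableAt (hO.mem_nhds hζ)).continuousAt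
  have d2 := ((hd.deriv hO).differentiableAt (hO.mem_nhds hζ)).continuousAt
  have d3 : ContinuousAt (fderiv ℝ Ξ) (ψ (cylMap s p)) :=
    ((hΞ _ h1 h2).fderiv_right (m := 0) (by norm_num)).continuousAt
  have d4 : ContinuousAt (curl Ξ) (ψ (cylMap s p)) :=
    ((d3.clm_apply continuousAt_const).clm_apply continuousAt_const).sub
      ((d3.clm_apply continuousAt_const).clm_apply continuousAt_const)
  have d5 : ContinuousAt (fun ζ => ‖deriv ψ ζ‖ ^ 2 * curl Ξ (ψ ζ)) (cylMap s p) :=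
    (d2.norm.pow 2).mul (ContinuousAt.comp (f := ψ) d4 d1)
  exact (d5.comp (f := cylMap s) (continuous_cylMap s).continuousAt).continuousWithinAt

/-- The divergence theorem on a rectangle, applied to the coefficients of the pulled-back 1-form.
The terms with the second derivative of `ψ` cancel in the curl, and the sides `t = 0` and `t = 1`
cancel by periodicity. -/
theorem integral_curl_strip (hp : ∀ ζ, ψ (ζ + Complex.I) = ψ ζ) (hTT' : T ≤ T') :
    ∫ ζ in strip s T T', ‖deriv ψ ζ‖ ^ 2 * curl Ξ (ψ ζ)
      = s * (circ s ψ Ξ T' - circ s ψ Ξ T) := by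
  have hcont := continuousOn_curl_comp hs hd hT hΞ
  rw [integral_strip hs hTT' hcont]
  let m : ℝ × ℝ →L[ℝ] ℂ := (Complex.ofRealCLM.comp (s • ContinuousLinearMap.fst ℝ ℝ ℝ)) +
    (ContinuousLinearMap.toSpanSingleton ℝ Complex.I).comp (ContinuousLinearMap.snd ℝ ℝ ℝ)
  have hm : ∀ p, cylMap s p = m p := fun p => by
    apply Complex.ext <;> simp [cylMap, m]
  have hm1 : m (1, 0) = s := by simp [m]
  have hm2 : m (0, 1) = Complex.I := by simp [m]
  have hex : ∀ w : ℂ, ∃ L : ℝ × ℝ → ℂ →L[ℝ] ℝ, ∀ p ∈ Icc T T' ×ˢ Icc (0 : ℝ) 1,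
      HasFDerivAt (fun ζ => Ξ (ψ ζ) (w * deriv ψ ζ)) (L p) (cylMap s p) ∧
      ∀ v, L p v = fderiv ℝ Ξ (ψ (cylMap s p)) (v * deriv ψ (cylMap s p))
          (w * deriv ψ (cylMap s p))
        + Ξ (ψ (cylMap s p)) (w * (v * deriv (deriv ψ) (cylMap s p))) := by
    intro w
    have : ∀ p : ℝ × ℝ, ∃ L : ℂ →L[ℝ] ℝ, p ∈ Icc T T' ×ˢ Icc (0 : ℝ) 1 →
      HasFDerivAt (fun ζ => Ξ (ψ ζ) (w * deriv ψ ζ)) L (cylMap s p) ∧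
      ∀ v, L v = fderiv ℝ Ξ (ψ (cylMap s p)) (v * deriv ψ (cylMap s p))
          (w * deriv ψ (cylMap s p))
        + Ξ (ψ (cylMap s p)) (w * (v * deriv (deriv ψ) (cylMap s p))) := by
      intro p
      by_cases hp : p ∈ Icc T T' ×ˢ Icc (0 : ℝ) 1
      · have e : s * (cylMap s p).re = p.1 := sign_mul_sign_mul hs p.1
        obtain ⟨L, hL⟩ := hasFDerivAt_form_comp hs hd hT hΞ w (cylMap s p)
          (by rw [e]; exact hp.1.1) (by rw [e]; exact hp.1.2)
        exact ⟨L, fun _ => hL⟩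
      · exact ⟨0, fun h => absurd h hp⟩
    choose L hL using this
    exact ⟨L, hL⟩
  obtain ⟨L1, hL1⟩ := hex 1
  obtain ⟨LI, hLI⟩ := hex Complex.I
  have hpt : ∀ p ∈ Icc T T' ×ˢ Icc (0 : ℝ) 1,
      (s • (LI p).comp m) (1, 0) + (-(L1 p).comp m) (0, 1)
        = ‖deriv ψ (cylMap s p)‖ ^ 2 * curl Ξ (ψ (cylMap s p)) := by
    intro p hp
    rw [curl, ← curl_conformal]
    simp only [smul_apply, neg_apply, ContinuousLinearMap.comp_apply, hm1, hm2]
    have h1 : s • LI p (s : ℂ) = LI p 1 := by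
      rw [← map_smul]
      congr 1
      rw [Complex.real_smul, ← Complex.ofReal_mul]
      have := sign_mul_sign_mul hs 1
      rw [mul_one] at this
      rw [this, Complex.ofReal_one]
    rw [h1, (hL1 p hp).2, (hLI p hp).2]
    simp only [one_mul]
    ring
  have hdiv := integral2_divergence_prod_of_hasFDerivAt
    (fun p => s • Ξ (ψ (cylMap s p)) (Complex.I * deriv ψ (cylMap s p)))
    (fun p => -Ξ (ψ (cylMap s p)) (1 * deriv ψ (cylMap s p)))
    (fun p => s • (LI p).comp m) (fun p => -(L1 p).comp m) T 0 T' 1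
    (by rw [uIcc_of_le hTT', uIcc_of_le zero_le_one]
        exact (continuousOn_circ_integrand hs hd hT hΞ Complex.I).const_smul s)
    (by rw [uIcc_of_le hTT', uIcc_of_le zero_le_one]
        exact (continuousOn_circ_integrand hs hd hT hΞ 1).neg)
    (by
      rw [min_eq_left hTT', max_eq_right hTT', min_eq_left zero_le_one, max_eq_right zero_le_one]
      intro p hp
      have hp' : p ∈ Icc T T' ×ˢ Icc (0 : ℝ) 1 :=
        ⟨Ioo_subset_Icc_self hp.1, Ioo_subset_Icc_self hp.2⟩
      have h1 := (hLI p hp').1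
      have h2 : HasFDerivAt (cylMap s) m p := by
        rw [funext hm]; exact m.hasFDerivAt
      exact (h1.comp p h2).const_smul s)
    (by
      rw [min_eq_left hTT', max_eq_right hTT', min_eq_left zero_le_one, max_eq_right zero_le_one]
      intro p hp
      have hp' : p ∈ Icc T T' ×ˢ Icc (0 : ℝ) 1 :=
        ⟨Ioo_subset_Icc_self hp.1, Ioo_subset_Icc_self hp.2⟩
      have h1 := (hL1 p hp').1
      have h2 : HasFDerivAt (cylMap s) m p := by
        rw [funext hm]; exact m.hasFDerivAt
      exact (h1.comp p h2).neg)
    (by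
      rw [uIcc_of_le hTT', uIcc_of_le zero_le_one]
      refine (integrableOn_congr_fun hpt (measurableSet_Icc.prod measurableSet_Icc)).2 ?_
      exact hcont.integrableOn_compact (isCompact_Icc.prod isCompact_Icc))
  have hper : ∀ x : ℝ, Ξ (ψ (cylMap s (x, 1))) (1 * deriv ψ (cylMap s (x, 1)))
      = Ξ (ψ (cylMap s (x, 0))) (1 * deriv ψ (cylMap s (x, 0))) := by
    intro x
    have h1 : cylMap s (x, 1) = cylMap s (x, 0) + Complex.I := by
      apply Complex.ext <;> simp [cylMap]
    have h2 : deriv ψ (cylMap s (x, 0) + Complex.I) = deriv ψ (cylMap s (x, 0)) := by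
      rw [← deriv_comp_add_const]
      exact congrArg (fun g => deriv g (cylMap s (x, 0))) (funext hp)
    rw [h1, hp, h2]
  have hL : (∫ x in T..T', ∫ t in (0 : ℝ)..1,
      ‖deriv ψ (cylMap s (x, t))‖ ^ 2 * curl Ξ (ψ (cylMap s (x, t))))
      = ∫ x in T..T', ∫ t in (0 : ℝ)..1,
        (s • (LI (x, t)).comp m) (1, 0) + (-(L1 (x, t)).comp m) (0, 1) := by
    refine intervalIntegral.integral_congr fun x hx => intervalIntegral.integral_congr fun t ht => ?_
    rw [uIcc_of_le hTT'] at hx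
    rw [uIcc_of_le zero_le_one] at ht
    exact (hpt (x, t) ⟨hx, ht⟩).symm
  rw [hL, hdiv]
  simp only [hper, sub_self, zero_add, smul_eq_mul, intervalIntegral.integral_const_mul]
  rw [circ, circ]
  ring

end Strip

theorem cyl_eq_union {i : Fin 3} {T : ℝ} (hT : 0 ≤ T) :
    cyl i = strip (sgn i) 0 T ∪ {ζ | T < sgn i * ζ.re ∧ 0 < ζ.im ∧ ζ.im ≤ 1} := by
  ext ζ
  constructor
  · rintro ⟨h1, h2⟩
    rcases le_or_gt (sgn i * ζ.re) T with h | h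
    · exact Or.inl ⟨h1, h, h2⟩
    · exact Or.inr ⟨h, h2⟩
  · rintro (⟨h1, h2, h3⟩ | ⟨h1, h2⟩)
    · exact ⟨h1, h3⟩
    · exact ⟨hT.trans_lt h1, h2⟩

theorem strip_subset_cyl (i : Fin 3) (T : ℝ) : strip (sgn i) 0 T ⊆ cyl i :=
  fun _ h => ⟨h.1, h.2.2⟩

/-- Stokes' theorem for the part of the pair of pants at distance at most `T`. -/
theorem sum_integral_curl {ψ : Fin 3 → ℂ → ℂ} (hψ : ∀ i, IsCylinderCoordinate i (ψ i))
    {Λ : ℂ → ℂ →L[ℝ] ℝ} {χ : ℂ → ℝ} (hχ : ContDiff ℝ (⊤ : ℕ∞) χ) (hχc : HasCompactSupport χ)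
    (hχs : tsupport χ ⊆ surface) (hΛ : ∀ z ∈ tsupport χ, ContDiffAt ℝ 1 Λ z) {T : ℝ} (hT : 0 < T)
    (hχ1 : ∀ i ζ, 0 ≤ sgn i * ζ.re → sgn i * ζ.re ≤ T → χ =ᶠ[𝓝 (ψ i ζ)] 1) :
    (∀ i, IntegrableOn (fun ζ => ‖deriv (ψ i) ζ‖ ^ 2 * curl Λ (ψ i ζ)) (strip (sgn i) 0 T)) ∧
    ∑ i, ∫ ζ in strip (sgn i) 0 T, ‖deriv (ψ i) ζ‖ ^ 2 * curl Λ (ψ i ζ)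
      = ∑ i, sgn i * circ (sgn i) (ψ i) Λ T := by
  -- After the cut-off the curl has integral zero over the plane. The part beyond depth `T` is then,
  -- up to sign, the boundary term at `T`, because the circles far out miss the support.
  let Ξ : ℂ → ℂ →L[ℝ] ℝ := fun z => χ z • Λ z
  have hΞ : ContDiff ℝ 1 Ξ := by
    refine contDiff_iff_contDiffAt.2 fun z => ?_
    by_cases hz : z ∈ tsupport χ
    · exact (hχ.contDiffAt.of_le (WithTop.coe_le_coe.2 (le_top : (1 : ℕ∞) ≤ ⊤))).smul (hΛ z hz)
    · refine (contDiffAt_const (c := 0)).congr_of_eventuallyEq ?_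
      filter_upwards [(isClosed_tsupport χ).isOpen_compl.mem_nhds hz] with x hx
      simp only [Ξ, image_eq_zero_of_notMem_tsupport hx, zero_smul]
  have hΞc : HasCompactSupport Ξ := hχc.smul_right
  have hΞs : tsupport Ξ ⊆ tsupport χ := closure_mono fun z hz => by
    rw [Function.mem_support] at hz ⊢
    intro h0
    exact hz (by simp only [Ξ, h0, zero_smul])
  have hcz : ∀ z ∉ tsupport Ξ, curl Ξ z = 0 := fun z hz => by
    have h1 : fderiv ℝ Ξ z = 0 := by
      by_contra h0
      exact hz (support_fderiv_subset ℝ h0)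
    simp [curl, h1]
  obtain ⟨hint, h0⟩ := integrable_curl_and_integral hΞ hΞc
  rw [integral_eq_sum_cyl hψ hint] at h0
  -- The derivative of `ψ i` is not known to be bounded near the seams; integrability up to them is
  -- obtained by changing variables from the plane.
  have hcylint : ∀ i, IntegrableOn (fun ζ => ‖deriv (ψ i) ζ‖ ^ 2 * curl Ξ (ψ i ζ)) (cyl i) :=
    fun i => (integrableOn_image_holomorphic (measurableSet_cyl i)
      (fun ζ hζ => (hψ i).differentiableAt hζ.1) (injOn_cyl hψ i) _).1 hint.integrableOn
  have hΛΞ : ∀ i ζ, 0 ≤ sgn i * ζ.re → sgn i * ζ.re ≤ T →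
      Λ (ψ i ζ) = Ξ (ψ i ζ) ∧ curl Λ (ψ i ζ) = curl Ξ (ψ i ζ) := by
    intro i ζ h1 h2
    have h3 : Ξ =ᶠ[𝓝 (ψ i ζ)] Λ := by
      filter_upwards [hχ1 i ζ h1 h2] with z hz
      simp only [Ξ, hz, Pi.one_apply, one_smul]
    exact ⟨h3.eq_of_nhds.symm, by rw [curl, curl, h3.fderiv_eq]⟩
  have hstrip : ∀ i, EqOn (fun ζ => ‖deriv (ψ i) ζ‖ ^ 2 * curl Λ (ψ i ζ))
      (fun ζ => ‖deriv (ψ i) ζ‖ ^ 2 * curl Ξ (ψ i ζ)) (strip (sgn i) 0 T) := by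
    intro i ζ hζ
    simp only
    rw [(hΛΞ i ζ hζ.1.le hζ.2.1).2]
  refine ⟨fun i => (integrableOn_congr_fun (hstrip i) (measurableSet_strip _ _ _)).2
    ((hcylint i).mono_set (strip_subset_cyl i T)), ?_⟩
  rw [← sub_eq_zero, ← Finset.sum_sub_distrib]
  refine Eq.trans ?_ h0
  refine Finset.sum_congr rfl fun i _ => ?_
  rw [setIntegral_congr_fun (measurableSet_strip _ _ _) (hstrip i)]
  have hout : IntegrableOn (fun ζ => ‖deriv (ψ i) ζ‖ ^ 2 * curl Ξ (ψ i ζ))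
      {ζ | T < sgn i * ζ.re ∧ 0 < ζ.im ∧ ζ.im ≤ 1} := by
    refine (hcylint i).mono_set ?_
    rw [cyl_eq_union hT.le]
    exact subset_union_right
  have hmout : MeasurableSet {ζ : ℂ | T < sgn i * ζ.re ∧ 0 < ζ.im ∧ ζ.im ≤ 1} :=
    (isOpen_end (sgn i) T).measurableSet.inter
    ((isOpen_lt continuous_const Complex.continuous_im).measurableSet.inter
      (isClosed_le Complex.continuous_im continuous_const).measurableSet)
  rw [cyl_eq_union hT.le, setIntegral_union ?_ hmout
    ((hcylint i).mono_set (strip_subset_cyl i T)) hout]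
  swap
  · exact Set.disjoint_left.2 fun ζ h1 h2 => absurd h2.1 (not_lt.2 h1.2.1)
  obtain ⟨T₁, hT₁0, hT₁⟩ := (hψ i).exists_notMem_of_isCompact hΞc
    (hΞs.trans hχs)
  set T' := max T T₁ with hT'
  have hsub : strip (sgn i) T T' ⊆ {ζ | T < sgn i * ζ.re ∧ 0 < ζ.im ∧ ζ.im ≤ 1} :=
    fun ζ h => ⟨h.1, h.2.2⟩
  have h5 : ∫ ζ in {ζ | T < sgn i * ζ.re ∧ 0 < ζ.im ∧ ζ.im ≤ 1},
      ‖deriv (ψ i) ζ‖ ^ 2 * curl Ξ (ψ i ζ)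
      = ∫ ζ in strip (sgn i) T T', ‖deriv (ψ i) ζ‖ ^ 2 * curl Ξ (ψ i ζ) := by
    refine setIntegral_eq_of_subset_of_forall_sdiff_eq_zero hmout hsub fun ζ hζ => ?_
    have : T' ≤ sgn i * ζ.re := by
      by_contra! hlt
      exact hζ.2 ⟨hζ.1.1, hlt.le, hζ.1.2⟩
    rw [hcz _ (hT₁ ζ ((le_max_right _ _).trans this)), mul_zero]
  rw [h5, integral_curl_strip (sgn_eq i) (hψ i).holomorphic hT
    (fun ζ _ _ => hΞ.contDiffAt) (hψ i).periodic (le_max_left _ _)]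
  have h6 : circ (sgn i) (ψ i) Ξ T' = 0 := by
    rw [circ]
    rw [intervalIntegral.integral_congr (g := fun _ => (0 : ℝ)), intervalIntegral.integral_zero]
    intro t _
    have h7 : T₁ ≤ sgn i * (cylMap (sgn i) (T', t)).re := by
      change T₁ ≤ sgn i * (sgn i * T')
      rw [sign_mul_sign_mul (sgn_eq i)]
      exact le_max_right _ _
    exact congrArg (fun L : ℂ →L[ℝ] ℝ => L _) (image_eq_zero_of_notMem_tsupport (hT₁ _ h7))
  have h8 : circ (sgn i) (ψ i) Ξ T = circ (sgn i) (ψ i) Λ T := by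
    refine intervalIntegral.integral_congr fun t _ => ?_
    have e : sgn i * (cylMap (sgn i) (T, t)).re = T := sign_mul_sign_mul (sgn_eq i) T
    exact congrArg (fun L : ℂ →L[ℝ] ℝ => L _)
      (hΛΞ i _ (by rw [e]; exact hT.le) (by rw [e])).1.symm
  rw [h6, h8]
  ring

/-! ### The exponential map and Stokes' theorem on a disc -/

/-- The parametrization of the punctured plane by the cylinder. -/
def expMap (ζ : ℂ) : ℂ := Complex.exp (2 * Real.pi * ζ)

theorem expMap_periodic (ζ : ℂ) : expMap (ζ + Complex.I) = expMap ζ := by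
  rw [expMap, mul_add, Complex.exp_periodic]
  rfl

theorem hasDerivAt_expMap (ζ : ℂ) : HasDerivAt expMap (2 * Real.pi * expMap ζ) ζ := by
  have h1 : HasDerivAt (fun ζ : ℂ => 2 * Real.pi * ζ) (2 * Real.pi * 1 : ℂ) ζ :=
    (hasDerivAt_id ζ).const_mul _
  have := h1.cexp
  refine this.congr_deriv ?_
  rw [expMap]
  ring

theorem norm_expMap (ζ : ℂ) : ‖expMap ζ‖ = Real.exp (2 * Real.pi * ζ.re) := by
  rw [expMap, Complex.norm_exp]
  simp

theorem image_expMap (T : ℝ) :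
    expMap '' {ζ | T < ζ.re ∧ 0 < ζ.im ∧ ζ.im ≤ 1} = {q | Real.exp (2 * Real.pi * T) < ‖q‖} := by
  have hpi := Real.two_pi_pos
  ext q
  constructor
  · rintro ⟨ζ, hζ, rfl⟩
    change _ < ‖expMap ζ‖
    rw [norm_expMap, Real.exp_lt_exp]
    exact mul_lt_mul_of_pos_left hζ.1 hpi
  · intro hq
    have hq : Real.exp (2 * Real.pi * T) < ‖q‖ := hq
    have hq0 : q ≠ 0 := norm_pos_iff.1 ((Real.exp_pos _).trans hq)
    let η : ℂ := Complex.log q / (2 * Real.pi)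
    have hη : expMap η = q := by
      have h2 : (2 * Real.pi : ℂ) ≠ 0 := by exact_mod_cast hpi.ne'
      rw [expMap, mul_div_cancel₀ _ h2, Complex.exp_log hq0]
    obtain ⟨n, hn, -⟩ := existsUnique_add_zsmul_mem_Ioc one_pos η.im 0
    refine ⟨η + n * Complex.I, ⟨?_, by simpa using hn.1, by simpa using hn.2⟩,
      (Pants.periodic_int expMap_periodic η n).trans hη⟩
    rw [← hη, norm_expMap, Real.exp_lt_exp, mul_lt_mul_iff_right₀ hpi] at hq
    simpa using hq

theorem injOn_expMap : InjOn expMap {ζ | 0 < ζ.im ∧ ζ.im ≤ 1} := by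
  intro ζ hζ ζ' hζ' h
  obtain ⟨n, hn⟩ := Complex.exp_eq_exp_iff_exists_int.1 h
  have h2 : (2 * Real.pi : ℂ) ≠ 0 := by exact_mod_cast Real.two_pi_pos.ne'
  have h3 : ζ = ζ' + n * Complex.I := by
    apply mul_left_cancel₀ h2
    rw [hn]
    ring
  have h1 := congrArg Complex.im h3
  simp at h1
  have h4 : (n : ℝ) < 1 := by linarith [hζ.2, hζ'.1]
  have h5 : (-1 : ℝ) < n := by linarith [hζ.1, hζ'.2]
  have h6 : n = 0 := by
    have : n < 1 := by exact_mod_cast h4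
    have : -1 < n := by exact_mod_cast h5
    omega
  rw [h3, h6]; simp

/-- Stokes' theorem for a disc. -/
theorem integral_curl_disc {Λ : ℂ → ℂ →L[ℝ] ℝ} {χ : ℂ → ℝ} (hχ : ContDiff ℝ (⊤ : ℕ∞) χ)
    (hχc : HasCompactSupport χ) (hΛ : ∀ z ∈ tsupport χ, ContDiffAt ℝ 1 Λ z) {T : ℝ}
    (hχ1 : ∀ q ∈ Metric.closedBall (0 : ℂ) (Real.exp (2 * Real.pi * T)), χ =ᶠ[𝓝 q] 1) :
    ∫ q in Metric.closedBall (0 : ℂ) (Real.exp (2 * Real.pi * T)), curl Λ q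
      = circ 1 expMap Λ T := by
  let Ξ : ℂ → ℂ →L[ℝ] ℝ := fun z => χ z • Λ z
  have hΞ : ContDiff ℝ 1 Ξ := by
    refine contDiff_iff_contDiffAt.2 fun z => ?_
    by_cases hz : z ∈ tsupport χ
    · exact (hχ.contDiffAt.of_le (WithTop.coe_le_coe.2 (le_top : (1 : ℕ∞) ≤ ⊤))).smul (hΛ z hz)
    · refine (contDiffAt_const (c := 0)).congr_of_eventuallyEq ?_
      filter_upwards [(isClosed_tsupport χ).isOpen_compl.mem_nhds hz] with x hx
      simp only [Ξ, image_eq_zero_of_notMem_tsupport hx, zero_smul]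
  have hΞc : HasCompactSupport Ξ := hχc.smul_right
  have hcz : ∀ z ∉ tsupport Ξ, curl Ξ z = 0 := fun z hz => by
    have h1 : fderiv ℝ Ξ z = 0 := by
      by_contra h0
      exact hz (support_fderiv_subset ℝ h0)
    simp [curl, h1]
  obtain ⟨hint, h0⟩ := integrable_curl_and_integral hΞ hΞc
  have hΛΞ : ∀ q ∈ Metric.closedBall (0 : ℂ) (Real.exp (2 * Real.pi * T)),
      Λ q = Ξ q ∧ curl Λ q = curl Ξ q := by
    intro q hq
    have h3 : Ξ =ᶠ[𝓝 q] Λ := by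
      filter_upwards [hχ1 q hq] with z hz
      simp only [Ξ, hz, Pi.one_apply, one_smul]
    exact ⟨h3.eq_of_nhds.symm, by rw [curl, curl, h3.fderiv_eq]⟩
  -- The outside of the disc is a half cylinder under `expMap`; the cut-off form has total curl
  -- zero, so the disc integral is minus that of the outside.
  have hcompl : (Metric.closedBall (0 : ℂ) (Real.exp (2 * Real.pi * T)))ᶜ
      = expMap '' {ζ | T < ζ.re ∧ 0 < ζ.im ∧ ζ.im ≤ 1} := by
    rw [image_expMap]
    ext q
    simp
  have hdiff : Differentiable ℂ expMap := fun ζ => (hasDerivAt_expMap ζ).differentiableAt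
  have hm : MeasurableSet {ζ : ℂ | T < ζ.re ∧ 0 < ζ.im ∧ ζ.im ≤ 1} :=
    (isOpen_lt continuous_const Complex.continuous_re).measurableSet.inter
    ((isOpen_lt continuous_const Complex.continuous_im).measurableSet.inter
      (isClosed_le Complex.continuous_im continuous_const).measurableSet)
  rw [← integral_add_compl (Metric.isClosed_closedBall (x := (0 : ℂ))
    (ε := Real.exp (2 * Real.pi * T))).measurableSet hint, hcompl,
    integral_image_holomorphic hm (fun ζ _ => hdiff ζ) (injOn_expMap.mono fun ζ hζ => hζ.2)] at h0
  rw [setIntegral_congr_fun Metric.isClosed_closedBall.measurableSet fun q hq => (hΛΞ q hq).2]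
  obtain ⟨B, hB⟩ := hΞc.isBounded.subset_closedBall (0 : ℂ)
  obtain ⟨T', hT'T, hT'⟩ : ∃ T', T ≤ T' ∧ ∀ ζ : ℂ, T' ≤ ζ.re → expMap ζ ∉ tsupport Ξ := by
    have h1 : Tendsto (fun x : ℝ => Real.exp (2 * Real.pi * x)) atTop atTop :=
      Real.tendsto_exp_atTop.comp (tendsto_id.const_mul_atTop Real.two_pi_pos)
    obtain ⟨b, hb⟩ := eventually_atTop.1 (h1.eventually_gt_atTop B)
    refine ⟨max T b, le_max_left _ _, fun ζ hζ hmem => ?_⟩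
    have h2 := hB hmem
    rw [mem_closedBall_zero_iff, norm_expMap] at h2
    exact absurd (hb _ ((le_max_right _ _).trans hζ)) (not_lt.2 h2)
  have hsub : strip 1 T T' ⊆ {ζ : ℂ | T < ζ.re ∧ 0 < ζ.im ∧ ζ.im ≤ 1} :=
    fun ζ h => ⟨by simpa using h.1, h.2.2⟩
  have h5 : ∫ ζ in {ζ : ℂ | T < ζ.re ∧ 0 < ζ.im ∧ ζ.im ≤ 1},
      ‖deriv expMap ζ‖ ^ 2 * curl Ξ (expMap ζ)
      = ∫ ζ in strip 1 T T', ‖deriv expMap ζ‖ ^ 2 * curl Ξ (expMap ζ) := by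
    refine setIntegral_eq_of_subset_of_forall_sdiff_eq_zero hm hsub fun ζ hζ => ?_
    have : T' ≤ ζ.re := by
      by_contra! hlt
      exact hζ.2 ⟨by simpa using hζ.1.1, by simpa using hlt.le, hζ.1.2⟩
    rw [hcz _ (hT' ζ this), mul_zero]
  rw [h5, integral_curl_strip (Or.inl rfl) hdiff.differentiableOn (sub_one_lt T)
    (fun ζ _ _ => hΞ.contDiffAt) expMap_periodic hT'T] at h0
  have h6 : circ 1 expMap Ξ T' = 0 := by
    rw [circ, intervalIntegral.integral_congr (g := fun _ => (0 : ℝ)),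
      intervalIntegral.integral_zero]
    intro t _
    have h7 : T' ≤ (cylMap 1 (T', t)).re := by simp [cylMap]
    exact congrArg (fun L : ℂ →L[ℝ] ℝ => L _) (image_eq_zero_of_notMem_tsupport (hT' _ h7))
  have h8 : circ 1 expMap Ξ T = circ 1 expMap Λ T := by
    refine intervalIntegral.integral_congr fun t _ => ?_
    have e : expMap (cylMap 1 (T, t)) ∈ Metric.closedBall (0 : ℂ) (Real.exp (2 * Real.pi * T)) := by
      rw [mem_closedBall_zero_iff, norm_expMap]
      simp [cylMap]
    exact congrArg (fun L : ℂ →L[ℝ] ℝ => L _) (hΛΞ _ e).1.symm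
  rw [h6, h8] at h0
  linarith

end Pants

namespace Pants

set_option maxSynthPendingDepth 3
set_option linter.unusedSectionVars false

universe u v

/-! ### The pair of pants and the three caps as parts of the sphere -/

/-- A continuous map from a compact set to a Hausdorff space is closed, hence a quotient map onto
its image. This replaces continuity of an inverse of `ψ`. -/
theorem continuousOn_image_of_comp {A B Y : Type*} [TopologicalSpace A] [TopologicalSpace B]
    [T2Space B] [TopologicalSpace Y] {ψ : A → B} {C : B → Y} {Q : Set A} (hQ : IsCompact Q)
    (hψ : ContinuousOn ψ Q) (hC : ContinuousOn (fun a => C (ψ a)) Q) : ContinuousOn C (ψ '' Q) := by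
  rw [continuousOn_iff_isClosed]
  intro F hF
  obtain ⟨G, hG, he⟩ := (continuousOn_iff_isClosed.1 hC) F hF
  refine ⟨ψ '' (G ∩ Q), ?_, ?_⟩
  · have h1 : IsCompact (G ∩ Q) := hQ.inter_left hG
    exact (h1.image_of_continuousOn (hψ.mono inter_subset_right)).isClosed
  · ext b
    constructor
    · rintro ⟨hb, a, ha, rfl⟩
      have : a ∈ (fun a => C (ψ a)) ⁻¹' F ∩ Q := ⟨hb, ha⟩
      rw [he] at this
      exact ⟨mem_image_of_mem _ this, mem_image_of_mem _ ha⟩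
    · rintro ⟨⟨a, ha, rfl⟩, hb⟩
      rw [← he] at ha
      exact ⟨ha.1, hb⟩

/-- The shrinking of the half cylinder to its part of length one. -/
def squeeze (s : ℝ) (ζ : ℂ) : ℂ := ⟨ζ.re / (1 + s * ζ.re), ζ.im⟩

theorem squeeze_nonneg {s : ℝ} {ζ : ℂ} (h : 0 ≤ s * ζ.re) : 0 ≤ s * (squeeze s ζ).re := by
  change 0 ≤ s * (ζ.re / (1 + s * ζ.re))
  rw [← mul_div_assoc]
  positivity

theorem continuousOn_squeeze (s : ℝ) : ContinuousOn (squeeze s) {ζ | 0 ≤ s * ζ.re} := by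
  have : squeeze s = fun ζ => ((ζ.re / (1 + s * ζ.re) : ℝ) : ℂ) + ζ.im * Complex.I := by
    ext ζ; apply Complex.ext <;> simp [squeeze, -Complex.ofReal_div]
  rw [this]
  have h1 : ContinuousOn (fun ζ : ℂ => ζ.re / (1 + s * ζ.re)) {ζ | 0 ≤ s * ζ.re} := by
    refine ContinuousOn.div (by fun_prop) (by fun_prop) fun ζ hζ => ?_
    have : 0 ≤ s * ζ.re := hζ
    positivity
  exact (Complex.continuous_ofReal.comp_continuousOn h1).add (by fun_prop)

open Classical in
/-- The shrinking of the pair of pants to its part at distance less than one. -/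
def compress (ψ : Fin 3 → ℂ → ℂ) (z : ℂ) : ℂ :=
  if h : ∃ p : Fin 3 × ℂ, 0 ≤ sgn p.1 * p.2.re ∧ ψ p.1 p.2 = z then
    ψ h.choose.1 (squeeze (sgn h.choose.1) h.choose.2) else z

section Triple

variable {ψ : Fin 3 → ℂ → ℂ} (hψ : ∀ i, IsCylinderCoordinate i (ψ i))
include hψ

/-- The coordinates of a point are ambiguous by a period, with which `squeeze` commutes, and on the
seams by the region, where `squeeze` is the identity. So the choice in the definition is immaterial.
-/
theorem compress_apply {i : Fin 3} {ζ : ℂ} (hζ : 0 ≤ sgn i * ζ.re) :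
    compress ψ (ψ i ζ) = ψ i (squeeze (sgn i) ζ) := by
  have h : ∃ p : Fin 3 × ℂ, 0 ≤ sgn p.1 * p.2.re ∧ ψ p.1 p.2 = ψ i ζ := ⟨(i, ζ), hζ, rfl⟩
  rw [compress, dif_pos h]
  obtain ⟨h1, h2⟩ := h.choose_spec
  generalize h.choose = p at *
  obtain ⟨j, η⟩ := p
  simp only at *
  by_cases hij : i = j
  · subst hij
    obtain ⟨n, rfl⟩ := (hψ i).injective _ _ hζ h1 h2.symm
    rw [← (hψ i).periodic_int (squeeze _ ζ) n]
    congr 1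
    apply Complex.ext <;> simp [squeeze]
  · have h3 := re_eq_zero_of_eq hψ hij hζ h1 h2.symm
    have h4 := re_eq_zero_of_eq hψ (Ne.symm hij) h1 hζ h2
    have h5 : ∀ s (ξ : ℂ), ξ.re = 0 → squeeze s ξ = ξ := fun s ξ h => by
      apply Complex.ext <;> simp [squeeze, h]
    rw [h5 _ _ h3, h5 _ _ h4, h2]

/-- The three regions are relatively closed, so continuity can be checked on each; there it descends
from the cylinder along `ψ i`, restricted to a compact piece. -/
theorem continuousOn_compress : ContinuousOn (compress ψ) surface := by
  intro z hz
  have key : ∀ i, ContinuousWithinAt (compress ψ) (endRegion i) z := by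
    intro i
    by_cases hzi : z ∈ endRegion i
    · obtain ⟨K, hK, hzK, hKs⟩ := exists_compact_subset isOpen_surface hz
      obtain ⟨T, hT0, hT⟩ := (hψ i).exists_notMem_of_isCompact hK hKs
      let Q : Set ℂ := cylMap (sgn i) '' (Icc 0 T ×ˢ Icc 0 1)
      have hQ : IsCompact Q := (isCompact_Icc.prod isCompact_Icc).image (continuous_cylMap _)
      have hQs : Q ⊆ {ζ | 0 ≤ sgn i * ζ.re} := by
        rintro _ ⟨p, hp, rfl⟩
        change 0 ≤ sgn i * (sgn i * p.1)
        rw [sign_mul_sign_mul (sgn_eq i)]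
        exact hp.1.1
      have hsub : endRegion i ∩ K ⊆ ψ i '' Q := by
        rintro x ⟨hx, hxK⟩
        rw [← (hψ i).image] at hx
        obtain ⟨ζ, hζ, rfl⟩ := hx
        obtain ⟨n, hn, -⟩ := existsUnique_add_zsmul_mem_Ioc one_pos ζ.im 0
        have hlt : sgn i * ζ.re ≤ T := by
          by_contra! h
          exact hT ζ h.le hxK
        refine ⟨ζ + n * Complex.I, ⟨(sgn i * ζ.re, ζ.im + n), ⟨⟨hζ, hlt⟩, ?_, ?_⟩, ?_⟩,
          (hψ i).periodic_int ζ n⟩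
        · simpa using hn.1.le
        · simpa using hn.2
        · apply Complex.ext <;> simp [cylMap, sign_mul_sign_mul (sgn_eq i)]
      have hc : ContinuousOn (compress ψ) (ψ i '' Q) := by
        refine continuousOn_image_of_comp hQ ((hψ i).continuousOn.mono hQs) ?_
        have h1 : ContinuousOn (fun ζ => ψ i (squeeze (sgn i) ζ)) {ζ | 0 ≤ sgn i * ζ.re} :=
          (hψ i).continuousOn.comp (continuousOn_squeeze _) fun ζ hζ => squeeze_nonneg hζ
        exact (h1.mono hQs).congr fun ζ hζ => compress_apply hψ (hQs hζ)
      refine (hc z (hsub ⟨hzi, interior_subset hzK⟩)).mono_of_mem_nhdsWithin ?_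
      exact mem_of_superset (inter_mem self_mem_nhdsWithin
        (mem_nhdsWithin_of_mem_nhds (mem_interior_iff_mem_nhds.1 hzK))) hsub
    · obtain ⟨F, hF, he⟩ := endRegion_closed i
      refine continuousWithinAt_of_notMem_closure fun hcl => hzi ?_
      rw [he]
      refine ⟨hz, closure_minimal ?_ hF hcl⟩
      rw [he]
      exact inter_subset_right
  have : ContinuousWithinAt (compress ψ) (⋃ i, endRegion i) z := by
    rw [ContinuousWithinAt, nhdsWithin_iUnion]
    exact tendsto_iSup.2 key
  exact this.mono surface_subset

variable {M : Type u} [TopologicalSpace M] {u : ℂ → M} {w : Fin 3 → ℂ → M}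
  {f : C(OnePoint ℂ, M)} (hf : IsCappedSphere ψ u w f)
include hf

/-- The map `squeeze` inverts the stretching in the definition of the capped sphere. Thus the smooth
map `u` factors continuously through `f`, which is what a gauge along `f` requires. -/
theorem IsCappedSphere.apply_compress {z : ℂ} (hz : z ∈ surface) :
    f (compress ψ z : ℂ) = u z := by
  obtain ⟨i, hi⟩ := mem_iUnion.1 (surface_subset hz)
  rw [← (hψ i).image] at hi
  obtain ⟨ζ, hζ, rfl⟩ := hi
  have hζ : 0 ≤ sgn i * ζ.re := hζ
  rw [compress_apply hψ hζ]
  have h1 : sgn i * (squeeze (sgn i) ζ).re = sgn i * ζ.re / (1 + sgn i * ζ.re) :=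
    (mul_div_assoc _ _ _).symm
  have h2 : 0 < 1 + sgn i * ζ.re := by positivity
  rw [(hf i _).1 (squeeze_nonneg hζ) (by rw [h1, div_lt_one h2]; linarith)]
  congr 2
  apply Complex.ext
  · simp only [h1]
    simp only [squeeze]
    generalize sgn i * ζ.re = x at *
    have h3 : 1 - x / (1 + x) = (1 + x)⁻¹ := by field_simp; ring
    rw [h3]
    field_simp
  · rfl

end Triple

theorem tendsto_squeeze {s : ℝ} (hs : s = 1 ∨ s = -1) (t : ℝ) :
    Tendsto (fun p => squeeze s (cylMap s p)) (atTop ×ˢ 𝓝 t) (𝓝 (cylMap s (1, t))) := by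
  have h1 : ∀ p : ℝ × ℝ, squeeze s (cylMap s p) = cylMap s (p.1 / (1 + p.1), p.2) := fun p => by
    apply Complex.ext
    · change s * p.1 / (1 + s * (s * p.1)) = s * (p.1 / (1 + p.1))
      rw [sign_mul_sign_mul hs, mul_div_assoc]
    · rfl
  simp_rw [h1]
  refine (continuous_cylMap s).continuousAt.tendsto.comp ?_
  rw [nhds_prod_eq]
  refine Tendsto.prodMk ?_ tendsto_snd
  have h2 : Tendsto (fun x : ℝ => 1 - (1 + x)⁻¹) atTop (𝓝 (1 - 0)) :=
    (tendsto_inv_atTop_zero.comp (tendsto_atTop_add_const_left _ 1 tendsto_id)).const_sub 1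
  rw [sub_zero] at h2
  refine (h2.comp tendsto_fst).congr' ?_
  filter_upwards [tendsto_fst.eventually (eventually_gt_atTop (0 : ℝ))] with p hp
  have : (0 : ℝ) < p.1 := hp
  simp only [Function.comp]
  field_simp
  ring

/-! ### The discs as parts of the sphere -/

/-- The part of the sphere that carries the disc `w i`. -/
def capMap (i : Fin 3) (ψ : ℂ → ℂ) (q : ℂ) : OnePoint ℂ :=
  if q = 0 then puncture i else
    (ψ (cylMap (sgn i) (1 - Real.log ‖q‖ / (2 * Real.pi), q.arg / (2 * Real.pi))) : ℂ)

namespace IsCylinderCoordinate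

variable {i : Fin 3} {ψ : ℂ → ℂ} (hψ : IsCylinderCoordinate i ψ)
include hψ

/-- The argument of `expMap η` differs from `2π Im η` by a multiple of `2π`, which periodicity
absorbs. -/
theorem capMap_expMap (η : ℂ) :
    capMap i ψ (expMap η) = (ψ (cylMap (sgn i) (1 - η.re, η.im)) : ℂ) := by
  have hpi := Real.two_pi_pos
  rw [capMap, if_neg (show expMap η ≠ 0 from Complex.exp_ne_zero _), norm_expMap, Real.log_exp,
    mul_div_cancel_left₀ _ hpi.ne']
  have h1 : Complex.exp ((expMap η).arg * Complex.I)
      = Complex.exp ((2 * Real.pi * η.im : ℝ) * Complex.I) := by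
    have h2 := Complex.norm_mul_exp_arg_mul_I (expMap η)
    rw [norm_expMap] at h2
    apply mul_left_cancel₀ (Complex.ofReal_ne_zero.2 (Real.exp_pos (2 * Real.pi * η.re)).ne')
    rw [h2, Complex.ofReal_exp, ← Complex.exp_add, expMap]
    congr 1
    apply Complex.ext <;> simp
  obtain ⟨n, hn⟩ := Complex.exp_eq_exp_iff_exists_int.1 h1
  have h3 : (expMap η).arg = 2 * Real.pi * η.im + n * (2 * Real.pi) := by
    have := congrArg Complex.im hn
    simpa using this
  have h4 : (expMap η).arg / (2 * Real.pi) = η.im + n := by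
    rw [h3]
    field_simp
  rw [h4, ← hψ.periodic_int (cylMap (sgn i) (1 - η.re, η.im)) n]
  congr 2
  apply Complex.ext <;> simp [cylMap]

theorem continuousOn_capMap : ContinuousOn (capMap i ψ) (Metric.ball 0 1) := by
  have hpi := Real.two_pi_pos
  intro q hq
  refine ContinuousAt.continuousWithinAt ?_
  -- At the centre of the disc the depth tends to infinity, and the coordinate tends to the
  -- puncture.
  by_cases hq0 : q = 0
  · subst hq0
    rw [continuousAt_iff_punctured_nhds]
    have h1 : Tendsto (fun q : ℂ => cylMap (sgn i) (1 - Real.log ‖q‖ / (2 * Real.pi),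
        q.arg / (2 * Real.pi))) (𝓝[≠] 0) (endFilter i) := by
      refine tendsto_comap_iff.2 ?_
      have h2 : ∀ q : ℂ, sgn i * (cylMap (sgn i) (1 - Real.log ‖q‖ / (2 * Real.pi),
          q.arg / (2 * Real.pi))).re = 1 + -(Real.log ‖q‖) / (2 * Real.pi) := fun q => by
        change sgn i * (sgn i * _) = _
        rw [sign_mul_sign_mul (sgn_eq i)]
        ring
      refine Tendsto.congr (fun q => (h2 q).symm) ?_
      refine tendsto_atTop_add_const_left _ 1 (Tendsto.atTop_div_const hpi ?_)
      exact tendsto_neg_atBot_atTop.comp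
        ((Real.tendsto_log_nhdsGT_zero).comp tendsto_norm_nhdsNE_zero)
    have h3 := hψ.tendsto_puncture.comp h1
    rw [show capMap i ψ 0 = puncture i from if_pos rfl]
    refine h3.congr' ?_
    filter_upwards [self_mem_nhdsWithin] with q hq
    exact (if_neg hq).symm
  · obtain ⟨η, rfl⟩ : ∃ η, expMap η = q := by
      refine ⟨Complex.log q / (2 * Real.pi), ?_⟩
      have h2 : (2 * Real.pi : ℂ) ≠ 0 := by exact_mod_cast hpi.ne'
      rw [expMap, mul_div_cancel₀ _ h2, Complex.exp_log hq0]
    have hre : η.re < 0 := by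
      rw [mem_ball_zero_iff, norm_expMap, Real.exp_lt_one_iff] at hq
      by_contra! h
      exact absurd hq (not_lt.2 (mul_nonneg hpi.le h))
    have hstrict : HasStrictDerivAt expMap (2 * Real.pi * expMap η) η := by
      have h1 : ContDiffAt ℂ 1 expMap η := by unfold expMap; fun_prop
      exact h1.hasStrictDerivAt' (hasDerivAt_expMap η) one_ne_zero
    have hne : 2 * Real.pi * expMap η ≠ 0 := by
      refine mul_ne_zero (by exact_mod_cast hpi.ne') (Complex.exp_ne_zero _)
    -- Away from the centre `expMap` has nonzero derivative, so neighbourhoods of its value are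
    -- images of neighbourhoods of `η`, and continuity can be tested in the coordinate `η`.
    rw [ContinuousAt, ← hstrict.map_nhds_eq hne, tendsto_map'_iff]
    have h4 : ContinuousAt (fun η : ℂ => cylMap (sgn i) (1 - η.re, η.im)) η :=
      (continuous_cylMap _).continuousAt.comp (by fun_prop)
    have h5 : 0 < sgn i * (cylMap (sgn i) (1 - η.re, η.im)).re := by
      change 0 < sgn i * (sgn i * _)
      rw [sign_mul_sign_mul (sgn_eq i)]
      linarith
    have h6 := (hψ.differentiableAt h5).continuousAt
    have h7 : ContinuousAt (fun η : ℂ => (ψ (cylMap (sgn i) (1 - η.re, η.im)) : OnePoint ℂ)) η :=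
      OnePoint.continuous_coe.continuousAt.comp
        (ContinuousAt.comp (f := fun η : ℂ => cylMap (sgn i) (1 - η.re, η.im)) h6 h4)
    rw [hψ.capMap_expMap]
    exact h7.tendsto.congr fun η => (hψ.capMap_expMap η).symm

end IsCylinderCoordinate

section Cap

variable {M : Type u} [TopologicalSpace M] {u : ℂ → M} {w : Fin 3 → ℂ → M} {ψ : Fin 3 → ℂ → ℂ}
  {f : C(OnePoint ℂ, M)} (hf : IsCappedSphere ψ u w f)
include hf

theorem IsCappedSphere.apply_cylMap (i : Fin 3) {η : ℂ} (hη : η.re ≤ 0) :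
    f (ψ i (cylMap (sgn i) (1 - η.re, η.im)) : ℂ) = w i (expMap η) := by
  have h1 : sgn i * (cylMap (sgn i) (1 - η.re, η.im)).re = 1 - η.re :=
    sign_mul_sign_mul (sgn_eq i) _
  rw [(hf i _).2 (by rw [h1]; linarith), expMap]
  congr 3
  apply Complex.ext
  · simp only [h1]; ring
  · rfl

theorem IsCappedSphere.apply_circle (i : Fin 3) {z : ℝ → M}
    (hz : ∀ t : ℝ, w i (Complex.exp (2 * Real.pi * t * Complex.I)) = z t) (t : ℝ) :
    f (ψ i (cylMap (sgn i) (1, t)) : ℂ) = z t := by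
  have := hf.apply_cylMap i (η := t * Complex.I) (by simp)
  rw [expMap, ← mul_assoc, hz] at this
  simpa using this

/-- Off the centre this is the definition of the capped sphere; at the centre, which no cylinder
point represents, both sides are limits of equal values. -/
theorem IsCappedSphere.apply_capMap [T2Space M] (hψ : ∀ i, IsCylinderCoordinate i (ψ i)) {i : Fin 3}
    (hw : ContinuousOn (w i) (Metric.ball 0 1)) {q : ℂ} (hq : q ∈ Metric.ball (0 : ℂ) 1) :
    f (capMap i (ψ i) q) = w i q := by
  have key : ∀ q ∈ Metric.ball (0 : ℂ) 1, q ≠ 0 → f (capMap i (ψ i) q) = w i q := by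
    intro q hq hq0
    have hpi := Real.two_pi_pos
    obtain ⟨η, rfl⟩ : ∃ η, expMap η = q := by
      refine ⟨Complex.log q / (2 * Real.pi), ?_⟩
      have h2 : (2 * Real.pi : ℂ) ≠ 0 := by exact_mod_cast hpi.ne'
      rw [expMap, mul_div_cancel₀ _ h2, Complex.exp_log hq0]
    have hre : η.re ≤ 0 := by
      rw [mem_ball_zero_iff, norm_expMap, Real.exp_lt_one_iff] at hq
      by_contra! h
      exact absurd hq (not_lt.2 (mul_nonneg hpi.le h.le))
    rw [(hψ i).capMap_expMap, hf.apply_cylMap i hre]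
  by_cases hq0 : q = 0
  · subst hq0
    have hb : Metric.ball (0 : ℂ) 1 ∈ 𝓝 0 := Metric.ball_mem_nhds _ one_pos
    have h1 : Tendsto (fun q => f (capMap i (ψ i) q)) (𝓝[≠] 0) (𝓝 (f (capMap i (ψ i) 0))) :=
      (f.continuous.continuousAt.comp ((hψ i).continuousOn_capMap.continuousAt hb)).tendsto.mono_left
        nhdsWithin_le_nhds
    have h2 : Tendsto (w i) (𝓝[≠] 0) (𝓝 (w i 0)) :=
      (hw.continuousAt hb).tendsto.mono_left nhdsWithin_le_nhds
    refine tendsto_nhds_unique h1 (h2.congr' ?_)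
    filter_upwards [self_mem_nhdsWithin, mem_nhdsWithin_of_mem_nhds hb] with q hq hqb
    exact (key q hqb hq).symm
  · exact key q hq hq0

end Cap

end Pants

namespace Pants

set_option maxSynthPendingDepth 3
set_option linter.unusedSectionVars false

universe u v

/-! ### Tensors in charts -/

section Charts

variable {E : Type v} [NormedAddCommGroup E] [NormedSpace ℝ E]
  {M : Type u} [TopologicalSpace M] [ChartedSpace E M]

/-- The derivative of the chart at `x₀`. -/
def chartD (x₀ y : M) : TangentSpace 𝓘(ℝ, E) y →L[ℝ] E :=
  mfderiv 𝓘(ℝ, E) 𝓘(ℝ, E) (extChartAt 𝓘(ℝ, E) x₀) y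

/-- The derivative of the inverse of the chart at `x₀`. -/
def chartDSymm (x₀ : M) (v : E) : E →L[ℝ] TangentSpace 𝓘(ℝ, E) ((extChartAt 𝓘(ℝ, E) x₀).symm v) :=
  mfderiv 𝓘(ℝ, E) 𝓘(ℝ, E) (extChartAt 𝓘(ℝ, E) x₀).symm v

variable [IsManifold 𝓘(ℝ, E) (⊤ : ℕ∞) M]

theorem chartDSymm_chartD {x₀ y : M} (hy : y ∈ (extChartAt 𝓘(ℝ, E) x₀).source)
    (ξ : TangentSpace 𝓘(ℝ, E) y) :
    (show E from chartDSymm x₀ (extChartAt 𝓘(ℝ, E) x₀ y) (chartD x₀ y ξ)) = ξ := by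
  set e := extChartAt 𝓘(ℝ, E) x₀ with he
  have h1 := mfderiv_comp y ((contMDiffAt_extChartAt_symm
    (e.map_source hy)).mdifferentiableAt (by simp))
    ((contMDiffAt_extChartAt_of_mem hy).mdifferentiableAt (by simp))
  have h2 : e.symm ∘ e =ᶠ[𝓝 y] id := by
    filter_upwards [(isOpen_extChartAt_source (I := 𝓘(ℝ, E)) x₀).mem_nhds hy] with q hq
    exact e.left_inv hq
  have h3 := h2.mfderiv_eq (I := 𝓘(ℝ, E)) (I' := 𝓘(ℝ, E))
  rw [mfderiv_id] at h3
  have h6 : (mfderiv 𝓘(ℝ, E) 𝓘(ℝ, E) (e.symm ∘ e) y : E →L[ℝ] E) ξ = ξ := by rw [h3]; rfl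
  rw [h1] at h6
  exact h6

theorem exists_chartD_eq {x₀ y : M} (hy : y ∈ (extChartAt 𝓘(ℝ, E) x₀).source) (v : E) :
    ∃ ξ : TangentSpace 𝓘(ℝ, E) y, chartD x₀ y ξ = v := by
  set e := extChartAt 𝓘(ℝ, E) x₀ with he
  have h1 := mfderiv_comp (e y) (g := e) (f := e.symm)
    (by rw [e.left_inv hy]; exact (contMDiffAt_extChartAt_of_mem hy).mdifferentiableAt (by simp))
    ((contMDiffAt_extChartAt_symm (e.map_source hy)).mdifferentiableAt (by simp))
  have h2 : e ∘ e.symm =ᶠ[𝓝 (e y)] id := by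
    filter_upwards [(isOpen_extChartAt_target (I := 𝓘(ℝ, E)) x₀).mem_nhds (e.map_source hy)]
      with q hq
    exact e.right_inv hq
  have h3 := h2.mfderiv_eq (I := 𝓘(ℝ, E)) (I' := 𝓘(ℝ, E))
  rw [mfderiv_id] at h3
  have h6 : (mfderiv 𝓘(ℝ, E) 𝓘(ℝ, E) (e ∘ e.symm) (e y) : E →L[ℝ] E) v = v := by rw [h3]; rfl
  rw [h1] at h6
  refine ⟨(mfderiv 𝓘(ℝ, E) 𝓘(ℝ, E) e.symm (e y) : E →L[ℝ] E) v, ?_⟩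
  refine Eq.trans ?_ h6
  have h7 : ∀ a b : M, a = b → ∀ ξ : E, (mfderiv 𝓘(ℝ, E) 𝓘(ℝ, E) e a : E →L[ℝ] E) ξ
      = (mfderiv 𝓘(ℝ, E) 𝓘(ℝ, E) e b : E →L[ℝ] E) ξ := by rintro a b rfl ξ; rfl
  exact h7 _ _ (e.left_inv hy).symm _

theorem form_eq_localForm (form : ∀ x : M, TangentSpace 𝓘(ℝ, E) x [⋀^Fin 2]→L[ℝ] ℝ) {x₀ y : M}
    (hy : y ∈ (extChartAt 𝓘(ℝ, E) x₀).source) (a b : TangentSpace 𝓘(ℝ, E) y) :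
    form y ![a, b] = localForm form x₀ (extChartAt 𝓘(ℝ, E) x₀ y) ![chartD x₀ y a, chartD x₀ y b] := by
  set e := extChartAt 𝓘(ℝ, E) x₀ with he
  have h1 : ∀ p q : M, p = q → ∀ v : Fin 2 → E, (form p : E [⋀^Fin 2]→L[ℝ] ℝ) v
      = (form q : E [⋀^Fin 2]→L[ℝ] ℝ) v := by rintro p q rfl v; rfl
  refine (h1 _ _ (e.left_inv hy).symm ![a, b]).trans ?_
  change _ = (form (e.symm (e y)) : E [⋀^Fin 2]→L[ℝ] ℝ)
    (fun k => show E from chartDSymm x₀ (e y) ((![chartD x₀ y a, chartD x₀ y b] : Fin 2 → E) k))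
  congr 1
  ext k
  fin_cases k
  · exact (chartDSymm_chartD hy a).symm
  · exact (chartDSymm_chartD hy b).symm

theorem chartD_end (A : ∀ x : M, TangentSpace 𝓘(ℝ, E) x →L[ℝ] TangentSpace 𝓘(ℝ, E) x) {x₀ y : M}
    (hy : y ∈ (extChartAt 𝓘(ℝ, E) x₀).source) (a : TangentSpace 𝓘(ℝ, E) y) :
    chartD x₀ y (A y a) = localEnd A x₀ (extChartAt 𝓘(ℝ, E) x₀ y) (chartD x₀ y a) := by
  set e := extChartAt 𝓘(ℝ, E) x₀ with he
  have h1 : ∀ p q : M, p = q → ∀ v : E,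
      (mfderiv 𝓘(ℝ, E) 𝓘(ℝ, E) e p : E →L[ℝ] E) ((A p : E →L[ℝ] E) v)
      = (mfderiv 𝓘(ℝ, E) 𝓘(ℝ, E) e q : E →L[ℝ] E) ((A q : E →L[ℝ] E) v) := by
    rintro p q rfl v; rfl
  refine (h1 _ _ (e.left_inv hy).symm a).trans ?_
  change _ = (mfderiv 𝓘(ℝ, E) 𝓘(ℝ, E) e (e.symm (e y)) : E →L[ℝ] E)
    ((A (e.symm (e y)) : E →L[ℝ] E)
      (show E from chartDSymm x₀ (e y) (chartD x₀ y a)))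
  rw [chartDSymm_chartD hy a]

variable {A : Type*} [NormedAddCommGroup A] [NormedSpace ℝ A]

theorem chartD_mfderiv {U : A → M} {q : A} {x₀ : M}
    (hU : MDifferentiableAt 𝓘(ℝ, A) 𝓘(ℝ, E) U q)
    (hq : U q ∈ (extChartAt 𝓘(ℝ, E) x₀).source) (v : A) :
    chartD x₀ (U q) (mfderiv 𝓘(ℝ, A) 𝓘(ℝ, E) U q v)
      = fderiv ℝ (fun q => extChartAt 𝓘(ℝ, E) x₀ (U q)) q v := by
  have h1 : MDifferentiableAt 𝓘(ℝ, E) 𝓘(ℝ, E) (extChartAt 𝓘(ℝ, E) x₀) (U q) :=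
    (contMDiffAt_extChartAt_of_mem hq).mdifferentiableAt (by simp)
  rw [← mfderiv_eq_fderiv]
  have := mfderiv_comp q h1 hU
  simp only [Function.comp_def] at this
  rw [this]
  rfl

end Charts

/-! ### Subdivisions of loops -/

section Subdivision

variable {X : Type*} [TopologicalSpace X] {R : X → X → Prop}
  (hR : IsOpen {p : X × X | R p.1 p.2}) (hrefl : ∀ x, R x x)
include hR

include hrefl in
theorem exists_subdivision {c : ℝ → X} (hc : Continuous c) (hc1 : c 1 = c 0) :
    ∃ (N : ℕ) (a : ℕ → X), 0 < N ∧ a N = a 0 ∧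
      ∀ j < N, ∀ t ∈ Icc (j / N : ℝ) ((j + 1 : ℕ) / N), R (c t) (a j) := by
  have h1 : ∀ᶠ δ in 𝓝 (0 : ℝ), ∀ t ∈ Icc (0 : ℝ) 1, R (c t) (c (t + δ)) := by
    refine eventually_forall_Icc (P := fun δ t => R (c t) (c (t + δ))) fun t _ => ?_
    rw [← nhds_prod_eq]
    have h2 : Continuous fun p : ℝ × ℝ => (c p.2, c (p.2 + p.1)) := by fun_prop
    exact h2.continuousAt.eventually_mem (hR.mem_nhds (by
      change R (c t) (c (t + 0)); rw [add_zero]; exact hrefl _))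
  obtain ⟨ε, hε, h⟩ := Metric.eventually_nhds_iff.1 h1
  obtain ⟨N, hN⟩ := exists_nat_gt (1 / ε)
  have hN' : (0 : ℝ) < N := (one_div_pos.2 hε).trans hN
  refine ⟨N, fun j => c (j / N), Nat.cast_pos.1 hN', ?_, fun j hj t ht => ?_⟩
  · simp [div_self hN'.ne', hc1]
  have h01 : t ∈ Icc (0 : ℝ) 1 := by
    refine ⟨le_trans (by positivity) ht.1, ht.2.trans ?_⟩
    rw [div_le_one hN']
    exact_mod_cast hj
  have h3 : dist ((j / N : ℝ) - t) 0 < ε := by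
    rw [dist_zero_right, Real.norm_eq_abs, abs_lt]
    have h4 : 1 / (N : ℝ) < ε := by rw [div_lt_iff₀ hN']; rw [div_lt_iff₀ hε] at hN; linarith
    have h5 := ht.2
    rw [Nat.cast_succ, add_div] at h5
    constructor <;> linarith [ht.1]
  have := h h3 t h01
  rwa [add_sub_cancel] at this

/-- Nearness is an open condition and the segments are compact, so the labels of the limit loop also
serve the loops close to it. -/
theorem eventually_subdivision_rel {ι : Type*} {ℓ : Filter ι} {c : ℝ → X} {c' : ι → ℝ → X} {N : ℕ}
    (hN : 0 < N) {a : ℕ → X}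
    (ha : ∀ j < N, ∀ t ∈ Icc (j / N : ℝ) ((j + 1 : ℕ) / N), R (c t) (a j))
    (hlim : ∀ t ∈ Icc (0 : ℝ) 1, Tendsto (fun p : ι × ℝ => c' p.1 p.2) (ℓ ×ˢ 𝓝 t) (𝓝 (c t))) :
    ∀ᶠ i in ℓ, ∀ j < N, ∀ t ∈ Icc (j / N : ℝ) ((j + 1 : ℕ) / N), R (c' i t) (a j) := by
  have hN' : (0 : ℝ) < N := Nat.cast_pos.2 hN
  have h1 : ∀ j ∈ Finset.range N, ∀ᶠ i in ℓ, ∀ t ∈ Icc (j / N : ℝ) ((j + 1 : ℕ) / N),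
      R (c' i t) (a j) := by
    intro j hj
    have hj := Finset.mem_range.1 hj
    refine eventually_forall_Icc fun t ht => ?_
    have h01 : t ∈ Icc (0 : ℝ) 1 := by
      refine ⟨le_trans (by positivity) ht.1, ht.2.trans ?_⟩
      rw [div_le_one hN']
      exact_mod_cast hj
    have h2 : IsOpen {x | R x (a j)} :=
      hR.preimage (by fun_prop : Continuous fun x : X => (x, a j))
    exact (hlim t h01).eventually_mem (h2.mem_nhds (ha j hj t ht))
  filter_upwards [(Finset.eventually_all _).2 h1] with i hi j hj
  exact hi j (Finset.mem_range.2 hj)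

end Subdivision

theorem hasDerivAt_circle {ψ : ℂ → ℂ} {s T t : ℝ} (h : DifferentiableAt ℂ ψ (cylMap s (T, t))) :
    HasDerivAt (fun t => ψ (cylMap s (T, t))) (Complex.I * deriv ψ (cylMap s (T, t))) t := by
  have h1 : HasDerivAt (fun t : ℝ => cylMap s (T, t)) Complex.I t := by
    have h2 : HasDerivAt (fun t : ℝ => ((s * T : ℝ) : ℂ) + t * Complex.I) (1 * Complex.I) t :=
      ((Complex.ofRealCLM.hasDerivAt).mul_const Complex.I).const_add _
    rw [one_mul] at h2
    exact h2.congr_of_eventuallyEq (Eventually.of_forall fun t => cylMap_eq s T t)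
  have h3 := (hasFDerivAt_cderiv h).comp_hasDerivAt t h1
  exact h3

/-! ### The area of a disc -/

section Disc

variable {E : Type v} [NormedAddCommGroup E] [NormedSpace ℝ E]
  {M : Type u} [TopologicalSpace M] [ChartedSpace E M] [IsManifold 𝓘(ℝ, E) (⊤ : ℕ∞) M]

/-- The coefficient of the pullback of `ω` by a map `U` from the plane. -/
def areaDensity (ω : SymplecticForm E M) (U : ℂ → M) (q : ℂ) : ℝ :=
  ω.form (U q) ![mfderiv 𝓘(ℝ, ℂ) 𝓘(ℝ, E) U q (1 : ℂ), mfderiv 𝓘(ℝ, ℂ) 𝓘(ℝ, E) U q Complex.I]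

section Boundary

variable {w : ℂ → M} {s : Set ℂ} {q₀ : ℂ} {x₀ : M}
  (hw : ContMDiffWithinAt 𝓘(ℝ, ℂ) 𝓘(ℝ, E) (⊤ : ℕ∞) w s q₀)
  (hx₀ : w q₀ ∈ (extChartAt 𝓘(ℝ, E) x₀).source)
include hw hx₀

theorem contDiffWithinAt_chart :
    ContDiffWithinAt ℝ (⊤ : ℕ∞) (fun q => extChartAt 𝓘(ℝ, E) x₀ (w q)) s q₀ := by
  have h1 : ContMDiffWithinAt 𝓘(ℝ, ℂ) 𝓘(ℝ, E) (⊤ : ℕ∞) (fun q => extChartAt 𝓘(ℝ, E) x₀ (w q)) s q₀ :=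
    (contMDiffAt_extChartAt_of_mem hx₀).comp_contMDiffWithinAt q₀ hw
  exact contMDiffWithinAt_iff_contDiffWithinAt.1 h1

variable (hs : UniqueDiffOn ℝ s) (hq₀ : q₀ ∈ s)
include hs hq₀

theorem continuousWithinAt_fderiv_chart :
    ContinuousWithinAt (fderivWithin ℝ (fun q => extChartAt 𝓘(ℝ, E) x₀ (w q)) s) s q₀ :=
  ((contDiffWithinAt_chart hw hx₀).fderivWithin_right (m := 0) hs (by norm_cast) hq₀
    ).continuousWithinAt

/-- The full derivative of `w` is only controlled in the interior of `s`. Writing the density in a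
chart with the derivative within `s` gives a function that is continuous up to the boundary and has
the right values inside. -/
theorem exists_areaDensity_eq (ω : SymplecticForm E M) :
    ∃ g : ℂ → ℝ, ContinuousWithinAt g s q₀ ∧ ∀ᶠ q in 𝓝[s] q₀, q ∈ interior s →
      ContMDiffAt 𝓘(ℝ, ℂ) 𝓘(ℝ, E) (⊤ : ℕ∞) w q → areaDensity ω w q = g q := by
  set e := extChartAt 𝓘(ℝ, E) x₀ with he
  let V := fun q => e (w q)
  have hV := continuousWithinAt_fderiv_chart hw hx₀ hs hq₀
  have hVc : ContinuousWithinAt V s q₀ := (contDiffWithinAt_chart hw hx₀).continuousWithinAt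
  refine ⟨fun q => alt2 E (localForm ω.form x₀ (V q)) (fderivWithin ℝ V s q 1)
    (fderivWithin ℝ V s q Complex.I), ?_, ?_⟩
  · have h1 : ContinuousAt (fun y => alt2 E (localForm ω.form x₀ y)) (V q₀) :=
      (alt2 E).continuous.continuousAt.comp ((ω.smooth x₀).continuousOn.continuousAt
        ((isOpen_extChartAt_target x₀).mem_nhds (e.map_source hx₀)))
    have h2 : ContinuousWithinAt (fun q => alt2 E (localForm ω.form x₀ (V q))) s q₀ :=
      ContinuousAt.comp_continuousWithinAt (f := V) h1 hVc
    exact (h2.clm_apply (hV.clm_apply continuousWithinAt_const)).clm_apply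
      (hV.clm_apply continuousWithinAt_const)
  · filter_upwards [hw.continuousWithinAt.eventually_mem
      ((isOpen_extChartAt_source (I := 𝓘(ℝ, E)) x₀).mem_nhds hx₀)] with q hq hqi hqw
    rw [alt2_apply, fderivWithin_of_mem_nhds (mem_interior_iff_mem_nhds.1 hqi), areaDensity,
      form_eq_localForm ω.form hq]
    have hm := hqw.mdifferentiableAt (by simp)
    have e1 := chartD_mfderiv hm hq 1
    have e2 := chartD_mfderiv hm hq Complex.I
    rw [e1, e2]

end Boundary

theorem contMDiffAt_of_ball {w : ℂ → M}
    (hw : ContMDiffOn 𝓘(ℝ, ℂ) 𝓘(ℝ, E) (⊤ : ℕ∞) w (Metric.closedBall 0 1)) {q : ℂ}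
    (hq : q ∈ Metric.ball (0 : ℂ) 1) : ContMDiffAt 𝓘(ℝ, ℂ) 𝓘(ℝ, E) (⊤ : ℕ∞) w q :=
  hw.contMDiffAt (mem_of_superset (Metric.isOpen_ball.mem_nhds hq) Metric.ball_subset_closedBall)

theorem uniqueDiffOn_closedBall : UniqueDiffOn ℝ (Metric.closedBall (0 : ℂ) 1) :=
  uniqueDiffOn_convex (convex_closedBall 0 1) (by
    rw [interior_closedBall _ one_ne_zero]; exact ⟨0, by simp⟩)

/-- The density is bounded near every point of the closed disc, boundary points included, so
compactness gives integrability. -/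
theorem integrableOn_areaDensity (ω : SymplecticForm E M) {w : ℂ → M}
    (hw : ContMDiffOn 𝓘(ℝ, ℂ) 𝓘(ℝ, E) (⊤ : ℕ∞) w (Metric.closedBall 0 1)) :
    IntegrableOn (areaDensity ω w) (Metric.ball 0 1) := by
  have key : ∀ q₀ ∈ Metric.closedBall (0 : ℂ) 1, ∃ g : ℂ → ℝ,
      ContinuousWithinAt g (Metric.closedBall 0 1) q₀ ∧ ∀ᶠ q in 𝓝[Metric.closedBall 0 1] q₀,
        q ∈ Metric.ball (0 : ℂ) 1 → areaDensity ω w q = g q := by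
    intro q₀ hq₀
    obtain ⟨g, hg, h⟩ := exists_areaDensity_eq (hw q₀ hq₀) (mem_extChartAt_source (w q₀))
      uniqueDiffOn_closedBall hq₀ ω
    refine ⟨g, hg, h.mono fun q hq hqb => hq ?_ (contMDiffAt_of_ball hw hqb)⟩
    rwa [interior_closedBall _ one_ne_zero]
  have hcont : ContinuousOn (areaDensity ω w) (Metric.ball 0 1) := by
    intro q₀ hq₀
    obtain ⟨g, hg, h⟩ := key q₀ (Metric.ball_subset_closedBall hq₀)
    have hb : Metric.closedBall (0 : ℂ) 1 ∈ 𝓝 q₀ :=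
      mem_of_superset (Metric.isOpen_ball.mem_nhds hq₀) Metric.ball_subset_closedBall
    rw [nhdsWithin_eq_nhds.2 hb] at h
    refine ((hg.continuousAt hb).congr ?_).continuousWithinAt
    filter_upwards [h, Metric.isOpen_ball.mem_nhds hq₀] with q hq hqb
    exact (hq hqb).symm
  have hmeas : AEStronglyMeasurable ((Metric.ball (0 : ℂ) 1).indicator (areaDensity ω w)) :=
    (aestronglyMeasurable_indicator_iff Metric.isOpen_ball.measurableSet).2
      (hcont.aestronglyMeasurable Metric.isOpen_ball.measurableSet)
  have hint : IntegrableOn ((Metric.ball (0 : ℂ) 1).indicator (areaDensity ω w))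
      (Metric.closedBall 0 1) := by
    refine LocallyIntegrableOn.integrableOn_isCompact (fun q₀ hq₀ => ?_)
      (isCompact_closedBall (0 : ℂ) 1)
    obtain ⟨g, hg, h⟩ := key q₀ hq₀
    have : IsMeasurablyGenerated (𝓝[Metric.closedBall (0 : ℂ) 1] q₀) :=
      Metric.isClosed_closedBall.measurableSet.nhdsWithin_isMeasurablyGenerated _
    refine Measure.FiniteAtFilter.integrableAtFilter hmeas.stronglyMeasurableAtFilter
      ((Measure.finiteAt_nhds volume q₀).filter_mono nhdsWithin_le_nhds) ?_
    refine isBoundedUnder_of_eventually_le (a := ‖g q₀‖ + 1) ?_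
    have h1 : ∀ᶠ q in 𝓝[Metric.closedBall 0 1] q₀, ‖g q‖ < ‖g q₀‖ + 1 :=
      hg.norm.eventually_lt_const (by linarith)
    filter_upwards [h, h1] with q hq hq1
    simp only [Function.comp]
    by_cases hqb : q ∈ Metric.ball (0 : ℂ) 1
    · rw [indicator_of_mem hqb, hq hqb]
      exact hq1.le
    · rw [indicator_of_notMem hqb, norm_zero]
      positivity
  have h2 := hint.mono_set (Metric.ball_subset_closedBall (x := (0 : ℂ)) (ε := 1))
  exact (integrableOn_congr_fun (fun q hq => indicator_of_mem hq _)
    Metric.isOpen_ball.measurableSet).1 h2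

end Disc

end Pants

namespace Pants

set_option maxSynthPendingDepth 3
set_option linter.unusedSectionVars false

universe u v

/-! ### The holonomy of the boundary of a disc -/

section Cap

variable {E : Type v} [NormedAddCommGroup E] [NormedSpace ℝ E]
  {M : Type u} [TopologicalSpace M] [ChartedSpace E M] [IsManifold 𝓘(ℝ, E) (⊤ : ℕ∞) M]
  {X : Type*} [TopologicalSpace X]
  {ω : SymplecticForm E M} {S : PotentialSystem ω} {f : X → M} (Γ : Gauge S f)

theorem cylMap_one (s T : ℝ) : cylMap s (T, 1) = cylMap s (T, 0) + Complex.I := by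
  apply Complex.ext <;> simp [cylMap]

theorem IsGaugedPrimitive.circ_eq_hol {U : ℂ → M} {c : ℂ → X} {O K : Set ℂ}
    {Λ : ℂ → ℂ →L[ℝ] ℝ} {ν : X → ℂ → ℝ} (hΛ : IsGaugedPrimitive Γ U c K Λ ν) (hKO : K ⊆ O)
    (hU : ∀ y ∈ O, ContMDiffAt 𝓘(ℝ, ℂ) 𝓘(ℝ, E) (⊤ : ℕ∞) U y) (hfc : ∀ y ∈ O, f (c y) = U y)
    {ψ : ℂ → ℂ} {s T₀ T : ℝ} (hs : s = 1 ∨ s = -1)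
    (hd : DifferentiableOn ℂ ψ {ζ | T₀ < s * ζ.re}) (hT : T₀ < T)
    (hp : ∀ ζ, ψ (ζ + Complex.I) = ψ ζ) (hK : ∀ t ∈ Icc (0 : ℝ) 1, ψ (cylMap s (T, t)) ∈ K)
    {a : ℕ → X} {N : ℕ} (hN : 0 < N) (haN : a N = a 0)
    (ha : ∀ j < N, ∀ t ∈ Icc (j / N : ℝ) ((j + 1 : ℕ) / N), Γ.R (c (ψ (cylMap s (T, t)))) (a j)) :
    circ s ψ Λ T = Γ.hol a N (fun t => U (ψ (cylMap s (T, t)))) := by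
  have hO := isOpen_end s T₀
  have hmem : ∀ t, cylMap s (T, t) ∈ {ζ : ℂ | T₀ < s * ζ.re} := fun t => by
    change T₀ < s * (s * T)
    rwa [sign_mul_sign_mul hs]
  refine hΛ.integral_loop Γ hKO hU hfc (γ := fun t => ψ (cylMap s (T, t)))
    (fun t => hasDerivAt_circle (hd.differentiableAt (hO.mem_nhds (hmem t)))) ?_ hK ?_ hN haN ha
  · refine continuous_const.mul (continuous_iff_continuousAt.2 fun t => ?_)
    have h1 := ((hd.deriv hO).differentiableAt (hO.mem_nhds (hmem t))).continuousAt
    refine ContinuousAt.comp (f := fun t : ℝ => cylMap s (T, t)) h1 ?_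
    exact ((continuous_cylMap s).comp (by fun_prop : Continuous fun t : ℝ => (T, t))).continuousAt
  · simp only [cylMap_one, hp]

theorem chartVel_comp {U : ℂ → M} {γ : ℝ → ℂ} {γ' : ℂ} {t : ℝ} {x₀ : M}
    (hU : ContMDiffAt 𝓘(ℝ, ℂ) 𝓘(ℝ, E) (⊤ : ℕ∞) U (γ t)) (hγ : HasDerivAt γ γ' t)
    (hx₀ : U (γ t) ∈ (extChartAt 𝓘(ℝ, E) x₀).source) :
    chartVel (E := E) x₀ (fun t => U (γ t)) t
      = fderiv ℝ (fun q => extChartAt 𝓘(ℝ, E) x₀ (U q)) (γ t) γ' := by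
  have h1 : ContMDiffAt 𝓘(ℝ, ℂ) 𝓘(ℝ, E) (⊤ : ℕ∞) (fun q => extChartAt 𝓘(ℝ, E) x₀ (U q)) (γ t) :=
    (contMDiffAt_extChartAt_of_mem hx₀).comp (γ t) hU
  have h2 := (h1.contDiffAt.differentiableAt (by simp)).hasFDerivAt.comp_hasDerivAt t hγ
  exact h2.deriv

/-- The holonomy along the boundary of a smooth disc is its symplectic area. -/
theorem Gauge.hol_cap {w : ℂ → M} {D : ℂ → X}
    (hw : ContMDiffOn 𝓘(ℝ, ℂ) 𝓘(ℝ, E) (⊤ : ℕ∞) w (Metric.closedBall 0 1))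
    (hD : ContinuousOn D (Metric.ball 0 1)) (hfD : ∀ q ∈ Metric.ball (0 : ℂ) 1, f (D q) = w q)
    (hf : Continuous f) {z : ℝ → M} (hz : ContMDiff 𝓘(ℝ, ℝ) 𝓘(ℝ, E) (⊤ : ℕ∞) z)
    (hwz : ∀ t, w (expMap (cylMap 1 (0, t))) = z t) {c : ℝ → X} (hc1 : c 1 = c 0)
    (hfc : ∀ t, f (c t) = z t)
    (hDc : ∀ t ∈ Icc (0 : ℝ) 1,
      Tendsto (fun p : ℝ × ℝ => D (expMap (cylMap 1 p))) (𝓝[<] 0 ×ˢ 𝓝 t) (𝓝 (c t)))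
    {a : ℕ → X} {N : ℕ} (hN : 0 < N) (haN : a N = a 0)
    (ha : ∀ j < N, ∀ t ∈ Icc (j / N : ℝ) ((j + 1 : ℕ) / N), Γ.R (c t) (a j)) :
    Γ.hol a N z = ∫ q in Metric.ball (0 : ℂ) 1, areaDensity ω w q := by
  have hpi := Real.two_pi_pos
  -- A parametrization by `atTop` of the approach to the boundary circle; `T x` stays negative, so
  -- every circle used lies in the open disc, where `w` has full derivatives.
  let T : ℝ → ℝ := fun x => -Real.exp (-x)
  have hT0 : ∀ x, T x < 0 := fun x => neg_lt_zero.2 (Real.exp_pos _)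
  have hTlim : Tendsto T atTop (𝓝[<] 0) := by
    refine tendsto_nhdsWithin_iff.2 ⟨?_, Eventually.of_forall hT0⟩
    have := (Real.tendsto_exp_atBot.comp tendsto_neg_atTop_atBot).neg
    rwa [neg_zero] at this
  have hnorm : ∀ x t, ‖expMap (cylMap 1 (x, t))‖ = Real.exp (2 * Real.pi * x) := fun x t => by
    rw [norm_expMap]
    simp [cylMap]
  have hr1 : ∀ x < 0, Real.exp (2 * Real.pi * x) < 1 := fun x hx =>
    Real.exp_lt_one_iff.2 (mul_neg_of_pos_of_neg hpi hx)
  have hball : ∀ x < 0, ∀ t, expMap (cylMap 1 (x, t)) ∈ Metric.ball (0 : ℂ) 1 := fun x hx t => by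
    rw [mem_ball_zero_iff, hnorm]
    exact hr1 x hx
  have hdiff : Differentiable ℂ expMap := fun ζ => (hasDerivAt_expMap ζ).differentiableAt
  let s : ℝ → Set ℂ := fun x => Metric.closedBall 0 (Real.exp (2 * Real.pi * T x))
  have hsmono : Monotone s := fun x y hxy => Metric.closedBall_subset_closedBall (by
    rw [Real.exp_le_exp]
    refine mul_le_mul_of_nonneg_left ?_ hpi.le
    exact neg_le_neg (Real.exp_le_exp.2 (neg_le_neg hxy)))
  have hsU : ⋃ x, s x = Metric.ball 0 1 := by
    ext q
    rw [mem_iUnion, mem_ball_zero_iff]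
    constructor
    · rintro ⟨x, hx⟩
      exact (mem_closedBall_zero_iff.1 hx).trans_lt (hr1 _ (hT0 x))
    · intro hq
      have h1 : Tendsto (fun x => Real.exp (2 * Real.pi * T x)) atTop (𝓝 1) := by
        have h2 : Continuous fun y : ℝ => Real.exp (2 * Real.pi * y) := by fun_prop
        have h3 := (h2.tendsto 0).comp (hTlim.mono_right nhdsWithin_le_nhds)
        simp only [mul_zero, Real.exp_zero] at h3
        exact h3
      obtain ⟨x, hx⟩ := (h1.eventually_const_lt hq).exists
      exact ⟨x, mem_closedBall_zero_iff.2 hx.le⟩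
  have hI : Tendsto (fun x => ∫ q in s x, areaDensity ω w q) atTop
      (𝓝 (∫ q in Metric.ball (0 : ℂ) 1, areaDensity ω w q)) := by
    rw [← hsU]
    refine tendsto_setIntegral_of_monotone
      (fun x => Metric.isClosed_closedBall.measurableSet) hsmono ?_
    rw [hsU]
    exact integrableOn_areaDensity ω hw
  have hDlim : ∀ t ∈ Icc (0 : ℝ) 1, Tendsto (fun p : ℝ × ℝ => D (expMap (cylMap 1 (T p.1, p.2))))
      (atTop ×ˢ 𝓝 t) (𝓝 (c t)) := fun t ht =>
    (hDc t ht).comp (Tendsto.prodMap hTlim tendsto_id)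
  have hlab := eventually_subdivision_rel (ℓ := atTop)
    (c' := fun x t => D (expMap (cylMap 1 (T x, t)))) Γ.isOpen_R hN ha hDlim
  have hstokes : ∀ᶠ x in atTop, ∫ q in s x, areaDensity ω w q
      = Γ.hol a N (fun t => w (expMap (cylMap 1 (T x, t)))) := by
    filter_upwards [hlab] with x hx
    set r := Real.exp (2 * Real.pi * T x) with hr
    have hr0 : 0 < r := Real.exp_pos _
    have hr' : r < 1 := hr1 _ (hT0 x)
    -- The two radii divide the interval from `r` to `1` into thirds: the bump is one near the disc
    -- of radius `r` and supported inside the open unit disc.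
    let χ : ContDiffBump (0 : ℂ) := ⟨(2 * r + 1) / 3, (r + 2) / 3, by linarith, by linarith⟩
    have hts : tsupport χ ⊆ Metric.ball 0 1 := by
      rw [χ.tsupport_eq]
      exact Metric.closedBall_subset_ball (by change (r + 2) / 3 < 1; linarith)
    have hone : ∀ q ∈ Metric.closedBall (0 : ℂ) r, χ =ᶠ[𝓝 q] 1 := fun q hq =>
      χ.eventuallyEq_one_of_mem_ball (Metric.closedBall_subset_ball
        (by change r < (2 * r + 1) / 3; linarith) hq)
    have hK : ∀ q ∈ Metric.closedBall (0 : ℂ) r, q ∈ tsupport χ := fun q hq => by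
      refine subset_tsupport _ ?_
      rw [Function.mem_support, (hone q hq).eq_of_nhds]
      exact one_ne_zero
    obtain ⟨Λ, ν, hΛ⟩ := Γ.exists_primitive Metric.isOpen_ball χ.hasCompactSupport hts
      (fun q hq => contMDiffAt_of_ball hw hq) hD hfD
    rw [← hΛ.circ_eq_hol Γ hts (fun q hq => contMDiffAt_of_ball hw hq) hfD (Or.inl rfl)
      (T₀ := T x - 1) hdiff.differentiableOn (sub_one_lt _) expMap_periodic
      (fun t _ => hK _ (by rw [mem_closedBall_zero_iff, hnorm])) hN haN hx,
      ← integral_curl_disc χ.contDiff χ.hasCompactSupport hΛ.contDiffAt hone]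
    exact setIntegral_congr_fun Metric.isClosed_closedBall.measurableSet fun q hq =>
      (hΛ.curl q (hK q hq) 1 Complex.I).symm
  -- The derivative of `w` is bounded up to the boundary, so the speeds are bounded and the
  -- comparison below needs no `σ`.
  have hspeed : ∀ t ∈ Icc (0 : ℝ) 1, ∀ x₀ : M, z t ∈ (extChartAt 𝓘(ℝ, E) x₀).source →
      ∃ C, ∀ᶠ p in atTop ×ˢ 𝓝 t,
        ‖chartVel (E := E) x₀ (fun t => w (expMap (cylMap 1 (T p.1, t)))) p.2‖ ≤ C * (1 + 0) := by
    intro t ht x₀ hx₀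
    set q₀ := expMap (cylMap 1 (0, t)) with hq₀
    have hq₀b : q₀ ∈ Metric.closedBall (0 : ℂ) 1 := by
      rw [mem_closedBall_zero_iff, hnorm]
      simp
    rw [← hwz] at hx₀
    have h1 := continuousWithinAt_fderiv_chart (hw q₀ hq₀b) hx₀ uniqueDiffOn_closedBall hq₀b
    have h2 : Tendsto (fun p : ℝ × ℝ => expMap (cylMap 1 (T p.1, p.2))) (atTop ×ˢ 𝓝 t)
        (𝓝[Metric.closedBall 0 1] q₀) := by
      refine tendsto_nhdsWithin_iff.2 ⟨?_, Eventually.of_forall fun p =>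
        Metric.ball_subset_closedBall (hball _ (hT0 _) _)⟩
      have h3 := (hdiff.continuous.comp (continuous_cylMap 1)).tendsto (0, t)
      rw [nhds_prod_eq] at h3
      exact h3.comp (Tendsto.prodMap (hTlim.mono_right nhdsWithin_le_nhds) tendsto_id)
    set V := fun q => extChartAt 𝓘(ℝ, E) x₀ (w q) with hV
    set B := ‖fderivWithin ℝ V (Metric.closedBall 0 1) q₀‖ + 1 with hB
    refine ⟨B * (2 * Real.pi), ?_⟩
    have h4 := h2.eventually (h1.norm.eventually_lt_const (show _ < B by linarith))
    have h5 := h2.eventually ((hw q₀ hq₀b).continuousWithinAt.eventually_mem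
      ((isOpen_extChartAt_source (I := 𝓘(ℝ, E)) x₀).mem_nhds hx₀))
    filter_upwards [h4, h5] with p hp hps
    have hqb := hball _ (hT0 p.1) p.2
    rw [fderivWithin_of_mem_nhds (mem_of_superset (Metric.isOpen_ball.mem_nhds hqb)
      Metric.ball_subset_closedBall)] at hp
    rw [chartVel_comp (γ := fun t => expMap (cylMap 1 (T p.1, t))) (contMDiffAt_of_ball hw hqb)
      (hasDerivAt_circle hdiff.differentiableAt) hps, (hasDerivAt_expMap _).deriv]
    refine (ContinuousLinearMap.le_opNorm _ _).trans ?_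
    rw [add_zero, mul_one]
    refine mul_le_mul hp.le ?_ (norm_nonneg _) (by positivity)
    rw [norm_mul, norm_mul, Complex.norm_I, one_mul]
    have h6 : ‖(2 * Real.pi : ℂ)‖ = 2 * Real.pi := by
      rw [show (2 * Real.pi : ℂ) = ((2 * Real.pi : ℝ) : ℂ) by push_cast; rfl, Complex.norm_real,
        Real.norm_eq_abs, abs_of_pos hpi]
    rw [h6]
    have h7 := (mem_ball_zero_iff.1 hqb).le
    nlinarith
  have hlimw : ∀ t ∈ Icc (0 : ℝ) 1, Tendsto (fun p : ℝ × ℝ => w (expMap (cylMap 1 (T p.1, p.2))))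
      (atTop ×ˢ 𝓝 t) (𝓝 (z t)) := by
    intro t ht
    have h1 := (hf.tendsto (c t)).comp (hDlim t ht)
    rw [hfc] at h1
    exact h1.congr fun p => hfD _ (hball _ (hT0 _) _)
  have hsm : ∀ x t, ContMDiffAt 𝓘(ℝ, ℝ) 𝓘(ℝ, E) (⊤ : ℕ∞)
      (fun t => w (expMap (cylMap 1 (T x, t)))) t := by
    intro x t
    have h1 : ContDiff ℝ (⊤ : ℕ∞) fun t : ℝ => expMap (cylMap 1 (T x, t)) := by
      have : (fun t : ℝ => expMap (cylMap 1 (T x, t)))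
          = fun t : ℝ => Complex.exp (2 * Real.pi * (((1 * T x : ℝ) : ℂ) + t * Complex.I)) := by
        ext t
        rw [cylMap_eq, expMap]
      rw [this]
      have h2 : ContDiff ℝ (⊤ : ℕ∞) fun t : ℝ => (t : ℂ) := Complex.ofRealCLM.contDiff
      exact (contDiff_const.mul (contDiff_const.add (h2.mul contDiff_const))).cexp
    exact ContMDiffAt.comp (f := fun t : ℝ => expMap (cylMap 1 (T x, t))) t
      (contMDiffAt_of_ball hw (hball _ (hT0 x) t)) h1.contMDiff.contMDiffAt
  have hhol : Tendsto (fun x => Γ.hol a N (fun t => w (expMap (cylMap 1 (T x, t))))) atTop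
      (𝓝 (Γ.hol a N z)) := by
    refine Metric.tendsto_nhds.2 fun ε hε => ?_
    have := Γ.eventually_hol_sub_le (ℓ := atTop)
      (μ := fun x t => w (expMap (cylMap 1 (T x, t)))) (σ := fun _ _ => 0) hN haN hc1 hz hfc ha
      (Eventually.of_forall fun x t _ => hsm x t) hlimw (fun _ _ => le_rfl)
      (Eventually.of_forall fun _ => continuousOn_const) hspeed (half_pos hε)
    filter_upwards [this] with x hx
    rw [Real.dist_eq]
    simp at hx
    linarith
  exact tendsto_nhds_unique (hhol.congr' (hstokes.mono fun x hx => hx.symm)) hI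

end Cap

end Pants

namespace Pants

set_option maxSynthPendingDepth 3
set_option linter.unusedSectionVars false

universe u v

/-! ### Local bounds for compatible almost complex structures and Hamiltonian vector fields -/

theorem exists_coercive {E : Type*} [NormedAddCommGroup E] [NormedSpace ℝ E]
    [FiniteDimensional ℝ E] (B : E →L[ℝ] E →L[ℝ] ℝ) (hB : ∀ v, v ≠ 0 → 0 < B v v) :
    ∃ c > 0, ∀ v, c * ‖v‖ ^ 2 ≤ B v v := by
  -- The unit sphere is empty when `E` is the zero space; otherwise `c` is the minimum over it.
  rcases (Metric.sphere (0 : E) 1).eq_empty_or_nonempty with h | h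
  · refine ⟨1, one_pos, fun v => ?_⟩
    have : v = 0 := by
      by_contra hv
      have : ‖v‖⁻¹ • v ∈ Metric.sphere (0 : E) 1 := by
        rw [mem_sphere_zero_iff_norm, norm_smul, norm_inv, norm_norm,
          inv_mul_cancel₀ (norm_ne_zero_iff.2 hv)]
      rw [h] at this
      exact this
    simp [this]
  · have hcont : Continuous fun v => B v v := by fun_prop
    obtain ⟨v₀, hv₀, hmin⟩ := (isCompact_sphere (0 : E) 1).exists_isMinOn h hcont.continuousOn
    have hv₀0 : v₀ ≠ 0 := by
      rintro rfl
      simp at hv₀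
    refine ⟨B v₀ v₀, hB v₀ hv₀0, fun v => ?_⟩
    by_cases hv : v = 0
    · simp [hv]
    have hv' : ‖v‖ ≠ 0 := norm_ne_zero_iff.2 hv
    have h1 : ‖v‖⁻¹ • v ∈ Metric.sphere (0 : E) 1 := by
      rw [mem_sphere_zero_iff_norm, norm_smul, norm_inv, norm_norm, inv_mul_cancel₀ hv']
    have h2 : B v₀ v₀ ≤ B (‖v‖⁻¹ • v) (‖v‖⁻¹ • v) := hmin h1
    simp only [map_smul, smul_apply, smul_eq_mul] at h2
    have h3 : 0 < ‖v‖ ^ 2 := by positivity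
    calc B v₀ v₀ * ‖v‖ ^ 2 ≤ (‖v‖⁻¹ * (‖v‖⁻¹ * B v v)) * ‖v‖ ^ 2 :=
          mul_le_mul_of_nonneg_right h2 h3.le
      _ = B v v := by field_simp

section Bounds

variable {E : Type v} [NormedAddCommGroup E] [NormedSpace ℝ E] [FiniteDimensional ℝ E]
  {M : Type u} [TopologicalSpace M] [ChartedSpace E M] [IsManifold 𝓘(ℝ, E) (⊤ : ℕ∞) M]
  {ω : SymplecticForm E M} {H : ℝ → M → ℝ} (hH : IsPeriodicHamiltonian (E := E) H)

include hH in
theorem contDiffAt_hamiltonian_chart {x₀ : M} {t : ℝ} {y : E}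
    (hy : y ∈ (extChartAt 𝓘(ℝ, E) x₀).target) :
    ContDiffAt ℝ (⊤ : ℕ∞) (fun p : ℝ × E => H p.1 ((extChartAt 𝓘(ℝ, E) x₀).symm p.2)) (t, y) := by
  have h1 : ContMDiffAt 𝓘(ℝ, ℝ × E) 𝓘(ℝ, E) (⊤ : ℕ∞)
      (fun p : ℝ × E => (extChartAt 𝓘(ℝ, E) x₀).symm p.2) (t, y) :=
    ContMDiffAt.comp (f := fun p : ℝ × E => p.2) (t, y) (contMDiffAt_extChartAt_symm hy)
      contDiff_snd.contMDiff.contMDiffAt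
  have h2 : ContMDiffAt 𝓘(ℝ, ℝ × E) 𝓘(ℝ, ℝ) (⊤ : ℕ∞) (fun p : ℝ × E => p.1) (t, y) :=
    contDiff_fst.contMDiff.contMDiffAt
  have h3 := (hH.smooth.contMDiffAt (x := (t, (extChartAt 𝓘(ℝ, E) x₀).symm y))).comp
    (f := fun p : ℝ × E => (p.1, (extChartAt 𝓘(ℝ, E) x₀).symm p.2)) (t, y) (h2.prodMk h1)
  exact h3.contDiffAt

include hH in
theorem mdifferentiableAt_hamiltonian (t : ℝ) (y : M) :
    MDifferentiableAt 𝓘(ℝ, E) 𝓘(ℝ, ℝ) (H t) y := by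
  have h1 : ContMDiffAt 𝓘(ℝ, E) (𝓘(ℝ, ℝ).prod 𝓘(ℝ, E)) (⊤ : ℕ∞) (fun y : M => (t, y)) y :=
    contMDiffAt_const.prodMk contMDiffAt_id
  have h2 := (hH.smooth.contMDiffAt (x := (t, y))).comp (f := fun y : M => (t, y)) y h1
  exact h2.mdifferentiableAt (by simp)

include hH in
theorem dApply_eq_chart {x₀ y : M} (hy : y ∈ (extChartAt 𝓘(ℝ, E) x₀).source) (t : ℝ)
    (ξ : TangentSpace 𝓘(ℝ, E) y) :
    dApply (H t) y ξ = fderiv ℝ (fun p : ℝ × E => H p.1 ((extChartAt 𝓘(ℝ, E) x₀).symm p.2))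
      (t, extChartAt 𝓘(ℝ, E) x₀ y) (0, chartD x₀ y ξ) := by
  set e := extChartAt 𝓘(ℝ, E) x₀ with he
  have h1 := ((contDiffAt_hamiltonian_chart hH (t := t) (e.map_source hy)).differentiableAt
    (by simp)).hasFDerivAt
  have h2 : HasFDerivAt (fun v : E => (t, v)) (ContinuousLinearMap.inr ℝ ℝ E) (e y) :=
    (hasFDerivAt_const t (e y)).prodMk (hasFDerivAt_id (e y))
  have h3 : HasMFDerivAt 𝓘(ℝ, E) 𝓘(ℝ, ℝ) (fun v : E => H t (e.symm v)) (e y) _ :=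
    (h1.comp (e y) h2).hasMFDerivAt
  have h4 : HasMFDerivAt 𝓘(ℝ, E) 𝓘(ℝ, E) e y (mfderiv 𝓘(ℝ, E) 𝓘(ℝ, E) e y) :=
    ((contMDiffAt_extChartAt_of_mem hy).mdifferentiableAt (by simp)).hasMFDerivAt
  have h5 := h3.comp y h4
  have h6 : H t =ᶠ[𝓝 y] (fun v : E => H t (e.symm v)) ∘ e := by
    filter_upwards [(isOpen_extChartAt_source (I := 𝓘(ℝ, E)) x₀).mem_nhds hy] with q hq
    simp only [Function.comp]
    rw [e.left_inv hq]
  have h7 := (h5.congr_of_eventuallyEq h6).mfderiv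
  rw [dApply, h7]
  rfl

variable {A : ℝ → ∀ x : M, TangentSpace 𝓘(ℝ, E) x →L[ℝ] TangentSpace 𝓘(ℝ, E) x} {x₀ y₀ : M} {t₀ : ℝ}
  (hy₀ : y₀ ∈ (extChartAt 𝓘(ℝ, E) x₀).source)
  (hA : ContinuousAt (fun p : ℝ × E => localEnd (A p.1) x₀ p.2) (t₀, extChartAt 𝓘(ℝ, E) x₀ y₀))
  (hpos : ∀ ξ : TangentSpace 𝓘(ℝ, E) y₀, ξ ≠ 0 → 0 < ω.form y₀ ![ξ, A t₀ y₀ ξ])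
include hy₀ hA hpos hH

/-- Coercivity at one point survives nearby with half the constant, by continuity in the chart. The
Hamiltonian vector field is pointwise chosen, but `c ‖X‖² ≤ ω(X, A X) = dH(A X) ≤ K ‖X‖` bounds it
without any regularity of that choice. -/
theorem exists_local_bounds : ∃ c > 0, ∃ K, ∀ᶠ p : ℝ × M in 𝓝 t₀ ×ˢ 𝓝 y₀,
    (∀ ξ : TangentSpace 𝓘(ℝ, E) p.2, c * ‖chartD x₀ p.2 ξ‖ ^ 2 ≤ ω.form p.2 ![ξ, A p.1 p.2 ξ]) ∧
      ‖chartD x₀ p.2 (ω.hamVF (H p.1) p.2)‖ ≤ K := by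
  set e := extChartAt 𝓘(ℝ, E) x₀ with he
  let L : ℝ × E → E →L[ℝ] E := fun p => localEnd (A p.1) x₀ p.2
  let B : ℝ × E → E →L[ℝ] E →L[ℝ] ℝ := fun p =>
    (ContinuousLinearMap.flipₗᵢ ℝ E E ℝ (alt2 E (localForm ω.form x₀ p.2))).comp (L p)
  have hBapp : ∀ (t : ℝ) (y : M), y ∈ e.source → ∀ ξ : TangentSpace 𝓘(ℝ, E) y,
      B (t, e y) (chartD x₀ y ξ) (chartD x₀ y ξ) = ω.form y ![ξ, A t y ξ] := by
    intro t y hy ξ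
    change alt2 E (localForm ω.form x₀ (e y)) (chartD x₀ y ξ)
      (localEnd (A t) x₀ (e y) (chartD x₀ y ξ)) = _
    rw [← chartD_end (A t) hy, alt2_apply, ← form_eq_localForm ω.form hy]
  have hBc : ContinuousAt B (t₀, e y₀) := by
    have h1 : ContinuousAt (fun y => alt2 E (localForm ω.form x₀ y)) (e y₀) :=
      (alt2 E).continuous.continuousAt.comp ((ω.smooth x₀).continuousOn.continuousAt
        ((isOpen_extChartAt_target x₀).mem_nhds (e.map_source hy₀)))
    have h2 : ContinuousAt (fun p : ℝ × E => alt2 E (localForm ω.form x₀ p.2)) (t₀, e y₀) :=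
      h1.tendsto.comp (continuous_snd.tendsto (t₀, e y₀))
    exact ((ContinuousLinearMap.flipₗᵢ ℝ E E ℝ).continuous.continuousAt.comp h2).clm_comp hA
  obtain ⟨c, hc, hcB⟩ := exists_coercive (B (t₀, e y₀)) (by
    intro v hv
    obtain ⟨ξ, rfl⟩ := exists_chartD_eq hy₀ v
    rw [hBapp _ _ hy₀]
    refine hpos ξ ?_
    rintro rfl
    exact hv (map_zero _))
  let G : ℝ × E → ℝ × E →L[ℝ] ℝ := fderiv ℝ (fun p : ℝ × E => H p.1 (e.symm p.2))
  have hGc : ContinuousAt G (t₀, e y₀) :=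
    ((contDiffAt_hamiltonian_chart hH (t := t₀) (e.map_source hy₀)).fderiv_right (m := 0)
      (by norm_cast)).continuousAt
  have hte : Tendsto (fun p : ℝ × M => (p.1, e p.2)) (𝓝 t₀ ×ˢ 𝓝 y₀) (𝓝 (t₀, e y₀)) := by
    rw [nhds_prod_eq]
    exact Tendsto.prodMap tendsto_id (contMDiffAt_extChartAt_of_mem hy₀).continuousAt
  have hsrc : ∀ᶠ p : ℝ × M in 𝓝 t₀ ×ˢ 𝓝 y₀, p.2 ∈ e.source :=
    tendsto_snd.eventually ((isOpen_extChartAt_source (I := 𝓘(ℝ, E)) x₀).eventually_mem hy₀)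
  set KG := ‖G (t₀, e y₀)‖ + 1 with hKG
  set KL := ‖L (t₀, e y₀)‖ + 1 with hKL
  have h1 : ∀ᶠ p in 𝓝 (t₀, e y₀), ‖B p - B (t₀, e y₀)‖ < c / 2 := by
    exact (tendsto_iff_norm_sub_tendsto_zero.1 hBc.tendsto).eventually_lt_const (half_pos hc)
  have h2 : ∀ᶠ p in 𝓝 (t₀, e y₀), ‖G p‖ < KG := hGc.norm.eventually_lt_const (lt_add_one _)
  have h3 : ∀ᶠ p in 𝓝 (t₀, e y₀), ‖L p‖ < KL := hA.norm.eventually_lt_const (lt_add_one _)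
  refine ⟨c / 2, half_pos hc, KG * KL / (c / 2), ?_⟩
  filter_upwards [hte.eventually (h1.and (h2.and h3)), hsrc] with p hp hps
  obtain ⟨hp1, hp2, hp3⟩ := hp
  have hco : ∀ ξ : TangentSpace 𝓘(ℝ, E) p.2,
      c / 2 * ‖chartD x₀ p.2 ξ‖ ^ 2 ≤ ω.form p.2 ![ξ, A p.1 p.2 ξ] := by
    intro ξ
    rw [← hBapp p.1 p.2 hps ξ]
    set v := chartD x₀ p.2 ξ with hv
    have h4 := hcB v
    have h5 : |(B (p.1, e p.2) - B (t₀, e y₀)) v v| ≤ c / 2 * ‖v‖ * ‖v‖ := by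
      rw [← Real.norm_eq_abs]
      refine (ContinuousLinearMap.le_opNorm₂ _ _ _).trans ?_
      gcongr
    have h6 : (B (p.1, e p.2) - B (t₀, e y₀)) v v = B (p.1, e p.2) v v - B (t₀, e y₀) v v := rfl
    rw [h6] at h5
    have h7 := (abs_le.1 h5).1
    nlinarith
  refine ⟨hco, ?_⟩
  set ξ := ω.hamVF (H p.1) p.2 with hξ
  set v := chartD x₀ p.2 ξ with hv
  have h8 := hco ξ
  rw [ω.hamVF_spec, dApply_eq_chart hH hps, chartD_end (A p.1) hps] at h8
  have h9 : G (p.1, e p.2) (0, L (p.1, e p.2) v) ≤ KG * (KL * ‖v‖) := by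
    refine (le_abs_self _).trans ?_
    rw [← Real.norm_eq_abs]
    refine (ContinuousLinearMap.le_opNorm _ _).trans ?_
    have h10 : ‖((0 : ℝ), L (p.1, e p.2) v)‖ = ‖L (p.1, e p.2) v‖ := by
      rw [Prod.norm_mk, norm_zero, max_eq_right (norm_nonneg _)]
    rw [h10]
    refine mul_le_mul hp2.le ?_ (norm_nonneg _) (by positivity)
    exact (ContinuousLinearMap.le_opNorm _ _).trans
      (mul_le_mul_of_nonneg_right hp3.le (norm_nonneg _))
  have h11 : c / 2 * ‖v‖ ^ 2 ≤ KG * (KL * ‖v‖) := h8.trans h9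
  rw [le_div_iff₀ (half_pos hc)]
  rcases (norm_nonneg v).eq_or_lt with h0 | h0
  · rw [← h0, zero_mul]
    positivity
  · have : (c / 2 * ‖v‖) * ‖v‖ ≤ (KG * KL) * ‖v‖ := by nlinarith
    have := le_of_mul_le_mul_right this h0
    linarith

end Bounds

end Pants

namespace Pants

set_option maxSynthPendingDepth 3
set_option linter.unusedSectionVars false

universe u v

/-! ### The energy density on an end -/

section Pointwise

variable {E : Type v} [NormedAddCommGroup E] [NormedSpace ℝ E] [FiniteDimensional ℝ E]
  {M : Type u} [TopologicalSpace M] [ChartedSpace E M] [IsManifold 𝓘(ℝ, E) (⊤ : ℕ∞) M]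

theorem form_self (Ω : E [⋀^Fin 2]→L[ℝ] ℝ) (v : E) : Ω ![v, v] = 0 := by
  have := alternating_swap Ω v v
  linarith

theorem form_smul_add (Ω : E [⋀^Fin 2]→L[ℝ] ℝ) (ξ X v : E) (r : ℝ) :
    Ω ![ξ, r • X + v] = Ω ![ξ, v] - r * Ω ![X, ξ] := by
  rw [alternating_swap Ω X ξ, ← alt2_apply, ← alt2_apply, ← alt2_apply]
  simp only [map_add, map_smul, smul_eq_mul]
  ring

theorem form_conformal (Ω : E [⋀^Fin 2]→L[ℝ] ℝ) (D : ℂ →L[ℝ] E) (p : ℂ) :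
    Ω ![D p, D (Complex.I * p)] = ‖p‖ ^ 2 * Ω ![D 1, D Complex.I] := by
  have h0 : ∀ a b : ℝ, Ω ![D (a • (1 : ℂ) + b • Complex.I), D (a • Complex.I - b • (1 : ℂ))]
      = (a * a + b * b) * Ω ![D 1, D Complex.I] := by
    intro a b
    have h3 : ∀ v : E, alt2 E Ω v v = 0 := fun v => by rw [alt2_apply, form_self]
    have h4 : alt2 E Ω (D Complex.I) (D 1) = - alt2 E Ω (D 1) (D Complex.I) := by
      rw [alt2_apply, alt2_apply, alternating_swap]
    rw [← alt2_apply, ← alt2_apply]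
    simp only [map_add, map_sub, map_smul, add_apply, smul_apply, smul_eq_mul, h3, h4]
    ring
  rw [← Complex.normSq_eq_norm_sq, Complex.normSq_apply, ← h0]
  congr 2
  · congr 1
    apply Complex.ext <;> simp
  · congr 2
    apply Complex.ext <;> simp

theorem areaDensity_comp {ω : SymplecticForm E M} {u : ℂ → M} {ψ : ℂ → ℂ} {ζ : ℂ}
    (hu : MDifferentiableAt 𝓘(ℝ, ℂ) 𝓘(ℝ, E) u (ψ ζ)) (hψ : DifferentiableAt ℂ ψ ζ) :
    areaDensity ω (fun ζ => u (ψ ζ)) ζ = ‖deriv ψ ζ‖ ^ 2 * areaDensity ω u (ψ ζ) := by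
  have h1 := (hu.hasMFDerivAt.comp ζ (hasFDerivAt_cderiv hψ).hasMFDerivAt).mfderiv
  have h2 : ∀ v : ℂ, mfderiv 𝓘(ℝ, ℂ) 𝓘(ℝ, E) (fun ζ => u (ψ ζ)) ζ v
      = mfderiv 𝓘(ℝ, ℂ) 𝓘(ℝ, E) u (ψ ζ) (v * deriv ψ ζ) := fun v => by
    rw [show (fun ζ => u (ψ ζ)) = u ∘ ψ from rfl, h1]
    rfl
  let D : ℂ →L[ℝ] TangentSpace 𝓘(ℝ, E) (u (ψ ζ)) := mfderiv 𝓘(ℝ, ℂ) 𝓘(ℝ, E) u (ψ ζ)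
  have h3 := form_conformal (E := E) (ω.form (u (ψ ζ))) D (deriv ψ ζ)
  rw [areaDensity]
  rw [h2, h2, one_mul]
  exact h3

variable {i : Fin 3} {ω : SymplecticForm E M} {H : ℝ → M → ℝ} {ρ : ℝ → ℝ} {R₁ R₂ : ℝ}
  {J : ℂ → ∀ x : M, TangentSpace 𝓘(ℝ, E) x →L[ℝ] TangentSpace 𝓘(ℝ, E) x}
  {ψ : ℂ → ℂ} {u : ℂ → M}

/-- The derivative of `u` in the first cylinder coordinate. -/
def dtau (E : Type v) [NormedAddCommGroup E] [NormedSpace ℝ E] [ChartedSpace E M] (ψ : ℂ → ℂ)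
    (u : ℂ → M) (ζ : ℂ) : TangentSpace 𝓘(ℝ, E) (u (ψ ζ)) :=
  mfderiv 𝓘(ℝ, ℂ) 𝓘(ℝ, E) (fun ζ' => u (ψ ζ')) ζ (1 : ℂ)

/-- The derivative of `u` in the second cylinder coordinate. -/
def dt (E : Type v) [NormedAddCommGroup E] [NormedSpace ℝ E] [ChartedSpace E M] (ψ : ℂ → ℂ)
    (u : ℂ → M) (ζ : ℂ) : TangentSpace 𝓘(ℝ, E) (u (ψ ζ)) :=
  mfderiv 𝓘(ℝ, ℂ) 𝓘(ℝ, E) (fun ζ' => u (ψ ζ')) ζ Complex.I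

/-- The vertical component of the holomorphic equation at `∂_τ` is Floer's equation. -/
theorem dt_eq (hhol : IsHolomorphicOnEnd ω H ρ J i ψ u) {ζ : ℂ} (hζ : 0 < sgn i * ζ.re) :
    dt E ψ u ζ = ρ ζ.re • ω.hamVF (H ζ.im) (u (ψ ζ)) + J (ψ ζ) (u (ψ ζ)) (dtau E ψ u ζ) := by
  have h := congrArg Prod.snd (hhol ζ hζ 1)
  rw [mul_one] at h
  refine h.trans ?_
  simp [Jtilde, horLift, vertProj, sectionDeriv, dtau]

theorem vertNormSq_zero {ζ : ℂ} {x : M}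
    {A : TangentSpace 𝓘(ℝ, E) x →L[ℝ] TangentSpace 𝓘(ℝ, E) x} (v : TangentSpace 𝓘(ℝ, E) x) :
    vertNormSq ω H ρ ζ x A ((0, v) : TP E x) = ω.form x ![v, A v] := by
  simp [vertNormSq, omegaP, Jtilde, horLift, vertProj]

/-- The vertical parts of the two coordinate derivatives are `∂_τ u` and `J ∂_τ u`, which have the
same norm because `J` preserves `ω`. -/
theorem vertEnergyDensity_eq (hψ : IsCylinderCoordinate i ψ) (hJ : IsCompatibleFamily ω J)
    (hhol : IsHolomorphicOnEnd ω H ρ J i ψ u) {ζ : ℂ} (hζ : 0 < sgn i * ζ.re) :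
    vertEnergyDensity ω H ρ J ψ u ζ
      = 2 * ω.form (u (ψ ζ)) ![dtau E ψ u ζ, J (ψ ζ) (u (ψ ζ)) (dtau E ψ u ζ)] := by
  have h1 : vertProj ω H ρ ζ (u (ψ ζ)) (sectionDeriv ψ u ζ 1)
      = ((0, dtau E ψ u ζ) : TP E (u (ψ ζ))) := by
    refine Prod.ext ?_ ?_ <;> simp [vertProj, horLift, sectionDeriv, dtau]
  have h2 : vertProj ω H ρ ζ (u (ψ ζ)) (sectionDeriv ψ u ζ Complex.I)
      = ((0, J (ψ ζ) (u (ψ ζ)) (dtau E ψ u ζ)) : TP E (u (ψ ζ))) := by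
    refine Prod.ext ?_ ?_
    · simp [vertProj, horLift, sectionDeriv]
    · have h3 : (vertProj ω H ρ ζ (u (ψ ζ)) (sectionDeriv ψ u ζ Complex.I)).2
          = dt E ψ u ζ - (Complex.I.im * ρ ζ.re) • ω.hamVF (H ζ.im) (u (ψ ζ)) := rfl
      rw [h3, dt_eq hhol hζ, Complex.I_im, one_mul, add_sub_cancel_left]
  rw [vertEnergyDensity, h1, h2, vertNormSq_zero, vertNormSq_zero,
    hJ.invariant _ (hψ.mem_surface hζ.le)]
  ring

theorem form_dt (hhol : IsHolomorphicOnEnd ω H ρ J i ψ u) {ζ : ℂ} (hζ : 0 < sgn i * ζ.re) :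
    areaDensity ω (fun ζ => u (ψ ζ)) ζ
      = ω.form (u (ψ ζ)) ![dtau E ψ u ζ, J (ψ ζ) (u (ψ ζ)) (dtau E ψ u ζ)]
        - ρ ζ.re * dApply (H ζ.im) (u (ψ ζ)) (dtau E ψ u ζ) := by
  change ω.form (u (ψ ζ)) ![dtau E ψ u ζ, dt E ψ u ζ] = _
  rw [dt_eq hhol hζ, ← ω.hamVF_spec]
  exact form_smul_add (E := E) (ω.form (u (ψ ζ))) _ _ _ _

theorem pullbackDensity_eq {ζ : ℂ} :
    pullbackDensity ω H ρ ψ u ζ = areaDensity ω (fun ζ => u (ψ ζ)) ζ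
      + curvatureDensity H ρ ψ u ζ + ρ ζ.re * dApply (H ζ.im) (u (ψ ζ)) (dtau E ψ u ζ) := by
  simp [pullbackDensity, omegaP, sectionDeriv, dRhoH, areaDensity, curvatureDensity, dtau]
  ring

/-- Inserting Floer's equation in `ω(∂_τ u, ∂_t u)` produces `-ρ dH(∂_τ u)`, which cancels the same
term of `d(ρ H) ∧ dt`; only the derivative of `ρ` is left over. -/
theorem pullbackDensity_eq_energy (hψ : IsCylinderCoordinate i ψ) (hJ : IsCompatibleFamily ω J)
    (hhol : IsHolomorphicOnEnd ω H ρ J i ψ u) {ζ : ℂ} (hζ : 0 < sgn i * ζ.re) :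
    pullbackDensity ω H ρ ψ u ζ = 1 / 2 * vertEnergyDensity ω H ρ J ψ u ζ
      + curvatureDensity H ρ ψ u ζ := by
  rw [pullbackDensity_eq, form_dt hhol hζ, vertEnergyDensity_eq hψ hJ hhol hζ]
  ring

theorem vertEnergyDensity_nonneg (hψ : IsCylinderCoordinate i ψ) (hJ : IsCompatibleFamily ω J)
    (hhol : IsHolomorphicOnEnd ω H ρ J i ψ u) {ζ : ℂ} (hζ : 0 < sgn i * ζ.re) :
    0 ≤ vertEnergyDensity ω H ρ J ψ u ζ := by
  rw [vertEnergyDensity_eq hψ hJ hhol hζ]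
  by_cases h : dtau E ψ u ζ = 0
  · rw [h, (ω.form (u (ψ ζ))).map_coord_zero 0 rfl, mul_zero]
  · have := hJ.positive _ (hψ.mem_surface hζ.le) _ _ h
    positivity

theorem contDiffAt_coordinate (hψ : IsCylinderCoordinate i ψ) {ζ : ℂ} (hζ : 0 < sgn i * ζ.re) :
    ContDiffAt ℝ (⊤ : ℕ∞) ψ ζ := by
  have h1 : AnalyticAt ℂ ψ ζ := hψ.holomorphic.analyticAt ((isOpen_end _ 0).mem_nhds hζ)
  exact (h1.contDiffAt (n := (⊤ : ℕ∞))).restrict_scalars ℝ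

theorem contMDiffAt_end (hψ : IsCylinderCoordinate i ψ)
    (hu : ContMDiffOn 𝓘(ℝ, ℂ) 𝓘(ℝ, E) (⊤ : ℕ∞) u surface) {ζ : ℂ} (hζ : 0 < sgn i * ζ.re) :
    ContMDiffAt 𝓘(ℝ, ℂ) 𝓘(ℝ, E) (⊤ : ℕ∞) (fun ζ => u (ψ ζ)) ζ :=
  ContMDiffAt.comp (f := ψ) ζ (hu.contMDiffAt (isOpen_surface.mem_nhds (hψ.mem_surface hζ.le)))
    (contDiffAt_coordinate hψ hζ).contMDiffAt

theorem contDiffAt_hamiltonian_end (hψ : IsCylinderCoordinate i ψ)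
    (hu : ContMDiffOn 𝓘(ℝ, ℂ) 𝓘(ℝ, E) (⊤ : ℕ∞) u surface) (hH : IsPeriodicHamiltonian (E := E) H)
    {ζ : ℂ} (hζ : 0 < sgn i * ζ.re) :
    ContDiffAt ℝ (⊤ : ℕ∞) (fun ζ : ℂ => H ζ.im (u (ψ ζ))) ζ := by
  have h1 : ContMDiffAt 𝓘(ℝ, ℂ) 𝓘(ℝ, ℝ) (⊤ : ℕ∞) Complex.im ζ :=
    Complex.imCLM.contDiff.contMDiff.contMDiffAt
  have h2 := (hH.smooth.contMDiffAt (x := (ζ.im, u (ψ ζ)))).comp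
    (f := fun ζ : ℂ => (ζ.im, u (ψ ζ))) ζ (h1.prodMk (contMDiffAt_end hψ hu hζ))
  exact h2.contDiffAt

/-- Along a line parallel to the `τ` axis the time argument of `H` is constant, so only the
derivative in the direction of `M` contributes. -/
theorem fderiv_hamiltonian_end (hψ : IsCylinderCoordinate i ψ)
    (hu : ContMDiffOn 𝓘(ℝ, ℂ) 𝓘(ℝ, E) (⊤ : ℕ∞) u surface) (hH : IsPeriodicHamiltonian (E := E) H)
    {ζ : ℂ} (hζ : 0 < sgn i * ζ.re) :
    fderiv ℝ (fun ζ : ℂ => H ζ.im (u (ψ ζ))) ζ 1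
      = dApply (H ζ.im) (u (ψ ζ)) (dtau E ψ u ζ) := by
  have h1 := ((contDiffAt_hamiltonian_end hψ hu hH hζ).differentiableAt (by simp)).hasFDerivAt
  have h2 := (mdifferentiableAt_hamiltonian hH ζ.im (u (ψ ζ))).hasMFDerivAt
  have h3 := hasMFDerivAt_iff_hasFDerivAt.1 (h2.comp ζ
    ((contMDiffAt_end hψ hu hζ).mdifferentiableAt (by simp)).hasMFDerivAt)
  have hl : HasDerivAt (fun r : ℝ => ζ + (r : ℂ)) 1 0 :=
    (Complex.ofRealCLM.hasDerivAt (x := (0 : ℝ))).const_add ζ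
  have e0 : ζ + ((0 : ℝ) : ℂ) = ζ := by simp
  have h4 := HasFDerivAt.comp_hasDerivAt (0 : ℝ) (f := fun r : ℝ => ζ + (r : ℂ))
    (by rw [e0]; exact h1) hl
  have h5 := HasFDerivAt.comp_hasDerivAt (0 : ℝ) (f := fun r : ℝ => ζ + (r : ℂ))
    (by rw [e0]; exact h3) hl
  have h6 : (fun ζ : ℂ => H ζ.im (u (ψ ζ))) ∘ (fun r : ℝ => ζ + (r : ℂ))
      = (H ζ.im ∘ fun ζ' => u (ψ ζ')) ∘ (fun r : ℝ => ζ + (r : ℂ)) := by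
    ext r
    simp
  rw [h6] at h4
  exact h4.unique h5

/-- The primitive `ρ H` of the Hamiltonian part of the energy. -/
def rhoH (H : ℝ → M → ℝ) (ρ : ℝ → ℝ) (ψ : ℂ → ℂ) (u : ℂ → M) (ζ : ℂ) : ℝ :=
  ρ ζ.re * H ζ.im (u (ψ ζ))

theorem contDiffAt_rhoH (hψ : IsCylinderCoordinate i ψ)
    (hu : ContMDiffOn 𝓘(ℝ, ℂ) 𝓘(ℝ, E) (⊤ : ℕ∞) u surface) (hH : IsPeriodicHamiltonian (E := E) H)
    (hρ : IsCutOff i R₁ R₂ ρ) {ζ : ℂ} (hζ : 0 < sgn i * ζ.re) :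
    ContDiffAt ℝ (⊤ : ℕ∞) (rhoH H ρ ψ u) ζ :=
  (hρ.smooth.comp Complex.reCLM.contDiff).contDiffAt.mul (contDiffAt_hamiltonian_end hψ hu hH hζ)

theorem fderiv_rhoH (hψ : IsCylinderCoordinate i ψ)
    (hu : ContMDiffOn 𝓘(ℝ, ℂ) 𝓘(ℝ, E) (⊤ : ℕ∞) u surface) (hH : IsPeriodicHamiltonian (E := E) H)
    (hρ : IsCutOff i R₁ R₂ ρ) {ζ : ℂ} (hζ : 0 < sgn i * ζ.re) :
    fderiv ℝ (rhoH H ρ ψ u) ζ 1 = curvatureDensity H ρ ψ u ζ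
      + ρ ζ.re * dApply (H ζ.im) (u (ψ ζ)) (dtau E ψ u ζ) := by
  have h1 : HasFDerivAt (fun ζ : ℂ => ρ ζ.re) _ ζ :=
    (((hρ.smooth.differentiable (by simp)) ζ.re).hasDerivAt.hasFDerivAt).comp ζ
      Complex.reCLM.hasFDerivAt
  have h2 := ((contDiffAt_hamiltonian_end hψ hu hH hζ).differentiableAt (by simp)).hasFDerivAt
  have h3 : HasFDerivAt (rhoH H ρ ψ u) _ ζ := h1.mul h2
  rw [h3.fderiv, ← fderiv_hamiltonian_end hψ hu hH hζ]
  simp [curvatureDensity]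
  ring

/-- The term `ρ dH(∂_τ u)` is rewritten as a total `τ`-derivative minus curvature, so integration up
to depth `T` leaves an area, a circle integral and the curvature integral. -/
theorem energy_eq (hψ : IsCylinderCoordinate i ψ)
    (hu : ContMDiffOn 𝓘(ℝ, ℂ) 𝓘(ℝ, E) (⊤ : ℕ∞) u surface) (hH : IsPeriodicHamiltonian (E := E) H)
    (hρ : IsCutOff i R₁ R₂ ρ) (hJ : IsCompatibleFamily ω J)
    (hhol : IsHolomorphicOnEnd ω H ρ J i ψ u) {ζ : ℂ} (hζ : 0 < sgn i * ζ.re) :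
    1 / 2 * vertEnergyDensity ω H ρ J ψ u ζ = ‖deriv ψ ζ‖ ^ 2 * areaDensity ω u (ψ ζ)
      + fderiv ℝ (rhoH H ρ ψ u) ζ 1 - curvatureDensity H ρ ψ u ζ := by
  have h1 := pullbackDensity_eq (ω := ω) (H := H) (ρ := ρ) (ψ := ψ) (u := u) (ζ := ζ)
  rw [pullbackDensity_eq_energy hψ hJ hhol hζ] at h1
  rw [fderiv_rhoH hψ hu hH hρ hζ, ← areaDensity_comp ((hu.contMDiffAt (isOpen_surface.mem_nhds
    (hψ.mem_surface hζ.le))).mdifferentiableAt (by simp)) (hψ.differentiableAt hζ)]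
  linarith

theorem continuousOn_areaDensity_surface (ω : SymplecticForm E M)
    (hu : ContMDiffOn 𝓘(ℝ, ℂ) 𝓘(ℝ, E) (⊤ : ℕ∞) u surface) :
    ContinuousOn (areaDensity ω u) surface := by
  intro q hq
  have hs := isOpen_surface
  obtain ⟨g, hg, h⟩ := exists_areaDensity_eq (hu q hq) (mem_extChartAt_source (u q))
    hs.uniqueDiffOn hq ω
  rw [nhdsWithin_eq_nhds.2 (hs.mem_nhds hq)] at h
  refine ((hg.continuousAt (hs.mem_nhds hq)).congr ?_).continuousWithinAt
  filter_upwards [h, hs.mem_nhds hq] with x hx hxs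
  exact (hx (by rwa [hs.interior_eq]) (hu.contMDiffAt (hs.mem_nhds hxs))).symm

theorem continuousAt_curvatureDensity (hψ : IsCylinderCoordinate i ψ)
    (hu : ContMDiffOn 𝓘(ℝ, ℂ) 𝓘(ℝ, E) (⊤ : ℕ∞) u surface) (hH : IsPeriodicHamiltonian (E := E) H)
    (hρ : IsCutOff i R₁ R₂ ρ) {ζ : ℂ} (hζ : 0 < sgn i * ζ.re) :
    ContinuousAt (curvatureDensity H ρ ψ u) ζ := by
  have h1 : Continuous (deriv ρ) := hρ.smooth.continuous_deriv (by simp)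
  exact (h1.comp Complex.continuous_re).continuousAt.mul
    (contDiffAt_hamiltonian_end hψ hu hH hζ).continuousAt

theorem continuousAt_fderiv_rhoH (hψ : IsCylinderCoordinate i ψ)
    (hu : ContMDiffOn 𝓘(ℝ, ℂ) 𝓘(ℝ, E) (⊤ : ℕ∞) u surface) (hH : IsPeriodicHamiltonian (E := E) H)
    (hρ : IsCutOff i R₁ R₂ ρ) {ζ : ℂ} (hζ : 0 < sgn i * ζ.re) :
    ContinuousAt (fun ζ => fderiv ℝ (rhoH H ρ ψ u) ζ 1) ζ :=
  (((contDiffAt_rhoH hψ hu hH hρ hζ).fderiv_right (m := 0) (by norm_cast)).continuousAt).clm_apply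
    continuousAt_const

theorem continuousAt_energy (hψ : IsCylinderCoordinate i ψ)
    (hu : ContMDiffOn 𝓘(ℝ, ℂ) 𝓘(ℝ, E) (⊤ : ℕ∞) u surface) (hH : IsPeriodicHamiltonian (E := E) H)
    (hρ : IsCutOff i R₁ R₂ ρ) (hJ : IsCompatibleFamily ω J)
    (hhol : IsHolomorphicOnEnd ω H ρ J i ψ u) {ζ : ℂ} (hζ : 0 < sgn i * ζ.re) :
    ContinuousAt (fun ζ => 1 / 2 * vertEnergyDensity ω H ρ J ψ u ζ) ζ := by
  have hO := isOpen_end (sgn i) 0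
  have h1 : ContinuousAt (fun ζ => ‖deriv ψ ζ‖ ^ 2 * areaDensity ω u (ψ ζ)) ζ := by
    have h2 := ((hψ.holomorphic.deriv hO).differentiableAt (hO.mem_nhds hζ)).continuousAt
    have h3 := (continuousOn_areaDensity_surface ω hu).continuousAt
      (isOpen_surface.mem_nhds (hψ.mem_surface hζ.le))
    exact (h2.norm.pow 2).mul (ContinuousAt.comp (f := ψ) h3 (hψ.differentiableAt hζ).continuousAt)
  refine ((h1.add (continuousAt_fderiv_rhoH hψ hu hH hρ hζ)).sub
    (continuousAt_curvatureDensity hψ hu hH hρ hζ)).congr ?_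
  filter_upwards [hO.mem_nhds hζ] with x hx
  exact (energy_eq hψ hu hH hρ hJ hhol hx).symm

end Pointwise

end Pants

namespace Pants

set_option maxSynthPendingDepth 3
set_option linter.unusedSectionVars false

universe u v

/-! ### Energy and curvature integrals on one end -/

theorem re_cylMap {s : ℝ} (hs : s = 1 ∨ s = -1) (x t : ℝ) : s * (cylMap s (x, t)).re = x :=
  sign_mul_sign_mul hs x

theorem ContinuousAt.comp_cylMap {s : ℝ} (hs : s = 1 ∨ s = -1) {g : ℂ → ℝ} {T T' : ℝ} (hT : 0 < T)
    (hg : ∀ ζ : ℂ, 0 < s * ζ.re → ContinuousAt g ζ) :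
    ContinuousOn (fun p => g (cylMap s p)) (Icc T T' ×ˢ Icc 0 1) := by
  rintro ⟨x, t⟩ hp
  have h := hg (cylMap s (x, t)) (by rw [re_cylMap hs]; exact hT.trans_le hp.1.1)
  exact (ContinuousAt.comp (f := cylMap s) h (continuous_cylMap s).continuousAt).continuousWithinAt

/-- The fundamental theorem of calculus in the first cylinder coordinate. -/
theorem integral_fderiv_one_strip {s : ℝ} (hs : s = 1 ∨ s = -1) {F : ℂ → ℝ} {T T' : ℝ}
    (hT : 0 < T) (hTT' : T ≤ T') (hF : ∀ ζ : ℂ, 0 < s * ζ.re → ContDiffAt ℝ 1 F ζ) :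
    ∫ ζ in strip s T T', fderiv ℝ F ζ 1
      = s * ((∫ t in (0 : ℝ)..1, F (cylMap s (T', t))) - ∫ t in (0 : ℝ)..1, F (cylMap s (T, t))) := by
  have hcont : ContinuousOn (fun p => fderiv ℝ F (cylMap s p) 1) (Icc T T' ×ˢ Icc 0 1) :=
    ContinuousAt.comp_cylMap (g := fun ζ => fderiv ℝ F ζ 1) hs hT fun ζ hζ =>
      (((hF ζ hζ).fderiv_right (m := 0) (by norm_num)).continuousAt).clm_apply continuousAt_const
  rw [integral_strip hs hTT' hcont]
  let m : ℝ × ℝ →L[ℝ] ℂ := (Complex.ofRealCLM.comp (s • ContinuousLinearMap.fst ℝ ℝ ℝ)) +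
    (ContinuousLinearMap.toSpanSingleton ℝ Complex.I).comp (ContinuousLinearMap.snd ℝ ℝ ℝ)
  have hm : ∀ p, cylMap s p = m p := fun p => by
    apply Complex.ext <;> simp [cylMap, m]
  have hm1 : m (1, 0) = s := by simp [m]
  have hpt : ∀ p : ℝ × ℝ, (s • (fderiv ℝ F (cylMap s p)).comp m) (1, 0)
      + (0 : ℝ × ℝ →L[ℝ] ℝ) (0, 1) = fderiv ℝ F (cylMap s p) 1 := by
    intro p
    simp only [smul_apply, zero_apply, ContinuousLinearMap.comp_apply, hm1, add_zero]
    rw [← map_smul, Complex.real_smul, ← Complex.ofReal_mul]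
    have := sign_mul_sign_mul hs 1
    rw [mul_one] at this
    rw [this, Complex.ofReal_one]
  have hdiv := integral2_divergence_prod_of_hasFDerivAt
    (fun p => s • F (cylMap s p)) (fun _ => (0 : ℝ))
    (fun p => s • (fderiv ℝ F (cylMap s p)).comp m) (fun _ => 0) T 0 T' 1
    (by rw [uIcc_of_le hTT', uIcc_of_le zero_le_one]
        exact (ContinuousAt.comp_cylMap hs hT fun ζ hζ => (hF ζ hζ).continuousAt).const_smul s)
    continuousOn_const
    (by
      rw [min_eq_left hTT', max_eq_right hTT', min_eq_left zero_le_one, max_eq_right zero_le_one]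
      rintro ⟨x, t⟩ hp
      have h1 := ((hF (cylMap s (x, t)) (by rw [re_cylMap hs]; exact hT.trans hp.1.1)).differentiableAt
        (by simp)).hasFDerivAt
      have h2 : HasFDerivAt (cylMap s) m (x, t) := by
        rw [funext hm]; exact m.hasFDerivAt
      exact (h1.comp (x, t) h2).const_smul s)
    (fun p _ => hasFDerivAt_const _ _)
    (by
      rw [uIcc_of_le hTT', uIcc_of_le zero_le_one]
      refine (integrableOn_congr_fun (fun p _ => hpt p)
        (measurableSet_Icc.prod measurableSet_Icc)).2 ?_
      exact hcont.integrableOn_compact (isCompact_Icc.prod isCompact_Icc))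
  simp only [hpt] at hdiv
  rw [hdiv]
  simp only [smul_eq_mul, intervalIntegral.integral_const_mul, intervalIntegral.integral_zero]
  ring

section End

variable {E : Type v} [NormedAddCommGroup E] [NormedSpace ℝ E] [FiniteDimensional ℝ E]
  {M : Type u} [TopologicalSpace M] [ChartedSpace E M] [IsManifold 𝓘(ℝ, E) (⊤ : ℕ∞) M]
  {i : Fin 3} {ω : SymplecticForm E M} {H : ℝ → M → ℝ} {ρ : ℝ → ℝ} {R₁ R₂ : ℝ}
  {J : ℂ → ∀ x : M, TangentSpace 𝓘(ℝ, E) x →L[ℝ] TangentSpace 𝓘(ℝ, E) x}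
  {ψ : ℂ → ℂ} {u : ℂ → M}

theorem IsCutOff.deriv_eq_zero (hρ : IsCutOff i R₁ R₂ ρ) {τ : ℝ}
    (hτ : sgn i * τ < R₁ ∨ R₂ < sgn i * τ) : deriv ρ τ = 0 := by
  have hc : Continuous fun τ : ℝ => sgn i * τ := continuous_const.mul continuous_id
  rcases hτ with h | h
  · have : ρ =ᶠ[𝓝 τ] fun _ => 0 := by
      filter_upwards [(isOpen_lt hc continuous_const).mem_nhds h] with x hx
      exact hρ.inner x (le_of_lt hx)
    rw [this.deriv_eq, deriv_const]
  · have : ρ =ᶠ[𝓝 τ] fun _ => 1 := by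
      filter_upwards [(isOpen_lt continuous_const hc).mem_nhds h] with x hx
      exact hρ.outer x (le_of_lt hx)
    rw [this.deriv_eq, deriv_const]

theorem curvatureDensity_eq_zero (hρ : IsCutOff i R₁ R₂ ρ) {ζ : ℂ}
    (hζ : sgn i * ζ.re < R₁ ∨ R₂ < sgn i * ζ.re) : curvatureDensity H ρ ψ u ζ = 0 := by
  rw [curvatureDensity, hρ.deriv_eq_zero hζ, zero_mul]

/-- The derivative of `ρ` vanishes outside depths `R₁` to `R₂`. The strip starts at `R₁ / 2` so that
its closure stays off the seam, where `ψ` need not be differentiable. -/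
theorem curvature_integrable (hψ : IsCylinderCoordinate i ψ)
    (hu : ContMDiffOn 𝓘(ℝ, ℂ) 𝓘(ℝ, E) (⊤ : ℕ∞) u surface) (hH : IsPeriodicHamiltonian (E := E) H)
    (hR₁ : 0 < R₁) (hρ : IsCutOff i R₁ R₂ ρ) {T : ℝ} (hT : R₂ ≤ T) :
    IntegrableOn (curvatureDensity H ρ ψ u) (cyl i) ∧
    ∫ ζ in cyl i, curvatureDensity H ρ ψ u ζ
      = ∫ ζ in strip (sgn i) (R₁ / 2) T, curvatureDensity H ρ ψ u ζ := by
  have h0 : ∀ ζ ∈ cyl i \ strip (sgn i) (R₁ / 2) T, curvatureDensity H ρ ψ u ζ = 0 := by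
    intro ζ hζ
    apply curvatureDensity_eq_zero hρ
    by_contra hn
    push Not at hn
    exact hζ.2 ⟨by linarith [hn.1], hn.2.trans hT, hζ.1.2⟩
  have hsub : strip (sgn i) (R₁ / 2) T ⊆ cyl i := fun ζ h => ⟨by linarith [h.1], h.2.2⟩
  have h1 : IntegrableOn (curvatureDensity H ρ ψ u) (strip (sgn i) (R₁ / 2) T) :=
    integrableOn_strip (sgn_eq i) (ContinuousAt.comp_cylMap (sgn_eq i) (half_pos hR₁)
      fun ζ hζ => continuousAt_curvatureDensity hψ hu hH hρ hζ)
  exact ⟨h1.of_forall_sdiff_eq_zero (measurableSet_cyl i) h0,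
    (setIntegral_eq_of_subset_of_forall_sdiff_eq_zero (measurableSet_cyl i) hsub h0)⟩

/-- As a function of depth, `ρ` increases from zero to one, so `sgn i * ρ'` is nonnegative with
integral one. Multiplying the bound on `-sgn i * H` by it and integrating gives the claim for every
cut-off function. -/
theorem neg_integral_curvature_le (hψ : IsCylinderCoordinate i ψ)
    (hu : ContMDiffOn 𝓘(ℝ, ℂ) 𝓘(ℝ, E) (⊤ : ℕ∞) u surface) (hH : IsPeriodicHamiltonian (E := E) H)
    (hR₁ : 0 < R₁) (hR : R₁ < R₂) (hρ : IsCutOff i R₁ R₂ ρ) {m : ℝ → ℝ} (hm : Continuous m)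
    (hHm : ∀ t y, -(sgn i * H t y) ≤ m t) :
    -∫ ζ in cyl i, curvatureDensity H ρ ψ u ζ ≤ ∫ t in (0 : ℝ)..1, m t := by
  have hs := sgn_eq i
  have hss : sgn i * sgn i = 1 := by have := sign_mul_sign_mul hs 1; rwa [mul_one] at this
  have hr : R₁ / 2 ≤ R₂ := by linarith
  have hd : ∀ x, HasDerivAt (fun x => ρ (sgn i * x)) (sgn i * deriv ρ (sgn i * x)) x := by
    intro x
    have h1 := ((hρ.smooth.differentiable (by simp)) (sgn i * x)).hasDerivAt
    have h2 : HasDerivAt (fun x => sgn i * x) (sgn i * 1) x := (hasDerivAt_id x).const_mul _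
    have := h1.scomp x h2
    rw [mul_one, smul_eq_mul] at this
    exact this
  have hmono : Monotone fun x => ρ (sgn i * x) := fun x y hxy =>
    hρ.monotone _ _ (by rwa [sign_mul_sign_mul hs, sign_mul_sign_mul hs])
  have hκ : ∀ x, 0 ≤ sgn i * deriv ρ (sgn i * x) := fun x => by
    rw [← (hd x).deriv]; exact hmono.deriv_nonneg
  have hdc : Continuous (deriv ρ) := hρ.smooth.continuous_deriv (by simp)
  have hg : ContinuousOn (fun p : ℝ × ℝ => (fun ζ : ℂ => sgn i * deriv ρ ζ.re * m ζ.im)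
      (cylMap (sgn i) p)) (Icc (R₁ / 2) R₂ ×ˢ Icc 0 1) := by
    refine ContinuousAt.comp_cylMap (g := fun ζ : ℂ => sgn i * deriv ρ ζ.re * m ζ.im) hs
      (half_pos hR₁) fun ζ _ => Continuous.continuousAt ?_
    exact (continuous_const.mul (hdc.comp Complex.continuous_re)).mul
      (hm.comp Complex.continuous_im)
  have h1 := (curvature_integrable hψ hu hH hR₁ hρ le_rfl)
  rw [h1.2, ← integral_neg]
  have hsub : strip (sgn i) (R₁ / 2) R₂ ⊆ cyl i := fun ζ h => ⟨by linarith [h.1], h.2.2⟩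
  have h2 : ∫ ζ in strip (sgn i) (R₁ / 2) R₂, -curvatureDensity H ρ ψ u ζ
      ≤ ∫ ζ in strip (sgn i) (R₁ / 2) R₂, sgn i * deriv ρ ζ.re * m ζ.im := by
    refine setIntegral_mono_on (h1.1.mono_set hsub).neg (integrableOn_strip hs hg)
      (measurableSet_strip _ _ _) fun ζ _ => ?_
    have h3 := mul_le_mul_of_nonneg_left (hHm ζ.im (u (ψ ζ))) (hκ (sgn i * ζ.re))
    rw [sign_mul_sign_mul hs] at h3
    refine le_trans (le_of_eq ?_) h3
    rw [curvatureDensity]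
    linear_combination (deriv ρ ζ.re * H ζ.im (u (ψ ζ))) * hss
  refine h2.trans (le_of_eq ?_)
  rw [integral_strip hs hr hg]
  have h4 : ∀ x : ℝ, ∫ t in (0 : ℝ)..1, sgn i * deriv ρ (cylMap (sgn i) (x, t)).re
      * m (cylMap (sgn i) (x, t)).im = sgn i * deriv ρ (sgn i * x) * ∫ t in (0 : ℝ)..1, m t :=
    fun x => intervalIntegral.integral_const_mul (sgn i * deriv ρ (sgn i * x)) m
  simp only [h4]
  rw [intervalIntegral.integral_mul_const,
    intervalIntegral.integral_eq_sub_of_hasDerivAt (fun x _ => hd x)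
      ((continuous_const.mul (hdc.comp (continuous_const.mul continuous_id))).intervalIntegrable _ _),
    hρ.outer _ (by rw [sign_mul_sign_mul hs]),
    hρ.inner _ (by rw [sign_mul_sign_mul hs]; linarith)]
  ring

/-- In the integral of `energy_eq` the total derivative of `ρ H` contributes only the circle at
depth `T`, where `ρ = 1`, since `ρ` vanishes near the seam. Integrability of the area up to the seam
is an assumption here and comes from Stokes' theorem. -/
theorem energy_strip (hψ : IsCylinderCoordinate i ψ)
    (hu : ContMDiffOn 𝓘(ℝ, ℂ) 𝓘(ℝ, E) (⊤ : ℕ∞) u surface) (hH : IsPeriodicHamiltonian (E := E) H)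
    (hR₁ : 0 < R₁) (hR : R₁ < R₂) (hρ : IsCutOff i R₁ R₂ ρ) (hJ : IsCompatibleFamily ω J)
    (hhol : IsHolomorphicOnEnd ω H ρ J i ψ u) {T : ℝ} (hT : R₂ ≤ T)
    (harea : IntegrableOn (fun ζ => ‖deriv ψ ζ‖ ^ 2 * areaDensity ω u (ψ ζ)) (strip (sgn i) 0 T)) :
    IntegrableOn (fun ζ => 1 / 2 * vertEnergyDensity ω H ρ J ψ u ζ) (strip (sgn i) 0 T) ∧
    ∫ ζ in strip (sgn i) 0 T, 1 / 2 * vertEnergyDensity ω H ρ J ψ u ζ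
      = (∫ ζ in strip (sgn i) 0 T, ‖deriv ψ ζ‖ ^ 2 * areaDensity ω u (ψ ζ))
        + sgn i * (∫ t in (0 : ℝ)..1, H t (u (ψ (cylMap (sgn i) (T, t)))))
        - ∫ ζ in cyl i, curvatureDensity H ρ ψ u ζ := by
  have hs := sgn_eq i
  have hm := measurableSet_strip (sgn i) 0 T
  have hsub : strip (sgn i) (R₁ / 2) T ⊆ strip (sgn i) 0 T := fun ζ h =>
    ⟨by linarith [h.1], h.2⟩
  have hc := curvature_integrable hψ hu hH hR₁ hρ hT
  have hF0 : ∀ ζ ∈ strip (sgn i) 0 T \ strip (sgn i) (R₁ / 2) T,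
      fderiv ℝ (rhoH H ρ ψ u) ζ 1 = 0 := by
    intro ζ hζ
    have hlt : sgn i * ζ.re < R₁ := by
      by_contra hn
      push Not at hn
      exact hζ.2 ⟨by linarith, hζ.1.2⟩
    have : rhoH H ρ ψ u =ᶠ[𝓝 ζ] fun _ => 0 := by
      filter_upwards [(isOpen_lt (continuous_const.mul Complex.continuous_re)
        continuous_const).mem_nhds hlt] with x hx
      rw [rhoH, hρ.inner _ (le_of_lt hx), zero_mul]
    rw [this.fderiv_eq]
    simp
  have hFi : IntegrableOn (fun ζ => fderiv ℝ (rhoH H ρ ψ u) ζ 1) (strip (sgn i) 0 T) :=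
    (integrableOn_strip hs (ContinuousAt.comp_cylMap hs (half_pos hR₁)
      fun ζ hζ => continuousAt_fderiv_rhoH hψ hu hH hρ hζ)).of_forall_sdiff_eq_zero hm hF0
  have hF : ∫ ζ in strip (sgn i) 0 T, fderiv ℝ (rhoH H ρ ψ u) ζ 1
      = sgn i * ∫ t in (0 : ℝ)..1, H t (u (ψ (cylMap (sgn i) (T, t)))) := by
    rw [setIntegral_eq_of_subset_of_forall_sdiff_eq_zero hm hsub hF0,
      integral_fderiv_one_strip hs (half_pos hR₁) (by linarith)
        fun ζ hζ => (contDiffAt_rhoH hψ hu hH hρ hζ).of_le (by norm_cast)]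
    have h1 : ∀ t, rhoH H ρ ψ u (cylMap (sgn i) (T, t))
        = H t (u (ψ (cylMap (sgn i) (T, t)))) := fun t => by
      rw [rhoH, hρ.outer _ (by rw [re_cylMap hs]; exact hT), one_mul]
      rfl
    have h2 : ∀ t, rhoH H ρ ψ u (cylMap (sgn i) (R₁ / 2, t)) = 0 := fun t => by
      rw [rhoH, hρ.inner _ (by rw [re_cylMap hs]; linarith), zero_mul]
    simp only [h1, h2, intervalIntegral.integral_zero, sub_zero]
  have hci := hc.1.mono_set (strip_subset_cyl i T)
  have hcE : ∫ ζ in cyl i, curvatureDensity H ρ ψ u ζ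
      = ∫ ζ in strip (sgn i) 0 T, curvatureDensity H ρ ψ u ζ := by
    refine setIntegral_eq_of_subset_of_forall_sdiff_eq_zero (measurableSet_cyl i)
      (strip_subset_cyl i T) fun ζ hζ => curvatureDensity_eq_zero hρ (Or.inr ?_)
    by_contra hn
    push Not at hn
    exact hζ.2 ⟨hζ.1.1, hn.trans hT, hζ.1.2⟩
  have he : ∀ ζ ∈ strip (sgn i) 0 T, ‖deriv ψ ζ‖ ^ 2 * areaDensity ω u (ψ ζ)
      + fderiv ℝ (rhoH H ρ ψ u) ζ 1 - curvatureDensity H ρ ψ u ζ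
      = 1 / 2 * vertEnergyDensity ω H ρ J ψ u ζ := fun ζ hζ =>
    (energy_eq hψ hu hH hρ hJ hhol hζ.1).symm
  refine ⟨((harea.add hFi).sub hci).congr_fun he hm, ?_⟩
  rw [← setIntegral_congr_fun hm he, hcE, ← hF]
  exact (integral_sub (harea.add hFi) hci).trans
    (congrArg (· - ∫ ζ in strip (sgn i) 0 T, curvatureDensity H ρ ψ u ζ) (integral_add harea hFi))

end End

/-! ### A differential inequality -/

/-- If `b` ever exceeded `L`, monotonicity would keep it above, eventually `(b - L)² ≤ b'`, and `b`
would blow up in finite time. If `b` stayed below some `a < L`, then `b' ≥ 1` eventually and `b`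
would pass `L`. -/
theorem tendsto_of_sub_le_sqrt_deriv {b b' : ℝ → ℝ} {T₁ L : ℝ}
    (hb : ∀ T, T₁ ≤ T → HasDerivAt b (b' T) T) (hb' : ∀ T, T₁ ≤ T → 0 ≤ b' T)
    (h : ∀ ε > 0, ∀ᶠ T in atTop, |b T - L| ≤ ε * (1 + √(b' T))) :
    Tendsto b atTop (𝓝 L) := by
  have hmono : MonotoneOn b (Ici T₁) := by
    refine monotoneOn_of_deriv_nonneg (convex_Ici _)
      (fun T hT => (hb T hT).continuousAt.continuousWithinAt)
      (fun T hT => ?_) fun T hT => ?_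
    · rw [interior_Ici] at hT
      exact (hb T (le_of_lt hT)).differentiableAt.differentiableWithinAt
    · rw [interior_Ici] at hT
      rw [(hb T (le_of_lt hT)).deriv]
      exact hb' T (le_of_lt hT)
  have hle : ∀ T, T₁ ≤ T → b T ≤ L := by
    intro T₀ hT₀
    by_contra hn
    push Not at hn
    set δ := b T₀ - L with hδ
    have hδ0 : 0 < δ := by linarith
    -- The bound `δ / 2` absorbs the constant term into half of `b - L`, and `1 / 2` leaves half of
    -- the root; together they give `b - L ≤ √b'`.
    obtain ⟨T₂, hT₂⟩ := eventually_atTop.1 (h (min (δ / 2) (1 / 2)) (by positivity))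
    set T₃ := max T₀ T₂
    have hgt : ∀ T, T₃ ≤ T → δ ≤ b T - L := fun T hT => by
      have := hmono (mem_Ici.2 hT₀) (mem_Ici.2 (hT₀.trans ((le_max_left _ _).trans hT)))
        ((le_max_left _ _).trans hT)
      linarith
    have hsq : ∀ T, T₃ ≤ T → (b T - L) ^ 2 ≤ b' T := by
      intro T hT
      have h1 := hT₂ T ((le_max_right _ _).trans hT)
      have h2 := hgt T hT
      rw [abs_of_pos (hδ0.trans_le h2)] at h1
      have h0 := Real.sqrt_nonneg (b' T)
      have h3 : min (δ / 2) (1 / 2) * (1 + √(b' T)) ≤ δ / 2 + 1 / 2 * √(b' T) := by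
        rw [mul_add, mul_one]
        exact add_le_add (min_le_left _ _) (mul_le_mul_of_nonneg_right (min_le_right _ _) h0)
      have h4 : b T - L ≤ √(b' T) := by linarith
      exact (Real.le_sqrt' (hδ0.trans_le h2)).1 h4
    -- The quantity `(b - L)⁻¹` decreases at rate at least one. It starts at most at `δ⁻¹`, so it
    -- cannot stay positive for time `δ⁻¹ + 1`.
    have hmono2 : MonotoneOn (fun T => -(b T - L)⁻¹ - T) (Ici T₃) := by
      have hd : ∀ T, T₃ ≤ T → HasDerivAt (fun T => -(b T - L)⁻¹ - T)
          (-(-(b' T) / (b T - L) ^ 2) - 1) T := fun T hT =>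
        ((((hb T (hT₀.trans ((le_max_left _ _).trans hT))).sub_const L).inv
          (hδ0.trans_le (hgt T hT)).ne').neg).sub (hasDerivAt_id T)
      refine monotoneOn_of_deriv_nonneg (convex_Ici _)
        (fun T hT => (hd T hT).continuousAt.continuousWithinAt) (fun T hT => ?_) fun T hT => ?_
      · rw [interior_Ici] at hT
        exact (hd T (le_of_lt hT)).differentiableAt.differentiableWithinAt
      · rw [interior_Ici] at hT
        rw [(hd T (le_of_lt hT)).deriv]
        have h1 := hsq T (le_of_lt hT)
        have h2 : 0 < (b T - L) ^ 2 := pow_pos (hδ0.trans_le (hgt T (le_of_lt hT))) 2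
        have h3 : 1 ≤ b' T / (b T - L) ^ 2 := (one_le_div h2).2 h1
        rw [neg_div]
        linarith
    have h5 := hmono2 (mem_Ici.2 le_rfl)
      (mem_Ici.2 (show T₃ ≤ T₃ + (δ⁻¹ + 1) by linarith [inv_pos.2 hδ0]))
      (show T₃ ≤ T₃ + (δ⁻¹ + 1) by linarith [inv_pos.2 hδ0])
    have h6 : 0 < (b (T₃ + (δ⁻¹ + 1)) - L)⁻¹ := inv_pos.2 (hδ0.trans_le
      (hgt _ (by linarith [inv_pos.2 hδ0])))
    have h7 : (b T₃ - L)⁻¹ ≤ δ⁻¹ := inv_anti₀ hδ0 (hgt _ le_rfl)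
    simp only at h5
    linarith
  refine tendsto_order.2 ⟨fun a ha => ?_, fun a ha => ?_⟩
  swap
  · filter_upwards [eventually_ge_atTop T₁] with T hT
    exact (hle T hT).trans_lt ha
  by_contra hn
  have hfr : ∀ T, T₁ ≤ T → b T ≤ a := by
    intro T hT
    by_contra hlt
    push Not at hlt
    apply hn
    filter_upwards [eventually_ge_atTop T] with T' hT'
    exact hlt.trans_le (hmono (mem_Ici.2 hT) (mem_Ici.2 (hT.trans hT')) hT')
  have hδ0 : 0 < L - a := by linarith
  -- With this `ε`, the lower bound `L - b ≥ L - a` forces `1 + √b' ≥ 2`.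
  obtain ⟨T₂, hT₂⟩ := eventually_atTop.1 (h ((L - a) / 2) (by positivity))
  set T₃ := max T₁ T₂
  have hge : ∀ T, T₃ ≤ T → 1 ≤ b' T := by
    intro T hT
    have h1 := (neg_le_abs _).trans (hT₂ T ((le_max_right _ _).trans hT))
    have h2 := hfr T ((le_max_left _ _).trans hT)
    have h3 : 1 ≤ √(b' T) := by
      have h4 : (L - a) / 2 * 2 ≤ (L - a) / 2 * (1 + √(b' T)) := by linarith
      have := le_of_mul_le_mul_left h4 (by positivity)
      linarith
    exact Real.one_le_sqrt.1 h3
  have hmono2 : MonotoneOn (fun T => b T - T) (Ici T₃) := by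
    have hd : ∀ T, T₃ ≤ T → HasDerivAt (fun T => b T - T) (b' T - 1) T := fun T hT =>
      (hb T ((le_max_left _ _).trans hT)).sub (hasDerivAt_id T)
    refine monotoneOn_of_deriv_nonneg (convex_Ici _)
      (fun T hT => (hd T hT).continuousAt.continuousWithinAt) (fun T hT => ?_) fun T hT => ?_
    · rw [interior_Ici] at hT
      exact (hd T (le_of_lt hT)).differentiableAt.differentiableWithinAt
    · rw [interior_Ici] at hT
      rw [(hd T (le_of_lt hT)).deriv]
      linarith [hge T (le_of_lt hT)]
  have hT1 : T₁ ≤ T₃ := le_max_left _ _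
  have h3 := hle T₃ hT1
  have h5 : T₃ ≤ T₃ + (L - b T₃ + 1) := by linarith
  have h6 := hmono2 (mem_Ici.2 le_rfl) (mem_Ici.2 h5) h5
  have h7 := hle (T₃ + (L - b T₃ + 1)) (hT1.trans h5)
  simp only at h6
  linarith

end Pants

namespace Pants

set_option maxSynthPendingDepth 3
set_option linter.unusedSectionVars false

universe u v

/-! ### The holonomy along the circles of one end -/

section Holonomy

variable {E : Type v} [NormedAddCommGroup E] [NormedSpace ℝ E] [FiniteDimensional ℝ E]
  {M : Type u} [TopologicalSpace M] [ChartedSpace E M] [IsManifold 𝓘(ℝ, E) (⊤ : ℕ∞) M]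
  {i : Fin 3} {ω : SymplecticForm E M} {H : ℝ → M → ℝ} {ρ : ℝ → ℝ} {R₁ R₂ : ℝ}
  {J : ℂ → ∀ x : M, TangentSpace 𝓘(ℝ, E) x →L[ℝ] TangentSpace 𝓘(ℝ, E) x}
  {ψ : ℂ → ℂ} {u : ℂ → M}

theorem hasDerivAt_cylMap (s T t : ℝ) :
    HasDerivAt (fun t => cylMap s (T, t)) Complex.I t := by
  have h : (fun t => cylMap s (T, t)) = fun t : ℝ => ((s * T : ℝ) : ℂ) + t * Complex.I :=
    funext fun t => cylMap_eq s T t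
  rw [h]
  have h1 : HasDerivAt (fun t : ℝ => (t : ℂ) * Complex.I) (1 * Complex.I) t :=
    (Complex.ofRealCLM.hasDerivAt (x := t)).mul_const Complex.I
  rw [one_mul] at h1
  exact h1.const_add _

theorem continuousAt_family (hJ : IsCompatibleFamily ω J) {ζ : ℝ → ℂ} {t₀ : ℝ}
    (hζ : ContinuousAt ζ t₀) (hs : ζ t₀ ∈ surface) {x₀ y₀ : M}
    (hy₀ : y₀ ∈ (extChartAt 𝓘(ℝ, E) x₀).source) :
    ContinuousAt (fun p : ℝ × E => localEnd (J (ζ p.1)) x₀ p.2)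
      (t₀, extChartAt 𝓘(ℝ, E) x₀ y₀) := by
  have h1 := (hJ.smooth x₀).continuousOn.continuousAt
    ((isOpen_surface.prod (isOpen_extChartAt_target (I := 𝓘(ℝ, E)) x₀)).mem_nhds
      (show (ζ t₀, extChartAt 𝓘(ℝ, E) x₀ y₀) ∈ _ from
        ⟨hs, (extChartAt 𝓘(ℝ, E) x₀).map_source hy₀⟩))
  have h2 : ContinuousAt (fun p : ℝ × E => (ζ p.1, p.2)) (t₀, extChartAt 𝓘(ℝ, E) x₀ y₀) :=
    (ContinuousAt.comp (f := Prod.fst) (x := (t₀, extChartAt 𝓘(ℝ, E) x₀ y₀)) hζ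
      continuousAt_fst).prodMk continuousAt_snd
  exact ContinuousAt.comp (f := fun p : ℝ × E => (ζ p.1, p.2))
    (x := (t₀, extChartAt 𝓘(ℝ, E) x₀ y₀)) h1 h2

/-- The square root of the energy density on the circle at distance `T`. -/
def circleSpeed (ω : SymplecticForm E M) (H : ℝ → M → ℝ) (ρ : ℝ → ℝ)
    (J : ℂ → ∀ x : M, TangentSpace 𝓘(ℝ, E) x →L[ℝ] TangentSpace 𝓘(ℝ, E) x) (i : Fin 3) (ψ : ℂ → ℂ)
    (u : ℂ → M) (T t : ℝ) : ℝ :=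
  √(1 / 2 * vertEnergyDensity ω H ρ J ψ u (cylMap (sgn i) (T, t)))

/-- Where `ρ = 1`, Floer's equation writes `∂_t u` as `X_H + J ∂_τ u`: the first summand is locally
bounded, and the norm of the second is comparable to the root of the energy density. -/
theorem exists_chartVel_le (hψ : IsCylinderCoordinate i ψ)
    (hu : ContMDiffOn 𝓘(ℝ, ℂ) 𝓘(ℝ, E) (⊤ : ℕ∞) u surface) (hH : IsPeriodicHamiltonian (E := E) H)
    (hR₂ : 0 < R₂) (hρ : IsCutOff i R₁ R₂ ρ) (hJ : IsCompatibleFamily ω J)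
    (hJend : ∀ ζ ζ' : ℂ, R₂ ≤ sgn i * ζ.re → R₂ ≤ sgn i * ζ'.re →
      ζ.im = ζ'.im → J (ψ ζ) = J (ψ ζ'))
    (hhol : IsHolomorphicOnEnd ω H ρ J i ψ u) {z : ℝ → M} (hlim : ConvergesTo i ψ u z) {t₀ : ℝ}
    {x₀ : M} (hx₀ : z t₀ ∈ (extChartAt 𝓘(ℝ, E) x₀).source) :
    ∃ C, ∀ᶠ p in atTop ×ˢ 𝓝 t₀,
      ‖chartVel (E := E) x₀ (fun t => u (ψ (cylMap (sgn i) (p.1, t)))) p.2‖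
        ≤ C * (1 + circleSpeed ω H ρ J i ψ u p.1 p.2) := by
  have hs := sgn_eq i
  have hpos0 : ∀ t, 0 < sgn i * (cylMap (sgn i) (R₂, t)).re := fun t => by rwa [re_cylMap hs]
  let A : ℝ → ∀ x : M, TangentSpace 𝓘(ℝ, E) x →L[ℝ] TangentSpace 𝓘(ℝ, E) x :=
    fun t => J (ψ (cylMap (sgn i) (R₂, t)))
  have hc : ContinuousAt (fun t => ψ (cylMap (sgn i) (R₂, t))) t₀ :=
    (hasDerivAt_circle (hψ.differentiableAt (hpos0 t₀))).continuousAt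
  obtain ⟨c, hc0, K, hev⟩ := exists_local_bounds (A := A) hH hx₀
    (continuousAt_family hJ hc (hψ.mem_surface (hpos0 t₀).le) hx₀)
    (hJ.positive _ (hψ.mem_surface (hpos0 t₀).le) _)
  have hlim' : Tendsto (fun p : ℝ × ℝ => (p.2, u (ψ (cylMap (sgn i) (p.1, p.2)))))
      (atTop ×ˢ 𝓝 t₀) (𝓝 t₀ ×ˢ 𝓝 (z t₀)) := tendsto_snd.prodMk (hlim t₀)
  have hsrc := (hlim t₀).eventually ((isOpen_extChartAt_source (I := 𝓘(ℝ, E)) x₀).mem_nhds hx₀)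
  refine ⟨|K| + (√c)⁻¹, ?_⟩
  filter_upwards [hlim'.eventually hev, hsrc,
    tendsto_fst.eventually (eventually_ge_atTop R₂)] with ⟨T, t⟩ hp hsr hT
  have hsr : u (ψ (cylMap (sgn i) (T, t))) ∈ (extChartAt 𝓘(ℝ, E) x₀).source := hsr
  have hT : R₂ ≤ T := hT
  set ζ := cylMap (sgn i) (T, t) with hζd
  have hre : sgn i * ζ.re = T := re_cylMap hs T t
  have hζ : 0 < sgn i * ζ.re := by rw [hre]; linarith
  -- The almost complex structures do not change beyond depth `R₂`, so bounds obtained for the fixed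
  -- family on the circle at depth `R₂` hold uniformly to infinity.
  have hAJ : A t = J (ψ ζ) := hJend _ _ (by rw [re_cylMap hs]) (by rw [hre]; exact hT) rfl
  have hvel : chartVel (E := E) x₀ (fun t => u (ψ (cylMap (sgn i) (T, t)))) t
      = chartD x₀ (u (ψ ζ)) (dt E ψ u ζ) := by
    have hU := contMDiffAt_end hψ hu hζ
    rw [chartVel_comp (U := fun ζ => u (ψ ζ)) (γ := fun t => cylMap (sgn i) (T, t)) hU
      (hasDerivAt_cylMap _ _ _) hsr]
    exact (chartD_mfderiv (hU.mdifferentiableAt (by simp)) hsr Complex.I).symm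
  have hdt := dt_eq (E := E) hhol hζ
  rw [hρ.outer _ (by rw [hre]; exact hT), one_smul] at hdt
  change ‖chartVel (E := E) x₀ (fun t => u (ψ (cylMap (sgn i) (T, t)))) t‖
        ≤ _ * (1 + circleSpeed ω H ρ J i ψ u T t)
  rw [hvel, hdt, map_add]
  set ξ := J (ψ ζ) (u (ψ ζ)) (dtau E ψ u ζ) with hξ
  have h1 : c * ‖chartD x₀ (u (ψ ζ)) ξ‖ ^ 2 ≤ 1 / 2 * vertEnergyDensity ω H ρ J ψ u ζ := by
    refine (hp.1 ξ).trans (le_of_eq ?_)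
    change ω.form (u (ψ ζ)) ![ξ, A t (u (ψ ζ)) ξ] = _
    rw [hAJ, vertEnergyDensity_eq hψ hJ hhol hζ, hξ, hJ.invariant _ (hψ.mem_surface hζ.le)]
    ring
  have h2 : ‖chartD x₀ (u (ψ ζ)) (ω.hamVF (H ζ.im) (u (ψ ζ)))‖ ≤ K := hp.2
  have h3 : ‖chartD x₀ (u (ψ ζ)) ξ‖ ≤ (√c)⁻¹ * circleSpeed ω H ρ J i ψ u T t := by
    rw [circleSpeed, ← hζd, ← Real.sqrt_inv, ← Real.sqrt_mul (inv_pos.2 hc0).le]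
    refine Real.le_sqrt_of_sq_le ?_
    rw [← mul_le_mul_iff_right₀ hc0, mul_inv_cancel_left₀ hc0.ne']
    exact h1
  have h4 : 0 ≤ circleSpeed ω H ρ J i ψ u T t := Real.sqrt_nonneg _
  have h5 : 0 ≤ (√c)⁻¹ := inv_nonneg.2 (Real.sqrt_nonneg _)
  have h6 := le_abs_self K
  have h7 := mul_nonneg (abs_nonneg K) h4
  refine (norm_add_le _ _).trans ((add_le_add h2 h3).trans ?_)
  rw [mul_add, add_mul]
  linarith

theorem continuous_circleSpeed (hψ : IsCylinderCoordinate i ψ)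
    (hu : ContMDiffOn 𝓘(ℝ, ℂ) 𝓘(ℝ, E) (⊤ : ℕ∞) u surface) (hH : IsPeriodicHamiltonian (E := E) H)
    (hρ : IsCutOff i R₁ R₂ ρ) (hJ : IsCompatibleFamily ω J)
    (hhol : IsHolomorphicOnEnd ω H ρ J i ψ u) {T : ℝ} (hT : 0 < T) :
    Continuous (circleSpeed ω H ρ J i ψ u T) := by
  refine Real.continuous_sqrt.comp (continuous_iff_continuousAt.2 fun t => ?_)
  have h1 := continuousAt_energy hψ hu hH hρ hJ hhol (ζ := cylMap (sgn i) (T, t))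
    (by rwa [re_cylMap (sgn_eq i)])
  exact ContinuousAt.comp (f := fun t => cylMap (sgn i) (T, t)) h1
    (hasDerivAt_cylMap _ _ _).continuousAt

theorem eventually_end_estimate {X : Type*} [TopologicalSpace X] {S : PotentialSystem ω} {f : X → M}
    (Γ : Gauge S f) (hψ : IsCylinderCoordinate i ψ)
    (hu : ContMDiffOn 𝓘(ℝ, ℂ) 𝓘(ℝ, E) (⊤ : ℕ∞) u surface) (hH : IsPeriodicHamiltonian (E := E) H)
    (hR₂ : 0 < R₂) (hρ : IsCutOff i R₁ R₂ ρ) (hJ : IsCompatibleFamily ω J)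
    (hJend : ∀ ζ ζ' : ℂ, R₂ ≤ sgn i * ζ.re → R₂ ≤ sgn i * ζ'.re →
      ζ.im = ζ'.im → J (ψ ζ) = J (ψ ζ'))
    (hhol : IsHolomorphicOnEnd ω H ρ J i ψ u) {z : ℝ → M}
    (hz : ContMDiff 𝓘(ℝ, ℝ) 𝓘(ℝ, E) (⊤ : ℕ∞) z) (hlim : ConvergesTo i ψ u z)
    {c : ℝ → X} {a : ℕ → X} {N : ℕ} (hN : 0 < N) (haN : a N = a 0) (hc1 : c 1 = c 0)
    (hfc : ∀ t, f (c t) = z t)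
    (ha : ∀ j < N, ∀ t ∈ Icc (j / N : ℝ) ((j + 1 : ℕ) / N), Γ.R (c t) (a j)) {ε : ℝ} (hε : 0 < ε) :
    ∀ᶠ T in atTop, |Γ.hol a N (fun t => u (ψ (cylMap (sgn i) (T, t)))) - Γ.hol a N z|
      ≤ ε * (1 + ∫ t in (0 : ℝ)..1, circleSpeed ω H ρ J i ψ u T t) := by
  refine Γ.eventually_hol_sub_le (μ := fun T t => u (ψ (cylMap (sgn i) (T, t))))
    (σ := circleSpeed ω H ρ J i ψ u) hN haN hc1 hz hfc
    ha ?_ (fun t _ => hlim t) (fun T t => Real.sqrt_nonneg _) ?_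
    (fun t _ x₀ hx₀ => exists_chartVel_le hψ hu hH hR₂ hρ hJ hJend hhol hlim hx₀) hε
  · filter_upwards [eventually_gt_atTop 0] with T hT t _
    have hd : ContDiffAt ℝ (⊤ : ℕ∞) (fun t => cylMap (sgn i) (T, t)) t := by
      have h : (fun t => cylMap (sgn i) (T, t))
          = fun t : ℝ => ((sgn i * T : ℝ) : ℂ) + t • Complex.I :=
        funext fun t => by rw [cylMap_eq, Complex.real_smul]
      rw [h]
      fun_prop
    exact ContMDiffAt.comp (f := fun t => cylMap (sgn i) (T, t)) t
      (contMDiffAt_end hψ hu (by rwa [re_cylMap (sgn_eq i)])) hd.contMDiffAt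
  · filter_upwards [eventually_gt_atTop 0] with T hT
    exact (continuous_circleSpeed hψ hu hH hρ hJ hhol hT).continuousOn

theorem eventually_hamiltonian_estimate (hH : IsPeriodicHamiltonian (E := E) H) {z : ℝ → M}
    (hlim : ConvergesTo i ψ u z) (hz : Continuous z) (hψ : IsCylinderCoordinate i ψ)
    (hu : ContMDiffOn 𝓘(ℝ, ℂ) 𝓘(ℝ, E) (⊤ : ℕ∞) u surface) {ε : ℝ} (hε : 0 < ε) :
    ∀ᶠ T in atTop, |(∫ t in (0 : ℝ)..1, H t (u (ψ (cylMap (sgn i) (T, t)))))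
      - ∫ t in (0 : ℝ)..1, H t (z t)| ≤ ε := by
  have hHc : Continuous fun p : ℝ × M => H p.1 p.2 := hH.smooth.continuous
  have hzc : Continuous fun t => H t (z t) := hHc.comp (continuous_id.prodMk hz)
  have h1 : ∀ᶠ T in atTop, ∀ t ∈ Icc (0 : ℝ) 1,
      |H t (u (ψ (cylMap (sgn i) (T, t)))) - H t (z t)| ≤ ε := by
    refine eventually_forall_Icc fun t _ => ?_
    have h2 : Tendsto (fun p : ℝ × ℝ => H p.2 (u (ψ (cylMap (sgn i) (p.1, p.2)))))
        (atTop ×ˢ 𝓝 t) (𝓝 (H t (z t))) :=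
      (hHc.tendsto (t, z t)).comp (tendsto_snd.prodMk_nhds (hlim t))
    have h3 := (h2.sub ((hzc.tendsto t).comp tendsto_snd)).abs
    rw [sub_self, abs_zero] at h3
    filter_upwards [h3.eventually (eventually_lt_nhds hε)] with p hp
    exact hp.le
  filter_upwards [h1, eventually_gt_atTop 0] with T hT hT0
  have hc : Continuous fun t => H t (u (ψ (cylMap (sgn i) (T, t)))) := by
    refine continuous_iff_continuousAt.2 fun t => ?_
    exact ContinuousAt.comp (f := fun t => cylMap (sgn i) (T, t))
      (contDiffAt_hamiltonian_end hψ hu hH (by rwa [re_cylMap (sgn_eq i)])).continuousAt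
      (hasDerivAt_cylMap _ _ _).continuousAt
  rw [← intervalIntegral.integral_sub (hc.intervalIntegrable _ _) (hzc.intervalIntegrable _ _)]
  have h4 := intervalIntegral.norm_integral_le_of_norm_le_const (a := (0 : ℝ)) (b := 1) (C := ε)
    (f := fun t => H t (u (ψ (cylMap (sgn i) (T, t)))) - H t (z t)) fun t ht => by
      rw [uIoc_of_le zero_le_one] at ht
      exact hT t ⟨ht.1.le, ht.2⟩
  simpa using h4

end Holonomy

end Pants

namespace Pants

set_option maxSynthPendingDepth 3
set_option linter.unusedSectionVars false

universe u v

/-! ### The area of the truncated surface -/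

section Area

variable {E : Type v} [NormedAddCommGroup E] [NormedSpace ℝ E] [FiniteDimensional ℝ E]
  {M : Type u} [TopologicalSpace M] [ChartedSpace E M] [IsManifold 𝓘(ℝ, E) (⊤ : ℕ∞) M] [T2Space M]
  {ω : SymplecticForm E M} {H : ℝ → M → ℝ} {ψ : Fin 3 → ℂ → ℂ} {w : Fin 3 → ℂ → M}
  {u : ℂ → M} {S : PotentialSystem ω} {f : C(OnePoint ℂ, M)} (Γ : Gauge S f)

/-- The circle at distance one from the boundary, along which the discs are glued. -/
def gluingCircle (ψ : Fin 3 → ℂ → ℂ) (i : Fin 3) (t : ℝ) : OnePoint ℂ :=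
  (ψ i (cylMap (sgn i) (1, t)) : ℂ)

theorem gluingCircle_one (hψ : ∀ i, IsCylinderCoordinate i (ψ i)) (i : Fin 3) :
    gluingCircle ψ i 1 = gluingCircle ψ i 0 := by
  rw [gluingCircle, cylMap_one, (hψ i).periodic]
  rfl

theorem continuousAt_end (hψ : ∀ i, IsCylinderCoordinate i (ψ i)) (i : Fin 3) {p : ℝ × ℝ}
    (hp : 0 < p.1) :
    ContinuousAt (fun p => ((ψ i (cylMap (sgn i) p) : ℂ) : OnePoint ℂ)) p := by
  have h1 : ContinuousAt (ψ i) (cylMap (sgn i) p) :=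
    ((hψ i).differentiableAt (by rwa [re_cylMap (sgn_eq i) p.1 p.2])).continuousAt
  exact OnePoint.continuous_coe.continuousAt.comp
    (ContinuousAt.comp (f := cylMap (sgn i)) h1 (continuous_cylMap _).continuousAt)

theorem continuous_gluingCircle (hψ : ∀ i, IsCylinderCoordinate i (ψ i)) (i : Fin 3) :
    Continuous (gluingCircle ψ i) := continuous_iff_continuousAt.2 fun t =>
  ContinuousAt.comp (f := fun t : ℝ => ((1 : ℝ), t)) (continuousAt_end hψ i one_pos)
    (by fun_prop)

/-- The disc factors through the sphere by `capMap`, whose boundary values are the gluing circle, so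
the gauge along `f` computes its area as a holonomy of the orbit. -/
theorem action_eq_hol (hψ : ∀ i, IsCylinderCoordinate i (ψ i)) (hf : IsCappedSphere ψ u w f)
    {i : Fin 3} {z : ℝ → M} (hz : IsCappedOrbit ω H z (w i)) {a : ℕ → OnePoint ℂ} {N : ℕ}
    (hN : 0 < N) (haN : a N = a 0)
    (ha : ∀ j < N, ∀ t ∈ Icc (j / N : ℝ) ((j + 1 : ℕ) / N), Γ.R (gluingCircle ψ i t) (a j)) :
    action ω H z (w i) = -Γ.hol a N z - ∫ t in (0 : ℝ)..1, H t (z t) := by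
  have hwb : ContinuousOn (w i) (Metric.ball 0 1) :=
    hz.smooth_disc.continuousOn.mono Metric.ball_subset_closedBall
  rw [Γ.hol_cap hz.smooth_disc (hψ i).continuousOn_capMap
    (fun q hq => hf.apply_capMap hψ hwb hq) f.continuous hz.smooth_orbit ?_
    (gluingCircle_one hψ i) (fun t => hf.apply_circle i hz.boundary t) ?_ hN haN ha]
  · rfl
  · intro t
    rw [← hz.boundary, expMap, cylMap_eq]
    congr 2
    push_cast
    ring
  · intro t _
    have h1 : ∀ p : ℝ × ℝ, capMap i (ψ i) (expMap (cylMap 1 p))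
        = (ψ i (cylMap (sgn i) (1 - p.1, p.2)) : ℂ) := fun p => by
      rw [(hψ i).capMap_expMap]
      simp [cylMap]
    simp only [h1]
    have h2 : ContinuousAt (fun p : ℝ × ℝ => ((ψ i (cylMap (sgn i) (1 - p.1, p.2)) : ℂ) :
        OnePoint ℂ)) (0, t) :=
      ContinuousAt.comp (f := fun p : ℝ × ℝ => (1 - p.1, p.2)) (x := ((0 : ℝ), t))
        (continuousAt_end hψ i (by simp)) (by fun_prop)
    have h3 := h2.tendsto
    rw [nhds_prod_eq, sub_zero] at h3
    exact h3.mono_left (Filter.prod_mono nhdsWithin_le_nhds le_rfl)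

/-- The part of the surface at distance at most `T` from the seams. -/
def truncation (ψ : Fin 3 → ℂ → ℂ) (T : ℝ) : Set ℂ :=
  ⋃ i, ψ i '' (cylMap (sgn i) '' (Icc 0 T ×ˢ Icc 0 1))

theorem isCompact_truncation (hψ : ∀ i, IsCylinderCoordinate i (ψ i)) (T : ℝ) :
    IsCompact (truncation ψ T) := by
  refine isCompact_iUnion fun i => ?_
  refine ((isCompact_Icc.prod isCompact_Icc).image (continuous_cylMap _)).image_of_continuousOn
    ((hψ i).continuousOn.mono ?_)
  rintro _ ⟨p, hp, rfl⟩
  change 0 ≤ sgn i * (cylMap (sgn i) (p.1, p.2)).re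
  rw [re_cylMap (sgn_eq i)]
  exact hp.1.1

theorem truncation_subset (hψ : ∀ i, IsCylinderCoordinate i (ψ i)) (T : ℝ) :
    truncation ψ T ⊆ surface := by
  refine iUnion_subset fun i => ?_
  rintro _ ⟨_, ⟨p, hp, rfl⟩, rfl⟩
  refine (hψ i).mem_surface ?_
  change 0 ≤ sgn i * (cylMap (sgn i) (p.1, p.2)).re
  rw [re_cylMap (sgn_eq i)]
  exact hp.1.1

theorem mem_truncation (hψ : ∀ i, IsCylinderCoordinate i (ψ i)) {i : Fin 3} {ζ : ℂ} {T : ℝ}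
    (h0 : 0 ≤ sgn i * ζ.re) (hT : sgn i * ζ.re ≤ T) : ψ i ζ ∈ truncation ψ T := by
  obtain ⟨n, hn, -⟩ := existsUnique_add_zsmul_mem_Ioc one_pos ζ.im 0
  refine mem_iUnion.2 ⟨i, ζ + n * Complex.I, ⟨(sgn i * ζ.re, ζ.im + n), ⟨⟨h0, hT⟩, ?_⟩, ?_⟩,
    (hψ i).periodic_int ζ n⟩
  · have hn' : ζ.im + n ∈ Ioc (0 : ℝ) (0 + 1) := by simpa using hn
    exact ⟨hn'.1.le, by simpa using hn'.2⟩
  · apply Complex.ext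
    · change sgn i * (sgn i * ζ.re) = _
      rw [sign_mul_sign_mul (sgn_eq i)]
      simp
    · change ζ.im + n = _
      simp

/-- By `compress` the map `u` factors through the sphere, so the gauge gives a primitive of `u^*ω`
near the truncated surface, and Stokes' theorem leaves the three circles. -/
theorem sum_area_strip (hψ : ∀ i, IsCylinderCoordinate i (ψ i)) (hf : IsCappedSphere ψ u w f)
    (hu : ContMDiffOn 𝓘(ℝ, ℂ) 𝓘(ℝ, E) (⊤ : ℕ∞) u surface) {T : ℝ} (hT : 0 < T)
    {a : Fin 3 → ℕ → OnePoint ℂ} {N : Fin 3 → ℕ} (hN : ∀ i, 0 < N i) (haN : ∀ i, a i (N i) = a i 0)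
    (ha : ∀ i, ∀ j < N i, ∀ t ∈ Icc (j / N i : ℝ) ((j + 1 : ℕ) / N i),
      Γ.R (compress ψ (ψ i (cylMap (sgn i) (T, t))) : ℂ) (a i j)) :
    (∀ i, IntegrableOn (fun ζ => ‖deriv (ψ i) ζ‖ ^ 2 * areaDensity ω u (ψ i ζ))
      (strip (sgn i) 0 T)) ∧
    ∑ i, ∫ ζ in strip (sgn i) 0 T, ‖deriv (ψ i) ζ‖ ^ 2 * areaDensity ω u (ψ i ζ)
      = ∑ i, sgn i * Γ.hol (a i) (N i) (fun t => u (ψ i (cylMap (sgn i) (T, t)))) := by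
  -- Room around the truncation, in which a cut-off function can fall from one to zero while the
  -- primitive still exists on its support.
  obtain ⟨K', hK', hKK', hK's⟩ := exists_compact_between (isCompact_truncation hψ T)
    isOpen_surface (truncation_subset hψ T)
  obtain ⟨χ, hχ1, hχ0, -⟩ := exists_contMDiffMap_one_nhds_of_subset_interior 𝓘(ℝ, ℂ)
    (n := (⊤ : ℕ∞)) (isCompact_truncation hψ T).isClosed hKK'
  have hχt : tsupport χ ⊆ K' := closure_minimal (fun x hx => by
    by_contra h
    exact hx (hχ0 x h)) hK'.isClosed
  have hU : ∀ y ∈ surface, ContMDiffAt 𝓘(ℝ, ℂ) 𝓘(ℝ, E) (⊤ : ℕ∞) u y := fun y hy =>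
    hu.contMDiffAt (isOpen_surface.mem_nhds hy)
  have hfc : ∀ y ∈ surface, f (compress ψ y : ℂ) = u y := fun y hy => hf.apply_compress hψ hy
  obtain ⟨Λ, ν, hΛ⟩ := Γ.exists_primitive (c := fun y => ((compress ψ y : ℂ) : OnePoint ℂ))
    isOpen_surface hK' hK's hU
    (OnePoint.continuous_coe.comp_continuousOn (continuousOn_compress hψ)) hfc
  have hmem : ∀ i ζ, 0 ≤ sgn i * ζ.re → sgn i * ζ.re ≤ T → ψ i ζ ∈ K' := fun i ζ h0 h1 =>
    interior_subset (hKK' (mem_truncation hψ h0 h1))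
  obtain ⟨h1, h2⟩ := sum_integral_curl hψ χ.contMDiff.contDiff
    (hK'.of_isClosed_subset (isClosed_tsupport _) hχt) (hχt.trans hK's)
    (fun z hz => hΛ.contDiffAt z (hχt hz)) hT fun i ζ h0 h1 =>
      (eventually_nhdsSet_iff_forall.1 hχ1) _ (mem_truncation hψ h0 h1)
  have hcurl : ∀ i, ∀ ζ ∈ strip (sgn i) 0 T, ‖deriv (ψ i) ζ‖ ^ 2 * curl Λ (ψ i ζ)
      = ‖deriv (ψ i) ζ‖ ^ 2 * areaDensity ω u (ψ i ζ) := fun i ζ hζ =>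
    congrArg _ (hΛ.curl _ (hmem i ζ hζ.1.le hζ.2.1) 1 Complex.I)
  refine ⟨fun i => (h1 i).congr_fun (hcurl i) (measurableSet_strip _ _ _), ?_⟩
  rw [← Finset.sum_congr rfl fun i _ => setIntegral_congr_fun (measurableSet_strip (sgn i) 0 T)
    (hcurl i), h2]
  refine Finset.sum_congr rfl fun i _ => ?_
  rw [hΛ.circ_eq_hol Γ hK's hU hfc (sgn_eq i) (hψ i).holomorphic hT (hψ i).periodic
    (fun t _ => hmem i _ (by rw [re_cylMap (sgn_eq i)]; exact hT.le)
      (by rw [re_cylMap (sgn_eq i)])) (hN i) (haN i) (ha i)]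

/-- The compressed circles at depth `T` converge to the gluing circle, so a single list of labels
serves both. This makes the holonomies from the surface side comparable with those from the disc
side. -/
theorem exists_labels (hψ : ∀ i, IsCylinderCoordinate i (ψ i)) (i : Fin 3) :
    ∃ (N : ℕ) (a : ℕ → OnePoint ℂ), 0 < N ∧ a N = a 0 ∧
      (∀ j < N, ∀ t ∈ Icc (j / N : ℝ) ((j + 1 : ℕ) / N), Γ.R (gluingCircle ψ i t) (a j)) ∧
      ∀ᶠ T in atTop, ∀ j < N, ∀ t ∈ Icc (j / N : ℝ) ((j + 1 : ℕ) / N),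
        Γ.R (compress ψ (ψ i (cylMap (sgn i) (T, t))) : ℂ) (a j) := by
  obtain ⟨N, a, hN, haN, ha⟩ := exists_subdivision Γ.isOpen_R Γ.refl
    (continuous_gluingCircle hψ i) (gluingCircle_one hψ i)
  refine ⟨N, a, hN, haN, ha, eventually_subdivision_rel Γ.isOpen_R
    (c' := fun T t => ((compress ψ (ψ i (cylMap (sgn i) (T, t))) : ℂ) : OnePoint ℂ)) hN ha ?_⟩
  intro t _
  have h1 : Tendsto (fun p : ℝ × ℝ => ((ψ i (squeeze (sgn i) (cylMap (sgn i) p)) : ℂ) :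
      OnePoint ℂ)) (atTop ×ˢ 𝓝 t) (𝓝 (gluingCircle ψ i t)) := by
    have h2 : ContinuousAt (ψ i) (cylMap (sgn i) (1, t)) :=
      ((hψ i).differentiableAt (by rw [re_cylMap (sgn_eq i)]; exact one_pos)).continuousAt
    exact (OnePoint.continuous_coe.continuousAt.comp h2).tendsto.comp
      (tendsto_squeeze (sgn_eq i) t)
  refine h1.congr' ?_
  filter_upwards [tendsto_fst.eventually (eventually_ge_atTop 0)] with p hp
  rw [compress_apply hψ (by
    rw [re_cylMap (sgn_eq i)]
    exact hp)]

end Area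

end Pants

namespace Pants

set_option maxSynthPendingDepth 3
set_option linter.unusedSectionVars false

universe u v

/-! ### The energy identity -/

theorem hasDerivAt_integral_strip {s : ℝ} (hs : s = 1 ∨ s = -1) {e : ℂ → ℝ}
    (he : ∀ ζ : ℂ, 0 < s * ζ.re → ContinuousAt e ζ)
    (hint : ∀ T, 0 < T → IntegrableOn e (strip s 0 T)) {T : ℝ} (hT : 0 < T) :
    HasDerivAt (fun T => ∫ ζ in strip s 0 T, e ζ) (∫ t in (0 : ℝ)..1, e (cylMap s (T, t))) T := by
  set T₁ := T / 2 with hT₁d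
  have hT₁ : 0 < T₁ := half_pos hT
  have hTT₁ : T₁ < T := half_lt_self hT
  -- The circle integrals are frozen below depth `T / 2`, so the integrand is continuous on the
  -- whole line and the seam plays no role in the derivative at `T`.
  let g : ℝ → ℝ := fun x => ∫ t in (0 : ℝ)..1, e (cylMap s (max x T₁, t))
  have hg : Continuous g := by
    refine intervalIntegral.continuous_parametric_intervalIntegral_of_continuous'
      (f := fun x t => e (cylMap s (max x T₁, t))) (continuous_iff_continuousAt.2 fun p => ?_) _ _
    have h1 := he (cylMap s (max p.1 T₁, p.2))
      (by rw [re_cylMap hs]; exact hT₁.trans_le (le_max_right _ _))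
    have h2 : Continuous fun p : ℝ × ℝ => cylMap s (max p.1 T₁, p.2) :=
      (continuous_cylMap s).comp (by fun_prop)
    exact ContinuousAt.comp (f := fun p : ℝ × ℝ => cylMap s (max p.1 T₁, p.2)) h1 h2.continuousAt
  have hgT : g T = ∫ t in (0 : ℝ)..1, e (cylMap s (T, t)) := by
    simp only [g, max_eq_left hTT₁.le]
  have h1 := ((hg.integral_hasStrictDerivAt T₁ T).hasDerivAt).const_add
    (∫ ζ in strip s 0 T₁, e ζ)
  rw [hgT] at h1
  refine h1.congr_of_eventuallyEq ?_
  filter_upwards [lt_mem_nhds hTT₁] with x hx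
  have hun : strip s 0 x = strip s 0 T₁ ∪ strip s T₁ x := by
    ext ζ
    constructor
    · rintro ⟨h1, h2, h3⟩
      rcases le_or_gt (s * ζ.re) T₁ with h | h
      · exact Or.inl ⟨h1, h, h3⟩
      · exact Or.inr ⟨h, h2, h3⟩
    · rintro (⟨h1, h2, h3⟩ | ⟨h1, h2, h3⟩)
      · exact ⟨h1, h2.trans hx.le, h3⟩
      · exact ⟨hT₁.trans h1, h2, h3⟩
  have hdis : Disjoint (strip s 0 T₁) (strip s T₁ x) :=
    Set.disjoint_left.2 fun ζ h1 h2 => absurd h1.2.1 (not_le.2 h2.1)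
  have hsub : strip s T₁ x ⊆ strip s 0 x := by rw [hun]; exact subset_union_right
  rw [hun, setIntegral_union hdis (measurableSet_strip _ _ _) (hint T₁ hT₁)
    ((hint x (hT₁.trans hx)).mono_set hsub), integral_strip hs hx.le
      (ContinuousAt.comp_cylMap hs hT₁ he)]
  congr 1
  refine intervalIntegral.integral_congr fun y hy => ?_
  rw [uIcc_of_le hx.le] at hy
  simp only [g, max_eq_left hy.1]

/-- The strips exhaust the half cylinder and the integrand is nonnegative, so bounded integrals give
integrability, and then convergence. -/
theorem integrableOn_cyl_of_bounded {i : Fin 3} {e : ℂ → ℝ} (h0 : ∀ ζ ∈ cyl i, 0 ≤ e ζ)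
    (hint : ∀ T, 0 < T → IntegrableOn e (strip (sgn i) 0 T)) {B : ℝ}
    (hB : ∀ᶠ T in atTop, ∫ ζ in strip (sgn i) 0 T, e ζ ≤ B) :
    IntegrableOn e (cyl i) ∧
      Tendsto (fun T => ∫ ζ in strip (sgn i) 0 T, e ζ) atTop (𝓝 (∫ ζ in cyl i, e ζ)) := by
  have hm : ∀ T, MeasurableSet {ζ : ℂ | sgn i * ζ.re ≤ T} := fun T =>
    (isClosed_le (continuous_const.mul Complex.continuous_re) continuous_const).measurableSet
  have hcov : AECover (volume.restrict (cyl i)) atTop fun T : ℝ => {ζ : ℂ | sgn i * ζ.re ≤ T} :=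
    ⟨Eventually.of_forall fun ζ => eventually_ge_atTop _, hm⟩
  have hr : ∀ T, (volume.restrict (cyl i)).restrict {ζ : ℂ | sgn i * ζ.re ≤ T}
      = volume.restrict (strip (sgn i) 0 T) := fun T => by
    rw [Measure.restrict_restrict (hm T)]
    congr 1
    ext ζ
    exact ⟨fun h => ⟨h.2.1, h.1, h.2.2⟩, fun h => ⟨h.2.1, h.1, h.2.2⟩⟩
  have hint' : ∀ T, IntegrableOn e (strip (sgn i) 0 T) := fun T =>
    (hint (max T 1) (by positivity)).mono_set fun ζ h => ⟨h.1, h.2.1.trans (le_max_left _ _), h.2.2⟩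
  have h1 : Integrable e (volume.restrict (cyl i)) := by
    refine hcov.integrable_of_integral_bounded_of_nonneg_ae B (fun T => ?_) ?_ ?_
    · rw [IntegrableOn, hr]
      exact hint' T
    · exact (ae_restrict_iff' (measurableSet_cyl i)).2 (Eventually.of_forall h0)
    · simpa only [hr] using hB
  refine ⟨h1, ?_⟩
  have h2 := hcov.integral_tendsto_of_countably_generated h1
  simpa only [hr] using h2

/-- The variance of `σ` on the unit interval is nonnegative. -/
theorem integral_le_sqrt_integral_sq {σ : ℝ → ℝ} (hσ : Continuous σ) :
    ∫ t in (0 : ℝ)..1, σ t ≤ √(∫ t in (0 : ℝ)..1, σ t ^ 2) := by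
  refine Real.le_sqrt_of_sq_le ?_
  set m := ∫ t in (0 : ℝ)..1, σ t
  have h1 : 0 ≤ ∫ t in (0 : ℝ)..1, (σ t - m) ^ 2 :=
    intervalIntegral.integral_nonneg zero_le_one fun t _ => sq_nonneg _
  have h2 : ∀ t, (σ t - m) ^ 2 = σ t ^ 2 - 2 * m * σ t + m ^ 2 := fun t => by ring
  simp only [h2] at h1
  have i1 : IntervalIntegrable (fun t => σ t ^ 2) volume 0 1 := (hσ.pow 2).intervalIntegrable _ _
  have i2 : IntervalIntegrable (fun t => 2 * m * σ t) volume 0 1 :=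
    (continuous_const.mul hσ).intervalIntegrable _ _
  rw [intervalIntegral.integral_add (i1.sub i2) (by simp), intervalIntegral.integral_sub i1 i2,
    intervalIntegral.integral_const_mul, intervalIntegral.integral_const] at h1
  simp only [sub_zero, one_smul] at h1
  nlinarith

section Main

variable {E : Type v} [NormedAddCommGroup E] [NormedSpace ℝ E] [FiniteDimensional ℝ E]
  {M : Type u} [TopologicalSpace M] [ChartedSpace E M] [IsManifold 𝓘(ℝ, E) (⊤ : ℕ∞) M]
  [CompactSpace M] [T2Space M]

theorem continuous_max_hamiltonian {H : ℝ → M → ℝ} (hH : IsPeriodicHamiltonian (E := E) H) :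
    Continuous fun t => ⨆ x, H t x := by
  have h := isCompact_univ.continuous_sSup (K := (univ : Set M)) (f := H) hH.smooth.continuous
  simp only [image_univ] at h
  exact h

theorem continuous_min_hamiltonian {H : ℝ → M → ℝ} (hH : IsPeriodicHamiltonian (E := E) H) :
    Continuous fun t => ⨅ x, H t x := by
  have h := isCompact_univ.continuous_sInf (K := (univ : Set M)) (f := H) hH.smooth.continuous
  simp only [image_univ] at h
  exact h

theorem isCompact_range_hamiltonian {H : ℝ → M → ℝ} (hH : IsPeriodicHamiltonian (E := E) H)
    (t : ℝ) : IsCompact (range (H t)) :=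
  isCompact_range (hH.smooth.continuous.comp (continuous_const.prodMk continuous_id))

variable {ω : SymplecticForm E M}
  {H : Fin 3 → ℝ → M → ℝ} (hH : ∀ i, IsPeriodicHamiltonian (E := E) (H i))
  {ψ : Fin 3 → ℂ → ℂ} (hψ : ∀ i, IsCylinderCoordinate i (ψ i))
  {R₁ R₂ : Fin 3 → ℝ} (hR₁ : ∀ i, 0 < R₁ i) (hR : ∀ i, R₁ i < R₂ i)
  {ρ : Fin 3 → ℝ → ℝ} (hρ : ∀ i, IsCutOff i (R₁ i) (R₂ i) (ρ i))
  {J : ℂ → ∀ x : M, TangentSpace 𝓘(ℝ, E) x →L[ℝ] TangentSpace 𝓘(ℝ, E) x}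
  (hJ : IsCompatibleFamily ω J)
  (hJend : ∀ (i : Fin 3) (ζ ζ' : ℂ), R₂ i ≤ sgn i * ζ.re → R₂ i ≤ sgn i * ζ'.re →
    ζ.im = ζ'.im → J (ψ i ζ) = J (ψ i ζ'))
  {z : Fin 3 → ℝ → M} {w : Fin 3 → ℂ → M}
  (hz : ∀ i, IsCappedOrbit ω (H i) (z i) (w i))
  {u : ℂ → M} (hu : ContMDiffOn 𝓘(ℝ, ℂ) 𝓘(ℝ, E) (⊤ : ℕ∞) u surface)
  (hhol : ∀ i, IsHolomorphicOnEnd ω (H i) (ρ i) J i (ψ i) u)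
  (hlim : ∀ i, ConvergesTo i (ψ i) u (z i))

-- The derivative of the truncated energy is the sum of the circle integrals of the energy density,
-- and by Cauchy–Schwarz the mean speed on a circle is at most its root. The estimate therefore
-- becomes the differential inequality of `tendsto_of_sub_le_sqrt_deriv`.
include hH hψ hρ hJ hhol hu in
theorem tendsto_energy {L : ℝ}
    (hint : ∀ i T, 0 < T → IntegrableOn
      (fun ζ => 1 / 2 * vertEnergyDensity ω (H i) (ρ i) J (ψ i) u ζ) (strip (sgn i) 0 T))
    (hest : ∀ ε > 0, ∀ᶠ T in atTop,
      |(∑ i, ∫ ζ in strip (sgn i) 0 T, 1 / 2 * vertEnergyDensity ω (H i) (ρ i) J (ψ i) u ζ) - L|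
        ≤ ∑ i, (ε * (1 + ∫ t in (0 : ℝ)..1, circleSpeed ω (H i) (ρ i) J i (ψ i) u T t) + ε)) :
    Tendsto (fun T => ∑ i, ∫ ζ in strip (sgn i) 0 T,
      1 / 2 * vertEnergyDensity ω (H i) (ρ i) J (ψ i) u ζ) atTop (𝓝 L) := by
  let e : Fin 3 → ℂ → ℝ := fun i ζ => 1 / 2 * vertEnergyDensity ω (H i) (ρ i) J (ψ i) u ζ
  let b' : ℝ → ℝ := fun T => ∑ i, ∫ t in (0 : ℝ)..1, e i (cylMap (sgn i) (T, t))
  have he0 : ∀ i (ζ : ℂ), 0 < sgn i * ζ.re → 0 ≤ e i ζ := fun i ζ hζ =>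
    mul_nonneg (by norm_num) (vertEnergyDensity_nonneg (hψ i) hJ (hhol i) hζ)
  have hpart : ∀ T, 0 < T → ∀ i, 0 ≤ ∫ t in (0 : ℝ)..1, e i (cylMap (sgn i) (T, t)) :=
    fun T hT i => intervalIntegral.integral_nonneg zero_le_one fun t _ =>
      he0 i _ (by rwa [re_cylMap (sgn_eq i)])
  have hb' : ∀ T, 0 < T → 0 ≤ b' T := fun T hT => Finset.sum_nonneg fun i _ => hpart T hT i
  refine tendsto_of_sub_le_sqrt_deriv (b' := b') (T₁ := 1) (fun T hT => ?_)
    (fun T hT => hb' T (zero_lt_one.trans_le hT)) fun ε hε => ?_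
  · refine HasDerivAt.fun_sum fun i _ => ?_
    exact hasDerivAt_integral_strip (sgn_eq i)
      (fun ζ hζ => continuousAt_energy (hψ i) hu (hH i) (hρ i) hJ (hhol i) hζ) (hint i)
      (zero_lt_one.trans_le hT)
  -- Each of the three ends contributes two errors, hence the factor `6`.
  · filter_upwards [hest (ε / 6) (by positivity), eventually_gt_atTop 0] with T hT hT0
    refine hT.trans ?_
    have h1 : ∀ i, ε / 6 * (1 + ∫ t in (0 : ℝ)..1, circleSpeed ω (H i) (ρ i) J i (ψ i) u T t)
        + ε / 6 ≤ ε / 6 * (1 + √(b' T)) + ε / 6 := by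
      intro i
      have h2 := integral_le_sqrt_integral_sq
        (continuous_circleSpeed (hψ i) hu (hH i) (hρ i) hJ (hhol i) hT0)
      have h3 : ∀ t, circleSpeed ω (H i) (ρ i) J i (ψ i) u T t ^ 2
          = e i (cylMap (sgn i) (T, t)) := fun t =>
        Real.sq_sqrt (he0 i _ (by rwa [re_cylMap (sgn_eq i)]))
      simp only [h3] at h2
      have h4 : ∫ t in (0 : ℝ)..1, e i (cylMap (sgn i) (T, t)) ≤ b' T :=
        Finset.single_le_sum (f := fun i => ∫ t in (0 : ℝ)..1, e i (cylMap (sgn i) (T, t)))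
          (fun i _ => hpart T hT0 i) (Finset.mem_univ i)
      have h5 := h2.trans (Real.sqrt_le_sqrt h4)
      gcongr
    refine (Finset.sum_le_sum fun i _ => h1 i).trans ?_
    rw [Finset.sum_const, Finset.card_univ, Fintype.card_fin]
    have h6 := mul_nonneg hε.le (Real.sqrt_nonneg (b' T))
    simp only [nsmul_eq_mul, Nat.cast_ofNat]
    linarith

-- At finite depth the energy is an expression in holonomies and Hamiltonian integrals of the three
-- circles; the asserted value is the same expression for the limit orbits. The difference of the
-- two satisfies the hypothesis of `tendsto_energy`.
include hH hψ hR₁ hR hρ hJ hJend hz hhol hlim hu in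
theorem energy_identity
    (hcap : ∃ f : C(OnePoint ℂ, M), IsCappedSphere ψ u w f ∧ RepresentsZero f) :
    (∀ i, IntegrableOn (fun ζ => 1 / 2 * vertEnergyDensity ω (H i) (ρ i) J (ψ i) u ζ) (cyl i)) ∧
    ∑ i, ∫ ζ in cyl i, 1 / 2 * vertEnergyDensity ω (H i) (ρ i) J (ψ i) u ζ
      = action ω (H 0) (z 0) (w 0) + action ω (H 1) (z 1) (w 1) - action ω (H 2) (z 2) (w 2)
        - ∑ i, ∫ ζ in cyl i, curvatureDensity (H i) (ρ i) (ψ i) u ζ := by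
  obtain ⟨f, hf, hf0⟩ := hcap
  obtain ⟨S⟩ := nonempty_potentialSystem ω
  obtain ⟨h, hh⟩ := exists_global_locCob S.locCocycle f hf0
  obtain ⟨Γ⟩ := nonempty_gauge S f hh
  choose N a hN haN ha hev using exists_labels Γ hψ
  have hR₂ : ∀ i, 0 < R₂ i := fun i => (hR₁ i).trans (hR i)
  let e : Fin 3 → ℂ → ℝ := fun i ζ => 1 / 2 * vertEnergyDensity ω (H i) (ρ i) J (ψ i) u ζ
  set L := action ω (H 0) (z 0) (w 0) + action ω (H 1) (z 1) (w 1) - action ω (H 2) (z 2) (w 2)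
        - ∑ i, ∫ ζ in cyl i, curvatureDensity (H i) (ρ i) (ψ i) u ζ with hL
  -- Each action is minus a holonomy minus a Hamiltonian integral, and the signs of the three
  -- actions are the opposites of `sgn`.
  have hL' : L = ∑ i, (sgn i * Γ.hol (a i) (N i) (z i)
      + sgn i * (∫ t in (0 : ℝ)..1, H i t (z i t))
      - ∫ ζ in cyl i, curvatureDensity (H i) (ρ i) (ψ i) u ζ) := by
    rw [hL, action_eq_hol Γ hψ hf (hz 0) (hN 0) (haN 0) (ha 0),
      action_eq_hol Γ hψ hf (hz 1) (hN 1) (haN 1) (ha 1),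
      action_eq_hol Γ hψ hf (hz 2) (hN 2) (haN 2) (ha 2)]
    simp only [Fin.sum_univ_three]
    simp only [sgn, Matrix.cons_val_zero, Matrix.cons_val_one, Matrix.cons_val]
    ring
  have hstrip : ∀ᶠ T in atTop, (∀ i, IntegrableOn (e i) (strip (sgn i) 0 T)) ∧
      ∑ i, ∫ ζ in strip (sgn i) 0 T, e i ζ
        = ∑ i, (sgn i * Γ.hol (a i) (N i) (fun t => u (ψ i (cylMap (sgn i) (T, t))))
          + sgn i * (∫ t in (0 : ℝ)..1, H i t (u (ψ i (cylMap (sgn i) (T, t)))))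
          - ∫ ζ in cyl i, curvatureDensity (H i) (ρ i) (ψ i) u ζ) := by
    filter_upwards [eventually_all.2 hev, eventually_all.2 fun i => eventually_ge_atTop (R₂ i)]
      with T hT hTR
    obtain ⟨h1, h2⟩ := sum_area_strip (T := T) Γ hψ hf hu ((hR₂ 0).trans_le (hTR 0)) hN haN hT
    have h3 := fun i => energy_strip (hψ i) hu (hH i) (hR₁ i) (hR i) (hρ i) hJ (hhol i) (hTR i) (h1 i)
    refine ⟨fun i => (h3 i).1, ?_⟩
    rw [Finset.sum_congr rfl fun i _ => (h3 i).2]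
    simp only [Finset.sum_add_distrib, Finset.sum_sub_distrib]
    rw [h2]
  have hint : ∀ i T, 0 < T → IntegrableOn (e i) (strip (sgn i) 0 T) := by
    intro i T hT
    obtain ⟨T', hT', hTT'⟩ := (hstrip.and (eventually_ge_atTop T)).exists
    exact (hT'.1 i).mono_set fun ζ h => ⟨h.1, h.2.1.trans hTT', h.2.2⟩
  have hlimL := tendsto_energy hH hψ hρ hJ hu hhol (L := L) hint fun ε hε => by
    filter_upwards [hstrip, eventually_all.2 fun i => eventually_end_estimate Γ (hψ i) hu (hH i)
        (hR₂ i) (hρ i) hJ (hJend i) (hhol i) (hz i).smooth_orbit (hlim i) (hN i) (haN i)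
        (gluingCircle_one hψ i) (fun t => hf.apply_circle i (hz i).boundary t) (ha i) hε,
      eventually_all.2 fun i => eventually_hamiltonian_estimate (hH i) (hlim i)
        (hz i).smooth_orbit.continuous (hψ i) hu hε] with T h1 h2 h3
    refine le_trans (le_of_eq (congrArg (fun x => |x - L|) h1.2)) ?_
    rw [hL', ← Finset.sum_sub_distrib]
    refine (Finset.abs_sum_le_sum_abs _ _).trans (Finset.sum_le_sum fun i _ => ?_)
    refine le_trans ?_ (add_le_add (h2 i) (h3 i))
    have habs : |sgn i| = 1 := by
      rcases sgn_eq i with h | h <;> rw [h] <;> simp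
    refine le_trans (le_of_eq ?_) (abs_add_le _ _)
    rw [← one_mul |_ + _|, ← habs, ← abs_mul]
    congr 1
    ring
  have hcyl : ∀ i, IntegrableOn (e i) (cyl i) ∧
      Tendsto (fun T => ∫ ζ in strip (sgn i) 0 T, e i ζ) atTop (𝓝 (∫ ζ in cyl i, e i ζ)) := by
    intro i
    have he0 : ∀ j, ∀ ζ ∈ cyl j, 0 ≤ e j ζ := fun j ζ hζ =>
      mul_nonneg (by norm_num) (vertEnergyDensity_nonneg (hψ j) hJ (hhol j) hζ.1)
    refine integrableOn_cyl_of_bounded (B := L + 1) (he0 i) (hint i) ?_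
    filter_upwards [hlimL.eventually (eventually_le_nhds (lt_add_one L))] with T hT
    refine le_trans ?_ hT
    exact Finset.single_le_sum (f := fun j => ∫ ζ in strip (sgn j) 0 T, e j ζ)
      (fun j _ => setIntegral_nonneg (measurableSet_strip _ _ _) fun ζ hζ =>
        he0 j ζ (strip_subset_cyl j T hζ)) (Finset.mem_univ i)
  exact ⟨fun i => (hcyl i).1,
    tendsto_nhds_unique (tendsto_finsetSum _ fun i _ => (hcyl i).2) hlimL⟩

-- On the ends with sign `-1` the function to be bounded is `H`, which gives the maximum; on the
-- third end it is `-H`, which gives minus the minimum.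
include hH hψ hR₁ hR hρ hu in
theorem neg_sum_curvature_le :
    -∑ i, ∫ ζ in cyl i, curvatureDensity (H i) (ρ i) (ψ i) u ζ
      ≤ Eplus (H 0) + Eplus (H 1) + Eminus (H 2) := by
  have hmax : ∀ i t y, H i t y ≤ ⨆ x, H i t x := fun i t y =>
    le_ciSup (isCompact_range_hamiltonian (hH i) t).bddAbove y
  have hmin : ∀ i t y, ⨅ x, H i t x ≤ H i t y := fun i t y =>
    ciInf_le (isCompact_range_hamiltonian (hH i) t).bddBelow y
  have h0 := neg_integral_curvature_le (hψ 0) hu (hH 0) (hR₁ 0) (hR 0) (hρ 0)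
    (continuous_max_hamiltonian (hH 0)) fun t y => by simpa [sgn] using hmax 0 t y
  have h1 := neg_integral_curvature_le (hψ 1) hu (hH 1) (hR₁ 1) (hR 1) (hρ 1)
    (continuous_max_hamiltonian (hH 1)) fun t y => by simpa [sgn] using hmax 1 t y
  have h2 := neg_integral_curvature_le (hψ 2) hu (hH 2) (hR₁ 2) (hR 2) (hρ 2)
    (continuous_min_hamiltonian (hH 2)).neg fun t y => by simpa [sgn] using hmin 2 t y
  rw [Fin.sum_univ_three]
  have h3 : ∀ x y z : ℝ, -(x + y + z) = -x + -y + -z := fun x y z => by ring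
  rw [h3]
  exact add_le_add (add_le_add h0 h1) h2

end Main

end Pants

end

/-! ### The energy identities and the uniform energy bound -/

theorem proposition4p3
    {E : Type*} [NormedAddCommGroup E] [NormedSpace ℝ E] [FiniteDimensional ℝ E]
    {M : Type*} [TopologicalSpace M] [ChartedSpace E M] [IsManifold 𝓘(ℝ, E) (⊤ : ℕ∞) M]
    [CompactSpace M] [T2Space M]
    (ω : SymplecticForm E M)
    (H : Fin 3 → ℝ → M → ℝ) (hH : ∀ i, IsPeriodicHamiltonian (E := E) (H i))
    (ψ : Fin 3 → ℂ → ℂ) (hψ : ∀ i, IsCylinderCoordinate i (ψ i))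
    (R₁ R₂ : Fin 3 → ℝ) (hR₁ : ∀ i, 0 < R₁ i) (hR : ∀ i, R₁ i < R₂ i)
    (ρ : Fin 3 → ℝ → ℝ) (hρ : ∀ i, IsCutOff i (R₁ i) (R₂ i) (ρ i))
    (J : ℂ → ∀ x : M, TangentSpace 𝓘(ℝ, E) x →L[ℝ] TangentSpace 𝓘(ℝ, E) x)
    (hJ : IsCompatibleFamily ω J)
    (hJend : ∀ (i : Fin 3) (ζ ζ' : ℂ), R₂ i ≤ sgn i * ζ.re → R₂ i ≤ sgn i * ζ'.re →
      ζ.im = ζ'.im → J (ψ i ζ) = J (ψ i ζ'))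
    (z : Fin 3 → ℝ → M) (w : Fin 3 → ℂ → M)
    (hz : ∀ i, IsCappedOrbit ω (H i) (z i) (w i))
    (u : ℂ → M) (hu : ContMDiffOn 𝓘(ℝ, ℂ) 𝓘(ℝ, E) (⊤ : ℕ∞) u surface)
    (hhol : ∀ i, IsHolomorphicOnEnd ω (H i) (ρ i) J i (ψ i) u)
    (hlim : ∀ i, ConvergesTo i (ψ i) u (z i))
    (hcap : ∃ f : C(OnePoint ℂ, M), IsCappedSphere ψ u w f ∧ RepresentsZero f) :
    (∀ i, IntegrableOn (vertEnergyDensity ω (H i) (ρ i) J (ψ i) u) (cyl i)) ∧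
    (∀ i, IntegrableOn (pullbackDensity ω (H i) (ρ i) (ψ i) u) (cyl i)) ∧
    (∀ i, IntegrableOn (curvatureDensity (H i) (ρ i) (ψ i) u) (cyl i)) ∧
    (1 / 2 : ℝ) * ∑ i, ∫ ζ in cyl i, vertEnergyDensity ω (H i) (ρ i) J (ψ i) u ζ
      = (∑ i, ∫ ζ in cyl i, pullbackDensity ω (H i) (ρ i) (ψ i) u ζ)
        - ∑ i, ∫ ζ in cyl i, curvatureDensity (H i) (ρ i) (ψ i) u ζ ∧
    (1 / 2 : ℝ) * ∑ i, ∫ ζ in cyl i, vertEnergyDensity ω (H i) (ρ i) J (ψ i) u ζ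
      = action ω (H 0) (z 0) (w 0) + action ω (H 1) (z 1) (w 1) - action ω (H 2) (z 2) (w 2)
        - ∑ i, ∫ ζ in cyl i, curvatureDensity (H i) (ρ i) (ψ i) u ζ ∧
    (1 / 2 : ℝ) * ∑ i, ∫ ζ in cyl i, vertEnergyDensity ω (H i) (ρ i) J (ψ i) u ζ
      ≤ action ω (H 0) (z 0) (w 0) + action ω (H 1) (z 1) (w 1) - action ω (H 2) (z 2) (w 2)
        + Eplus (H 0) + Eplus (H 1) + Eminus (H 2) := by
  obtain ⟨h1, h2⟩ := energy_identity hH hψ hR₁ hR hρ hJ hJend hz hu hhol hlim hcap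
  have hc := fun i => (curvature_integrable (hψ i) hu (hH i) (hR₁ i) (hρ i) (le_refl (R₂ i))).1
  have hpe : ∀ i, ∀ ζ ∈ cyl i, 1 / 2 * vertEnergyDensity ω (H i) (ρ i) J (ψ i) u ζ
      + curvatureDensity (H i) (ρ i) (ψ i) u ζ = pullbackDensity ω (H i) (ρ i) (ψ i) u ζ :=
    fun i ζ hζ => (pullbackDensity_eq_energy (hψ i) hJ (hhol i) hζ.1).symm
  have he : ∀ i, IntegrableOn (vertEnergyDensity ω (H i) (ρ i) J (ψ i) u) (cyl i) := fun i => by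
    have h3 := (h1 i).const_mul 2
    refine IntegrableOn.congr_fun h3 (fun ζ _ => ?_) (measurableSet_cyl i)
    ring
  have hp : ∀ i, ∫ ζ in cyl i, pullbackDensity ω (H i) (ρ i) (ψ i) u ζ
      = (∫ ζ in cyl i, 1 / 2 * vertEnergyDensity ω (H i) (ρ i) J (ψ i) u ζ)
        + ∫ ζ in cyl i, curvatureDensity (H i) (ρ i) (ψ i) u ζ := fun i => by
    rw [← setIntegral_congr_fun (measurableSet_cyl i) (hpe i)]
    exact integral_add (h1 i) (hc i)
  have hhalf : (1 / 2 : ℝ) * ∑ i, ∫ ζ in cyl i, vertEnergyDensity ω (H i) (ρ i) J (ψ i) u ζ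
      = ∑ i, ∫ ζ in cyl i, 1 / 2 * vertEnergyDensity ω (H i) (ρ i) J (ψ i) u ζ := by
    rw [Finset.mul_sum]
    exact Finset.sum_congr rfl fun i _ => (integral_const_mul _ _).symm
  refine ⟨he, fun i => ((h1 i).add (hc i)).congr_fun (hpe i) (measurableSet_cyl i), hc, ?_,
    hhalf.trans h2, ?_⟩
  · rw [hhalf, Finset.sum_congr rfl fun i _ => hp i, Finset.sum_add_distrib, add_sub_cancel_right]
  · rw [hhalf, h2]
    have h3 := neg_sum_curvature_le hH hψ hR₁ hR hρ hu
    linarith
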